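/- Let $\alpha,\beta:\mathbb R\to\mathbb R$ be continuous odd functions with $\alpha'(0)=0$ that are $C^3$ on $(0,\infty)$. For $t>0$ put $$h_2(t)=t\alpha'(t)-\alpha(t),\quad \bar\beta(t)=\beta(t)-\tfrac12\int_0^t h_2,\quad \bar h_\beta(t)=t\bar\beta'(t)-\bar\beta(t),\quad \bar h_3(t)=\frac{1}{\alpha''(t)}\det\begin{pmatrix} t&\alpha(t)&\bar\beta(t)\\ 1&\alpha'(t)&\bar\beta'(t)\\ 0&\alpha''(t)&\bar\beta''(t)\end{pmatrix}.$$ Assume that for all $t>0$ the following five functions are positive: $\alpha''$, $\ \alpha''\bar\beta'''-\alpha'''\bar\beta''$, $\ \alpha''(\bar\beta'''+2\alpha'')-\alpha'''(\bar\beta''+\alpha')$, $\ \alpha''(\bar\beta'''-\alpha'')-\alpha'''(\bar\beta''-\alpha')$, $\ \alpha''(\bar\beta'''-\alpha'')-\alpha'''(\bar\beta''-\alpha'+\alpha/t)$; and that for some $c>0$ and all $t>0$, $h_2'(t)\ge c\,h_2(t)/t$, $\bar h_3'(t)\ge c\,\bar h_3(t)/t$ and $\bar h_3(t)\ge c\int_0^t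 h_2$. Let $\{\phi_j\}_{j\in\mathbb N}$ ($\mathbb N=\{0,1,2,\dots\}$) be a sequence bounded in $C_c^\infty([-8,-2]\cup[2,8])$, i.e. the $\phi_j$ are smooth and complex-valued with support in $[-8,-2]\cup[2,8]$, and $\sup_{j,t}|\phi_j^{(n)}(t)|<\infty$ for every $n$. For $j\in\mathbb N$ put $d_j=2^{-j}h_2(2^{-j})+\bar h_3(2^{-j})$, $\xi_j=\frac12\,2^{-j}h_2(2^{-j})/d_j$, and $$C_2(t)=\frac{\alpha(2^{-j}t)-t\alpha(2^{-j})}{h_2(2^{-j})},\qquad C_3(t)=\frac{\beta(2^{-j}t)-t\bar\beta(2^{-j})-\big(\alpha(2^{-j}t)-t\alpha(2^{-j})\big)\bar h_\beta(2^{-j})/h_2(2^{-j})}{d_j}.$$ On $\mathbb R^3$ write $x\odot_j y=\big(x_1+y_1,\,x_2+y_2,\,x_3+y_3+\xi_j(x_1y_2-x_2y_1)\big)$, a group law with $x^{-1}=-x$, and let $\gamma(t)=(t,C_2(t),C_3(t))$. Define $$\Phi(t,s,u)=\gamma(t)^{-1}\odot_j\gamma(s)\odot_j\gamma(u)^{-1},\qquad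 \hat\Phi(s,u,r)=\gamma(s)\odot_j\gamma(u)^{-1}\odot_j\gamma(r),$$ $$\Psi(t,s,r)=\hat\Psi(t,u,r)=\gamma(t)^{-1}\odot_j\gamma(s)\odot_j\gamma(u)^{-1}\odot_j\gamma(r),$$ where $u$ is a parameter of $\Psi$ and $s$ is a parameter of $\hat\Psi$. With $I=[2,8]\cap[0,2^j]$ let $$R_1=\{(t,s,u)\in I^3: t\le u\},\qquad R_2=\{(s,u,r)\in I^3: r\le s\},$$ $$R_3=\{(t,s,r)\in I^3: r\ge t\ge u,\ r\ge s\},\qquad R_4=\{(t,u,r)\in I^3: t\ge r\ge s,\ t\ge u\},$$ and define complex measures on $\mathbb R^3$ as the pushforwards $$\mu=\Phi_*\big(\phi_j(t)\overline{\phi_j(s)}\phi_j(u)1_{R_1}\,dt\,ds\,du\big),\qquad \hat\mu=\hat\Phi_*\big(\overline{\phi_j(s)}\phi_j(u)\overline{\phi_j(r)}1_{R_2}\,ds\,du\,dr\big),$$ $$\nu=\Psi_*\big(\phi_j(t)\overline{\phi_j(s)}\,\overline{\phi_j(r)}1_{R_3}\,dt\,ds\,dr\big),\qquad \hat\nu=\hat\Psi_*\big(\phi_j(t)\phi_j(u)\overline{\phi_j(r)}1_{R_4}\,dt\,du\,dr\big).$$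 Then for every $j\in\mathbb N$ and all parameters $u,s\in[2,8]$ the measures $\mu,\hat\mu,\nu,\hat\nu$ are absolutely continuous with respect to Lebesgue measure on $\mathbb R^3$, and their densities $\kappa,\hat\kappa,\chi,\hat\chi$ satisfy the following. There is a constant $C_0$, independent of $j,u,s$, with $$\int|\kappa|,\ \int|\hat\kappa|,\ \int|\chi|,\ \int|\hat\chi|\ \le\ C_0 .$$ Moreover there is $\sigma>0$, independent of $j,u,s$, and for every $M$ a constant $C_M$, independent of $j,u,s,\delta$, such that for $0\le\delta\le1$ and all $\tilde y,\tilde v\in\mathbb R^3$ with $|\tilde y|,|\tilde v|\le M\delta$, $$\int|\kappa(z)-\kappa(\tilde y\odot_j z)|\,dz\le C_M\delta^\sigma,\qquad \int|\hat\kappa(w)-\hat\kappa(w\odot_j\tilde v^{-1})|\,dw\le C_M\delta^\sigma,$$ $$\int|\chi(\zeta)-\chi(\tilde y\odot_j\zeta)|\,d\zeta\le C_M\delta^\sigma,\qquad \int|\hat\chi(\zeta)-\hat\chi(\zeta\odot_j\tilde v^{-1})|\,d\zeta\le C_M\delta^\sigma .$$ -/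

import Mathlib

open MeasureTheory Set
open scoped ContDiff ComplexConjugate

noncomputable section

/-! ### The curve `Γ(t) = (t, α(t), β(t))` and the functions attached to it -/

/-- `h₂(t) = t α'(t) - α(t)`. -/
def h2 (α : ℝ → ℝ) (t : ℝ) : ℝ := t * deriv α t - α t

/-- `β̄(t) = β(t) - ½ ∫₀ᵗ h₂`. -/
def betaBar (α β : ℝ → ℝ) (t : ℝ) : ℝ := β t - (1 / 2) * ∫ s in (0 : ℝ)..t, h2 α s

/-- `h̄_β(t) = t β̄'(t) - β̄(t)`. -/
def hBeta (α β : ℝ → ℝ) (t : ℝ) : ℝ := t * deriv (betaBar α β) t - betaBar α β t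

/-- `D₂ = α''`. -/
def D2 (α : ℝ → ℝ) (t : ℝ) : ℝ := iteratedDeriv 2 α t

/-- The determinant `N̄₃`. -/
def N3Bar (α β : ℝ → ℝ) (t : ℝ) : ℝ :=
  Matrix.det !![t, α t, betaBar α β t;
                1, deriv α t, deriv (betaBar α β) t;
                0, iteratedDeriv 2 α t, iteratedDeriv 2 (betaBar α β) t]

/-- `h̄₃ = N̄₃ / D₂`. -/
def h3Bar (α β : ℝ → ℝ) (t : ℝ) : ℝ := N3Bar α β t / D2 α t

/-- `D̄₃`. -/
def D3Bar (α β : ℝ → ℝ) (t : ℝ) : ℝ :=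
  iteratedDeriv 2 α t * iteratedDeriv 3 (betaBar α β) t
    - iteratedDeriv 3 α t * iteratedDeriv 2 (betaBar α β) t

/-- `D̂₃`. -/
def D3Hat (α β : ℝ → ℝ) (t : ℝ) : ℝ :=
  iteratedDeriv 2 α t * (iteratedDeriv 3 (betaBar α β) t + 2 * iteratedDeriv 2 α t)
    - iteratedDeriv 3 α t * (iteratedDeriv 2 (betaBar α β) t + deriv α t)

/-- `D₃` with a double hat. -/
def D3DoubleHat (α β : ℝ → ℝ) (t : ℝ) : ℝ :=
  iteratedDeriv 2 α t * (iteratedDeriv 3 (betaBar α β) t - iteratedDeriv 2 α t)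
    - iteratedDeriv 3 α t * (iteratedDeriv 2 (betaBar α β) t - deriv α t)

/-- `D₃` with a triple hat. -/
def D3TripleHat (α β : ℝ → ℝ) (t : ℝ) : ℝ :=
  iteratedDeriv 2 α t * (iteratedDeriv 3 (betaBar α β) t - iteratedDeriv 2 α t)
    - iteratedDeriv 3 α t * (iteratedDeriv 2 (betaBar α β) t - deriv α t + α t / t)

/-- The standing assumptions on the curve `Γ(t) = (t, α(t), β(t))`: it is continuous and odd,
`α'(0) = 0`, it is of class `C³` on `(0, ∞)`, the five determinants are positive on `(0, ∞)`, and
`h₂' ≳ h₂ / t`, `h̄₃' ≳ h̄₃ / t`, `h̄₃ ≳ ∫₀ᵗ h₂` on `(0, ∞)`. -/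
structure IsAdmissibleCurve (α β : ℝ → ℝ) : Prop where
  continuous_α : Continuous α
  continuous_β : Continuous β
  odd_α : Function.Odd α
  odd_β : Function.Odd β
  deriv_zero : HasDerivAt α 0 0
  contDiffOn_α : ContDiffOn ℝ 3 α (Ioi 0)
  contDiffOn_β : ContDiffOn ℝ 3 β (Ioi 0)
  D2_pos : ∀ t > 0, 0 < D2 α t
  D3Bar_pos : ∀ t > 0, 0 < D3Bar α β t
  D3Hat_pos : ∀ t > 0, 0 < D3Hat α β t
  D3DoubleHat_pos : ∀ t > 0, 0 < D3DoubleHat α β t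
  D3TripleHat_pos : ∀ t > 0, 0 < D3TripleHat α β t
  growth_h2 : ∃ c > 0, ∀ t > 0, c * (h2 α t / t) ≤ deriv (h2 α) t
  growth_h3 : ∃ c > 0, ∀ t > 0, c * (h3Bar α β t / t) ≤ deriv (h3Bar α β) t
  integral_h2_le : ∃ c > 0, ∀ t > 0, c * (∫ s in (0 : ℝ)..t, h2 α s) ≤ h3Bar α β t

/-- `(φ_j)` is a bounded sequence in the Fréchet space `C_c^∞([-8,-2] ∪ [2,8])` of complex-valued
smooth functions with support in `[-8,-2] ∪ [2,8]`. -/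
structure IsBoundedFamily (φ : ℕ → ℝ → ℂ) : Prop where
  smooth : ∀ j, ContDiff ℝ ∞ (φ j)
  support_subset : ∀ j, tsupport (φ j) ⊆ Icc (-8) (-2) ∪ Icc 2 8
  bounded : ∀ n : ℕ, ∃ C : ℝ, ∀ j t, ‖iteratedDeriv n (φ j) t‖ ≤ C

/-! ### Rescaled coefficients of the curve and the Heisenberg-type product -/

/-- The dyadic scale `2^{-j}`. -/
def scale (j : ℕ) : ℝ := ((2 : ℝ) ^ j)⁻¹

/-- `2^{-j} h₂(2^{-j}) + h̄₃(2^{-j})`, the last diagonal entry of `Ã_j`. -/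
def diag3 (α β : ℝ → ℝ) (j : ℕ) : ℝ := scale j * h2 α (scale j) + h3Bar α β (scale j)

/-- `ξ_j`. -/
def xi (α β : ℝ → ℝ) (j : ℕ) : ℝ := (1 / 2) * (scale j * h2 α (scale j) / diag3 α β j)

/-- The coefficient `C₂`. -/
def C2 (α : ℝ → ℝ) (j : ℕ) (t : ℝ) : ℝ :=
  (α (scale j * t) - t * α (scale j)) / h2 α (scale j)

/-- The coefficient `C₃`. -/
def C3 (α β : ℝ → ℝ) (j : ℕ) (t : ℝ) : ℝ :=
  (β (scale j * t) - t * betaBar α β (scale j)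
    - (α (scale j * t) - t * α (scale j)) * hBeta α β (scale j) / h2 α (scale j))
    / diag3 α β j

/-- `x ⊙ y = (x₁ + y₁, x₂ + y₂, x₃ + y₃ + ξ (x₁ y₂ - x₂ y₁))`; the inverse of `x` is `-x`. -/
def heisMul (ξ : ℝ) (x y : ℝ × ℝ × ℝ) : ℝ × ℝ × ℝ :=
  (x.1 + y.1, x.2.1 + y.2.1, x.2.2 + y.2.2 + ξ * (x.1 * y.2.1 - x.2.1 * y.1))

/-- The Euclidean length on `ℝ³`. -/
def euclLength (x : ℝ × ℝ × ℝ) : ℝ := Real.sqrt (x.1 ^ 2 + x.2.1 ^ 2 + x.2.2 ^ 2)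

/-! ### The maps `Φ`, `Φ̂`, `Ψ`, `Ψ̂` -/

/-- `Φ(t, s, u)`. -/
def Phi (α β : ℝ → ℝ) (j : ℕ) (τ : ℝ × ℝ × ℝ) : ℝ × ℝ × ℝ :=
  let t := τ.1
  let s := τ.2.1
  let u := τ.2.2
  let c₂ := C2 α j
  let c₃ := C3 α β j
  (-t + s - u,
   -c₂ t + c₂ s - c₂ u,
   -c₃ t + c₃ s - c₃ u
    - xi α β j * (t * c₂ s - s * c₂ t - t * c₂ u + s * c₂ u + u * c₂ t - u * c₂ s))

/-- `Φ̂(s, u, r)`. -/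
def PhiHat (α β : ℝ → ℝ) (j : ℕ) (τ : ℝ × ℝ × ℝ) : ℝ × ℝ × ℝ :=
  let s := τ.1
  let u := τ.2.1
  let r := τ.2.2
  let c₂ := C2 α j
  let c₃ := C3 α β j
  (s - u + r,
   c₂ s - c₂ u + c₂ r,
   c₃ s - c₃ u + c₃ r
    - xi α β j * (s * c₂ u - u * c₂ s - s * c₂ r + u * c₂ r + r * c₂ s - r * c₂ u))

/-- The common expression, in the four variables `t, s, u, r`, of which `Ψ` and `Ψ̂` are the
restrictions to fixed `u` and to fixed `s`. -/
def zeta (α β : ℝ → ℝ) (j : ℕ) (t s u r : ℝ) : ℝ × ℝ × ℝ :=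
  let c₂ := C2 α j
  let c₃ := C3 α β j
  (-t + s - u + r,
   -c₂ t + c₂ s - c₂ u + c₂ r,
   -c₃ t + c₃ s - c₃ u + c₃ r
    - xi α β j * (s * c₂ u - u * c₂ s - s * c₂ r + u * c₂ r + r * c₂ s - r * c₂ u
        + t * c₂ s - t * c₂ u + t * c₂ r - s * c₂ t + u * c₂ t - r * c₂ t))

/-- `Ψ(t, s, r)`, with parameter `u`. -/
def Psi (α β : ℝ → ℝ) (j : ℕ) (u : ℝ) (τ : ℝ × ℝ × ℝ) : ℝ × ℝ × ℝ :=
  zeta α β j τ.1 τ.2.1 u τ.2.2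

/-- `Ψ̂(t, u, r)`, with parameter `s`. -/
def PsiHat (α β : ℝ → ℝ) (j : ℕ) (s : ℝ) (τ : ℝ × ℝ × ℝ) : ℝ × ℝ × ℝ :=
  zeta α β j τ.1 s τ.2.1 τ.2.2

/-! ### The regions of integration -/

/-- `[2,8] ∩ [0,2^j]`. -/
def timeSet (j : ℕ) : Set ℝ := Icc 2 8 ∩ Icc 0 (2 ^ j)

/-- `([2,8] ∩ [0,2^j])³`. -/
def timeCube (j : ℕ) : Set (ℝ × ℝ × ℝ) := timeSet j ×ˢ timeSet j ×ˢ timeSet j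

/-- `(t, s, u)` with `t ≤ u`. -/
def R1 (j : ℕ) : Set (ℝ × ℝ × ℝ) := {τ | τ ∈ timeCube j ∧ τ.1 ≤ τ.2.2}

/-- `(s, u, r)` with `r ≤ s`. -/
def R2 (j : ℕ) : Set (ℝ × ℝ × ℝ) := {τ | τ ∈ timeCube j ∧ τ.2.2 ≤ τ.1}

/-- `(t, s, r)` with `r ≥ t ≥ u` and `r ≥ s`. -/
def R3 (j : ℕ) (u : ℝ) : Set (ℝ × ℝ × ℝ) :=
  {τ | τ ∈ timeCube j ∧ τ.1 ≤ τ.2.2 ∧ u ≤ τ.1 ∧ τ.2.1 ≤ τ.2.2}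

/-- `(t, u, r)` with `t ≥ r ≥ s` and `t ≥ u`. -/
def R4 (j : ℕ) (s : ℝ) : Set (ℝ × ℝ × ℝ) :=
  {τ | τ ∈ timeCube j ∧ τ.2.2 ≤ τ.1 ∧ s ≤ τ.2.2 ∧ τ.2.1 ≤ τ.1}

/-! ### The transported complex measures -/

/-- The complex measure `F_*(w 1_R dτ)` on `ℝ³`. -/
def transported (F : ℝ × ℝ × ℝ → ℝ × ℝ × ℝ) (R : Set (ℝ × ℝ × ℝ)) (w : ℝ × ℝ × ℝ → ℂ) :
    ComplexMeasure (ℝ × ℝ × ℝ) :=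
  ((volume : Measure (ℝ × ℝ × ℝ)).withDensityᵥ (R.indicator w)).map F

/-- `μ = Φ_*(φ(t) φ̄(s) φ(u) 1_{R₁} dt ds du)`. -/
def mu (α β : ℝ → ℝ) (φ : ℕ → ℝ → ℂ) (j : ℕ) : ComplexMeasure (ℝ × ℝ × ℝ) :=
  transported (Phi α β j) (R1 j) fun τ => φ j τ.1 * conj (φ j τ.2.1) * φ j τ.2.2

/-- `μ̂ = Φ̂_*(φ̄(s) φ(u) φ̄(r) 1_{R₂} ds du dr)`. -/
def muHat (α β : ℝ → ℝ) (φ : ℕ → ℝ → ℂ) (j : ℕ) : ComplexMeasure (ℝ × ℝ × ℝ) :=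
  transported (PhiHat α β j) (R2 j) fun τ => conj (φ j τ.1) * φ j τ.2.1 * conj (φ j τ.2.2)

/-- `ν = Ψ_*(φ(t) φ̄(s) φ̄(r) 1_{R₃} dt ds dr)`, with parameter `u`. -/
def nu (α β : ℝ → ℝ) (φ : ℕ → ℝ → ℂ) (j : ℕ) (u : ℝ) : ComplexMeasure (ℝ × ℝ × ℝ) :=
  transported (Psi α β j u) (R3 j u) fun τ => φ j τ.1 * conj (φ j τ.2.1) * conj (φ j τ.2.2)

/-- `ν̂ = Ψ̂_*(φ(t) φ(u) φ̄(r) 1_{R₄} dt du dr)`, with parameter `s`. -/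
def nuHat (α β : ℝ → ℝ) (φ : ℕ → ℝ → ℂ) (j : ℕ) (s : ℝ) : ComplexMeasure (ℝ × ℝ × ℝ) :=
  transported (PsiHat α β j s) (R4 j s) fun τ => φ j τ.1 * φ j τ.2.1 * conj (φ j τ.2.2)

/-- Absolute continuity of a complex measure with respect to Lebesgue measure on `ℝ³`. -/
def IsAbsCont (m : ComplexMeasure (ℝ × ℝ × ℝ)) : Prop :=
  VectorMeasure.AbsolutelyContinuous m
    (volume : Measure (ℝ × ℝ × ℝ)).toENNRealVectorMeasure

/-- `κ` is the (almost everywhere unique) density of `m` with respect to Lebesgue measure. -/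
def IsDensity (m : ComplexMeasure (ℝ × ℝ × ℝ)) (κ : ℝ × ℝ × ℝ → ℂ) : Prop :=
  Integrable κ volume ∧ m = (volume : Measure (ℝ × ℝ × ℝ)).withDensityᵥ κ

end

/-!
All four measures are transports of a bounded weight on triples of times by a product of points of
the curve. Their densities and the Hölder estimates in `L¹` follow from estimates of
`∫ (φ(F) - φ(y⁻¹ F)) W` that are uniform in the test functions `φ` with values in `[0, 1]`: a
measure that is close in total variation to its small translates does not charge null sets, and its
density inherits the estimate (`exists_isDensity_of_isTestFunction_bound`).

Left translation by `y` is the flow of a right-invariant vector field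
(`IsPulledBack.norm_integral_sub_le`). Off the zeros of the Jacobian determinant of `F` this field
is the image of a field in the space of times, whose components are, by Cramer's rule, the quotients
`num₁ / jac`, `num₂ / jac` and `± num₃ / jac` (`isProductMap_prodThree`, `isProductMap_prodFour`).
An integration by parts in the times then leaves the derivatives of these quotients, multiplied by
the weight. As the determinant can vanish, the weight is first multiplied by
`jac² / (jac² + θ² size²)`, where `size` is the determinant with all its contributions counted
positively (`regQuot`, `regWeight`).

The derivatives of the curve admit no upper bounds on their growth that are uniform in the scale,
only lower ones. The `L¹` norms of the derivatives of the regularised quotients are nevertheless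
bounded uniformly, since they are compared with derivatives of monotone functions: the essential
term is of the form `n E' / (E + n)²`, with a bounded primitive (`lintegral_regQuotDeriv_le`). This
only requires that the numerators are dominated by the size, which holds with constants polynomial
in `η⁻¹` when the times are separated by gaps of length `η` (`IsNormalized.isGap`, `size_bounds₁`,
`size_bounds₂`, `size_bounds₃`).

Up to strips of volume `O(η)` near the diagonals and the boundaries (`volume_strips_le`), the times
are in one of the orders `s < t < r`, `t < s < r` and `t < r < s`; the last one occurs only in the
products of three points. In the last two orders the contributions to the determinant have the same
sign, so that `jac = ± size`. In the first one they have different signs, but the ratio of the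
positive to the negative ones increases in `t`; hence the determinant is small only for `t` in an
interval of length `O(η)`, and the regularisation changes the weight by `O(η)` in `L¹`
(`mul_sub_le_of_abs_jac_le`, `lintegral_sub_regWeight_le`). The total is a multiple of
`‖y‖ η⁻⁵⁸ + η`, and `η = ‖y‖ ^ (1 / 59) / 2` gives the exponent `1 / 59` (`moveBound_eq`).

Uniformity in `j` holds because the rescaled curves all satisfy the same bounds
(`exists_isRescaled`, `IsRescaled.isNormalized`). The two measures for which right translations are
considered are reflections of the other two (`HasHolderDensity.right`).
-/

noncomputable section

/-! ### Test functions and total variation -/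

/-- The factor `4` comes from the positive and negative parts of the real and imaginary parts. -/
lemma lintegral_enorm_le_of_setIntegral_le {k : ℝ × ℝ × ℝ → ℂ} (hk : Integrable k) {b : ℝ}
    (hb : ∀ E, MeasurableSet E → ‖∫ z in E, k z‖ ≤ b) :
    ∫⁻ z, ‖k z‖ₑ ≤ ENNReal.ofReal (4 * b) := by
  have key : ∀ g : ℝ × ℝ × ℝ → ℝ, Integrable g → (∀ E, MeasurableSet E → |∫ z in E, g z| ≤ b) →
      ∫ z, |g z| ≤ 2 * b := by
    intro g hg h
    obtain ⟨g', hg'm, hgg'⟩ := hg.aestronglyMeasurable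
    have hg' : Integrable g' := hg.congr hgg'
    have h' : ∀ E, MeasurableSet E → |∫ z in E, g' z| ≤ b := by
      intro E hE
      rw [setIntegral_congr_ae (g := g) hE (hgg'.mono fun x hx _ => hx.symm)]
      exact h E hE
    have hms : MeasurableSet {z | 0 ≤ g' z} :=
      measurableSet_le measurable_const hg'm.measurable
    rw [integral_congr_ae (g := fun z => |g' z|) (hgg'.mono fun x hx => by simp [hx]),
      ← integral_add_compl hms hg'.abs]
    have e1 : ∫ z in {z | 0 ≤ g' z}, |g' z| = ∫ z in {z | 0 ≤ g' z}, g' z :=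
      setIntegral_congr_fun hms fun z hz => abs_of_nonneg hz
    have e2 : ∫ z in {z | 0 ≤ g' z}ᶜ, |g' z| = ∫ z in {z | 0 ≤ g' z}ᶜ, -g' z :=
      setIntegral_congr_fun hms.compl fun z hz => abs_of_neg (not_le.1 hz)
    rw [e1, e2, integral_neg]
    have := h' _ hms
    have := h' _ hms.compl
    grind
  have hre : Integrable (fun z => (k z).re) := hk.re
  have him : Integrable (fun z => (k z).im) := hk.im
  have h1 := key _ hre fun E hE => by
    have : ∫ z in E, (k z).re = (∫ z in E, k z).re := integral_re hk.integrableOn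
    rw [this]; exact (Complex.abs_re_le_norm _).trans (hb E hE)
  have h2 := key _ him fun E hE => by
    have : ∫ z in E, (k z).im = (∫ z in E, k z).im := integral_im hk.integrableOn
    rw [this]; exact (Complex.abs_im_le_norm _).trans (hb E hE)
  have h3 : ∫ z, ‖k z‖ ≤ 4 * b := by
    calc ∫ z, ‖k z‖ ≤ ∫ z, (|(k z).re| + |(k z).im|) :=
          integral_mono hk.norm (hre.abs.add him.abs) fun z => Complex.norm_le_abs_re_add_abs_im _
      _ = (∫ z, |(k z).re|) + ∫ z, |(k z).im| := integral_add hre.abs him.abs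
      _ ≤ 4 * b := by linarith
  rw [← ofReal_integral_norm_eq_lintegral_enorm hk]
  exact ENNReal.ofReal_le_ofReal h3

/-- A function from the class of test functions: smooth, compactly supported, with values
in `[0, 1]`. -/
structure IsTestFunction (h : ℝ × ℝ × ℝ → ℝ) : Prop where
  contDiff : ContDiff ℝ ∞ h
  hasCompactSupport : HasCompactSupport h
  nonneg : ∀ z, 0 ≤ h z
  le_one : ∀ z, h z ≤ 1

open scoped Manifold in
/-- Lusin's theorem for indicator functions: a smooth Urysohn function between a compact subset and
an open superset of `E`. -/
lemma exists_isTestFunction_eq_indicator_off (Λ : Measure (ℝ × ℝ × ℝ)) [IsFiniteMeasure Λ]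
    {E : Set (ℝ × ℝ × ℝ)} (hE : MeasurableSet E) {ε : ENNReal} (hε : ε ≠ 0) :
    ∃ h, IsTestFunction h ∧ ∃ B, MeasurableSet B ∧ Λ B ≤ ε ∧ ∀ z ∉ B, h z = E.indicator 1 z := by
  have hε2 : ε / 2 ≠ 0 := by simp [hε]
  obtain ⟨U, hEU, hU, -, hUlt⟩ := hE.exists_isOpen_sdiff_lt (measure_ne_top Λ E) hε2
  obtain ⟨K, hKE, hK, hKlt⟩ := hE.exists_isCompact_sdiff_lt (measure_ne_top Λ E) hε2
  obtain ⟨R, hR⟩ := hK.isBounded.subset_ball 0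
  obtain ⟨f, hf0, hf1, hf⟩ := exists_contMDiffMap_zero_one_of_isClosed (n := (⊤ : ℕ∞)) 𝓘(ℝ, ℝ × ℝ × ℝ)
    (s := (U ∩ Metric.ball 0 R)ᶜ) (t := K) (hU.inter Metric.isOpen_ball).isClosed_compl
    hK.isClosed (disjoint_compl_left_iff.2 (subset_inter (hKE.trans hEU) hR))
  refine ⟨f, ⟨f.contMDiff.contDiff, ?_, fun z => (hf z).1, fun z => (hf z).2⟩, U \ K,
    hU.measurableSet.diff hK.measurableSet, ?_, ?_⟩
  · refine HasCompactSupport.of_support_subset_isCompact (isCompact_closedBall 0 R) ?_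
    intro z hz
    by_contra hzR
    exact hz (hf0 fun h => hzR (Metric.ball_subset_closedBall h.2))
  · calc Λ (U \ K) ≤ Λ (U \ E ∪ E \ K) := measure_mono (by
          intro z hz; by_cases h : z ∈ E
          · exact Or.inr ⟨h, hz.2⟩
          · exact Or.inl ⟨hz.1, h⟩)
      _ ≤ Λ (U \ E) + Λ (E \ K) := measure_union_le _ _
      _ ≤ ε / 2 + ε / 2 := add_le_add hUlt.le hKlt.le
      _ = ε := ENNReal.add_halves ε
  · intro z hz
    by_cases h : z ∈ K
    · rw [indicator_of_mem (hKE h)]; exact hf1 h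
    · have hzU : z ∉ U := fun h' => hz ⟨h', h⟩
      rw [indicator_of_notMem fun h' => hzU (hEU h')]
      exact hf0 fun h' => hzU h'.1

/-- A bound against test functions passes to indicator functions, which they approximate with
respect to the transports of `|W|` by both maps. -/
lemma norm_setIntegral_sub_le_of_isTestFunction {W : ℝ × ℝ × ℝ → ℂ} (hW : Integrable W)
    {F G : ℝ × ℝ × ℝ → ℝ × ℝ × ℝ} (hF : Measurable F) (hG : Measurable G) {b : ℝ}
    (hb : ∀ h, IsTestFunction h → ‖∫ τ, ((h (F τ) - h (G τ) : ℝ) : ℂ) * W τ‖ ≤ b)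
    {E : Set (ℝ × ℝ × ℝ)} (hE : MeasurableSet E) :
    ‖(∫ τ in F ⁻¹' E, W τ) - ∫ τ in G ⁻¹' E, W τ‖ ≤ b := by
  refine le_of_forall_pos_le_add fun ε hε => ?_
  set L : Measure (ℝ × ℝ × ℝ) := volume.withDensity fun τ => ‖W τ‖ₑ
  have hL : IsFiniteMeasure L := isFiniteMeasure_withDensity hW.2.ne
  obtain ⟨h, hh, B, hB, hBε, hhB⟩ := exists_isTestFunction_eq_indicator_off (L.map F + L.map G) hE
    (ε := ENNReal.ofReal ε) (by simpa using hε)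
  have hint : ∀ H : ℝ × ℝ × ℝ → ℝ × ℝ × ℝ, Measurable H →
      Integrable fun τ => ((h (H τ) : ℝ) : ℂ) * W τ := by
    intro H hH
    refine hW.bdd_mul (c := 1) ?_ (Filter.Eventually.of_forall fun τ => ?_)
    · exact (Complex.measurable_ofReal.comp
        (hh.contDiff.continuous.measurable.comp hH)).aestronglyMeasurable
    · rw [Complex.norm_real, Real.norm_of_nonneg (hh.nonneg _)]; exact hh.le_one _
  have err : ∀ H : ℝ × ℝ × ℝ → ℝ × ℝ × ℝ, Measurable H →
      ‖(∫ τ in H ⁻¹' E, W τ) - ∫ τ, ((h (H τ) : ℝ) : ℂ) * W τ‖ₑ ≤ L.map H B := by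
    intro H hH
    rw [← integral_indicator (hH hE), ← integral_sub (hW.indicator (hH hE)) (hint H hH)]
    refine (enorm_integral_le_lintegral_enorm _).trans ?_
    rw [Measure.map_apply hH hB, withDensity_apply _ (hH hB), ← lintegral_indicator (hH hB)]
    refine lintegral_mono fun τ => ?_
    by_cases hτ : H τ ∈ B
    · rw [indicator_of_mem (s := H ⁻¹' B) hτ]
      have h0 := hh.nonneg (H τ)
      have h1 := hh.le_one (H τ)
      rw [enorm_le_iff_norm_le]
      by_cases hτE : H τ ∈ E
      · rw [indicator_of_mem (s := H ⁻¹' E) hτE]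
        have : W τ - ((h (H τ) : ℝ) : ℂ) * W τ = ((1 - h (H τ) : ℝ) : ℂ) * W τ := by
          push_cast; ring
        rw [this, norm_mul, Complex.norm_real, Real.norm_of_nonneg (by linarith)]
        nlinarith [norm_nonneg (W τ)]
      · rw [indicator_of_notMem (s := H ⁻¹' E) hτE, zero_sub, norm_neg, norm_mul,
          Complex.norm_real, Real.norm_of_nonneg h0]
        nlinarith [norm_nonneg (W τ)]
    · rw [indicator_of_notMem (s := H ⁻¹' B) hτ, hhB _ hτ]
      by_cases hτE : H τ ∈ E
      · rw [indicator_of_mem (s := H ⁻¹' E) hτE, indicator_of_mem hτE]; simp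
      · rw [indicator_of_notMem (s := H ⁻¹' E) hτE, indicator_of_notMem hτE]; simp
  have hsum : ‖(∫ τ in F ⁻¹' E, W τ) - ∫ τ, ((h (F τ) : ℝ) : ℂ) * W τ‖
      + ‖(∫ τ in G ⁻¹' E, W τ) - ∫ τ, ((h (G τ) : ℝ) : ℂ) * W τ‖ ≤ ε := by
    have := (add_le_add (err F hF) (err G hG)).trans hBε
    rw [← ofReal_norm, ← ofReal_norm, ← ENNReal.ofReal_add (norm_nonneg _) (norm_nonneg _)] at this
    exact (ENNReal.ofReal_le_ofReal_iff hε.le).1 this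
  have hbh := hb h hh
  have e : ∫ τ, ((h (F τ) - h (G τ) : ℝ) : ℂ) * W τ
      = (∫ τ, ((h (F τ) : ℝ) : ℂ) * W τ) - ∫ τ, ((h (G τ) : ℝ) : ℂ) * W τ := by
    rw [← integral_sub (hint F hF) (hint G hG)]
    congr 1; ext τ; push_cast; ring
  rw [e] at hbh
  set a1 := ∫ τ in F ⁻¹' E, W τ
  set a2 := ∫ τ in G ⁻¹' E, W τ
  set c1 := ∫ τ, ((h (F τ) : ℝ) : ℂ) * W τ
  set c2 := ∫ τ, ((h (G τ) : ℝ) : ℂ) * W τ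
  calc ‖a1 - a2‖ = ‖(a1 - c1) - (a2 - c2) + (c1 - c2)‖ := by congr 1; ring
    _ ≤ ‖a1 - c1‖ + ‖a2 - c2‖ + ‖c1 - c2‖ :=
      (norm_add_le _ _).trans (add_le_add_left (norm_sub_le _ _) _)
    _ ≤ b + ε := by linarith

/-! ### Translations of the group -/

lemma heisMul_neg_cancel (ξ : ℝ) (y z : ℝ × ℝ × ℝ) : heisMul ξ (-y) (heisMul ξ y z) = z := by
  ext <;> simp [heisMul]; ring

lemma heisMul_cancel_neg (ξ : ℝ) (y z : ℝ × ℝ × ℝ) : heisMul ξ y (heisMul ξ (-y) z) = z := by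
  simpa using heisMul_neg_cancel ξ (-y) z

lemma continuous_heisMul (ξ : ℝ) : Continuous fun p : (ℝ × ℝ × ℝ) × ℝ × ℝ × ℝ =>
    heisMul ξ p.1 p.2 := by
  unfold heisMul; fun_prop

lemma measurePreserving_heisMul (ξ : ℝ) (y : ℝ × ℝ × ℝ) :
    MeasurePreserving (heisMul ξ y) := by
  have h1 : ∀ c : ℝ, MeasurePreserving (fun p : ℝ × ℝ => (y.2.1 + p.1, p.2 + (c + ξ * y.1 * p.1))) :=
    fun c => (measurePreserving_add_left volume y.2.1).skew_product
      (g := fun a b : ℝ => b + (c + ξ * y.1 * a)) (by fun_prop)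
      (Filter.Eventually.of_forall fun p => (measurePreserving_add_right volume _).map_eq)
  have h2 : MeasurePreserving (fun q : ℝ × ℝ × ℝ =>
      (y.1 + q.1, (fun p : ℝ × ℝ => (y.2.1 + p.1, p.2 + ((y.2.2 - ξ * y.2.1 * q.1) + ξ * y.1 * p.1)))
        q.2)) :=
    (measurePreserving_add_left volume y.1).skew_product
      (g := fun (a : ℝ) (p : ℝ × ℝ) =>
        (y.2.1 + p.1, p.2 + ((y.2.2 - ξ * y.2.1 * a) + ξ * y.1 * p.1))) (by fun_prop)
      (Filter.Eventually.of_forall fun x => (h1 _).map_eq)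
  convert h2 using 1
  ext q <;> simp [heisMul]; ring

lemma measurePreserving_neg_prod : MeasurePreserving (fun w : ℝ × ℝ × ℝ => -w) :=
  (Measure.measurePreserving_neg (volume : Measure ℝ)).prod
    ((Measure.measurePreserving_neg (volume : Measure ℝ)).prod
      (Measure.measurePreserving_neg (volume : Measure ℝ)))

lemma measurePreserving_heisMul_left_neg (ξ : ℝ) (z : ℝ × ℝ × ℝ) :
    MeasurePreserving (fun y => heisMul ξ (-y) z) := by
  have : (fun y => heisMul ξ (-y) z) = (fun w => -w) ∘ heisMul ξ (-z) := by
    ext y <;> simp [heisMul] <;> ring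
  rw [this]
  exact measurePreserving_neg_prod.comp (measurePreserving_heisMul ξ (-z))

/-! ### Densities of transported measures -/

/-- The Radon-Nikodym theorem for complex measures, from the one for signed measures. -/
lemma exists_isDensity_of_absCont {m : ComplexMeasure (ℝ × ℝ × ℝ)} (hm : IsAbsCont m) :
    ∃ κ, IsDensity m κ := by
  have hre : (ComplexMeasure.re m).AbsolutelyContinuous
      (volume : Measure (ℝ × ℝ × ℝ)).toENNRealVectorMeasure := fun s hs => by
    have : ComplexMeasure.re m s = (m s).re := rfl
    rw [this, hm hs, Complex.zero_re]
  have him : (ComplexMeasure.im m).AbsolutelyContinuous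
      (volume : Measure (ℝ × ℝ × ℝ)).toENNRealVectorMeasure := fun s hs => by
    have : ComplexMeasure.im m s = (m s).im := rfl
    rw [this, hm hs, Complex.zero_im]
  have h1 := SignedMeasure.withDensityᵥ_rnDeriv_eq _ _ hre
  have h2 := SignedMeasure.withDensityᵥ_rnDeriv_eq _ _ him
  have hi := ComplexMeasure.integrable_rnDeriv m (volume : Measure (ℝ × ℝ × ℝ))
  refine ⟨m.rnDeriv volume, hi, VectorMeasure.ext fun E hE => ?_⟩
  rw [withDensityᵥ_apply hi hE]
  apply Complex.ext
  · have : (m E).re = ComplexMeasure.re m E := rfl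
    rw [this, ← h1, withDensityᵥ_apply (SignedMeasure.integrable_rnDeriv _ _) hE]
    exact integral_re (𝕜 := ℂ) hi.integrableOn
  · have : (m E).im = ComplexMeasure.im m E := rfl
    rw [this, ← h2, withDensityᵥ_apply (SignedMeasure.integrable_rnDeriv _ _) hE]
    exact integral_im (𝕜 := ℂ) hi.integrableOn

lemma IsDensity.isAbsCont {m : ComplexMeasure (ℝ × ℝ × ℝ)} {κ : ℝ × ℝ × ℝ → ℂ}
    (h : IsDensity m κ) : IsAbsCont m := by
  intro E hE
  by_cases hEm : MeasurableSet E
  · rw [Measure.toENNRealVectorMeasure_apply_measurable hEm] at hE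
    rw [h.2, withDensityᵥ_apply h.1 hEm, Measure.restrict_eq_zero.2 hE, integral_zero_measure]
  · exact m.not_measurable hEm

lemma IsDensity.setIntegral_eq {W : ℝ × ℝ × ℝ → ℂ} (hW : Integrable W)
    {F : ℝ × ℝ × ℝ → ℝ × ℝ × ℝ} (hF : Measurable F) {κ : ℝ × ℝ × ℝ → ℂ}
    (h : IsDensity (((volume : Measure (ℝ × ℝ × ℝ)).withDensityᵥ W).map F) κ)
    {E : Set (ℝ × ℝ × ℝ)} (hE : MeasurableSet E) :
    ∫ z in E, κ z = ∫ τ in F ⁻¹' E, W τ := by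
  rw [← withDensityᵥ_apply h.1 hE, ← h.2, VectorMeasure.map_apply _ hF hE,
    withDensityᵥ_apply hW (hF hE)]

/-- A measure whose left translates by small elements are close to it in total variation is
absolutely continuous: almost every translate of a null set is not charged at all. -/
lemma isAbsCont_map_of_translation_bound (ξ : ℝ) {W : ℝ × ℝ × ℝ → ℂ} (hW : Integrable W)
    {F : ℝ × ℝ × ℝ → ℝ × ℝ × ℝ} (hF : Measurable F) {b : ℝ × ℝ × ℝ → ℝ}
    (hb : ∀ y E, MeasurableSet E →
      ‖(∫ τ in F ⁻¹' E, W τ) - ∫ τ in (fun τ => heisMul ξ (-y) (F τ)) ⁻¹' E, W τ‖ ≤ b y)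
    (hb0 : Filter.Tendsto b (nhds 0) (nhds 0)) :
    IsAbsCont (((volume : Measure (ℝ × ℝ × ℝ)).withDensityᵥ W).map F) := by
  intro E hE
  by_cases hEm : MeasurableSet E
  swap
  · exact VectorMeasure.not_measurable _ hEm
  rw [Measure.toENNRealVectorMeasure_apply_measurable hEm] at hE
  rw [VectorMeasure.map_apply _ hF hEm, withDensityᵥ_apply hW (hF hEm)]
  have hmeas : Measurable fun p : (ℝ × ℝ × ℝ) × ℝ × ℝ × ℝ => heisMul ξ (-p.1) (F p.2) :=
    (continuous_heisMul ξ).measurable.comp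
      ((measurable_fst.neg).prodMk (hF.comp measurable_snd))
  have hnull : ∀ᵐ y : ℝ × ℝ × ℝ, ∀ᵐ τ : ℝ × ℝ × ℝ, heisMul ξ (-y) (F τ) ∉ E := by
    rw [Measure.ae_ae_comm (p := fun y τ => heisMul ξ (-y) (F τ) ∉ E) (hmeas hEm).compl]
    refine Filter.Eventually.of_forall fun τ => ?_
    have := (measurePreserving_heisMul_left_neg ξ (F τ)).measure_preimage hEm.nullMeasurableSet
    rw [hE] at this
    exact measure_eq_zero_iff_ae_notMem.1 this
  have hy : ∀ᵐ y : ℝ × ℝ × ℝ, ‖∫ τ in F ⁻¹' E, W τ‖ ≤ b y := by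
    filter_upwards [hnull] with y hy
    have h0 : volume ((fun τ => heisMul ξ (-y) (F τ)) ⁻¹' E) = 0 :=
      measure_eq_zero_iff_ae_notMem.2 hy
    simpa [Measure.restrict_eq_zero.2 h0] using hb y E hEm
  have hd := Measure.dense_of_ae hy
  refine norm_le_zero_iff.1 (le_of_forall_pos_le_add fun ε hε => ?_)
  have hev : {y | b y < ε} ∈ nhds (0 : ℝ × ℝ × ℝ) := hb0.eventually (gt_mem_nhds hε)
  obtain ⟨V, hV, hVo, hV0⟩ := mem_nhds_iff.1 hev
  obtain ⟨y, hyV, hyb⟩ := hd.inter_open_nonempty V hVo ⟨0, hV0⟩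
  simpa using hyb.trans (hV hyV).le

/-- The passage from estimates against test functions to the density of the transported measure. -/
theorem exists_isDensity_of_isTestFunction_bound (ξ : ℝ) {W : ℝ × ℝ × ℝ → ℂ} (hW : Integrable W)
    {F : ℝ × ℝ × ℝ → ℝ × ℝ × ℝ} (hF : Measurable F) {b : ℝ × ℝ × ℝ → ℝ}
    (hb : ∀ y h, IsTestFunction h →
      ‖∫ τ, ((h (F τ) - h (heisMul ξ (-y) (F τ)) : ℝ) : ℂ) * W τ‖ ≤ b y)
    (hb0 : Filter.Tendsto b (nhds 0) (nhds 0)) :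
    ∃ κ, IsDensity (((volume : Measure (ℝ × ℝ × ℝ)).withDensityᵥ W).map F) κ ∧
      ∫⁻ z, ‖κ z‖ₑ ≤ ENNReal.ofReal (4 * ∫ τ, ‖W τ‖) ∧
      ∀ y, ∫⁻ z, ‖κ z - κ (heisMul ξ y z)‖ₑ ≤ ENNReal.ofReal (4 * b y) := by
  have hG : ∀ y, Measurable fun τ => heisMul ξ (-y) (F τ) := fun y =>
    (measurePreserving_heisMul ξ (-y)).measurable.comp hF
  have hset : ∀ y E, MeasurableSet E →
      ‖(∫ τ in F ⁻¹' E, W τ) - ∫ τ in (fun τ => heisMul ξ (-y) (F τ)) ⁻¹' E, W τ‖ ≤ b y :=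
    fun y E hE => norm_setIntegral_sub_le_of_isTestFunction hW hF (hG y) (hb y) hE
  obtain ⟨κ, hκ⟩ := exists_isDensity_of_absCont
    (isAbsCont_map_of_translation_bound ξ hW hF hset hb0)
  refine ⟨κ, hκ, lintegral_enorm_le_of_setIntegral_le hκ.1 fun E hE => ?_, fun y => ?_⟩
  · rw [hκ.setIntegral_eq hW hF hE]
    exact (norm_integral_le_integral_norm _).trans
      (setIntegral_le_integral hW.norm (Filter.Eventually.of_forall fun _ => norm_nonneg _))
  · have hmp := measurePreserving_heisMul ξ y
    have hκy : Integrable fun z => κ (heisMul ξ y z) := hmp.integrable_comp_of_integrable hκ.1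
    refine lintegral_enorm_le_of_setIntegral_le (hκ.1.sub hκy) fun E hE => ?_
    have hmy := (measurePreserving_heisMul ξ (-y)).measurable hE
    have hpre : E = heisMul ξ y ⁻¹' (heisMul ξ (-y) ⁻¹' E) := by
      ext z; simp [heisMul_neg_cancel]
    have e : ∫ z in E, κ (heisMul ξ y z) = ∫ z in heisMul ξ (-y) ⁻¹' E, κ z := by
      conv_lhs => rw [hpre]
      refine hmp.setIntegral_preimage_emb ?_ _ _
      exact (MeasurableEquiv.mk ⟨heisMul ξ y, heisMul ξ (-y), heisMul_neg_cancel ξ y,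
        heisMul_cancel_neg ξ y⟩ hmp.measurable
        (measurePreserving_heisMul ξ (-y)).measurable).measurableEmbedding
    rw [integral_sub' hκ.1.integrableOn hκy.integrableOn, e, hκ.setIntegral_eq hW hF hE,
      hκ.setIntegral_eq hW hF hmy]
    exact hset y E hE

/-! ### Integration by parts along a coordinate -/

section IntegrationByParts

variable {G g : ℝ × ℝ × ℝ → ℂ}

lemma integral_eq_zero_of_hasDerivAt_slice {G g : ℝ → ℂ} (hGc : HasCompactSupport G)
    (hgc : Continuous g) (h : ∀ x, HasDerivAt G (g x) x) : ∫ x, g x = 0 := by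
  have hG : Continuous G := continuous_iff_continuousAt.2 fun x => (h x).continuousAt
  have hgs : HasCompactSupport g := by
    have : g = deriv G := funext fun x => (h x).deriv.symm
    rw [this]; exact hGc.deriv
  exact integral_eq_zero_of_hasDerivAt_of_integrable h (hgc.integrable_of_hasCompactSupport hgs)
    (hG.integrable_of_hasCompactSupport hGc)

lemma HasCompactSupport.slice₁ (hGc : HasCompactSupport G) (p : ℝ × ℝ) :
    HasCompactSupport fun x => G (x, p) :=
  HasCompactSupport.intro (hGc.isCompact.image continuous_fst) fun _ hx =>
    image_eq_zero_of_notMem_tsupport fun h => hx ⟨_, h, rfl⟩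

lemma HasCompactSupport.slice₂ (hGc : HasCompactSupport G) (x z : ℝ) :
    HasCompactSupport fun y => G (x, y, z) :=
  HasCompactSupport.intro (hGc.isCompact.image (continuous_fst.comp continuous_snd)) fun _ hy =>
    image_eq_zero_of_notMem_tsupport fun h => hy ⟨_, h, rfl⟩

lemma HasCompactSupport.slice₃ (hGc : HasCompactSupport G) (x y : ℝ) :
    HasCompactSupport fun z => G (x, y, z) :=
  HasCompactSupport.intro (hGc.isCompact.image (continuous_snd.comp continuous_snd)) fun _ hz =>
    image_eq_zero_of_notMem_tsupport fun h => hz ⟨_, h, rfl⟩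

lemma integral_eq_zero_of_hasDerivAt₁ (hGc : HasCompactSupport G) (hgc : Continuous g)
    (hgs : HasCompactSupport g) (h : ∀ τ, HasDerivAt (fun x => G (x, τ.2)) (g τ) τ.1) :
    ∫ τ, g τ = 0 := by
  have hgi := hgc.integrable_of_hasCompactSupport hgs (μ := volume)
  rw [Measure.volume_eq_prod, integral_prod_symm _ hgi]
  refine integral_eq_zero_of_ae (Filter.Eventually.of_forall fun p => ?_)
  exact integral_eq_zero_of_hasDerivAt_slice (hGc.slice₁ p) (by fun_prop) fun x => h (x, p)

lemma integral_eq_zero_of_hasDerivAt₂ (hGc : HasCompactSupport G) (hgc : Continuous g)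
    (hgs : HasCompactSupport g)
    (h : ∀ τ, HasDerivAt (fun x => G (τ.1, x, τ.2.2)) (g τ) τ.2.1) :
    ∫ τ, g τ = 0 := by
  have hgi := hgc.integrable_of_hasCompactSupport hgs (μ := volume)
  rw [Measure.volume_eq_prod, integral_prod _ hgi]
  refine integral_eq_zero_of_ae (Filter.Eventually.of_forall fun x => ?_)
  have hc : Continuous fun p : ℝ × ℝ => g (x, p) := by fun_prop
  have hs : HasCompactSupport fun p : ℝ × ℝ => g (x, p) :=
    HasCompactSupport.intro (hgs.isCompact.image continuous_snd) fun y hy =>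
      image_eq_zero_of_notMem_tsupport fun h => hy ⟨_, h, rfl⟩
  have hci := hc.integrable_of_hasCompactSupport hs (μ := volume)
  simp only [Pi.zero_apply]
  rw [Measure.volume_eq_prod, integral_prod_symm _ hci]
  refine integral_eq_zero_of_ae (Filter.Eventually.of_forall fun z => ?_)
  exact integral_eq_zero_of_hasDerivAt_slice (hGc.slice₂ x z) (by fun_prop) fun y => h (x, y, z)

lemma integral_eq_zero_of_hasDerivAt₃ (hGc : HasCompactSupport G) (hgc : Continuous g)
    (hgs : HasCompactSupport g)
    (h : ∀ τ, HasDerivAt (fun x => G (τ.1, τ.2.1, x)) (g τ) τ.2.2) :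
    ∫ τ, g τ = 0 := by
  have hgi := hgc.integrable_of_hasCompactSupport hgs (μ := volume)
  rw [Measure.volume_eq_prod, integral_prod _ hgi]
  refine integral_eq_zero_of_ae (Filter.Eventually.of_forall fun x => ?_)
  have hc : Continuous fun p : ℝ × ℝ => g (x, p) := by fun_prop
  have hs : HasCompactSupport fun p : ℝ × ℝ => g (x, p) :=
    HasCompactSupport.intro (hgs.isCompact.image continuous_snd) fun y hy =>
      image_eq_zero_of_notMem_tsupport fun h => hy ⟨_, h, rfl⟩
  have hci := hc.integrable_of_hasCompactSupport hs (μ := volume)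
  simp only [Pi.zero_apply]
  rw [Measure.volume_eq_prod, integral_prod _ hci]
  refine integral_eq_zero_of_ae (Filter.Eventually.of_forall fun y => ?_)
  exact integral_eq_zero_of_hasDerivAt_slice (hGc.slice₃ x y) (by fun_prop) fun z => h (x, y, z)

end IntegrationByParts

/-- The value at `z` of the right-invariant vector field with value `y` at the origin: the
velocity of `θ ↦ (θ y) ⊙ z`. -/
def rightInvField (ξ : ℝ) (y z : ℝ × ℝ × ℝ) : ℝ × ℝ × ℝ :=
  (y.1, y.2.1, y.2.2 + ξ * (y.1 * z.2.1 - y.2.1 * z.1))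

/-- A slice datum: `Q` is a compactly supported function whose derivative along the curve
`x ↦ ins τ x` through `τ` is the continuous function `q`. -/
structure IsSlicePrimitive (ins : ℝ × ℝ × ℝ → ℝ → ℝ × ℝ × ℝ) (pr : ℝ × ℝ × ℝ → ℝ)
    (Q q : ℝ × ℝ × ℝ → ℂ) : Prop where
  hasCompactSupport : HasCompactSupport Q
  continuous : Continuous Q
  continuous_deriv : Continuous q
  support_deriv : tsupport q ⊆ tsupport Q
  hasDerivAt : ∀ τ, HasDerivAt (fun x => Q (ins τ x)) (q τ) (pr τ)

/-- Replacement of the first coordinate. -/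
def ins₁ (τ : ℝ × ℝ × ℝ) (x : ℝ) : ℝ × ℝ × ℝ := (x, τ.2)
/-- Replacement of the second coordinate. -/
def ins₂ (τ : ℝ × ℝ × ℝ) (x : ℝ) : ℝ × ℝ × ℝ := (τ.1, x, τ.2.2)
/-- Replacement of the third coordinate. -/
def ins₃ (τ : ℝ × ℝ × ℝ) (x : ℝ) : ℝ × ℝ × ℝ := (τ.1, τ.2.1, x)

/-- Integration by parts along one coordinate, for the composition of a function with a map `F`
that is differentiable only near the support of `Q`. -/
lemma integral_comp_slice_add {ins : ℝ × ℝ × ℝ → ℝ → ℝ × ℝ × ℝ} {pr : ℝ × ℝ × ℝ → ℝ}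
    (hins : ∀ τ, ins τ (pr τ) = τ) (hinsc : ∀ τ, Continuous (ins τ))
    (hzero : ∀ G g : ℝ × ℝ × ℝ → ℂ, HasCompactSupport G → Continuous g → HasCompactSupport g →
      (∀ τ, HasDerivAt (fun x => G (ins τ x)) (g τ) (pr τ)) → ∫ τ, g τ = 0)
    {F F' : ℝ × ℝ × ℝ → ℝ × ℝ × ℝ} (hFc : Continuous F) {Ω : Set (ℝ × ℝ × ℝ)} (hΩ : IsOpen Ω)
    (hF : ∀ τ ∈ Ω, HasDerivAt (fun x => F (ins τ x)) (F' τ) (pr τ)) (hF' : ContinuousOn F' Ω)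
    {Q q : ℝ × ℝ × ℝ → ℂ} (hQ : IsSlicePrimitive ins pr Q q) (hQΩ : tsupport Q ⊆ Ω)
    {h : ℝ × ℝ × ℝ → ℝ} (hh : ContDiff ℝ 1 h) :
    Integrable (fun τ => ((fderiv ℝ h (F τ) (F' τ) : ℝ) : ℂ) * Q τ) ∧
    Integrable (fun τ => ((h (F τ) : ℝ) : ℂ) * q τ) ∧
    (∫ τ, ((fderiv ℝ h (F τ) (F' τ) : ℝ) : ℂ) * Q τ) = - ∫ τ, ((h (F τ) : ℝ) : ℂ) * q τ := by
  have hqs : HasCompactSupport q := hQ.hasCompactSupport.of_isClosed_subset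
    (isClosed_tsupport q) hQ.support_deriv
  have hdh : Continuous (fderiv ℝ h) := hh.continuous_fderiv one_ne_zero
  have c2 : Continuous fun τ => ((h (F τ) : ℝ) : ℂ) * q τ :=
    (Complex.continuous_ofReal.comp (hh.continuous.comp hFc)).mul hQ.continuous_deriv
  have s2 : HasCompactSupport fun τ => ((h (F τ) : ℝ) : ℂ) * q τ := hqs.mul_left
  have s1 : HasCompactSupport fun τ => ((fderiv ℝ h (F τ) (F' τ) : ℝ) : ℂ) * Q τ :=
    hQ.hasCompactSupport.mul_left
  have c1 : Continuous fun τ => ((fderiv ℝ h (F τ) (F' τ) : ℝ) : ℂ) * Q τ := by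
    refine continuous_of_tsupport fun τ hτ => ?_
    have hτΩ : τ ∈ Ω := hQΩ (tsupport_mul_subset_right hτ)
    have e1 : ContinuousAt F' τ := hF'.continuousAt (hΩ.mem_nhds hτΩ)
    have e2 : ContinuousAt (fun τ => fderiv ℝ h (F τ)) τ := (hdh.comp hFc).continuousAt
    exact (Complex.continuous_ofReal.continuousAt.comp (e2.clm_apply e1)).mul
      hQ.continuous.continuousAt
  have i1 := c1.integrable_of_hasCompactSupport s1 (μ := volume)
  have i2 := c2.integrable_of_hasCompactSupport s2 (μ := volume)
  refine ⟨i1, i2, eq_neg_of_add_eq_zero_left ?_⟩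
  rw [← integral_add i1 i2]
  refine hzero (fun τ => ((h (F τ) : ℝ) : ℂ) * Q τ) _ hQ.hasCompactSupport.mul_left (c1.add c2)
    (s1.add s2) fun τ => ?_
  by_cases hτ : τ ∈ tsupport Q
  · have d1 : HasDerivAt (fun x => h (F (ins τ x))) (fderiv ℝ h (F τ) (F' τ)) (pr τ) := by
      have := (hh.differentiable one_ne_zero (F (ins τ (pr τ)))).hasFDerivAt.comp_hasDerivAt (pr τ)
        (hF τ (hQΩ hτ))
      rwa [hins] at this
    have := d1.ofReal_comp.mul (hQ.hasDerivAt τ)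
    simp only [hins] at this
    exact this
  · have hq0 : q τ = 0 := image_eq_zero_of_notMem_tsupport fun h' => hτ (hQ.support_deriv h')
    have hQ0 : Q τ = 0 := image_eq_zero_of_notMem_tsupport hτ
    simp only [hq0, hQ0, mul_zero, add_zero]
    have hev : ∀ᶠ x in nhds (pr τ), ins τ x ∈ (tsupport Q)ᶜ := by
      refine (hinsc τ).continuousAt.eventually_mem ?_
      rw [hins]; exact (isClosed_tsupport Q).isOpen_compl.mem_nhds hτ
    refine (hasDerivAt_const (pr τ) (0 : ℂ)).congr_of_eventuallyEq (hev.mono fun x hx => ?_)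
    simp [image_eq_zero_of_notMem_tsupport hx]

/-! ### Flows of right-invariant fields -/

/-- The data expressing that, along a map `F` with partial derivatives `F₁, F₂, F₃`, the weight `w`
times the right-invariant field with value `y` at the origin is the image of the vector field with
components `Q₁, Q₂, Q₃`, whose partial derivatives are `q₁, q₂, q₃`. -/
structure IsPulledBack (ξ : ℝ) (y : ℝ × ℝ × ℝ) (Ω : Set (ℝ × ℝ × ℝ))
    (F F₁ F₂ F₃ : ℝ × ℝ × ℝ → ℝ × ℝ × ℝ) (w Q₁ Q₂ Q₃ q₁ q₂ q₃ : ℝ × ℝ × ℝ → ℂ) : Prop where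
  slice₁ : IsSlicePrimitive ins₁ (fun τ => τ.1) Q₁ q₁
  slice₂ : IsSlicePrimitive ins₂ (fun τ => τ.2.1) Q₂ q₂
  slice₃ : IsSlicePrimitive ins₃ (fun τ => τ.2.2) Q₃ q₃
  tsupport₁ : tsupport Q₁ ⊆ Ω
  tsupport₂ : tsupport Q₂ ⊆ Ω
  tsupport₃ : tsupport Q₃ ⊆ Ω
  deriv₁ : ∀ τ ∈ Ω, HasDerivAt (fun x => F (ins₁ τ x)) (F₁ τ) τ.1
  deriv₂ : ∀ τ ∈ Ω, HasDerivAt (fun x => F (ins₂ τ x)) (F₂ τ) τ.2.1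
  deriv₃ : ∀ τ ∈ Ω, HasDerivAt (fun x => F (ins₃ τ x)) (F₃ τ) τ.2.2
  cont₁ : ContinuousOn F₁ Ω
  cont₂ : ContinuousOn F₂ Ω
  cont₃ : ContinuousOn F₃ Ω
  hasCompactSupport : HasCompactSupport w
  continuous : Continuous w
  eq_zero : ∀ τ ∉ Ω, w τ = 0
  eq : ∀ τ ∈ Ω, ∃ n₁ n₂ n₃ D : ℝ, ∃ G : ℂ, Q₁ τ = n₁ * G ∧ Q₂ τ = n₂ * G ∧ Q₃ τ = n₃ * G ∧
    w τ = D * G ∧ n₁ • F₁ τ + n₂ • F₂ τ + n₃ • F₃ τ = D • rightInvField ξ y (F τ)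

variable {ξ : ℝ} {y : ℝ × ℝ × ℝ} {Ω : Set (ℝ × ℝ × ℝ)} {F F₁ F₂ F₃ : ℝ × ℝ × ℝ → ℝ × ℝ × ℝ}
  {w Q₁ Q₂ Q₃ q₁ q₂ q₃ : ℝ × ℝ × ℝ → ℂ}

/-- The derivative of `h` along the right-invariant field is written in terms of the partial
derivatives of `h ∘ F`, and these are integrated by parts, each in its own variable. -/
lemma IsPulledBack.norm_integral_fderiv_le
    (H : IsPulledBack ξ y Ω F F₁ F₂ F₃ w Q₁ Q₂ Q₃ q₁ q₂ q₃) (hFc : Continuous F)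
    (hΩ : IsOpen Ω) {B : ℝ} (hB0 : 0 ≤ B)
    (hB : (∫⁻ τ, ‖q₁ τ‖ₑ) + (∫⁻ τ, ‖q₂ τ‖ₑ) + ∫⁻ τ, ‖q₃ τ‖ₑ ≤ ENNReal.ofReal B)
    {h : ℝ × ℝ × ℝ → ℝ} (hh : ContDiff ℝ 1 h) (hh1 : ∀ z, |h z| ≤ 1) :
    ‖∫ τ, ((fderiv ℝ h (F τ) (rightInvField ξ y (F τ)) : ℝ) : ℂ) * w τ‖ ≤ B := by
  obtain ⟨i₁, j₁, e₁⟩ := integral_comp_slice_add (ins := ins₁) (pr := fun τ => τ.1)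
    (fun τ => rfl) (fun τ => by unfold ins₁; fun_prop)
    (fun G g a b c d => integral_eq_zero_of_hasDerivAt₁ a b c d) hFc hΩ H.deriv₁ H.cont₁
    H.slice₁ H.tsupport₁ hh
  obtain ⟨i₂, j₂, e₂⟩ := integral_comp_slice_add (ins := ins₂) (pr := fun τ => τ.2.1)
    (fun τ => rfl) (fun τ => by unfold ins₂; fun_prop)
    (fun G g a b c d => integral_eq_zero_of_hasDerivAt₂ a b c d) hFc hΩ H.deriv₂ H.cont₂
    H.slice₂ H.tsupport₂ hh
  obtain ⟨i₃, j₃, e₃⟩ := integral_comp_slice_add (ins := ins₃) (pr := fun τ => τ.2.2)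
    (fun τ => rfl) (fun τ => by unfold ins₃; fun_prop)
    (fun G g a b c d => integral_eq_zero_of_hasDerivAt₃ a b c d) hFc hΩ H.deriv₃ H.cont₃
    H.slice₃ H.tsupport₃ hh
  have hpt : ∀ τ, ((fderiv ℝ h (F τ) (rightInvField ξ y (F τ)) : ℝ) : ℂ) * w τ
      = ((fderiv ℝ h (F τ) (F₁ τ) : ℝ) : ℂ) * Q₁ τ + ((fderiv ℝ h (F τ) (F₂ τ) : ℝ) : ℂ) * Q₂ τ
        + ((fderiv ℝ h (F τ) (F₃ τ) : ℝ) : ℂ) * Q₃ τ := by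
    intro τ
    by_cases hτ : τ ∈ Ω
    · obtain ⟨n₁, n₂, n₃, D, G, h1, h2, h3, h4, h5⟩ := H.eq τ hτ
      have := congrArg (fderiv ℝ h (F τ)) h5
      simp only [map_add, map_smul, smul_eq_mul] at this
      rw [h1, h2, h3, h4]
      have hc := congrArg (Complex.ofReal) this
      push_cast at hc
      linear_combination -G * hc
    · rw [H.eq_zero τ hτ, image_eq_zero_of_notMem_tsupport fun h => hτ (H.tsupport₁ h),
        image_eq_zero_of_notMem_tsupport fun h => hτ (H.tsupport₂ h),
        image_eq_zero_of_notMem_tsupport fun h => hτ (H.tsupport₃ h)]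
      simp
  have hbd : ∀ q : ℝ × ℝ × ℝ → ℂ, ‖∫ τ, ((h (F τ) : ℝ) : ℂ) * q τ‖ₑ ≤ ∫⁻ τ, ‖q τ‖ₑ := by
    intro q
    refine (enorm_integral_le_lintegral_enorm _).trans (lintegral_mono fun τ => ?_)
    rw [enorm_le_iff_norm_le, norm_mul, Complex.norm_real]
    exact mul_le_of_le_one_left (norm_nonneg _) (hh1 _)
  have hadd := integral_add (i₁.add i₂) i₃
  simp only [Pi.add_apply] at hadd
  rw [integral_congr_ae (Filter.Eventually.of_forall hpt), hadd, integral_add i₁ i₂, e₁, e₂, e₃]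
  have : ‖-(∫ τ, ((h (F τ) : ℝ) : ℂ) * q₁ τ) + -(∫ τ, ((h (F τ) : ℝ) : ℂ) * q₂ τ)
      + -∫ τ, ((h (F τ) : ℝ) : ℂ) * q₃ τ‖ₑ ≤ ENNReal.ofReal B := by
    refine (enorm_add_le _ _).trans ((add_le_add (enorm_add_le _ _) le_rfl).trans ?_)
    rw [enorm_neg, enorm_neg, enorm_neg]
    exact (add_le_add (add_le_add (hbd q₁) (hbd q₂)) (hbd q₃)).trans hB
  rw [← ofReal_norm] at this
  exact (ENNReal.ofReal_le_ofReal_iff hB0).1 this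

lemma hasDerivAt_heisMul_neg_smul (ξ : ℝ) (y z : ℝ × ℝ × ℝ) (θ : ℝ) :
    HasDerivAt (fun θ : ℝ => heisMul ξ (-(θ • y)) z) (-rightInvField ξ y z) θ := by
  have hl : ∀ c d : ℝ, HasDerivAt (fun θ : ℝ => -(θ * c) + d) (-c) θ := fun c d => by
    simpa using ((hasDerivAt_id θ).mul_const c).neg.add_const d
  have h := (hl y.1 z.1).prodMk ((hl y.2.1 z.2.1).prodMk
    (hl (y.2.2 + ξ * (y.1 * z.2.1 - y.2.1 * z.1)) z.2.2))
  have e : (fun θ : ℝ => heisMul ξ (-(θ • y)) z) = fun θ : ℝ => (-(θ * y.1) + z.1,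
      -(θ * y.2.1) + z.2.1, -(θ * (y.2.2 + ξ * (y.1 * z.2.1 - y.2.1 * z.1))) + z.2.2) := by
    ext θ <;> simp [heisMul]
    ring
  rw [e]
  refine h.congr_deriv ?_
  ext <;> simp [rightInvField]

lemma differentiable_heisMul (ξ : ℝ) (x : ℝ × ℝ × ℝ) : ContDiff ℝ 1 (heisMul ξ x) := by
  unfold heisMul; fun_prop

/-- The right-invariant field is carried to itself by the translations of its own flow. -/
lemma fderiv_heisMul_rightInvField (ξ : ℝ) (y z : ℝ × ℝ × ℝ) (θ : ℝ) :
    fderiv ℝ (heisMul ξ (-(θ • y))) z (rightInvField ξ y z) = rightInvField ξ y z := by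
  have hl : ∀ c d : ℝ, HasDerivAt (fun s : ℝ => c + s * d) d 0 := fun c d => by
    simpa using ((hasDerivAt_id (0 : ℝ)).mul_const d).const_add c
  have h1 : HasDerivAt (fun s : ℝ => z + s • rightInvField ξ y z) (rightInvField ξ y z) 0 := by
    simpa using ((hasDerivAt_id (0 : ℝ)).smul_const (rightInvField ξ y z)).const_add z
  have h2 := ((differentiable_heisMul ξ (-(θ • y))).differentiable one_ne_zero
    (z + (0 : ℝ) • rightInvField ξ y z)).hasFDerivAt.comp_hasDerivAt (0 : ℝ) h1
  rw [zero_smul, add_zero] at h2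
  refine h2.unique ?_
  have h := (hl (heisMul ξ (-(θ • y)) z).1 y.1).prodMk
    ((hl (heisMul ξ (-(θ • y)) z).2.1 y.2.1).prodMk
    (hl (heisMul ξ (-(θ • y)) z).2.2 (y.2.2 + ξ * (y.1 * z.2.1 - y.2.1 * z.1))))
  have e : (heisMul ξ (-(θ • y)) ∘ fun s : ℝ => z + s • rightInvField ξ y z) = fun x : ℝ =>
      ((heisMul ξ (-(θ • y)) z).1 + x * y.1, (heisMul ξ (-(θ • y)) z).2.1 + x * y.2.1,
        (heisMul ξ (-(θ • y)) z).2.2 + x * (y.2.2 + ξ * (y.1 * z.2.1 - y.2.1 * z.1))) := by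
    ext s <;> simp [heisMul, rightInvField] <;> ring
  rw [e]
  exact h

/-- The basic smoothing estimate: if the weighted invariant field is pulled back to a field whose
divergence has small total mass, the transported measure moves little under left translation. -/
theorem IsPulledBack.norm_integral_sub_le
    (H : IsPulledBack ξ y Ω F F₁ F₂ F₃ w Q₁ Q₂ Q₃ q₁ q₂ q₃) (hFc : Continuous F)
    (hΩ : IsOpen Ω) {B : ℝ} (hB0 : 0 ≤ B)
    (hB : (∫⁻ τ, ‖q₁ τ‖ₑ) + (∫⁻ τ, ‖q₂ τ‖ₑ) + ∫⁻ τ, ‖q₃ τ‖ₑ ≤ ENNReal.ofReal B)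
    {h : ℝ × ℝ × ℝ → ℝ} (hh : IsTestFunction h) :
    ‖∫ τ, ((h (F τ) - h (heisMul ξ (-y) (F τ)) : ℝ) : ℂ) * w τ‖ ≤ B := by
  have hC1 : ContDiff ℝ 1 h := hh.contDiff.of_le (by exact_mod_cast le_top)
  have hdc : Continuous (fderiv ℝ h) := hC1.continuous_fderiv one_ne_zero
  obtain ⟨C, hC⟩ := (hh.hasCompactSupport.fderiv (𝕜 := ℝ)).exists_bound_of_continuous hdc
  set φ : ℝ → ℂ := fun θ => ∫ τ, ((h (heisMul ξ (-(θ • y)) (F τ)) : ℝ) : ℂ) * w τ with hφ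
  set R : ℝ × ℝ × ℝ → ℝ × ℝ × ℝ := fun τ => rightInvField ξ y (F τ) with hR
  have hRc : Continuous R := by
    simp only [hR, rightInvField]; fun_prop
  have htr : ∀ θ : ℝ, Continuous fun τ => heisMul ξ (-(θ • y)) (F τ) := fun θ =>
    (continuous_heisMul ξ).comp (continuous_const.prodMk hFc)
  have hderiv : ∀ θ : ℝ, HasDerivAt φ
      (∫ τ, ((fderiv ℝ h (heisMul ξ (-(θ • y)) (F τ)) (-R τ) : ℝ) : ℂ) * w τ) θ := by
    intro θ
    refine (hasDerivAt_integral_of_dominated_loc_of_deriv_le (𝕜 := ℝ) (s := univ)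
      (F := fun θ τ => ((h (heisMul ξ (-(θ • y)) (F τ)) : ℝ) : ℂ) * w τ)
      (F' := fun θ τ => ((fderiv ℝ h (heisMul ξ (-(θ • y)) (F τ)) (-R τ) : ℝ) : ℂ) * w τ)
      (bound := fun τ => C * ‖R τ‖ * ‖w τ‖) Filter.univ_mem ?_ ?_ ?_ ?_ ?_ ?_).2
    · exact Filter.Eventually.of_forall fun θ' => ((Complex.continuous_ofReal.comp
        (hC1.continuous.comp (htr θ'))).mul H.continuous).aestronglyMeasurable
    · exact ((Complex.continuous_ofReal.comp
        (hC1.continuous.comp (htr θ))).mul H.continuous).integrable_of_hasCompactSupport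
        H.hasCompactSupport.mul_left
    · exact ((Complex.continuous_ofReal.comp
        ((hdc.comp (htr θ)).clm_apply hRc.neg)).mul H.continuous).aestronglyMeasurable
    · refine Filter.Eventually.of_forall fun τ θ' _ => ?_
      rw [norm_mul, Complex.norm_real]
      refine mul_le_mul_of_nonneg_right ?_ (norm_nonneg _)
      refine (ContinuousLinearMap.le_opNorm _ _).trans ?_
      rw [norm_neg]
      exact mul_le_mul_of_nonneg_right (hC _) (norm_nonneg _)
    · exact ((continuous_const.mul hRc.norm).mul
        H.continuous.norm).integrable_of_hasCompactSupport H.hasCompactSupport.norm.mul_left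
    · refine Filter.Eventually.of_forall fun τ θ' _ => ?_
      have := (hC1.differentiable one_ne_zero _).hasFDerivAt.comp_hasDerivAt θ'
        (hasDerivAt_heisMul_neg_smul ξ y (F τ) θ')
      exact this.ofReal_comp.mul_const (w τ)
  have hbound : ∀ θ : ℝ,
      ‖∫ τ, ((fderiv ℝ h (heisMul ξ (-(θ • y)) (F τ)) (-R τ) : ℝ) : ℂ) * w τ‖ ≤ B := by
    intro θ
    have h1 := H.norm_integral_fderiv_le hFc hΩ hB0 hB (h := h ∘ heisMul ξ (-(θ • y)))
      (hC1.comp (differentiable_heisMul ξ _))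
      (fun z => (abs_of_nonneg (hh.nonneg (heisMul ξ (-(θ • y)) z))).trans_le (hh.le_one _))
    have e : ∀ τ, fderiv ℝ (h ∘ heisMul ξ (-(θ • y))) (F τ) (rightInvField ξ y (F τ))
        = fderiv ℝ h (heisMul ξ (-(θ • y)) (F τ)) (R τ) := by
      intro τ
      rw [fderiv_comp _ (hC1.differentiable one_ne_zero _)
        ((differentiable_heisMul ξ _).differentiable one_ne_zero _)]
      rw [ContinuousLinearMap.comp_apply, fderiv_heisMul_rightInvField]
    simp only [e] at h1
    simp only [map_neg, Complex.ofReal_neg, neg_mul]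
    rwa [integral_neg, norm_neg]
  have hmv := norm_image_sub_le_of_norm_deriv_le_segment_01' (f := φ) (C := B)
    (fun θ _ => (hderiv θ).hasDerivWithinAt) (fun θ _ => hbound θ)
  have hint : ∀ θ : ℝ, Integrable fun τ => ((h (heisMul ξ (-(θ • y)) (F τ)) : ℝ) : ℂ) * w τ :=
    fun θ => ((Complex.continuous_ofReal.comp
        (hC1.continuous.comp (htr θ))).mul H.continuous).integrable_of_hasCompactSupport
        H.hasCompactSupport.mul_left
  have e : ∫ τ, ((h (F τ) - h (heisMul ξ (-y) (F τ)) : ℝ) : ℂ) * w τ = φ 0 - φ 1 := by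
    simp only [hφ]
    rw [← integral_sub (hint 0) (hint 1)]
    congr 1; ext τ
    have : heisMul ξ (-((0 : ℝ) • y)) (F τ) = F τ := by simp [heisMul]
    rw [this, one_smul]; push_cast; ring
  rw [e, norm_sub_rev]
  exact hmv

/-! ### The one-variable estimate -/

/-- A component of the pulled-back field, with numerator `N`, determinant `D` and weight `g`. The
quotient `N / D` is regularised to `N D / (D² + θ² S²)`, where `S` is the size of `D` in the absence
of cancellation, so that only `S` has to be kept away from zero. -/
def regQuot (θ N D S : ℝ) (g : ℂ) : ℂ := ((N * (D / (D ^ 2 + θ ^ 2 * S ^ 2)) : ℝ) : ℂ) * g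

lemma regQuot_eq (θ N D S : ℝ) (g : ℂ) :
    regQuot θ N D S g = N * (((D / (D ^ 2 + θ ^ 2 * S ^ 2) : ℝ) : ℂ) * g) := by
  unfold regQuot; push_cast; ring

/-- The derivative of `regQuot`, in terms of the derivatives of its arguments. -/
def regQuotDeriv (θ N N' D D' S S' : ℝ) (g g' : ℂ) : ℂ :=
  ((N' * (D / (D ^ 2 + θ ^ 2 * S ^ 2))
    + N * (D' / (D ^ 2 + θ ^ 2 * S ^ 2)
      - D * (2 * D * D' + 2 * θ ^ 2 * S * S') / (D ^ 2 + θ ^ 2 * S ^ 2) ^ 2) : ℝ) : ℂ) * g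
  + ((N * (D / (D ^ 2 + θ ^ 2 * S ^ 2)) : ℝ) : ℂ) * g'

lemma hasDerivAt_regQuot {θ : ℝ} (hθ : 0 < θ) {N D S : ℝ → ℝ} {N' D' S' x : ℝ} {g : ℝ → ℂ} {g' : ℂ}
    (hN : HasDerivAt N N' x) (hD : HasDerivAt D D' x) (hS : HasDerivAt S S' x)
    (hg : HasDerivAt g g' x) (hSpos : 0 < S x) :
    HasDerivAt (fun x => regQuot θ (N x) (D x) (S x) (g x))
      (regQuotDeriv θ (N x) N' (D x) D' (S x) S' (g x) g') x := by
  have hE : (D x) ^ 2 + θ ^ 2 * (S x) ^ 2 ≠ 0 := by positivity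
  have h1 : HasDerivAt (fun x => (D x) ^ 2 + θ ^ 2 * (S x) ^ 2)
      (2 * D x * D' + 2 * θ ^ 2 * S x * S') x :=
    ((hD.pow 2).add ((hS.pow 2).const_mul (θ ^ 2))).congr_deriv (by push_cast; ring)
  have h2 := ((hN.mul (hD.div h1 hE)).ofReal_comp.mul hg)
  refine h2.congr_deriv ?_
  unfold regQuotDeriv
  congr 3
  simp only [Pi.div_apply]
  field_simp

/-- The numerator `N` and the derivatives `D'`, `S'` are kept in the bound; all else is estimated by
the size `S`, at the cost of powers of `θ⁻¹`. -/
lemma norm_regQuotDeriv_le {θ N N' D D' S S' a b c d : ℝ} {g g' : ℂ} (hθ : 0 < θ) (hθ1 : θ ≤ 1)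
    (hS : 0 < S) (hDS : |D| ≤ S) (hN : |N| ≤ a) (hN' : |N'| ≤ b * S) (hD' : |D'| ≤ c)
    (hS' : |S'| ≤ c) (hg : ‖g‖ ≤ d) (hg' : ‖g'‖ ≤ d) :
    ‖regQuotDeriv θ N N' D D' S S' g g'‖ ≤ θ⁻¹ ^ 4 * d * (b + a * (5 * c / S ^ 2) + a / S) := by
  have ha : 0 ≤ a := (abs_nonneg _).trans hN
  have hb : 0 ≤ b := by
    by_contra hb
    have := (abs_nonneg N').trans hN'
    nlinarith
  have hc : 0 ≤ c := (abs_nonneg _).trans hS'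
  have hd : 0 ≤ d := (norm_nonneg _).trans hg
  set E := D ^ 2 + θ ^ 2 * S ^ 2 with hE
  have hEge : θ ^ 2 * S ^ 2 ≤ E := by rw [hE]; nlinarith [sq_nonneg D]
  have hE0 : 0 < θ ^ 2 * S ^ 2 := by positivity
  have hEpos : 0 < E := hE0.trans_le hEge
  have hti : 1 ≤ θ⁻¹ := (one_le_inv₀ hθ).2 hθ1
  have ht2 : θ⁻¹ ^ 2 ≤ θ⁻¹ ^ 4 := pow_le_pow_right₀ hti (by norm_num)
  have k1 : |D / E| ≤ θ⁻¹ ^ 4 / S := by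
    rw [abs_div, abs_of_pos hEpos]
    calc |D| / E ≤ S / (θ ^ 2 * S ^ 2) := div_le_div₀ hS.le hDS hE0 hEge
      _ = θ⁻¹ ^ 2 / S := by field_simp
      _ ≤ _ := by gcongr
  have k2 : |D' / E - D * (2 * D * D' + 2 * θ ^ 2 * S * S') / E ^ 2|
      ≤ θ⁻¹ ^ 4 * (5 * c / S ^ 2) := by
    have e1 : |D' / E| ≤ θ⁻¹ ^ 4 * (c / S ^ 2) := by
      rw [abs_div, abs_of_pos hEpos]
      calc |D'| / E ≤ c / (θ ^ 2 * S ^ 2) := div_le_div₀ hc hD' hE0 hEge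
        _ = θ⁻¹ ^ 2 * (c / S ^ 2) := by field_simp
        _ ≤ _ := by gcongr
    have e2 : |D * (2 * D * D' + 2 * θ ^ 2 * S * S') / E ^ 2| ≤ θ⁻¹ ^ 4 * (4 * c / S ^ 2) := by
      rw [abs_div, abs_of_pos (pow_pos hEpos 2), abs_mul]
      have h3 : |2 * D * D' + 2 * θ ^ 2 * S * S'| ≤ 4 * S * c := by
        have i1 : |2 * D * D'| ≤ 2 * S * c := by
          rw [abs_mul, abs_mul, abs_two]; gcongr
        have i2 : |2 * θ ^ 2 * S * S'| ≤ 2 * 1 ^ 2 * S * c := by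
          rw [abs_mul, abs_of_pos (by positivity)]; gcongr
        exact (abs_add_le _ _).trans (by linarith)
      calc |D| * |2 * D * D' + 2 * θ ^ 2 * S * S'| / E ^ 2
          ≤ S * (4 * S * c) / (θ ^ 2 * S ^ 2) ^ 2 := by gcongr
        _ = θ⁻¹ ^ 4 * (4 * c / S ^ 2) := by field_simp
    calc _ ≤ _ := abs_sub _ _
      _ ≤ θ⁻¹ ^ 4 * (c / S ^ 2) + θ⁻¹ ^ 4 * (4 * c / S ^ 2) := add_le_add e1 e2
      _ = _ := by ring
  unfold regQuotDeriv
  rw [← hE]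
  refine (norm_add_le _ _).trans ?_
  rw [norm_mul, norm_mul, Complex.norm_real, Complex.norm_real, Real.norm_eq_abs,
    Real.norm_eq_abs]
  have m1 : |N' * (D / E) + N * (D' / E - D * (2 * D * D' + 2 * θ ^ 2 * S * S') / E ^ 2)|
      ≤ b * S * (θ⁻¹ ^ 4 / S) + a * (θ⁻¹ ^ 4 * (5 * c / S ^ 2)) := by
    refine (abs_add_le _ _).trans ?_
    rw [abs_mul, abs_mul]
    gcongr
  have m2 : |N * (D / E)| ≤ a * (θ⁻¹ ^ 4 / S) := by rw [abs_mul]; gcongr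
  calc _ ≤ (b * S * (θ⁻¹ ^ 4 / S) + a * (θ⁻¹ ^ 4 * (5 * c / S ^ 2))) * d
        + a * (θ⁻¹ ^ 4 / S) * d := by gcongr
    _ = _ := by field_simp

/-- The integral of a function is at most the increment of a primitive of a majorant, whose
integrability is automatic. -/
lemma lintegral_Icc_enorm_le_of_hasDerivAt {x₀ x₁ : ℝ} (h01 : x₀ ≤ x₁) {q : ℝ → ℂ} {B B' : ℝ → ℝ}
    (hB : ∀ x ∈ Icc x₀ x₁, HasDerivAt B (B' x) x) (hq : ∀ x ∈ Icc x₀ x₁, ‖q x‖ ≤ B' x) :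
    ∫⁻ x in Icc x₀ x₁, ‖q x‖ₑ ≤ ENNReal.ofReal (B x₁ - B x₀) := by
  have hc : ContinuousOn B (Icc x₀ x₁) := fun x hx => (hB x hx).continuousAt.continuousWithinAt
  have hpos : ∀ x ∈ Icc x₀ x₁, 0 ≤ B' x := fun x hx => (norm_nonneg _).trans (hq x hx)
  have hint : IntegrableOn B' (Ioc x₀ x₁) :=
    intervalIntegral.integrableOn_deriv_of_nonneg hc
      (fun x hx => hB x (Ioo_subset_Icc_self hx)) fun x hx => hpos x (Ioo_subset_Icc_self hx)
  have hint' : IntervalIntegrable B' volume x₀ x₁ :=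
    (intervalIntegrable_iff_integrableOn_Ioc_of_le h01).2 hint
  have hFTC := intervalIntegral.integral_eq_sub_of_hasDerivAt
    (fun x hx => hB x (by rwa [uIcc_of_le h01] at hx)) hint'
  rw [intervalIntegral.integral_of_le h01] at hFTC
  rw [← hFTC, ofReal_integral_eq_lintegral_ofReal hint
    ((ae_restrict_iff' measurableSet_Ioc).2
      (Filter.Eventually.of_forall fun x hx => hpos x (Ioc_subset_Icc_self hx))),
    setLIntegral_congr Ioc_ae_eq_Icc]
  refine setLIntegral_mono' measurableSet_Icc fun x hx => ?_
  rw [← ofReal_norm]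
  exact ENNReal.ofReal_le_ofReal (hq x hx)

/-- The one-variable estimate. The numerator is controlled by a slowly varying `n`, the change of
the denominator by a monotone `E` and a bounded monotone `Ψ`, and both `n` and `E` by the size `S`
of the denominator. The primitive `-n / (E + n)` of `n E' / (E + n)²`, up to harmless terms, gives a
bound that does not depend on the ratio between the extreme values of `S`. -/
theorem lintegral_regQuotDeriv_le {x₀ x₁ : ℝ} (h01 : x₀ ≤ x₁) (h6 : x₁ - x₀ ≤ 6)
    {θ δ M : ℝ} (hθ : 0 < θ) (hθ1 : θ ≤ 1) (hδ : 0 ≤ δ) (hM : 1 ≤ M)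
    {N N' D D' S S' n n' E E' Ψ Ψ' : ℝ → ℝ} {g g' : ℝ → ℂ}
    (dn : ∀ x ∈ Icc x₀ x₁, HasDerivAt n (n' x) x) (dE : ∀ x ∈ Icc x₀ x₁, HasDerivAt E (E' x) x)
    (dΨ : ∀ x ∈ Icc x₀ x₁, HasDerivAt Ψ (Ψ' x) x)
    (hN : ∀ x ∈ Icc x₀ x₁, |N x| ≤ δ * (M * n x))
    (hN' : ∀ x ∈ Icc x₀ x₁, |N' x| ≤ δ * (M * S x))
    (hS : ∀ x ∈ Icc x₀ x₁, 0 < S x) (hDS : ∀ x ∈ Icc x₀ x₁, |D x| ≤ S x)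
    (hn : ∀ x ∈ Icc x₀ x₁, 0 < n x) (hnS : ∀ x ∈ Icc x₀ x₁, n x ≤ M * S x)
    (hE : ∀ x ∈ Icc x₀ x₁, 0 ≤ E x) (hES : ∀ x ∈ Icc x₀ x₁, E x ≤ M * S x)
    (hn' : ∀ x ∈ Icc x₀ x₁, |n' x| ≤ M * (E x + n x))
    (hE' : (∀ x ∈ Icc x₀ x₁, 0 ≤ E' x) ∨ ∀ x ∈ Icc x₀ x₁, E' x ≤ 0)
    (hΨ : ∀ x ∈ Icc x₀ x₁, Ψ x ∈ Icc (0 : ℝ) 1) (hΨ' : ∀ x ∈ Icc x₀ x₁, 0 ≤ Ψ' x)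
    (hD' : ∀ x ∈ Icc x₀ x₁, |D' x| ≤ M * (|E' x| + S x * Ψ' x))
    (hS' : ∀ x ∈ Icc x₀ x₁, |S' x| ≤ M * (|E' x| + S x * Ψ' x))
    (hg : ∀ x ∈ Icc x₀ x₁, ‖g x‖ ≤ M) (hg' : ∀ x ∈ Icc x₀ x₁, ‖g' x‖ ≤ M) :
    ∫⁻ x in Icc x₀ x₁, ‖regQuotDeriv θ (N x) (N' x) (D x) (D' x) (S x) (S' x) (g x) (g' x)‖ₑ
      ≤ ENNReal.ofReal (300 * δ * θ⁻¹ ^ 4 * M ^ 6) := by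
  obtain ⟨σ, hσ, hσE⟩ : ∃ σ : ℝ, (σ = 1 ∨ σ = -1) ∧ ∀ x ∈ Icc x₀ x₁, |E' x| = σ * E' x := by
    rcases hE' with h | h
    · exact ⟨1, Or.inl rfl, fun x hx => by rw [abs_of_nonneg (h x hx), one_mul]⟩
    · exact ⟨-1, Or.inr rfl, fun x hx => by rw [abs_of_nonpos (h x hx), neg_one_mul]⟩
  set c := 20 * δ * θ⁻¹ ^ 4 * M ^ 5 with hc
  have hc0 : 0 ≤ c := by positivity
  have hEn : ∀ x ∈ Icc x₀ x₁, 0 < E x + n x := fun x hx => by linarith [hE x hx, hn x hx]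
  set B : ℝ → ℝ := fun x => c * ((1 + M) * x - σ * (n x / (E x + n x)) + Ψ x) with hB
  set B' : ℝ → ℝ := fun x => c * ((1 + M)
    - σ * ((n' x * (E x + n x) - n x * (E' x + n' x)) / (E x + n x) ^ 2) + Ψ' x) with hB'
  have hBd : ∀ x ∈ Icc x₀ x₁, HasDerivAt B (B' x) x := fun x hx =>
    ((((hasDerivAt_id x).const_mul (1 + M)).sub
      (((dn x hx).div ((dE x hx).add (dn x hx)) (hEn x hx).ne').const_mul σ)).add
      (dΨ x hx)).const_mul c |>.congr_deriv (by simp [hB'])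
  have hle : ∀ x ∈ Icc x₀ x₁,
      ‖regQuotDeriv θ (N x) (N' x) (D x) (D' x) (S x) (S' x) (g x) (g' x)‖ ≤ B' x := by
    intro x hx
    have hSx := hS x hx
    have hnx := hn x hx
    have hEx := hE x hx
    have hX := hEn x hx
    have hψ := hΨ' x hx
    refine (norm_regQuotDeriv_le hθ hθ1 hSx (hDS x hx) (hN x hx) (b := δ * M)
      (by rw [mul_assoc]; exact hN' x hx) (hD' x hx) (hS' x hx) (hg x hx) (hg' x hx)).trans ?_
    -- the basic ratio, compared with the derivative of the primitive
    have r1 : n x * |E' x| / (E x + n x) ^ 2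
        ≤ M - σ * ((n' x * (E x + n x) - n x * (E' x + n' x)) / (E x + n x) ^ 2) := by
      have e : σ * ((n' x * (E x + n x) - n x * (E' x + n' x)) / (E x + n x) ^ 2)
          = σ * (n' x * E x / (E x + n x) ^ 2) - n x * |E' x| / (E x + n x) ^ 2 := by
        rw [hσE x hx]; ring
      have e2 : σ * (n' x * E x / (E x + n x) ^ 2) ≤ M := by
        refine (le_abs_self _).trans ?_
        have hσ1 : |σ| = 1 := by rcases hσ with h | h <;> simp [h]
        rw [abs_mul, hσ1, one_mul, abs_div, abs_mul, abs_of_nonneg hEx,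
          abs_of_pos (pow_pos hX 2), div_le_iff₀ (pow_pos hX 2)]
        calc |n' x| * E x ≤ M * (E x + n x) * (E x + n x) := by
              gcongr
              · exact hn' x hx
              · linarith
          _ = _ := by ring
      rw [e]; linarith
    have hX2 : E x + n x ≤ 2 * M * S x := by linarith [hnS x hx, hES x hx]
    have r2 : n x * |E' x| / S x ^ 2 ≤ 4 * M ^ 2 * (n x * |E' x| / (E x + n x) ^ 2) := by
      rw [div_le_iff₀ (pow_pos hSx 2)]
      have : (E x + n x) ^ 2 ≤ (2 * M * S x) ^ 2 := by gcongr
      calc n x * |E' x| = n x * |E' x| / (E x + n x) ^ 2 * (E x + n x) ^ 2 := by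
            field_simp
        _ ≤ n x * |E' x| / (E x + n x) ^ 2 * (2 * M * S x) ^ 2 := by gcongr
        _ = _ := by ring
    have r3 : n x / S x ≤ M := (div_le_iff₀ hSx).2 (hnS x hx)
    have r4 : δ * (M * n x) * (5 * (M * (|E' x| + S x * Ψ' x)) / S x ^ 2)
        = 5 * δ * M ^ 2 * (n x * |E' x| / S x ^ 2 + n x / S x * Ψ' x) := by
      field_simp
    have r5 : δ * (M * n x) / S x = δ * M * (n x / S x) := by ring
    rw [r4, r5]
    set Z := n x * |E' x| / (E x + n x) ^ 2 with hZ
    have hZ0 : 0 ≤ Z := by positivity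
    calc θ⁻¹ ^ 4 * M * (δ * M + 5 * δ * M ^ 2 * (n x * |E' x| / S x ^ 2 + n x / S x * Ψ' x)
          + δ * M * (n x / S x))
        ≤ θ⁻¹ ^ 4 * M * (δ * M + 5 * δ * M ^ 2 * (4 * M ^ 2 * Z + M * Ψ' x)
          + δ * M * M) := by gcongr
      _ = δ * θ⁻¹ ^ 4 * (M ^ 2 + M ^ 3 + 20 * M ^ 5 * Z + 5 * M ^ 4 * Ψ' x) := by ring
      _ ≤ δ * θ⁻¹ ^ 4 * (M ^ 5 + M ^ 5 + 20 * M ^ 5 * Z + 5 * M ^ 5 * Ψ' x) := by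
          gcongr <;> first | exact hM | norm_num
      _ ≤ c * (1 + Z + Ψ' x) := by
          rw [hc]
          have : 0 ≤ δ * θ⁻¹ ^ 4 * M ^ 5 := by positivity
          nlinarith [mul_nonneg this hψ]
      _ ≤ B' x := by
          simp only [hB']
          gcongr
          linarith
  refine (lintegral_Icc_enorm_le_of_hasDerivAt h01 hBd hle).trans (ENNReal.ofReal_le_ofReal ?_)
  have hq : ∀ x ∈ Icc x₀ x₁, σ * (n x / (E x + n x)) ∈ Icc (-1 : ℝ) 1 := by
    intro x hx
    have h1 : 0 ≤ n x / (E x + n x) := div_nonneg (hn x hx).le (hEn x hx).le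
    have h2 : n x / (E x + n x) ≤ 1 := (div_le_one (hEn x hx)).2 (by linarith [hE x hx])
    rcases hσ with h | h <;> rw [h] <;> constructor <;> linarith
  have h0 := left_mem_Icc.2 h01
  have h1 := right_mem_Icc.2 h01
  have b1 := (hq _ h0).1; have b2 := (hq _ h0).2
  have b3 := (hq _ h1).1; have b4 := (hq _ h1).2
  have b5 := (hΨ _ h0).1; have b6 := (hΨ _ h1).2
  calc B x₁ - B x₀ = c * ((1 + M) * (x₁ - x₀) - σ * (n x₁ / (E x₁ + n x₁))
        + σ * (n x₀ / (E x₀ + n x₀)) + Ψ x₁ - Ψ x₀) := by simp only [hB]; ring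
    _ ≤ c * (15 * M) := by
        gcongr
        nlinarith
    _ = 300 * δ * θ⁻¹ ^ 4 * M ^ 6 := by rw [hc]; ring

/-! ### Normalised curves -/

/-- The functions attached to a rescaled curve `(t, A(t), C(t))`: `a = A'`, `a₂ = A''`, the third
component `f` of the left-invariant velocity `(1, a, f)`, the slope `P = f' / a₂` with derivative
`P₁`, and the constant `ξ` of the group law. -/
structure CurveData where
  /-- the second component of the curve -/
  A : ℝ → ℝ
  /-- the derivative of `A` -/
  a : ℝ → ℝ
  /-- the second derivative of `A` -/
  a₂ : ℝ → ℝ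
  /-- the third component of the left-invariant velocity -/
  f : ℝ → ℝ
  /-- the slope `f' / a₂` -/
  P : ℝ → ℝ
  /-- the derivative of `P` -/
  P₁ : ℝ → ℝ
  /-- the constant of the group law -/
  ξ : ℝ

namespace CurveData

variable (c : CurveData)

/-- The Legendre-type function `a P - f`, with derivative `a P₁`. -/
def K (t : ℝ) : ℝ := c.a t * c.P t - c.f t
/-- `∫ₓʸ (a(y) - a) P₁`. -/
def T (x y : ℝ) : ℝ := c.f y - c.f x - c.P x * (c.a y - c.a x)
/-- `∫ₓʸ (a - a(x)) P₁`. -/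
def Y (x y : ℝ) : ℝ := c.P y * (c.a y - c.a x) - (c.f y - c.f x)
/-- The size of the exterior product of the velocities at `x < y`. -/
def W (x y : ℝ) : ℝ := c.K x * c.a y + c.a x * c.T x y
/-- `∫ₓʸ (z - x) a₂(z) dz`. -/
def S (x y : ℝ) : ℝ := (y - x) * c.a y - c.A y + c.A x
/-- The determinant of the velocities at three times. -/
def J (p q l : ℝ) : ℝ := (c.a q - c.a p) * c.T q l + (c.a l - c.a q) * c.Y p q

/-- The quantitative properties, on the time interval `[2, 8]`, that hold uniformly in the scale. -/
structure IsNormalized (κ : ℝ) : Prop where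
  κ_pos : 0 < κ
  κ_le : κ ≤ 1
  ξ_pos : 0 < c.ξ
  hA : ∀ t, 1 < t → HasDerivAt c.A (c.a t) t
  ha : ∀ t, 1 < t → HasDerivAt c.a (c.a₂ t) t
  hf : ∀ t, 1 < t → HasDerivAt c.f (c.a₂ t * c.P t) t
  hP : ∀ t, 1 < t → HasDerivAt c.P (c.P₁ t) t
  ca₂ : ContinuousOn c.a₂ (Ioi 1)
  a_ge : ∀ t ∈ Icc (2 : ℝ) 8, 1 ≤ c.a t
  A_ge : ∀ t ∈ Icc (2 : ℝ) 8, 1 ≤ c.A t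
  A_le : ∀ t ∈ Icc (2 : ℝ) 8, c.A t ≤ 8 * c.a t
  P_nonneg : ∀ t ∈ Icc (2 : ℝ) 8, 0 ≤ c.P t
  a₂_ge : ∀ t ∈ Icc (2 : ℝ) 8, κ * c.a t ≤ c.a₂ t
  K_ge : ∀ t ∈ Icc (2 : ℝ) 8, κ ≤ c.K t
  P_le : ∀ t ∈ Icc (2 : ℝ) 8, c.P t ≤ c.K t
  P₁_ge : ∀ t ∈ Icc (2 : ℝ) 8, κ * c.K t ≤ c.a t * c.P₁ t

end CurveData

lemma le_of_hasDerivAt_nonneg {F F' : ℝ → ℝ} {x y : ℝ} (hxy : x ≤ y)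
    (hF : ∀ z ∈ Icc x y, HasDerivAt F (F' z) z) (hF' : ∀ z ∈ Icc x y, 0 ≤ F' z) : F x ≤ F y := by
  refine monotoneOn_of_deriv_nonneg (convex_Icc x y)
    (fun z hz => (hF z hz).continuousAt.continuousWithinAt)
    (fun z hz => (hF z (interior_subset hz)).differentiableAt.differentiableWithinAt)
    (fun z hz => ?_) (left_mem_Icc.2 hxy) (right_mem_Icc.2 hxy) hxy
  rw [(hF z (interior_subset hz)).deriv]
  exact hF' z (interior_subset hz)

/-- A relative increase over the smaller value is a relative increase over the larger one. -/
lemma half_mul_le_sub_of_mul_le_sub {u v k : ℝ} (hv : 0 < v) (h0 : 0 ≤ k) (h1 : k ≤ 1)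
    (h : k * v ≤ u - v) : k / 2 * u ≤ u - v := by
  have e1 : 0 ≤ (1 - k / 2) * (u - v - k * v) := mul_nonneg (by linarith) (by linarith)
  have e2 : 0 ≤ k * (1 - k) * v := mul_nonneg (mul_nonneg h0 (by linarith)) hv.le
  nlinarith

lemma mem_Icc_of_mem_Icc {x y z : ℝ} (hx : x ∈ Icc (2 : ℝ) 8) (hy : y ∈ Icc (2 : ℝ) 8)
    (hz : z ∈ Icc x y) : z ∈ Icc (2 : ℝ) 8 := ⟨hx.1.trans hz.1, hz.2.trans hy.2⟩

lemma one_lt_of_mem_Icc {x : ℝ} (hx : x ∈ Icc (2 : ℝ) 8) : 1 < x := by linarith [hx.1]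

namespace CurveData.IsNormalized

variable {c : CurveData} {κ : ℝ} (h : c.IsNormalized κ) {x y p q l η : ℝ}
include h

lemma a_pos (hx : x ∈ Icc (2 : ℝ) 8) : 0 < c.a x := by linarith [h.a_ge x hx]

lemma K_pos (hx : x ∈ Icc (2 : ℝ) 8) : 0 < c.K x := by linarith [h.K_ge x hx, h.κ_pos]

lemma a₂_pos (hx : x ∈ Icc (2 : ℝ) 8) : 0 < c.a₂ x :=
  (mul_pos h.κ_pos (h.a_pos hx)).trans_le (h.a₂_ge x hx)

lemma P₁_nonneg (hx : x ∈ Icc (2 : ℝ) 8) : 0 ≤ c.P₁ x := by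
  have := h.P₁_ge x hx
  have h1 := mul_pos h.κ_pos (h.K_pos hx)
  have h2 := h.a_pos hx
  by_contra hneg
  nlinarith

lemma hK {t : ℝ} (ht : 1 < t) : HasDerivAt c.K (c.a t * c.P₁ t) t :=
  (((h.ha t ht).mul (h.hP t ht)).sub (h.hf t ht)).congr_deriv (by ring)

lemma a_le (hx : x ∈ Icc (2 : ℝ) 8) (hy : y ∈ Icc (2 : ℝ) 8) (hxy : x ≤ y) : c.a x ≤ c.a y :=
  le_of_hasDerivAt_nonneg hxy (fun z hz => h.ha z (one_lt_of_mem_Icc (mem_Icc_of_mem_Icc hx hy hz)))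
    fun _ hz => (h.a₂_pos (mem_Icc_of_mem_Icc hx hy hz)).le

lemma A_mono (hx : x ∈ Icc (2 : ℝ) 8) (hy : y ∈ Icc (2 : ℝ) 8) (hxy : x ≤ y) : c.A x ≤ c.A y :=
  le_of_hasDerivAt_nonneg hxy (fun z hz => h.hA z (one_lt_of_mem_Icc (mem_Icc_of_mem_Icc hx hy hz)))
    fun _ hz => (h.a_pos (mem_Icc_of_mem_Icc hx hy hz)).le

lemma P_mono (hx : x ∈ Icc (2 : ℝ) 8) (hy : y ∈ Icc (2 : ℝ) 8) (hxy : x ≤ y) : c.P x ≤ c.P y :=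
  le_of_hasDerivAt_nonneg hxy (fun z hz => h.hP z (one_lt_of_mem_Icc (mem_Icc_of_mem_Icc hx hy hz)))
    fun _ hz => h.P₁_nonneg (mem_Icc_of_mem_Icc hx hy hz)

lemma K_mono (hx : x ∈ Icc (2 : ℝ) 8) (hy : y ∈ Icc (2 : ℝ) 8) (hxy : x ≤ y) : c.K x ≤ c.K y :=
  le_of_hasDerivAt_nonneg hxy (fun _ hz => h.hK (one_lt_of_mem_Icc (mem_Icc_of_mem_Icc hx hy hz)))
    fun _ hz => mul_nonneg (h.a_pos (mem_Icc_of_mem_Icc hx hy hz)).le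
      (h.P₁_nonneg (mem_Icc_of_mem_Icc hx hy hz))

lemma T_nonneg (hx : x ∈ Icc (2 : ℝ) 8) (hy : y ∈ Icc (2 : ℝ) 8) (hxy : x ≤ y) : 0 ≤ c.T x y := by
  have := le_of_hasDerivAt_nonneg (F := fun z => c.f z - c.f x - c.P x * (c.a z - c.a x))
    (F' := fun z => c.a₂ z * c.P z - c.P x * c.a₂ z) hxy
    (fun z hz => (((h.hf z (one_lt_of_mem_Icc (mem_Icc_of_mem_Icc hx hy hz))).sub_const _).sub
      (((h.ha z (one_lt_of_mem_Icc (mem_Icc_of_mem_Icc hx hy hz))).sub_const _).const_mul _)))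
    fun z hz => by
      have hz' := mem_Icc_of_mem_Icc hx hy hz
      nlinarith [h.a₂_pos hz', h.P_mono hx hz' hz.1]
  simpa [T] using this

lemma Y_nonneg (hx : x ∈ Icc (2 : ℝ) 8) (hy : y ∈ Icc (2 : ℝ) 8) (hxy : x ≤ y) : 0 ≤ c.Y x y := by
  have := le_of_hasDerivAt_nonneg (F := fun z => c.P z * (c.a z - c.a x) - (c.f z - c.f x))
    (F' := fun z => c.P₁ z * (c.a z - c.a x) + c.P z * c.a₂ z - c.a₂ z * c.P z) hxy
    (fun z hz => ((h.hP z (one_lt_of_mem_Icc (mem_Icc_of_mem_Icc hx hy hz))).mul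
      ((h.ha z (one_lt_of_mem_Icc (mem_Icc_of_mem_Icc hx hy hz))).sub_const _)).sub
      ((h.hf z (one_lt_of_mem_Icc (mem_Icc_of_mem_Icc hx hy hz))).sub_const _))
    fun z hz => by
      have hz' := mem_Icc_of_mem_Icc hx hy hz
      nlinarith [mul_nonneg (h.P₁_nonneg hz') (sub_nonneg.2 (h.a_le hx hz' hz.1))]
  simpa [Y] using this

/-- This is `Y_nonneg`, since `T x y + Y x y = (P y - P x) (a y - a x)`. -/
lemma T_le (hx : x ∈ Icc (2 : ℝ) 8) (hy : y ∈ Icc (2 : ℝ) 8) (hxy : x ≤ y) :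
    c.T x y ≤ (c.P y - c.P x) * (c.a y - c.a x) := by
  have := h.Y_nonneg hx hy hxy
  unfold T; unfold Y at this; linarith

/-- This is `Y_nonneg`, since `Y x y = (K y - K x) - a x (P y - P x)`. -/
lemma a_mul_P_sub_le (hx : x ∈ Icc (2 : ℝ) 8) (hy : y ∈ Icc (2 : ℝ) 8) (hxy : x ≤ y) :
    c.a x * (c.P y - c.P x) ≤ c.K y - c.K x := by
  have := h.Y_nonneg hx hy hxy
  unfold K; unfold Y at this; linarith

lemma S_nonneg_of_le (hx : x ∈ Icc (2 : ℝ) 8) (hy : y ∈ Icc (2 : ℝ) 8) (hxy : x ≤ y) :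
    0 ≤ c.S x y := by
  have := le_of_hasDerivAt_nonneg (F := fun z => (z - x) * c.a z - c.A z + c.A x)
    (F' := fun z => 1 * c.a z + (z - x) * c.a₂ z - c.a z) hxy
    (fun z hz => (((((hasDerivAt_id z).sub_const x).mul
      (h.ha z (one_lt_of_mem_Icc (mem_Icc_of_mem_Icc hx hy hz)))).sub
      (h.hA z (one_lt_of_mem_Icc (mem_Icc_of_mem_Icc hx hy hz)))).add_const _))
    fun z hz => by
      have hz' := mem_Icc_of_mem_Icc hx hy hz
      nlinarith [mul_nonneg (sub_nonneg.2 hz.1) (h.a₂_pos hz').le]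
  simpa [S] using this

lemma S_nonneg_of_ge (hx : x ∈ Icc (2 : ℝ) 8) (hy : y ∈ Icc (2 : ℝ) 8) (hxy : x ≤ y) :
    0 ≤ c.S y x := by
  have := le_of_hasDerivAt_nonneg (F := fun z => (x - z) * c.a x - c.A x + c.A z)
    (F' := fun z => (-1) * c.a x + c.a z) hxy
    (fun z hz => (((((hasDerivAt_id z).const_sub x).mul_const (c.a x)).sub_const (c.A x)).add
      (h.hA z (one_lt_of_mem_Icc (mem_Icc_of_mem_Icc hx hy hz)))))
    fun z hz => by
      have hz' := mem_Icc_of_mem_Icc hx hy hz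
      linarith [h.a_le hx hz' hz.1]
  simpa [S] using this

lemma S_le_a (hx : x ∈ Icc (2 : ℝ) 8) (hy : y ∈ Icc (2 : ℝ) 8) (hxy : x ≤ y) :
    c.S x y ≤ 6 * c.a y := by
  have := h.A_mono hx hy hxy
  have h1 := h.a_pos hy
  unfold S
  nlinarith [hx.1, hy.2]

lemma S_le_A (hx : x ∈ Icc (2 : ℝ) 8) (hxy : x ≤ y) :
    c.S y x ≤ c.A y := by
  have := h.A_ge x hx
  have h1 := h.a_pos hx
  unfold S
  nlinarith

lemma le_a_sub (hx : x ∈ Icc (2 : ℝ) 8) (hy : y ∈ Icc (2 : ℝ) 8) (hη : 0 < η) (hη1 : η ≤ 1)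
    (hxy : x + η ≤ y) : κ * η / 2 * c.a y ≤ c.a y - c.a x := by
  have hxy' : x ≤ y := by linarith
  have := le_of_hasDerivAt_nonneg (F := fun z => c.a z - κ * c.a x * z)
    (F' := fun z => c.a₂ z - κ * c.a x * 1) hxy'
    (fun z hz => (h.ha z (one_lt_of_mem_Icc (mem_Icc_of_mem_Icc hx hy hz))).sub
      ((hasDerivAt_id z).const_mul _))
    fun z hz => by
      have hz' := mem_Icc_of_mem_Icc hx hy hz
      nlinarith [h.a₂_ge z hz', h.a_le hx hz' hz.1, h.κ_pos]
  have h1 : κ * η * c.a x ≤ c.a y - c.a x := by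
    have : κ * c.a x * η ≤ κ * c.a x * (y - x) :=
      mul_le_mul_of_nonneg_left (by linarith) (mul_pos h.κ_pos (h.a_pos hx)).le
    nlinarith
  have h3 : κ * η ≤ 1 := by nlinarith [h.κ_pos, h.κ_le]
  exact half_mul_le_sub_of_mul_le_sub (h.a_pos hx) (mul_pos h.κ_pos hη).le h3 h1

lemma le_K_sub (hx : x ∈ Icc (2 : ℝ) 8) (hy : y ∈ Icc (2 : ℝ) 8) (hη : 0 < η) (hη1 : η ≤ 1)
    (hxy : x + η ≤ y) : κ * η / 2 * c.K y ≤ c.K y - c.K x := by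
  have hxy' : x ≤ y := by linarith
  have := le_of_hasDerivAt_nonneg (F := fun z => c.K z - κ * c.K x * z)
    (F' := fun z => c.a z * c.P₁ z - κ * c.K x * 1) hxy'
    (fun z hz => (h.hK (one_lt_of_mem_Icc (mem_Icc_of_mem_Icc hx hy hz))).sub
      ((hasDerivAt_id z).const_mul _))
    fun z hz => by
      have hz' := mem_Icc_of_mem_Icc hx hy hz
      nlinarith [h.P₁_ge z hz', h.K_mono hx hz' hz.1, h.κ_pos]
  have h1 : κ * η * c.K x ≤ c.K y - c.K x := by
    have : κ * c.K x * η ≤ κ * c.K x * (y - x) :=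
      mul_le_mul_of_nonneg_left (by linarith) (mul_pos h.κ_pos (h.K_pos hx)).le
    nlinarith
  have h3 : κ * η ≤ 1 := by nlinarith [h.κ_pos, h.κ_le]
  exact half_mul_le_sub_of_mul_le_sub (h.K_pos hx) (mul_pos h.κ_pos hη).le h3 h1

/-- Up to the midpoint `x + η / 2` the function `a - a x` acquires a definite part of `a`; after it,
`(a - a x) P₁` dominates a multiple of `a P₁ = K'`. -/
lemma le_Y (hx : x ∈ Icc (2 : ℝ) 8) (hy : y ∈ Icc (2 : ℝ) 8) (hη : 0 < η) (hη1 : η ≤ 1)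
    (hxy : x + η ≤ y) : (κ * η / 4) ^ 2 * c.K y ≤ c.Y x y := by
  have hm : x + η / 2 ∈ Icc (2 : ℝ) 8 := ⟨by linarith [hx.1], by linarith [hy.2]⟩
  have hmy : x + η / 2 ≤ y := by linarith
  have := le_of_hasDerivAt_nonneg
    (F := fun z => c.P z * (c.a z - c.a x) - (c.f z - c.f x) - κ * η / 4 * c.K z)
    (F' := fun z => c.P₁ z * (c.a z - c.a x) + c.P z * c.a₂ z - c.a₂ z * c.P z
      - κ * η / 4 * (c.a z * c.P₁ z)) hmy
    (fun z hz => (((h.hP z (one_lt_of_mem_Icc (mem_Icc_of_mem_Icc hm hy hz))).mul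
      ((h.ha z (one_lt_of_mem_Icc (mem_Icc_of_mem_Icc hm hy hz))).sub_const _)).sub
      ((h.hf z (one_lt_of_mem_Icc (mem_Icc_of_mem_Icc hm hy hz))).sub_const _)).sub
      ((h.hK (one_lt_of_mem_Icc (mem_Icc_of_mem_Icc hm hy hz))).const_mul _))
    fun z hz => by
      have hz' := mem_Icc_of_mem_Icc hm hy hz
      have := h.le_a_sub hx hz' (half_pos hη) (by linarith) hz.1
      nlinarith [mul_nonneg (h.P₁_nonneg hz') (sub_nonneg.2 this)]
  have h1 := h.Y_nonneg hx hm (by linarith)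
  have h2 := h.le_K_sub hm hy (half_pos hη) (by linarith) (by linarith)
  have h4 : 0 < κ * η := mul_pos h.κ_pos hη
  simp only [Y] at *
  nlinarith

/-- After the midpoint `x + η / 2` the factor `z - x` in the integral is at least `η / 2`. -/
lemma le_S_of_le (hx : x ∈ Icc (2 : ℝ) 8) (hy : y ∈ Icc (2 : ℝ) 8) (hη : 0 < η) (hη1 : η ≤ 1)
    (hxy : x + η ≤ y) : κ * η ^ 2 / 8 * c.a y ≤ c.S x y := by
  have hm : x + η / 2 ∈ Icc (2 : ℝ) 8 := ⟨by linarith [hx.1], by linarith [hy.2]⟩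
  have hmy : x + η / 2 ≤ y := by linarith
  have := le_of_hasDerivAt_nonneg (F := fun z => (z - x) * c.a z - c.A z + c.A x - η / 2 * c.a z)
    (F' := fun z => 1 * c.a z + (z - x) * c.a₂ z - c.a z - η / 2 * c.a₂ z) hmy
    (fun z hz => (((((hasDerivAt_id z).sub_const x).mul
      (h.ha z (one_lt_of_mem_Icc (mem_Icc_of_mem_Icc hm hy hz)))).sub
      (h.hA z (one_lt_of_mem_Icc (mem_Icc_of_mem_Icc hm hy hz)))).add_const _).sub
      ((h.ha z (one_lt_of_mem_Icc (mem_Icc_of_mem_Icc hm hy hz))).const_mul _))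
    fun z hz => by
      have hz' := mem_Icc_of_mem_Icc hm hy hz
      nlinarith [mul_nonneg (sub_nonneg.2 hz.1) (h.a₂_pos hz').le]
  have h1 := h.S_nonneg_of_le hx hm (by linarith)
  have h2 := h.le_a_sub hm hy (half_pos hη) (by linarith) (by linarith)
  simp only [S] at *
  nlinarith

lemma a_mul_le_A_sub (hx : x ∈ Icc (2 : ℝ) 8) (hy : y ∈ Icc (2 : ℝ) 8) (hxy : x ≤ y) :
    c.a x * (y - x) ≤ c.A y - c.A x := by
  have := h.S_nonneg_of_ge hx hy hxy
  unfold S at this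
  linarith

/-- After the midpoint `x + η / 2` the derivative `a - a x` dominates a multiple of `a = A'`. -/
lemma le_S_of_ge (hx : x ∈ Icc (2 : ℝ) 8) (hy : y ∈ Icc (2 : ℝ) 8) (hη : 0 < η) (hη1 : η ≤ 1)
    (hxy : x + η ≤ y) : κ * η ^ 2 / 128 * c.A y ≤ c.S y x := by
  have hm : x + η / 2 ∈ Icc (2 : ℝ) 8 := ⟨by linarith [hx.1], by linarith [hy.2]⟩
  have hmy : x + η / 2 ≤ y := by linarith
  have := le_of_hasDerivAt_nonneg
    (F := fun z => (x - z) * c.a x - c.A x + c.A z - κ * η / 4 * c.A z)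
    (F' := fun z => (-1) * c.a x + c.a z - κ * η / 4 * c.a z) hmy
    (fun z hz => ((((((hasDerivAt_id z).const_sub x).mul_const (c.a x)).sub_const (c.A x)).add
      (h.hA z (one_lt_of_mem_Icc (mem_Icc_of_mem_Icc hm hy hz))))).sub
      ((h.hA z (one_lt_of_mem_Icc (mem_Icc_of_mem_Icc hm hy hz))).const_mul _))
    fun z hz => by
      have hz' := mem_Icc_of_mem_Icc hm hy hz
      have := h.le_a_sub hx hz' (half_pos hη) (by linarith) hz.1
      linarith
  have h1 := h.S_nonneg_of_ge hx hm (by linarith)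
  have h2 := h.a_mul_le_A_sub hm hy hmy
  have h3 := h.A_le _ hm
  have h5 := h.A_ge _ hm
  have h4 : 0 < κ * η := mul_pos h.κ_pos hη
  have h6 : η / 16 / 2 * c.A y ≤ c.A y - c.A (x + η / 2) := by
    refine half_mul_le_sub_of_mul_le_sub (by linarith) (by linarith) (by linarith) ?_
    nlinarith [h.a_pos hm]
  simp only [S] at *
  nlinarith

lemma a_le_A (hx : x ∈ Icc (2 : ℝ) 8) (hy : y ∈ Icc (2 : ℝ) 8) (hη : 0 < η)
    (hxy : x + η ≤ y) : η * c.a x ≤ c.A y := by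
  have := h.a_mul_le_A_sub hx hy (by linarith)
  nlinarith [h.A_ge x hx, h.a_pos hx]

end CurveData.IsNormalized

/-! ### The Jacobian determinant and Cramer's numerators -/

namespace CurveData

variable (c : CurveData)

/-- The lower bounds available, with the small constant `e`, for two times `x < y` that are not too
close to each other. -/
structure IsGap (e x y : ℝ) : Prop where
  mem_left : x ∈ Icc (2 : ℝ) 8
  mem_right : y ∈ Icc (2 : ℝ) 8
  le : x ≤ y
  a_sub : e * c.a y ≤ c.a y - c.a x
  Y_ge : e * c.K y ≤ c.Y x y
  S_ge : e * c.a y ≤ c.S x y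
  S_rev_ge : e * c.A y ≤ c.S y x
  a_le_A : e * c.a x ≤ c.A y

/-- Times at distance `η` are separated quantitatively, with a constant that depends only on `κ` and
`η`. -/
lemma IsNormalized.isGap {c : CurveData} {κ x y η : ℝ} (h : c.IsNormalized κ)
    (hx : x ∈ Icc (2 : ℝ) 8) (hy : y ∈ Icc (2 : ℝ) 8) (hη : 0 < η) (hη1 : η ≤ 1)
    (hxy : x + η ≤ y) : c.IsGap ((κ * η) ^ 2 / 128) x y := by
  have h0 : 0 < κ * η := mul_pos h.κ_pos hη
  have h1 : κ * η ≤ 1 := by nlinarith [h.κ_pos, h.κ_le]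
  have hκ1 := h.κ_le
  have hκ0 := h.κ_pos
  have h2 : (κ * η) ^ 2 ≤ κ * η := by nlinarith
  have h3 : (κ * η) ^ 2 ≤ κ * η ^ 2 := by
    have : 0 ≤ κ * (1 - κ) * η ^ 2 := by
      have : 0 ≤ 1 - κ := by linarith
      positivity
    nlinarith
  have h4 : κ * η ≤ η := by nlinarith
  have ay := h.a_pos hy
  have ax := h.a_pos hx
  have Ky := h.K_pos hy
  have Ay := h.A_ge y hy
  refine ⟨hx, hy, by linarith, ?_, ?_, ?_, ?_, ?_⟩
  · refine le_trans ?_ (h.le_a_sub hx hy hη hη1 hxy)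
    gcongr; linarith
  · refine le_trans ?_ (h.le_Y hx hy hη hη1 hxy)
    gcongr; nlinarith
  · refine le_trans ?_ (h.le_S_of_le hx hy hη hη1 hxy)
    gcongr; nlinarith
  · refine le_trans ?_ (h.le_S_of_ge hx hy hη hη1 hxy)
    gcongr
  · refine le_trans ?_ (h.a_le_A hx hy hη hxy)
    gcongr; linarith

/-- The determinant of the left-invariant velocities at the times `t, s, r`. -/
def det₀ (t s r : ℝ) : ℝ :=
  c.a s * (c.f r - c.f t) + c.f s * (c.a t - c.a r) + c.a r * c.f t - c.a t * c.f r

/-- The contribution to the Jacobian determinant of the conjugation between the times `t`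
and `s`. -/
def det₂ (t s r : ℝ) : ℝ := 2 * c.ξ * ((c.a r - c.a s) * c.S s t)

/-- The contribution to the Jacobian determinant of the conjugation between the times `r`
and `u`. -/
def det₃ (k u t s r : ℝ) : ℝ := 2 * c.ξ * k * ((c.a s - c.a t) * c.S u r)

/-- The Jacobian determinant in the variables `t, s, r`. The case `k = 1` belongs to the product of
four points, of which that at the time `u` is fixed; the case `k = 0` to the product of three. -/
def jac (k u t s r : ℝ) : ℝ := c.det₀ t s r + c.det₂ t s r + c.det₃ k u t s r

/-- The three contributions to the Jacobian determinant, combined with given signs. For the signs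
that make all contributions positive this is the size of the determinant without cancellation. -/
def size (σ₀ σ₂ σ₃ k u t s r : ℝ) : ℝ :=
  σ₀ * c.det₀ t s r + σ₂ * c.det₂ t s r + σ₃ * c.det₃ k u t s r

/-- The third component of the conjugated velocity at the time `t`. -/
def e₁ (t s : ℝ) : ℝ := c.f t + 2 * c.ξ * c.S s t

/-- The third component of the conjugated velocity at the time `r`. -/
def e₃ (k u r : ℝ) : ℝ := c.f r + 2 * c.ξ * k * c.S u r

/-- The third component of the conjugated direction of translation. -/
def yTilde (y : ℝ × ℝ × ℝ) (t s : ℝ) : ℝ :=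
  y.2.2 + 2 * c.ξ * ((t - s) * y.2.1 - (c.A t - c.A s) * y.1)

/-- Cramer's numerator in the variable `t`. -/
def num₁ (k u : ℝ) (y : ℝ × ℝ × ℝ) (t s r : ℝ) : ℝ :=
  -(y.1 * (c.a s * c.e₃ k u r - c.a r * c.f s) + y.2.1 * (c.f s - c.e₃ k u r)
    + c.yTilde y t s * (c.a r - c.a s))

/-- Cramer's numerator in the variable `s`. -/
def num₂ (k u : ℝ) (y : ℝ × ℝ × ℝ) (t s r : ℝ) : ℝ :=
  y.1 * (c.a r * c.e₁ t s - c.a t * c.e₃ k u r) + y.2.1 * (c.e₃ k u r - c.e₁ t s)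
    - c.yTilde y t s * (c.a r - c.a t)

/-- Cramer's numerator in the variable `r`. -/
def num₃ (y : ℝ × ℝ × ℝ) (t s : ℝ) : ℝ :=
  y.1 * (c.a t * c.f s - c.a s * c.e₁ t s) + y.2.1 * (c.e₁ t s - c.f s)
    + c.yTilde y t s * (c.a s - c.a t)

/-- The derivative of `num₂` in `s`, and the opposite of the derivative of `num₁` in `t`. -/
def numDeriv (y : ℝ × ℝ × ℝ) (t s r : ℝ) : ℝ :=
  2 * c.ξ * ((y.2.1 - c.a t * y.1) * (c.a r - c.a s))

/-- The derivative of `size` in `t`. -/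
def size₁ (σ₀ σ₂ σ₃ k u t s r : ℝ) : ℝ :=
  σ₀ * (c.a₂ t * ((c.a r - c.a s) * c.P t - (c.f r - c.f s)))
    + σ₂ * (2 * c.ξ * ((c.a r - c.a s) * ((t - s) * c.a₂ t)))
    + σ₃ * (2 * c.ξ * k * (-c.a₂ t * c.S u r))

/-- The derivative of `size` in `s`. -/
def size₂ (σ₀ σ₂ σ₃ k u t s r : ℝ) : ℝ :=
  σ₀ * (c.a₂ s * ((c.f r - c.f t) - c.P s * (c.a r - c.a t)))
    + σ₂ * (2 * c.ξ * (-c.a₂ s * c.S s t + (c.a r - c.a s) * (c.a s - c.a t)))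
    + σ₃ * (2 * c.ξ * k * (c.a₂ s * c.S u r))

/-- The derivative of `size` in `r`. -/
def size₃ (σ₀ σ₂ σ₃ k u t s r : ℝ) : ℝ :=
  σ₀ * (c.a₂ r * ((c.a s - c.a t) * c.P r - (c.f s - c.f t)))
    + σ₂ * (2 * c.ξ * (c.a₂ r * c.S s t))
    + σ₃ * (2 * c.ξ * k * ((c.a s - c.a t) * ((r - u) * c.a₂ r)))

lemma jac_eq_size (k u t s r : ℝ) : c.jac k u t s r = c.size 1 1 1 k u t s r := by
  unfold jac size; ring

/-- The sign of `det₀` depends on the order of the three times. -/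
lemma det₀_eq_J (t s r : ℝ) : c.det₀ t s r = c.J t s r := by unfold det₀ J T Y; ring
lemma det₀_eq_neg_J (t s r : ℝ) : c.det₀ t s r = -c.J s t r := by unfold det₀ J T Y; ring
lemma det₀_eq_neg_J' (t s r : ℝ) : c.det₀ t s r = -c.J t r s := by unfold det₀ J T Y; ring

namespace IsNormalized

variable {c} {κ : ℝ} (h : c.IsNormalized κ) {t s r x y : ℝ}
include h

lemma hasDerivAt_S_right (x : ℝ) (hy : 1 < y) :
    HasDerivAt (fun y => c.S x y) ((y - x) * c.a₂ y) y :=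
  (((((hasDerivAt_id y).sub_const x).mul (h.ha y hy)).sub (h.hA y hy)).add_const _).congr_deriv
    (by simp)

lemma hasDerivAt_S_left (hx : 1 < x) (y : ℝ) :
    HasDerivAt (fun x => c.S x y) (c.a x - c.a y) x :=
  (((((hasDerivAt_id x).const_sub y).mul_const (c.a y)).sub_const _).add (h.hA x hx)).congr_deriv
    (by ring)

lemma hasDerivAt_size₁ (σ₀ σ₂ σ₃ k u : ℝ) (ht : 1 < t) (s r : ℝ) :
    HasDerivAt (fun x => c.size σ₀ σ₂ σ₃ k u x s r) (c.size₁ σ₀ σ₂ σ₃ k u t s r) t := by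
  have d0 : HasDerivAt (fun x => c.det₀ x s r) _ t :=
    ((((((h.hf t ht).const_sub (c.f r)).const_mul (c.a s)).add
      (((h.ha t ht).sub_const (c.a r)).const_mul (c.f s))).add
      ((h.hf t ht).const_mul (c.a r))).sub ((h.ha t ht).mul_const (c.f r)))
  have d2 : HasDerivAt (fun x => c.det₂ x s r) _ t :=
    (((h.hasDerivAt_S_right s ht).const_mul (c.a r - c.a s)).const_mul (2 * c.ξ))
  have d3 : HasDerivAt (fun x => c.det₃ k u x s r) _ t :=
    ((((h.ha t ht).const_sub (c.a s)).mul_const (c.S u r)).const_mul (2 * c.ξ * k))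
  refine (((d0.const_mul σ₀).add (d2.const_mul σ₂)).add (d3.const_mul σ₃)).congr_deriv ?_
  unfold size₁; ring

lemma hasDerivAt_size₂ (σ₀ σ₂ σ₃ k u t : ℝ) (hs : 1 < s) (r : ℝ) :
    HasDerivAt (fun x => c.size σ₀ σ₂ σ₃ k u t x r) (c.size₂ σ₀ σ₂ σ₃ k u t s r) s := by
  have d0 : HasDerivAt (fun x => c.det₀ t x r) _ s :=
    ((((h.ha s hs).mul_const (c.f r - c.f t)).add ((h.hf s hs).mul_const (c.a t - c.a r))).add_const
      (c.a r * c.f t)).sub_const (c.a t * c.f r)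
  have d2 : HasDerivAt (fun x => c.det₂ t x r) _ s :=
    ((((h.ha s hs).const_sub (c.a r)).mul (h.hasDerivAt_S_left hs t)).const_mul (2 * c.ξ))
  have d3 : HasDerivAt (fun x => c.det₃ k u t x r) _ s :=
    ((((h.ha s hs).sub_const (c.a t)).mul_const (c.S u r)).const_mul (2 * c.ξ * k))
  refine (((d0.const_mul σ₀).add (d2.const_mul σ₂)).add (d3.const_mul σ₃)).congr_deriv ?_
  unfold size₂; ring

lemma hasDerivAt_size₃ (σ₀ σ₂ σ₃ k u t s : ℝ) (hr : 1 < r) :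
    HasDerivAt (fun x => c.size σ₀ σ₂ σ₃ k u t s x) (c.size₃ σ₀ σ₂ σ₃ k u t s r) r := by
  have d0 : HasDerivAt (fun x => c.det₀ t s x) _ r :=
    ((((((h.hf r hr).sub_const (c.f t)).const_mul (c.a s)).add
      (((h.ha r hr).const_sub (c.a t)).const_mul (c.f s))).add
      ((h.ha r hr).mul_const (c.f t))).sub ((h.hf r hr).const_mul (c.a t)))
  have d2 : HasDerivAt (fun x => c.det₂ t s x) _ r :=
    ((((h.ha r hr).sub_const (c.a s)).mul_const (c.S s t)).const_mul (2 * c.ξ))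
  have d3 : HasDerivAt (fun x => c.det₃ k u t s x) _ r :=
    (((h.hasDerivAt_S_right u hr).const_mul (c.a s - c.a t)).const_mul (2 * c.ξ * k))
  refine (((d0.const_mul σ₀).add (d2.const_mul σ₂)).add (d3.const_mul σ₃)).congr_deriv ?_
  unfold size₃; ring

lemma hasDerivAt_num₁ (k u : ℝ) (y : ℝ × ℝ × ℝ) (ht : 1 < t) (s r : ℝ) :
    HasDerivAt (fun x => c.num₁ k u y x s r) (-c.numDeriv y t s r) t := by
  have d : HasDerivAt (fun x => c.yTilde y x s) _ t :=
    (((((hasDerivAt_id t).sub_const s).mul_const y.2.1).sub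
      (((h.hA t ht).sub_const (c.A s)).mul_const y.1)).const_mul (2 * c.ξ)).const_add y.2.2
  refine (((d.mul_const (c.a r - c.a s)).const_add (y.1 * (c.a s * c.e₃ k u r - c.a r * c.f s)
    + y.2.1 * (c.f s - c.e₃ k u r))).neg).congr_deriv ?_
  unfold numDeriv; ring

lemma hasDerivAt_num₂ (k u : ℝ) (y : ℝ × ℝ × ℝ) (t : ℝ) (hs : 1 < s) (r : ℝ) :
    HasDerivAt (fun x => c.num₂ k u y t x r) (c.numDeriv y t s r) s := by
  have d : HasDerivAt (fun x => c.yTilde y t x) _ s :=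
    (((((hasDerivAt_id s).const_sub t).mul_const y.2.1).sub
      (((h.hA s hs).const_sub (c.A t)).mul_const y.1)).const_mul (2 * c.ξ)).const_add y.2.2
  have de : HasDerivAt (fun x => c.e₁ t x) _ s :=
    ((h.hasDerivAt_S_left hs t).const_mul (2 * c.ξ)).const_add (c.f t)
  refine ((((de.const_mul (c.a r)).sub_const (c.a t * c.e₃ k u r)).const_mul y.1).add
    ((de.const_sub (c.e₃ k u r)).const_mul y.2.1)).sub (d.mul_const (c.a r - c.a t))
    |>.congr_deriv ?_
  unfold numDeriv; ring

/-! ### Size of the exterior products and of the determinant -/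

lemma W_nonneg (hx : x ∈ Icc (2 : ℝ) 8) (hy : y ∈ Icc (2 : ℝ) 8) (hxy : x ≤ y) :
    0 ≤ c.W x y :=
  add_nonneg (mul_nonneg (h.K_pos hx).le (h.a_pos hy).le)
    (mul_nonneg (h.a_pos hx).le (h.T_nonneg hx hy hxy))

lemma le_W (hx : x ∈ Icc (2 : ℝ) 8) (hy : y ∈ Icc (2 : ℝ) 8) (hxy : x ≤ y) :
    κ * c.a y ≤ c.W x y := by
  have h1 := mul_nonneg (h.a_pos hx).le (h.T_nonneg hx hy hxy)
  have h2 := h.K_ge x hx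
  have h3 := h.a_pos hy
  unfold W; nlinarith

lemma κ_mul_a_sub_le_W (hx : x ∈ Icc (2 : ℝ) 8) (hy : y ∈ Icc (2 : ℝ) 8) (hxy : x ≤ y) :
    κ * (c.a y - c.a x) ≤ c.W x y := by
  have := h.le_W hx hy hxy
  nlinarith [mul_pos h.κ_pos (h.a_pos hx)]

lemma f_sub_nonneg (hx : x ∈ Icc (2 : ℝ) 8) (hy : y ∈ Icc (2 : ℝ) 8) (hxy : x ≤ y) :
    0 ≤ c.f y - c.f x := by
  have := h.T_nonneg hx hy hxy
  have h2 := mul_nonneg (h.P_nonneg x hx) (sub_nonneg.2 (h.a_le hx hy hxy))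
  unfold T at this; linarith

lemma f_sub_le_W (hx : x ∈ Icc (2 : ℝ) 8) (hy : y ∈ Icc (2 : ℝ) 8) (hxy : x ≤ y) :
    c.f y - c.f x ≤ c.W x y := by
  have h0 := h.T_nonneg hx hy hxy
  have h1 : c.f y - c.f x = c.T x y + c.P x * (c.a y - c.a x) := by unfold T; ring
  have h2 : c.P x * (c.a y - c.a x) ≤ c.K x * c.a y :=
    mul_le_mul (h.P_le x hx) (by linarith [h.a_pos hx]) (sub_nonneg.2 (h.a_le hx hy hxy))
      (h.K_pos hx).le
  have h3 : c.T x y ≤ c.a x * c.T x y := le_mul_of_one_le_left h0 (h.a_ge x hx)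
  unfold W; linarith

lemma cross_nonneg (hx : x ∈ Icc (2 : ℝ) 8) (hy : y ∈ Icc (2 : ℝ) 8) (hxy : x ≤ y) :
    0 ≤ c.a x * c.f y - c.a y * c.f x := by
  have h0 := mul_nonneg (h.a_pos hx).le (h.T_nonneg hx hy hxy)
  have h1 := mul_nonneg (h.K_pos hx).le (sub_nonneg.2 (h.a_le hx hy hxy))
  have e : c.a x * c.f y - c.a y * c.f x = c.a x * c.T x y + c.K x * (c.a y - c.a x) := by
    unfold T K; ring
  rw [e]; positivity

lemma cross_le_W (hx : x ∈ Icc (2 : ℝ) 8) :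
    c.a x * c.f y - c.a y * c.f x ≤ c.W x y := by
  have e : c.a x * c.f y - c.a y * c.f x = c.W x y - c.K x * c.a x := by unfold W T K; ring
  rw [e]; linarith [mul_pos (h.K_pos hx) (h.a_pos hx)]

variable {p q l e : ℝ}

lemma T_le_T_add (hp : p ∈ Icc (2 : ℝ) 8) (hq : q ∈ Icc (2 : ℝ) 8) (hpq : p ≤ q) :
    c.T p l ≤ c.T q l + (c.P q - c.P p) * (c.a l - c.a p) := by
  have h1 := h.T_le hp hq hpq
  have e : c.T p l = c.T q l + c.T p q + (c.P q - c.P p) * (c.a l - c.a q) := by unfold T; ring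
  rw [e]; linarith

/-- The exterior product with the latest velocity is larger for later velocities. -/
lemma W_le_W_left (hp : p ∈ Icc (2 : ℝ) 8) (hq : q ∈ Icc (2 : ℝ) 8) (hl : l ∈ Icc (2 : ℝ) 8)
    (hpq : p ≤ q) (hql : q ≤ l) : c.W p l ≤ c.W q l := by
  have h1 := h.T_le_T_add hp hq hpq (l := l)
  have h2 := h.a_mul_P_sub_le hp hq hpq
  have h3 := h.T_nonneg hq hl hql
  have h4 := h.a_le hp hq hpq
  have ap := h.a_pos hp
  have al := h.a_pos hl
  have hP := h.P_mono hp hq hpq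
  have i1 : c.a p * c.T p l ≤ c.a p * c.T q l + c.a p * (c.P q - c.P p) * (c.a l - c.a p) := by
    rw [mul_assoc, ← mul_add]; exact mul_le_mul_of_nonneg_left h1 ap.le
  have i2 : c.a p * (c.P q - c.P p) * (c.a l - c.a p) ≤ (c.K q - c.K p) * c.a l :=
    mul_le_mul h2 (by linarith) (by linarith [h.a_le hp hl (hpq.trans hql)])
      (by linarith [h.K_mono hp hq hpq])
  have i3 : c.a p * c.T q l ≤ c.a q * c.T q l := mul_le_mul_of_nonneg_right h4 h3
  unfold W; linarith

lemma W_le_W_right (hp : p ∈ Icc (2 : ℝ) 8) (hq : q ∈ Icc (2 : ℝ) 8) (hl : l ∈ Icc (2 : ℝ) 8)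
    (hpq : p ≤ q) (hql : q ≤ l) : c.W p q ≤ c.W q l := by
  have h1 := h.T_le hp hq hpq
  have h2 := h.a_mul_P_sub_le hp hq hpq
  have h3 := mul_nonneg (h.a_pos hq).le (h.T_nonneg hq hl hql)
  have h4 := h.a_le hq hl hql
  have ap := h.a_pos hp
  have aq := h.a_pos hq
  have i1 : c.a p * c.T p q ≤ c.a p * (c.P q - c.P p) * (c.a q - c.a p) := by
    rw [mul_assoc]; exact mul_le_mul_of_nonneg_left h1 ap.le
  have i2 : c.a p * (c.P q - c.P p) * (c.a q - c.a p) ≤ (c.K q - c.K p) * c.a q :=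
    mul_le_mul h2 (by linarith) (by linarith [h.a_le hp hq hpq])
      (by linarith [h.K_mono hp hq hpq])
  have i3 : c.K q * c.a q ≤ c.K q * c.a l := mul_le_mul_of_nonneg_left h4 (h.K_pos hq).le
  unfold W at *; linarith

/-- The determinant of three velocities in the order `p < q < l` controls the exterior product of
the last two. -/
lemma W_le_J (he : 0 < e) (he1 : e ≤ 1) (hpq : c.IsGap e p q) (hql : c.IsGap e q l) :
    e ^ 2 * c.W q l ≤ c.J p q l := by
  have hT := h.T_nonneg hql.mem_left hql.mem_right hql.le
  have aq := h.a_pos hql.mem_left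
  have al := h.a_pos hql.mem_right
  have Kq := h.K_pos hql.mem_left
  have i1 : e * c.a q * c.T q l ≤ (c.a q - c.a p) * c.T q l :=
    mul_le_mul_of_nonneg_right hpq.a_sub hT
  have i2 : (e * c.a l) * (e * c.K q) ≤ (c.a l - c.a q) * c.Y p q :=
    mul_le_mul hql.a_sub hpq.Y_ge (by positivity) (le_trans (by positivity) hql.a_sub)
  have i3 : e ^ 2 * (c.a q * c.T q l) ≤ e * c.a q * c.T q l := by
    have h2 : e ^ 2 ≤ e := by nlinarith
    rw [mul_assoc]
    exact mul_le_mul_of_nonneg_right h2 (by positivity)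
  unfold J W; nlinarith

lemma J_nonneg (hp : p ∈ Icc (2 : ℝ) 8) (hq : q ∈ Icc (2 : ℝ) 8) (hl : l ∈ Icc (2 : ℝ) 8)
    (hpq : p ≤ q) (hql : q ≤ l) : 0 ≤ c.J p q l :=
  add_nonneg (mul_nonneg (sub_nonneg.2 (h.a_le hp hq hpq)) (h.T_nonneg hq hl hql))
    (mul_nonneg (sub_nonneg.2 (h.a_le hq hl hql)) (h.Y_nonneg hp hq hpq))

end IsNormalized

end CurveData

/-! ### Constants and bounds for the numerators -/

/-- Admissible choices of a small constant `e` for lower bounds and of large constants `R` and `M`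
for upper bounds. -/
structure IsConst (κ e R M : ℝ) : Prop where
  e_pos : 0 < e
  e_le_one : e ≤ 1
  e_le : e ≤ κ
  one_le : 1 ≤ R * e ^ 3
  le : 100 * R ≤ M

namespace IsConst

variable {κ e R M X S : ℝ} (C : IsConst κ e R M)
include C

lemma cube_le_sq : e ^ 3 ≤ e ^ 2 :=
  pow_le_pow_of_le_one C.e_pos.le C.e_le_one (by norm_num)

lemma sq_le : e ^ 2 ≤ e := by
  simpa using pow_le_pow_of_le_one C.e_pos.le C.e_le_one (show 1 ≤ 2 by norm_num)

lemma R_pos : 0 < R := by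
  have h1 := pow_pos C.e_pos 3
  have h2 := C.one_le
  by_contra h
  nlinarith

/-- A lower bound with the factor `e³` becomes an upper bound with the factor `R`. -/
lemma le_of_cube (hX : 0 ≤ X) (h : e ^ 3 * X ≤ S) : X ≤ R * S :=
  calc X ≤ R * e ^ 3 * X := le_mul_of_one_le_left hX C.one_le
    _ = R * (e ^ 3 * X) := by ring
    _ ≤ R * S := mul_le_mul_of_nonneg_left h C.R_pos.le

lemma le_of_sq (hX : 0 ≤ X) (h : e ^ 2 * X ≤ S) : X ≤ R * S :=
  C.le_of_cube hX ((mul_le_mul_of_nonneg_right C.cube_le_sq hX).trans h)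

lemma le_of_self (hX : 0 ≤ X) (h : e * X ≤ S) : X ≤ R * S :=
  C.le_of_sq hX ((mul_le_mul_of_nonneg_right C.sq_le hX).trans h)

lemma one_le_R : 1 ≤ R := by
  simpa using C.le_of_self (X := 1) (S := 1) zero_le_one (by simpa using C.e_le_one)

lemma le_of_kappa (hX : 0 ≤ X) (h : κ * X ≤ S) : X ≤ R * S :=
  C.le_of_self hX ((mul_le_mul_of_nonneg_right C.e_le hX).trans h)

lemma le_of_le (hX : 0 ≤ X) (h : X ≤ S) : X ≤ R * S :=
  C.le_of_self hX ((mul_le_of_le_one_left hX C.e_le_one).trans h)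

lemma mul_le (hS : 0 ≤ S) : 100 * (R * S) ≤ M * S := by
  rw [← mul_assoc]; exact mul_le_mul_of_nonneg_right C.le hS

end IsConst

lemma abs_comb_le {y : ℝ × ℝ × ℝ} {δ α β γ p q w : ℝ} (h1 : |y.1| ≤ δ) (h2 : |y.2.1| ≤ δ)
    (h3 : |y.2.2| ≤ δ) (hα : |α| ≤ p) (hβ : |β| ≤ q) (hγ : |γ| ≤ w) :
    |y.1 * α + y.2.1 * β + y.2.2 * γ| ≤ δ * (p + q + w) := by
  have hδ : 0 ≤ δ := (abs_nonneg _).trans h1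
  refine (abs_add_three _ _ _).trans ?_
  rw [abs_mul, abs_mul, abs_mul, mul_add, mul_add]
  gcongr

namespace CurveData

variable (c : CurveData)

/-- The order `s < t < r`, with gaps, and a fourth time `u < r`. -/
structure IsConf₁ (e k u t s r : ℝ) : Prop where
  k_nonneg : 0 ≤ k
  k_le : k ≤ 1
  st : c.IsGap e s t
  tr : c.IsGap e t r
  ur : c.IsGap e u r

/-- The order `t < s < r`, with gaps, and a fourth time `u < r`. -/
structure IsConf₂ (e k u t s r : ℝ) : Prop where
  k_nonneg : 0 ≤ k
  k_le : k ≤ 1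
  ts : c.IsGap e t s
  sr : c.IsGap e s r
  ur : c.IsGap e u r

/-- The order `t < r < s`, with gaps. -/
structure IsConf₃ (e t s r : ℝ) : Prop where
  tr : c.IsGap e t r
  rs : c.IsGap e r s
  ts : c.IsGap e t s

namespace IsNormalized

variable {c} {κ e R M k u t s r δ : ℝ} {y : ℝ × ℝ × ℝ} (h : c.IsNormalized κ)
include h

lemma a_sub_le (C : IsConst κ e R M) (ht : t ∈ Icc (2 : ℝ) 8) (hs : s ∈ Icc (2 : ℝ) 8)
    (hts : t ≤ s) : c.a s - c.a t ≤ R * c.W t s :=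
  C.le_of_kappa (sub_nonneg.2 (h.a_le ht hs hts)) (h.κ_mul_a_sub_le_W ht hs hts)

lemma W_bounds (C : IsConst κ e R M) (hx : t ∈ Icc (2 : ℝ) 8) (hy : s ∈ Icc (2 : ℝ) 8)
    (hxy : t ≤ s) : |c.a t * c.f s - c.a s * c.f t| ≤ c.W t s ∧ |c.f s - c.f t| ≤ c.W t s ∧
      |c.a s - c.a t| ≤ R * c.W t s ∧ |c.a s - c.a t| ≤ c.a s :=
  ⟨abs_le.2 ⟨by linarith [h.cross_nonneg hx hy hxy, h.W_nonneg hx hy hxy], h.cross_le_W hx⟩,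
    abs_le.2 ⟨by linarith [h.f_sub_nonneg hx hy hxy, h.W_nonneg hx hy hxy],
      h.f_sub_le_W hx hy hxy⟩,
    by rw [abs_of_nonneg (sub_nonneg.2 (h.a_le hx hy hxy))]; exact h.a_sub_le C hx hy hxy,
    by rw [abs_of_nonneg (sub_nonneg.2 (h.a_le hx hy hxy))]; linarith [h.a_pos hx]⟩

lemma W_bounds' (C : IsConst κ e R M) (hx : t ∈ Icc (2 : ℝ) 8) (hy : s ∈ Icc (2 : ℝ) 8)
    (hxy : t ≤ s) : |c.a s * c.f t - c.a t * c.f s| ≤ c.W t s ∧ |c.f t - c.f s| ≤ c.W t s ∧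
      |c.a t - c.a s| ≤ R * c.W t s ∧ |c.a t - c.a s| ≤ c.a s := by
  have := h.W_bounds C hx hy hxy
  rw [abs_sub_comm (c.a s * c.f t), abs_sub_comm (c.f t), abs_sub_comm (c.a t)]
  exact this

lemma k_mul_S_mem (hk : 0 ≤ k) (hu : u ∈ Icc (2 : ℝ) 8) (hr : r ∈ Icc (2 : ℝ) 8) (hur : u ≤ r) :
    0 ≤ k * c.S u r ∧ k * c.S u r ≤ 6 * (k * c.a r) := by
  refine ⟨mul_nonneg hk (h.S_nonneg_of_le hu hr hur), ?_⟩
  calc _ ≤ k * (6 * c.a r) := mul_le_mul_of_nonneg_left (h.S_le_a hu hr hur) hk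
    _ = _ := by ring

/-- The bound `m` of `A`, the bound `w` of the exterior product and the bound `p` of `a r - a s`
depend on the order of the times. -/
lemma abs_num₁_le {w p m : ℝ} (hS : 0 ≤ k * c.S u r ∧ k * c.S u r ≤ 6 * (k * c.a r))
    (ht : t ∈ Icc (2 : ℝ) 8) (hs : s ∈ Icc (2 : ℝ) 8)
    (hw : |c.a s * c.f r - c.a r * c.f s| ≤ w ∧ |c.f r - c.f s| ≤ w ∧ |c.a r - c.a s| ≤ R * w ∧
      |c.a r - c.a s| ≤ p) (hm1 : c.A t ≤ m) (hm2 : c.A s ≤ m)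
    (h1 : |y.1| ≤ δ) (h2 : |y.2.1| ≤ δ) (h3 : |y.2.2| ≤ δ) :
    |c.num₁ k u y t s r| ≤ δ * ((2 + R) * w + 24 * (c.ξ * (k * c.a r * c.a s))
      + 14 * (c.ξ * (p * m))) := by
  have e1 : c.num₁ k u y t s r
      = y.1 * (-(c.a s * c.f r - c.a r * c.f s) - 2 * c.ξ * c.a s * (k * c.S u r)
          + 2 * c.ξ * ((c.A t - c.A s) * (c.a r - c.a s)))
        + y.2.1 * ((c.f r - c.f s) + 2 * c.ξ * (k * c.S u r)
          - 2 * c.ξ * ((t - s) * (c.a r - c.a s)))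
        + y.2.2 * (-(c.a r - c.a s)) := by
    unfold num₁ e₃ yTilde; ring
  obtain ⟨w1, w2, w3, w4⟩ := hw
  have as := h.a_ge s hs
  have ξ0 : 0 < 2 * c.ξ := by linarith [h.ξ_pos]
  have At := h.A_ge t ht
  have As := h.A_ge s hs
  have p0 : 0 ≤ p := (abs_nonneg _).trans w4
  have hts : |t - s| ≤ 6 := abs_le.2 ⟨by linarith [ht.1, hs.2], by linarith [ht.2, hs.1]⟩
  have i1 : 2 * c.ξ * c.a s * (k * c.S u r) ≤ 12 * (c.ξ * (k * c.a r * c.a s)) := by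
    calc _ ≤ 2 * c.ξ * c.a s * (6 * (k * c.a r)) :=
          mul_le_mul_of_nonneg_left hS.2 (mul_nonneg ξ0.le (by linarith))
      _ = _ := by ring
  have i2 : |2 * c.ξ * ((c.A t - c.A s) * (c.a r - c.a s))| ≤ 2 * (c.ξ * (p * m)) := by
    have hA : |c.A t - c.A s| ≤ m := abs_le.2 ⟨by linarith, by linarith⟩
    rw [abs_mul (2 * c.ξ), abs_of_pos ξ0, abs_mul]
    calc 2 * c.ξ * (|c.A t - c.A s| * |c.a r - c.a s|) ≤ 2 * c.ξ * (m * p) := by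
          gcongr
          linarith
      _ = _ := by ring
  have i3 : 2 * c.ξ * (k * c.S u r) ≤ 12 * (c.ξ * (k * c.a r * c.a s)) := by
    refine le_trans ?_ i1
    exact mul_le_mul_of_nonneg_right (le_mul_of_one_le_right ξ0.le as) hS.1
  have i4 : |2 * c.ξ * ((t - s) * (c.a r - c.a s))| ≤ 12 * (c.ξ * (p * m)) := by
    rw [abs_mul (2 * c.ξ), abs_of_pos ξ0, abs_mul]
    calc 2 * c.ξ * (|t - s| * |c.a r - c.a s|) ≤ 2 * c.ξ * (6 * (p * m)) := by
          gcongr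
          exact w4.trans (le_mul_of_one_le_right p0 (by linarith))
      _ = _ := by ring
  rw [e1]
  refine (abs_comb_le h1 h2 h3
    (p := w + 12 * (c.ξ * (k * c.a r * c.a s)) + 2 * (c.ξ * (p * m)))
    (q := w + 12 * (c.ξ * (k * c.a r * c.a s)) + 12 * (c.ξ * (p * m)))
    (w := R * w) ?_ ?_ ?_).trans (le_of_eq (by ring))
  · refine (abs_add_le _ _).trans (add_le_add ((abs_sub _ _).trans (add_le_add ?_ ?_)) i2)
    · rwa [abs_neg]
    · rwa [abs_of_nonneg (mul_nonneg (mul_nonneg ξ0.le (by linarith)) hS.1)]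
  · refine (abs_sub _ _).trans (add_le_add ((abs_add_le _ _).trans (add_le_add w2 ?_)) i4)
    rwa [abs_of_nonneg (mul_nonneg ξ0.le hS.1)]
  · rwa [abs_neg]

/-- The terms with `A` cancel up to a quantity controlled by `a(t)`. -/
lemma abs_num₂_le {w m : ℝ} (hS : 0 ≤ k * c.S u r ∧ k * c.S u r ≤ 6 * (k * c.a r))
    (hk1 : k ≤ 1)
    (ht : t ∈ Icc (2 : ℝ) 8) (hs : s ∈ Icc (2 : ℝ) 8) (hr : r ∈ Icc (2 : ℝ) 8)
    (hw : |c.a t * c.f r - c.a r * c.f t| ≤ w ∧ |c.f r - c.f t| ≤ w ∧ |c.a r - c.a t| ≤ R * w ∧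
      |c.a r - c.a t| ≤ c.a r) (hm1 : c.A t ≤ m) (hm2 : c.A s ≤ m)
    (hS' : 0 ≤ c.S s t ∧ c.S s t ≤ m)
    (h1 : |y.1| ≤ δ) (h2 : |y.2.1| ≤ δ) (h3 : |y.2.2| ≤ δ) :
    |c.num₂ k u y t s r| ≤ δ * ((2 + R) * w + 48 * (c.ξ * (c.a r * c.a t))
      + 4 * (c.ξ * (c.a t * m))) := by
  have e1 : c.num₂ k u y t s r
      = y.1 * (-(c.a t * c.f r - c.a r * c.f t) - 2 * c.ξ * c.a t * (k * c.S u r)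
          + 2 * c.ξ * (c.a r * c.a t * (t - s)) + 2 * c.ξ * (c.a t * (c.A s - c.A t)))
        + y.2.1 * ((c.f r - c.f t) + 2 * c.ξ * (k * c.S u r)
          - 2 * c.ξ * c.S s t - 2 * c.ξ * ((t - s) * (c.a r - c.a t)))
        + y.2.2 * (-(c.a r - c.a t)) := by
    unfold num₂ e₃ e₁ yTilde S; ring
  obtain ⟨w1, w2, w3, w4⟩ := hw
  have at' := h.a_ge t ht
  have ar := h.a_ge r hr
  have ξ0 : 0 < 2 * c.ξ := by linarith [h.ξ_pos]
  have At := h.A_ge t ht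
  have As := h.A_ge s hs
  have hts : |t - s| ≤ 6 := abs_le.2 ⟨by linarith [ht.1, hs.2], by linarith [ht.2, hs.1]⟩
  have hS2 : k * c.S u r ≤ 6 * c.a r := by nlinarith [hS.2]
  have hat : c.a r ≤ c.a r * c.a t := le_mul_of_one_le_right (by linarith) at'
  have i1 : 2 * c.ξ * c.a t * (k * c.S u r) ≤ 12 * (c.ξ * (c.a r * c.a t)) := by
    calc _ ≤ 2 * c.ξ * c.a t * (6 * c.a r) :=
          mul_le_mul_of_nonneg_left hS2 (mul_nonneg ξ0.le (by linarith))
      _ = _ := by ring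
  have i2 : |2 * c.ξ * (c.a r * c.a t * (t - s))| ≤ 12 * (c.ξ * (c.a r * c.a t)) := by
    have : 0 ≤ c.a r * c.a t := by nlinarith
    rw [abs_mul (2 * c.ξ), abs_of_pos ξ0, abs_mul, abs_of_nonneg this]
    calc 2 * c.ξ * (c.a r * c.a t * |t - s|) ≤ 2 * c.ξ * (c.a r * c.a t * 6) := by gcongr
      _ = _ := by ring
  have i3 : |2 * c.ξ * (c.a t * (c.A s - c.A t))| ≤ 2 * (c.ξ * (c.a t * m)) := by
    rw [abs_mul (2 * c.ξ), abs_of_pos ξ0, abs_mul, abs_of_pos (by linarith : 0 < c.a t), mul_assoc]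
    have := h.ξ_pos
    gcongr
    exact abs_le.2 ⟨by linarith, by linarith⟩
  have i4 : 2 * c.ξ * (k * c.S u r) ≤ 12 * (c.ξ * (c.a r * c.a t)) := by
    refine le_trans ?_ i1
    exact mul_le_mul_of_nonneg_right (le_mul_of_one_le_right ξ0.le at') hS.1
  have i5 : 2 * c.ξ * c.S s t ≤ 2 * (c.ξ * (c.a t * m)) := by
    rw [mul_assoc]
    have := h.ξ_pos
    gcongr
    exact hS'.2.trans (le_mul_of_one_le_left (by linarith) at')
  have i6 : |2 * c.ξ * ((t - s) * (c.a r - c.a t))| ≤ 12 * (c.ξ * (c.a r * c.a t)) := by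
    rw [abs_mul (2 * c.ξ), abs_of_pos ξ0, abs_mul]
    calc 2 * c.ξ * (|t - s| * |c.a r - c.a t|) ≤ 2 * c.ξ * (6 * (c.a r * c.a t)) := by
          gcongr; exact w4.trans hat
      _ = _ := by ring
  rw [e1]
  refine (abs_comb_le h1 h2 h3
    (p := w + 12 * (c.ξ * (c.a r * c.a t)) + 12 * (c.ξ * (c.a r * c.a t))
      + 2 * (c.ξ * (c.a t * m)))
    (q := w + 12 * (c.ξ * (c.a r * c.a t)) + 2 * (c.ξ * (c.a t * m))
      + 12 * (c.ξ * (c.a r * c.a t)))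
    (w := R * w) ?_ ?_ ?_).trans (le_of_eq (by ring))
  · refine (abs_add_le _ _).trans (add_le_add ((abs_add_le _ _).trans (add_le_add
      ((abs_sub _ _).trans (add_le_add ?_ ?_)) i2)) i3)
    · rwa [abs_neg]
    · rwa [abs_of_nonneg (mul_nonneg (mul_nonneg ξ0.le (by linarith)) hS.1)]
  · refine (abs_sub _ _).trans (add_le_add ((abs_sub _ _).trans (add_le_add
      ((abs_add_le _ _).trans (add_le_add w2 ?_)) ?_)) i6)
    · rwa [abs_of_nonneg (mul_nonneg ξ0.le hS.1)]
    · rwa [abs_of_nonneg (mul_nonneg ξ0.le hS'.1)]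
  · rwa [abs_neg]

lemma abs_num₃_le {w m p : ℝ} (ht : t ∈ Icc (2 : ℝ) 8) (hs : s ∈ Icc (2 : ℝ) 8)
    (hw : |c.a t * c.f s - c.a s * c.f t| ≤ w ∧ |c.f s - c.f t| ≤ w ∧ |c.a s - c.a t| ≤ R * w ∧
      |c.a s - c.a t| ≤ p) (hm1 : c.A t ≤ m) (hm2 : c.A s ≤ m)
    (hS' : 0 ≤ c.S s t ∧ c.S s t ≤ 6 * p)
    (h1 : |y.1| ≤ δ) (h2 : |y.2.1| ≤ δ) (h3 : |y.2.2| ≤ δ) :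
    |c.num₃ y t s| ≤ δ * ((2 + R) * w + 12 * (c.ξ * (c.a s * c.a t))
      + 2 * (c.ξ * (c.a t * m)) + 24 * (c.ξ * p)) := by
  have e1 : c.num₃ y t s
      = y.1 * ((c.a t * c.f s - c.a s * c.f t)
          - 2 * c.ξ * (c.a s * c.a t * (t - s)) - 2 * c.ξ * (c.a t * (c.A s - c.A t)))
        + y.2.1 * (-(c.f s - c.f t) + 2 * c.ξ * c.S s t + 2 * c.ξ * ((t - s) * (c.a s - c.a t)))
        + y.2.2 * (c.a s - c.a t) := by
    unfold num₃ e₁ yTilde S; ring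
  obtain ⟨w1, w2, w3, w4⟩ := hw
  have at' := h.a_pos ht
  have as := h.a_pos hs
  have ξ0 : 0 < 2 * c.ξ := by linarith [h.ξ_pos]
  have ξ1 := h.ξ_pos
  have At := h.A_ge t ht
  have As := h.A_ge s hs
  have hts : |t - s| ≤ 6 := abs_le.2 ⟨by linarith [ht.1, hs.2], by linarith [ht.2, hs.1]⟩
  have i2 : |2 * c.ξ * (c.a s * c.a t * (t - s))| ≤ 12 * (c.ξ * (c.a s * c.a t)) := by
    have : 0 ≤ c.a s * c.a t := by positivity
    rw [abs_mul (2 * c.ξ), abs_of_pos ξ0, abs_mul, abs_of_nonneg this]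
    calc 2 * c.ξ * (c.a s * c.a t * |t - s|) ≤ 2 * c.ξ * (c.a s * c.a t * 6) := by gcongr
      _ = _ := by ring
  have i3 : |2 * c.ξ * (c.a t * (c.A s - c.A t))| ≤ 2 * (c.ξ * (c.a t * m)) := by
    rw [abs_mul (2 * c.ξ), abs_of_pos ξ0, abs_mul, abs_of_pos at', mul_assoc]
    gcongr
    exact abs_le.2 ⟨by linarith, by linarith⟩
  have i5 : 2 * c.ξ * c.S s t ≤ 12 * (c.ξ * p) := by
    calc _ ≤ 2 * c.ξ * (6 * p) := mul_le_mul_of_nonneg_left hS'.2 ξ0.le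
      _ = _ := by ring
  have i6 : |2 * c.ξ * ((t - s) * (c.a s - c.a t))| ≤ 12 * (c.ξ * p) := by
    rw [abs_mul (2 * c.ξ), abs_of_pos ξ0, abs_mul]
    calc 2 * c.ξ * (|t - s| * |c.a s - c.a t|) ≤ 2 * c.ξ * (6 * p) := by gcongr
      _ = _ := by ring
  rw [e1]
  refine (abs_comb_le h1 h2 h3
    (p := w + 12 * (c.ξ * (c.a s * c.a t)) + 2 * (c.ξ * (c.a t * m)))
    (q := w + 12 * (c.ξ * p) + 12 * (c.ξ * p))
    (w := R * w) ?_ ?_ w3).trans (le_of_eq (by ring))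
  · exact (abs_sub _ _).trans (add_le_add ((abs_sub _ _).trans (add_le_add w1 i2)) i3)
  · refine (abs_add_le _ _).trans (add_le_add ((abs_add_le _ _).trans (add_le_add ?_ ?_)) i6)
    · rwa [abs_neg]
    · rwa [abs_of_nonneg (mul_nonneg ξ0.le hS'.1)]

lemma abs_numDeriv_le {p : ℝ} (ht : t ∈ Icc (2 : ℝ) 8) (hp : |c.a r - c.a s| ≤ p)
    (h1 : |y.1| ≤ δ) (h2 : |y.2.1| ≤ δ) :
    |c.numDeriv y t s r| ≤ δ * (4 * (c.ξ * (c.a t * p))) := by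
  have at' := h.a_ge t ht
  have ξ0 := h.ξ_pos
  have hδ : 0 ≤ δ := (abs_nonneg _).trans h1
  have i : |y.2.1 - c.a t * y.1| ≤ 2 * (c.a t * δ) := by
    refine (abs_sub _ _).trans ?_
    rw [abs_mul, abs_of_pos (by linarith : 0 < c.a t)]
    nlinarith [mul_nonneg (by linarith : 0 ≤ c.a t) (sub_nonneg.2 h1)]
  unfold numDeriv
  rw [abs_mul (2 * c.ξ), abs_of_pos (by linarith : 0 < 2 * c.ξ), abs_mul]
  calc 2 * c.ξ * (|y.2.1 - c.a t * y.1| * |c.a r - c.a s|)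
      ≤ 2 * c.ξ * (2 * (c.a t * δ) * p) := by gcongr
    _ = _ := by ring

end IsNormalized
end CurveData

/-! ### Line estimates in the order `s < t < r` -/

/-- The one-variable estimate in the case of a monotone size `S` that dominates the variation of
the denominator. -/
theorem lintegral_regQuotDeriv_le_of_monotone {x₀ x₁ : ℝ} (h01 : x₀ ≤ x₁) (h6 : x₁ - x₀ ≤ 6)
    {θ δ M : ℝ} (hθ : 0 < θ) (hθ1 : θ ≤ 1) (hδ : 0 ≤ δ) (hM : 1 ≤ M)
    {N N' D D' S S' n n' : ℝ → ℝ} {g g' : ℝ → ℂ}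
    (dn : ∀ x ∈ Icc x₀ x₁, HasDerivAt n (n' x) x) (dS : ∀ x ∈ Icc x₀ x₁, HasDerivAt S (S' x) x)
    (hN : ∀ x ∈ Icc x₀ x₁, |N x| ≤ δ * (M * n x))
    (hN' : ∀ x ∈ Icc x₀ x₁, |N' x| ≤ δ * (M * S x))
    (hS : ∀ x ∈ Icc x₀ x₁, 0 < S x) (hDS : ∀ x ∈ Icc x₀ x₁, |D x| ≤ S x)
    (hn : ∀ x ∈ Icc x₀ x₁, 0 < n x) (hnS : ∀ x ∈ Icc x₀ x₁, n x ≤ M * S x)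
    (hn' : ∀ x ∈ Icc x₀ x₁, |n' x| ≤ M * S x)
    (hS' : (∀ x ∈ Icc x₀ x₁, 0 ≤ S' x) ∨ ∀ x ∈ Icc x₀ x₁, S' x ≤ 0)
    (hD' : ∀ x ∈ Icc x₀ x₁, |D' x| ≤ |S' x|)
    (hg : ∀ x ∈ Icc x₀ x₁, ‖g x‖ ≤ M) (hg' : ∀ x ∈ Icc x₀ x₁, ‖g' x‖ ≤ M) :
    ∫⁻ x in Icc x₀ x₁, ‖regQuotDeriv θ (N x) (N' x) (D x) (D' x) (S x) (S' x) (g x) (g' x)‖ₑ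
      ≤ ENNReal.ofReal (300 * δ * θ⁻¹ ^ 4 * M ^ 6) := by
  have hM0 : 0 ≤ M := zero_le_one.trans hM
  have key : ∀ z, |z| ≤ M * (|z| + 0) := fun z => by
    rw [add_zero]; exact le_mul_of_one_le_left (abs_nonneg z) hM
  refine lintegral_regQuotDeriv_le (Ψ := fun _ => 0) (Ψ' := fun _ => 0) (E := S) (E' := S')
    h01 h6 hθ hθ1 hδ hM dn dS (fun x _ => hasDerivAt_const x 0) hN hN' hS hDS hn hnS
    (fun x hx => (hS x hx).le) (fun x hx => le_mul_of_one_le_left (hS x hx).le hM)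
    (fun x hx => (hn' x hx).trans (mul_le_mul_of_nonneg_left (by linarith [hn x hx]) hM0))
    hS' (fun _ _ => ⟨le_rfl, zero_le_one⟩) (fun _ _ => le_rfl)
    (fun x hx => ?_) (fun x hx => ?_) hg hg'
  · rw [mul_zero]; exact (hD' x hx).trans (key _)
  · rw [mul_zero]; exact key _

namespace CurveData

variable {c : CurveData} {κ e R M k u t s r δ θ x₀ x₁ : ℝ} {y : ℝ × ℝ × ℝ} {g g' : ℝ → ℂ}

namespace IsNormalized

variable (h : c.IsNormalized κ)
include h

lemma hasDerivAt_T_left (hx : 1 < t) (r : ℝ) :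
    HasDerivAt (fun x => c.T x r) (-(c.P₁ t * (c.a r - c.a t))) t :=
  (((h.hf t hx).const_sub (c.f r)).sub ((h.hP t hx).mul ((h.ha t hx).const_sub (c.a r)))).congr_deriv
    (by ring)

lemma hasDerivAt_Y_right (s : ℝ) (hx : 1 < t) :
    HasDerivAt (fun x => c.Y s x) (c.P₁ t * (c.a t - c.a s)) t :=
  (((h.hP t hx).mul ((h.ha t hx).sub_const (c.a s))).sub ((h.hf t hx).sub_const (c.f s))).congr_deriv
    (by ring)

/-- The determinant without cancellation controls all the quantities in the numerators. -/
lemma size_bounds₁ (C : IsConst κ e R M) (O : c.IsConf₁ e k u t s r) :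
    0 ≤ -c.det₀ t s r ∧ 0 ≤ c.det₂ t s r ∧ 0 ≤ -c.det₃ k u t s r ∧
    c.W t r ≤ R * c.size (-1) 1 (-1) k u t s r ∧
    c.ξ * (c.a r * c.a t) ≤ R * c.size (-1) 1 (-1) k u t s r ∧
    c.a r * c.Y s t ≤ R * c.size (-1) 1 (-1) k u t s r ∧
    (c.a t - c.a s) * c.T t r ≤ R * c.size (-1) 1 (-1) k u t s r := by
  have ξ0 := h.ξ_pos
  have as := h.a_pos O.st.mem_left
  have at' := h.a_pos O.st.mem_right
  have ar := h.a_pos O.tr.mem_right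
  have e0 := C.e_pos
  have Y0 := h.Y_nonneg O.st.mem_left O.st.mem_right O.st.le
  have T0 := h.T_nonneg O.tr.mem_left O.tr.mem_right O.tr.le
  have ast := h.a_le O.st.mem_left O.st.mem_right O.st.le
  have d0 : -c.det₀ t s r = c.J s t r := by rw [det₀_eq_neg_J, neg_neg]
  have J0 : 0 ≤ -c.det₀ t s r := by
    rw [d0]; exact h.J_nonneg O.st.mem_left O.st.mem_right O.tr.mem_right O.st.le O.tr.le
  have g1 : e * c.a r ≤ c.a r - c.a s := by linarith [O.tr.a_sub]
  have q2 : e ^ 2 * (c.ξ * (c.a r * c.a t)) ≤ c.det₂ t s r := by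
    have i := mul_le_mul g1 O.st.S_ge (by positivity) (by linarith [mul_pos e0 ar])
    have j : 0 ≤ c.ξ * ((c.a r - c.a s) * c.S s t - e * c.a r * (e * c.a t)) :=
      mul_nonneg ξ0.le (sub_nonneg.2 i)
    have l : 0 ≤ c.ξ * (e * c.a r * (e * c.a t)) := by positivity
    unfold det₂; nlinarith
  have d2 : 0 ≤ c.det₂ t s r := le_trans (by positivity) q2
  have d3 : 0 ≤ -c.det₃ k u t s r := by
    have i := h.S_nonneg_of_le O.ur.mem_left O.ur.mem_right O.ur.le
    have := O.k_nonneg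
    have : 0 ≤ 2 * c.ξ * k * ((c.a t - c.a s) * c.S u r) :=
      mul_nonneg (by positivity) (mul_nonneg (by linarith) i)
    unfold det₃; linarith
  have hS : c.size (-1) 1 (-1) k u t s r
      = -c.det₀ t s r + c.det₂ t s r + -c.det₃ k u t s r := by unfold size; ring
  have hJ : (c.a t - c.a s) * c.T t r + (c.a r - c.a t) * c.Y s t = -c.det₀ t s r := by
    rw [d0]; rfl
  have n1 : 0 ≤ (c.a t - c.a s) * c.T t r := mul_nonneg (by linarith) T0
  have n2 : e * (c.a r * c.Y s t) ≤ (c.a r - c.a t) * c.Y s t := by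
    rw [← mul_assoc]; exact mul_le_mul_of_nonneg_right O.tr.a_sub Y0
  have n3 : 0 ≤ e * (c.a r * c.Y s t) := by positivity
  refine ⟨J0, d2, d3, C.le_of_sq (h.W_nonneg O.tr.mem_left O.tr.mem_right O.tr.le) ?_,
    C.le_of_sq (by positivity) ?_, C.le_of_self (by positivity) ?_, C.le_of_le n1 ?_⟩
  · rw [hS, d0]; rw [d0] at J0; linarith [h.W_le_J e0 C.e_le_one O.st O.tr]
  · linarith
  · linarith
  · linarith

lemma size_pos₁ (C : IsConst κ e R M) (O : c.IsConf₁ e k u t s r) :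
    0 < c.size (-1) 1 (-1) k u t s r := by
  have := (h.size_bounds₁ C O).2.2.2.2.1
  have h1 := mul_pos h.ξ_pos (mul_pos (h.a_pos O.tr.mem_right) (h.a_pos O.tr.mem_left))
  by_contra h2
  nlinarith [C.R_pos]

lemma abs_jac_le₁ (C : IsConst κ e R M) (O : c.IsConf₁ e k u t s r) :
    |c.jac k u t s r| ≤ c.size (-1) 1 (-1) k u t s r := by
  obtain ⟨d0, d2, d3, -⟩ := h.size_bounds₁ C O
  unfold jac size
  exact abs_le.2 ⟨by linarith, by linarith⟩

lemma abs_numDeriv_le₁ (C : IsConst κ e R M) (O : c.IsConf₁ e k u t s r)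
    (h1 : |y.1| ≤ δ) (h2 : |y.2.1| ≤ δ) :
    |c.numDeriv y t s r| ≤ δ * (M * c.size (-1) 1 (-1) k u t s r) := by
  have hsr := O.st.le.trans O.tr.le
  have b := (h.W_bounds C O.st.mem_left O.tr.mem_right hsr).2.2.2
  refine (h.abs_numDeriv_le O.st.mem_right b h1 h2).trans
    (mul_le_mul_of_nonneg_left ?_ ((abs_nonneg _).trans h1))
  have i := (h.size_bounds₁ C O).2.2.2.2.1
  have j := C.mul_le (h.size_pos₁ C O).le
  have l := mul_pos C.R_pos (h.size_pos₁ C O)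
  rw [mul_comm (c.a t)]
  linarith

/-- The middle time moves, and the contributions to the determinant need not vary in the same
direction. The size is replaced by a monotone function `E` dominated by it; the part of the
variation which has the wrong sign is at most the size times the derivative of `Ψ = a / a(r)`. -/
theorem lintegral_line₁_conf₁ (C : IsConst κ e R M) (h01 : x₀ ≤ x₁) (hθ : 0 < θ) (hθ1 : θ ≤ 1)
    (O : ∀ x ∈ Icc x₀ x₁, c.IsConf₁ e k u x s r)
    (h1 : |y.1| ≤ δ) (h2 : |y.2.1| ≤ δ) (h3 : |y.2.2| ≤ δ)
    (hg : ∀ x ∈ Icc x₀ x₁, ‖g x‖ ≤ M) (hg' : ∀ x ∈ Icc x₀ x₁, ‖g' x‖ ≤ M) :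
    ∫⁻ x in Icc x₀ x₁, ‖regQuotDeriv θ (c.num₁ k u y x s r) (-c.numDeriv y x s r)
        (c.jac k u x s r) (c.size₁ 1 1 1 k u x s r) (c.size (-1) 1 (-1) k u x s r)
        (c.size₁ (-1) 1 (-1) k u x s r) (g x) (g' x)‖ₑ
      ≤ ENNReal.ofReal (300 * δ * θ⁻¹ ^ 4 * M ^ 6) := by
  have hδ : 0 ≤ δ := (abs_nonneg _).trans h1
  have O0 := O x₀ (left_mem_Icc.2 h01)
  have O1 := O x₁ (right_mem_Icc.2 h01)
  have R1 := C.one_le_R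
  have hM : 1 ≤ M := by linarith [C.le]
  have ξ0 := h.ξ_pos
  have hs := O0.st.mem_left
  have hr := O0.tr.mem_right
  have hsr := O0.st.le.trans O0.tr.le
  have as := h.a_pos hs
  have ar := h.a_pos hr
  have W0 := h.W_nonneg hs hr hsr
  have lt1 : ∀ x ∈ Icc x₀ x₁, 1 < x := fun x hx => one_lt_of_mem_Icc (O x hx).st.mem_right
  have hE'0 : ∀ x ∈ Icc x₀ x₁, 0 ≤ c.a₂ x * c.T x r ∧ 0 ≤ c.P₁ x * (c.a x - c.a s) * c.a x ∧
      0 ≤ c.ξ * (c.a r * c.a₂ x) := fun x hx => by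
    have O := O x hx
    have a2 := h.a₂_pos O.st.mem_right
    refine ⟨mul_nonneg a2.le (h.T_nonneg O.tr.mem_left O.tr.mem_right O.tr.le),
      mul_nonneg (mul_nonneg (h.P₁_nonneg O.st.mem_right)
        (sub_nonneg.2 (h.a_le O.st.mem_left O.st.mem_right O.st.le))) (h.a_pos O.st.mem_right).le,
      by positivity⟩
  -- the derivative of each of the contributions is controlled by that of `E` and of `Ψ`
  have key : ∀ x ∈ Icc x₀ x₁, ∀ σ₀ σ₂ σ₃ : ℝ, |σ₀| = 1 → |σ₂| = 1 → |σ₃| = 1 →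
      |c.size₁ σ₀ σ₂ σ₃ k u x s r| ≤ M * (|c.a₂ x * c.T x r + c.P₁ x * (c.a x - c.a s) * c.a x
        + c.ξ * (c.a r * c.a₂ x)| + c.size (-1) 1 (-1) k u x s r * (c.a₂ x / c.a r)) := by
    intro x hx σ₀ σ₂ σ₃ hσ₀ hσ₂ hσ₃
    obtain ⟨p1, p2, p3⟩ := hE'0 x hx
    have O := O x hx
    have a2 := h.a₂_pos O.st.mem_right
    obtain ⟨-, -, -, -, -, bY, -⟩ := h.size_bounds₁ C O
    have Y0 := h.Y_nonneg O.st.mem_left O.st.mem_right O.st.le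
    have S0 := (h.size_pos₁ C O).le
    set Z := c.size (-1) 1 (-1) k u x s r * (c.a₂ x / c.a r) with hZ
    have Z0 : 0 ≤ Z := by positivity
    have j0 : |c.a₂ x * ((c.a r - c.a s) * c.P x - (c.f r - c.f s))|
        ≤ c.a₂ x * c.T x r + R * Z := by
      have e1 : c.a₂ x * ((c.a r - c.a s) * c.P x - (c.f r - c.f s))
          = c.a₂ x * c.Y s x - c.a₂ x * c.T x r := by unfold Y T; ring
      have e2 : c.a₂ x * c.Y s x ≤ R * Z := by
        have : c.a₂ x * c.Y s x = (c.a r * c.Y s x) * (c.a₂ x / c.a r) := by field_simp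
        rw [this, hZ, ← mul_assoc]
        exact mul_le_mul_of_nonneg_right bY (by positivity)
      have e3 : 0 ≤ c.a₂ x * c.Y s x := by positivity
      rw [e1]
      exact abs_le.2 ⟨by linarith, by linarith⟩
    have j2 : |2 * c.ξ * ((c.a r - c.a s) * ((x - s) * c.a₂ x))| ≤ 12 * (c.ξ * (c.a r * c.a₂ x)) := by
      have q0 : 0 ≤ c.a r - c.a s := sub_nonneg.2 (h.a_le hs hr hsr)
      have q1 : 0 ≤ x - s := sub_nonneg.2 O.st.le
      rw [abs_of_nonneg (by positivity)]
      calc _ ≤ 2 * c.ξ * (c.a r * (6 * c.a₂ x)) := by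
            gcongr
            · linarith
            · linarith [O.st.mem_left.1, O.st.mem_right.2]
        _ = _ := by ring
    have j3 : |2 * c.ξ * k * (-c.a₂ x * c.S u r)| ≤ 12 * (c.ξ * (c.a r * c.a₂ x)) := by
      have q := h.k_mul_S_mem O.k_nonneg O.ur.mem_left O.ur.mem_right O.ur.le
      have e1 : 2 * c.ξ * k * (-c.a₂ x * c.S u r) = -(2 * c.ξ * c.a₂ x * (k * c.S u r)) := by ring
      rw [e1, abs_neg, abs_of_nonneg (mul_nonneg (by positivity) q.1)]
      calc _ ≤ 2 * c.ξ * c.a₂ x * (6 * (1 * c.a r)) := by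
            refine mul_le_mul_of_nonneg_left (q.2.trans ?_) (by positivity)
            have := O.k_le
            gcongr
        _ = _ := by ring
    have tot : |c.size₁ σ₀ σ₂ σ₃ k u x s r|
        ≤ (c.a₂ x * c.T x r + R * Z) + 12 * (c.ξ * (c.a r * c.a₂ x))
          + 12 * (c.ξ * (c.a r * c.a₂ x)) := by
      unfold size₁
      refine (abs_add_three _ _ _).trans ?_
      rw [abs_mul σ₀, abs_mul σ₂, abs_mul σ₃, hσ₀, hσ₂, hσ₃, one_mul, one_mul, one_mul]
      exact add_le_add (add_le_add j0 j2) j3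
    refine tot.trans ?_
    rw [abs_of_nonneg (by linarith)]
    have m1 : 100 * R * (c.a₂ x * c.T x r + c.P₁ x * (c.a x - c.a s) * c.a x
        + c.ξ * (c.a r * c.a₂ x) + Z) ≤ M * (c.a₂ x * c.T x r + c.P₁ x * (c.a x - c.a s) * c.a x
        + c.ξ * (c.a r * c.a₂ x) + Z) := mul_le_mul_of_nonneg_right C.le (by linarith)
    refine le_trans ?_ m1
    nlinarith [mul_nonneg (sub_nonneg.2 R1) p1, mul_nonneg (sub_nonneg.2 R1) p2,
      mul_nonneg (sub_nonneg.2 R1) p3, mul_nonneg C.R_pos.le Z0]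
  refine lintegral_regQuotDeriv_le
    (n := fun x => c.W s r + c.ξ * (c.a r * c.a s) + c.ξ * (c.a r * c.A x))
    (n' := fun x => c.ξ * (c.a r * c.a x))
    (E := fun x => (c.a x - c.a s) * c.T x r + c.a r * c.Y s x + c.ξ * (c.a r * c.a x))
    (E' := fun x => c.a₂ x * c.T x r + c.P₁ x * (c.a x - c.a s) * c.a x + c.ξ * (c.a r * c.a₂ x))
    (Ψ := fun x => c.a x / c.a r) (Ψ' := fun x => c.a₂ x / c.a r)
    h01 (by linarith [O0.st.mem_right.1, O1.st.mem_right.2]) hθ hθ1 hδ hM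
    (fun x hx => (((h.hA x (lt1 x hx)).const_mul (c.a r)).const_mul c.ξ).const_add _)
    (fun x hx => ?_) (fun x hx => (h.ha x (lt1 x hx)).div_const _)
    (fun x hx => ?_) (fun x hx => ?_) (fun x hx => h.size_pos₁ C (O x hx))
    (fun x hx => h.abs_jac_le₁ C (O x hx)) (fun x hx => ?_) (fun x hx => ?_) (fun x hx => ?_)
    (fun x hx => ?_) (fun x hx => ?_) (Or.inl fun x hx => ?_) (fun x hx => ?_) (fun x hx => ?_)
    (fun x hx => key x hx 1 1 1 (by simp) (by simp) (by simp))
    (fun x hx => key x hx (-1) 1 (-1) (by simp) (by simp) (by simp)) hg hg'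
  · exact (((((h.ha x (lt1 x hx)).sub_const _).mul (h.hasDerivAt_T_left (lt1 x hx) r)).add
      ((h.hasDerivAt_Y_right s (lt1 x hx)).const_mul _)).add
      (((h.ha x (lt1 x hx)).const_mul _).const_mul _)).congr_deriv (by ring)
  · have O := O x hx
    have Ax := h.A_ge x O.st.mem_right
    refine (h.abs_num₁_le (p := c.a r) (m := c.A x)
      (h.k_mul_S_mem O.k_nonneg O.ur.mem_left O.ur.mem_right O.ur.le) O.st.mem_right hs
      (h.W_bounds C hs hr hsr) le_rfl (h.A_mono hs O.st.mem_right O.st.le) h1 h2 h3).trans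
      (mul_le_mul_of_nonneg_left ?_ hδ)
    have i1 : c.ξ * (k * c.a r * c.a s) ≤ c.ξ * (c.a r * c.a s) := by
      rw [mul_assoc]
      exact mul_le_mul_of_nonneg_left (mul_le_of_le_one_left (by positivity) O.k_le) ξ0.le
    have i2 : 0 ≤ c.ξ * (c.a r * c.a s) := by positivity
    have i3 : 0 ≤ c.ξ * (c.a r * c.A x) := by positivity
    refine le_trans ?_ (mul_le_mul_of_nonneg_right C.le (by positivity))
    nlinarith [mul_nonneg (sub_nonneg.2 R1) W0, mul_nonneg (sub_nonneg.2 R1) i2,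
      mul_nonneg (sub_nonneg.2 R1) i3]
  · rw [abs_neg]; exact h.abs_numDeriv_le₁ C (O x hx) h1 h2
  · have Ax := h.A_ge x (O x hx).st.mem_right
    positivity
  · have O := O x hx
    obtain ⟨-, -, -, bW, bξ, -, -⟩ := h.size_bounds₁ C O
    have i1 := h.W_le_W_left hs O.st.mem_right hr O.st.le O.tr.le
    have i2 := h.a_le hs O.st.mem_right O.st.le
    have i3 := h.A_le x O.st.mem_right
    have i4 : c.ξ * (c.a r * c.a s) ≤ c.ξ * (c.a r * c.a x) := by gcongr
    have i5 : c.ξ * (c.a r * c.A x) ≤ 8 * (c.ξ * (c.a r * c.a x)) := by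
      calc _ ≤ c.ξ * (c.a r * (8 * c.a x)) := by gcongr
        _ = _ := by ring
    have := C.mul_le (h.size_pos₁ C O).le
    have := mul_pos C.R_pos (h.size_pos₁ C O)
    linarith
  · have O := O x hx
    have ax := h.a_pos O.st.mem_right
    have := h.Y_nonneg O.st.mem_left O.st.mem_right O.st.le
    have := h.T_nonneg O.tr.mem_left O.tr.mem_right O.tr.le
    have := sub_nonneg.2 (h.a_le O.st.mem_left O.st.mem_right O.st.le)
    positivity
  · have O := O x hx
    obtain ⟨-, -, -, -, bξ, bY, bT⟩ := h.size_bounds₁ C O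
    have := C.mul_le (h.size_pos₁ C O).le
    have := mul_pos C.R_pos (h.size_pos₁ C O)
    linarith
  · have O := O x hx
    have ax := h.a_pos O.st.mem_right
    have Ax := h.A_ge x O.st.mem_right
    have p0 := h.Y_nonneg O.st.mem_left O.st.mem_right O.st.le
    have p1 := h.T_nonneg O.tr.mem_left O.tr.mem_right O.tr.le
    have p2 := sub_nonneg.2 (h.a_le O.st.mem_left O.st.mem_right O.st.le)
    rw [abs_of_pos (by positivity)]
    have q : c.ξ * (c.a r * c.a x) ≤ (c.a x - c.a s) * c.T x r + c.a r * c.Y s x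
      + c.ξ * (c.a r * c.a x) + (c.W s r + c.ξ * (c.a r * c.a s) + c.ξ * (c.a r * c.A x)) := by
      have : 0 ≤ (c.a x - c.a s) * c.T x r + c.a r * c.Y s x
        + (c.W s r + c.ξ * (c.a r * c.a s) + c.ξ * (c.a r * c.A x)) := by positivity
      linarith
    exact q.trans (le_mul_of_one_le_left (le_trans (by positivity) q) hM)
  · obtain ⟨p1, p2, p3⟩ := hE'0 x hx
    linarith
  · have O := O x hx
    exact ⟨div_nonneg (h.a_pos O.st.mem_right).le ar.le, (div_le_one ar).2
      (h.a_le O.tr.mem_left O.tr.mem_right O.tr.le)⟩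
  · exact div_nonneg (h.a₂_pos (O x hx).st.mem_right).le ar.le

/-- An extreme time moves; the three contributions to the size vary in the same direction, so that
the size itself is monotone. -/
theorem lintegral_line₂_conf₁ (C : IsConst κ e R M) (h01 : x₀ ≤ x₁) (hθ : 0 < θ) (hθ1 : θ ≤ 1)
    (O : ∀ x ∈ Icc x₀ x₁, c.IsConf₁ e k u t x r)
    (h1 : |y.1| ≤ δ) (h2 : |y.2.1| ≤ δ) (h3 : |y.2.2| ≤ δ)
    (hg : ∀ x ∈ Icc x₀ x₁, ‖g x‖ ≤ M) (hg' : ∀ x ∈ Icc x₀ x₁, ‖g' x‖ ≤ M) :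
    ∫⁻ x in Icc x₀ x₁, ‖regQuotDeriv θ (c.num₂ k u y t x r) (c.numDeriv y t x r)
        (c.jac k u t x r) (c.size₂ 1 1 1 k u t x r) (c.size (-1) 1 (-1) k u t x r)
        (c.size₂ (-1) 1 (-1) k u t x r) (g x) (g' x)‖ₑ
      ≤ ENNReal.ofReal (300 * δ * θ⁻¹ ^ 4 * M ^ 6) := by
  have hδ : 0 ≤ δ := (abs_nonneg _).trans h1
  have O0 := O x₀ (left_mem_Icc.2 h01)
  have O1 := O x₁ (right_mem_Icc.2 h01)
  have R1 := C.one_le_R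
  have hM : 1 ≤ M := by linarith [C.le]
  have ξ0 := h.ξ_pos
  have ht := O0.st.mem_right
  have hr := O0.tr.mem_right
  have htr := O0.tr.le
  have at' := h.a_pos ht
  have ar := h.a_pos hr
  have W0 := h.W_nonneg ht hr htr
  have atr := h.a_le ht hr htr
  have lt1 : ∀ x ∈ Icc x₀ x₁, 1 < x := fun x hx => one_lt_of_mem_Icc (O x hx).st.mem_left
  have parts : ∀ x ∈ Icc x₀ x₁,
      0 ≤ c.a₂ x * ((c.f r - c.f t) - c.P x * (c.a r - c.a t)) ∧
      2 * c.ξ * (-c.a₂ x * c.S x t + (c.a r - c.a x) * (c.a x - c.a t)) ≤ 0 ∧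
      0 ≤ 2 * c.ξ * k * (c.a₂ x * c.S u r) := by
    intro x hx
    have O := O x hx
    have a2 := h.a₂_pos O.st.mem_left
    have hk := O.k_nonneg
    have i1 := h.a_le O.st.mem_left ht O.st.le
    have i2 := h.S_nonneg_of_le O.st.mem_left ht O.st.le
    have i3 := h.S_nonneg_of_le O.ur.mem_left hr O.ur.le
    have i4 : 0 ≤ (c.f r - c.f t) - c.P x * (c.a r - c.a t) := by
      have j1 := h.T_nonneg ht hr htr
      have j2 := mul_nonneg (sub_nonneg.2 (h.P_mono O.st.mem_left ht O.st.le)) (sub_nonneg.2 atr)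
      unfold T at j1; linarith
    have i5 : 0 ≤ (c.a r - c.a x) * (c.a t - c.a x) := mul_nonneg (by linarith) (by linarith)
    have i6 : 0 ≤ c.a₂ x * c.S x t := by positivity
    refine ⟨by positivity, ?_, by positivity⟩
    exact mul_nonpos_of_nonneg_of_nonpos (by positivity) (by linarith)
  refine lintegral_regQuotDeriv_le_of_monotone
    (n := fun _ => c.W t r + c.ξ * (c.a r * c.a t)) (n' := fun _ => 0)
    h01 (by linarith [O0.st.mem_left.1, O1.st.mem_left.2]) hθ hθ1 hδ hM
    (fun x _ => hasDerivAt_const x _)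
    (fun x hx => h.hasDerivAt_size₂ _ _ _ k u t (lt1 x hx) r)
    (fun x hx => ?_) (fun x hx => h.abs_numDeriv_le₁ C (O x hx) h1 h2)
    (fun x hx => h.size_pos₁ C (O x hx))
    (fun x hx => h.abs_jac_le₁ C (O x hx)) (fun x hx => ?_) (fun x hx => ?_) (fun x hx => ?_)
    (Or.inr fun x hx => ?_) (fun x hx => ?_) hg hg'
  · have O := O x hx
    have At := h.A_ge t ht
    refine (h.abs_num₂_le (m := 8 * c.a t)
      (h.k_mul_S_mem O.k_nonneg O.ur.mem_left O.ur.mem_right O.ur.le) O.k_le ht O.st.mem_left hr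
      (h.W_bounds C ht hr htr) (h.A_le t ht)
      ((h.A_mono O.st.mem_left ht O.st.le).trans (h.A_le t ht))
      ⟨h.S_nonneg_of_le O.st.mem_left ht O.st.le,
        (h.S_le_a O.st.mem_left ht O.st.le).trans (by linarith)⟩ h1 h2 h3).trans
      (mul_le_mul_of_nonneg_left ?_ hδ)
    have i1 : c.ξ * (c.a t * (8 * c.a t)) ≤ 8 * (c.ξ * (c.a r * c.a t)) := by
      calc c.ξ * (c.a t * (8 * c.a t)) = 8 * (c.ξ * (c.a t * c.a t)) := by ring
        _ ≤ _ := by gcongr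
    have i2 : 0 ≤ c.ξ * (c.a r * c.a t) := by positivity
    refine le_trans ?_ (mul_le_mul_of_nonneg_right C.le (by positivity))
    nlinarith [mul_nonneg (sub_nonneg.2 R1) W0, mul_nonneg (sub_nonneg.2 R1) i2]
  · positivity
  · obtain ⟨-, -, -, bW, bξ, -, -⟩ := h.size_bounds₁ C (O x hx)
    have := C.mul_le (h.size_pos₁ C (O x hx)).le
    have := mul_pos C.R_pos (h.size_pos₁ C (O x hx))
    linarith
  · rw [abs_zero]
    exact mul_nonneg (by linarith) (h.size_pos₁ C (O x hx)).le
  · obtain ⟨p1, p2, p3⟩ := parts x hx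
    unfold size₂; linarith
  · obtain ⟨p1, p2, p3⟩ := parts x hx
    unfold size₂
    rw [abs_of_nonpos (a := -1 * _ + _ + _) (by linarith)]
    exact abs_le.2 ⟨by linarith, by linarith⟩

/-- As `lintegral_line₂_conf₁`, with the other extreme time. -/
theorem lintegral_line₃_conf₁ (C : IsConst κ e R M) (h01 : x₀ ≤ x₁) (hθ : 0 < θ) (hθ1 : θ ≤ 1)
    (O : ∀ x ∈ Icc x₀ x₁, c.IsConf₁ e k u t s x)
    (h1 : |y.1| ≤ δ) (h2 : |y.2.1| ≤ δ) (h3 : |y.2.2| ≤ δ)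
    (hg : ∀ x ∈ Icc x₀ x₁, ‖g x‖ ≤ M) (hg' : ∀ x ∈ Icc x₀ x₁, ‖g' x‖ ≤ M) :
    ∫⁻ x in Icc x₀ x₁, ‖regQuotDeriv θ (c.num₃ y t s) 0
        (c.jac k u t s x) (c.size₃ 1 1 1 k u t s x) (c.size (-1) 1 (-1) k u t s x)
        (c.size₃ (-1) 1 (-1) k u t s x) (g x) (g' x)‖ₑ
      ≤ ENNReal.ofReal (300 * δ * θ⁻¹ ^ 4 * M ^ 6) := by
  have hδ : 0 ≤ δ := (abs_nonneg _).trans h1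
  have O0 := O x₀ (left_mem_Icc.2 h01)
  have O1 := O x₁ (right_mem_Icc.2 h01)
  have R1 := C.one_le_R
  have hM : 1 ≤ M := by linarith [C.le]
  have ξ0 := h.ξ_pos
  have ht := O0.st.mem_right
  have hs := O0.st.mem_left
  have hst := O0.st.le
  have at' := h.a_pos ht
  have at1 := h.a_ge t ht
  have as := h.a_pos hs
  have W0 := h.W_nonneg hs ht hst
  have ast := h.a_le hs ht hst
  have lt1 : ∀ x ∈ Icc x₀ x₁, 1 < x := fun x hx => one_lt_of_mem_Icc (O x hx).tr.mem_right
  have parts : ∀ x ∈ Icc x₀ x₁,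
      c.a₂ x * ((c.a s - c.a t) * c.P x - (c.f s - c.f t)) ≤ 0 ∧
      0 ≤ 2 * c.ξ * (c.a₂ x * c.S s t) ∧
      2 * c.ξ * k * ((c.a s - c.a t) * ((x - u) * c.a₂ x)) ≤ 0 := by
    intro x hx
    have O := O x hx
    have hx' := O.tr.mem_right
    have a2 := h.a₂_pos hx'
    have hk := O.k_nonneg
    have i2 := h.S_nonneg_of_le hs ht hst
    have i4 : (c.a s - c.a t) * c.P x - (c.f s - c.f t) ≤ 0 := by
      have j1 := h.Y_nonneg hs ht hst
      have j2 := mul_nonneg (sub_nonneg.2 (h.P_mono ht hx' O.tr.le)) (sub_nonneg.2 ast)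
      unfold Y at j1; linarith
    have i5 : 0 ≤ (x - u) * c.a₂ x := mul_nonneg (sub_nonneg.2 O.ur.le) a2.le
    exact ⟨mul_nonpos_of_nonneg_of_nonpos a2.le i4, by positivity,
      mul_nonpos_of_nonneg_of_nonpos (by positivity)
        (mul_nonpos_of_nonpos_of_nonneg (by linarith) i5)⟩
  refine lintegral_regQuotDeriv_le_of_monotone (N := fun _ => c.num₃ y t s) (N' := fun _ => 0)
    (n := fun _ => c.W s t + c.ξ * (c.a t * c.a t)) (n' := fun _ => 0)
    h01 (by linarith [O0.tr.mem_right.1, O1.tr.mem_right.2]) hθ hθ1 hδ hM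
    (fun x _ => hasDerivAt_const x _)
    (fun x hx => h.hasDerivAt_size₃ _ _ _ k u t s (lt1 x hx))
    (fun x hx => ?_) (fun x hx => ?_)
    (fun x hx => h.size_pos₁ C (O x hx))
    (fun x hx => h.abs_jac_le₁ C (O x hx)) (fun x hx => ?_) (fun x hx => ?_) (fun x hx => ?_)
    (Or.inl fun x hx => ?_) (fun x hx => ?_) hg hg'
  · have a1 := le_mul_of_one_le_left at'.le at1
    have bW := h.W_bounds' C hs ht hst
    refine (h.abs_num₃_le (m := 8 * c.a t) (p := c.a t * c.a t) ht hs
      ⟨bW.1, bW.2.1, bW.2.2.1, bW.2.2.2.trans a1⟩ (h.A_le t ht)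
      ((h.A_mono hs ht hst).trans (h.A_le t ht))
      ⟨h.S_nonneg_of_le hs ht hst, (h.S_le_a hs ht hst).trans (by linarith)⟩ h1 h2 h3).trans
      (mul_le_mul_of_nonneg_left ?_ hδ)
    have i1 : c.ξ * (c.a s * c.a t) ≤ c.ξ * (c.a t * c.a t) := by gcongr
    have i2 : 0 ≤ c.ξ * (c.a t * c.a t) := by positivity
    have i3 : c.ξ * (c.a t * (8 * c.a t)) = 8 * (c.ξ * (c.a t * c.a t)) := by ring
    rw [i3]
    refine le_trans ?_ (mul_le_mul_of_nonneg_right C.le (by positivity))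
    nlinarith [mul_nonneg (sub_nonneg.2 R1) W0, mul_nonneg (sub_nonneg.2 R1) i2]
  · rw [abs_zero]
    exact mul_nonneg hδ (mul_nonneg (by linarith) (h.size_pos₁ C (O x hx)).le)
  · positivity
  · have O := O x hx
    obtain ⟨-, -, -, bW, bξ, -, -⟩ := h.size_bounds₁ C O
    have i1 := h.W_le_W_right hs ht O.tr.mem_right hst O.tr.le
    have i2 := h.a_le ht O.tr.mem_right O.tr.le
    have i3 : c.ξ * (c.a t * c.a t) ≤ c.ξ * (c.a x * c.a t) := by gcongr
    have := C.mul_le (h.size_pos₁ C O).le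
    have := mul_pos C.R_pos (h.size_pos₁ C O)
    linarith
  · rw [abs_zero]
    exact mul_nonneg (by linarith) (h.size_pos₁ C (O x hx)).le
  · obtain ⟨p1, p2, p3⟩ := parts x hx
    unfold size₃; linarith
  · obtain ⟨p1, p2, p3⟩ := parts x hx
    unfold size₃
    rw [abs_of_nonneg (a := -1 * _ + _ + _) (by linarith)]
    exact abs_le.2 ⟨by linarith, by linarith⟩

end IsNormalized
end CurveData

/-! ### Line estimates in the order `t < s < r` -/

namespace CurveData.IsNormalized

variable {c : CurveData} {κ e R M k u t s r δ θ x₀ x₁ : ℝ} {y : ℝ × ℝ × ℝ} {g g' : ℝ → ℂ}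
  (h : c.IsNormalized κ)
include h

/-- The determinant without cancellation controls all the quantities in the numerators. -/
lemma size_bounds₂ (C : IsConst κ e R M) (O : c.IsConf₂ e k u t s r) :
    (0 ≤ c.det₀ t s r ∧ 0 ≤ c.det₂ t s r ∧ 0 ≤ c.det₃ k u t s r) ∧
    c.W s r ≤ R * c.size 1 1 1 k u t s r ∧
    c.ξ * (c.a r * c.A s) ≤ R * c.size 1 1 1 k u t s r ∧
    c.ξ * (c.a r * c.a t) ≤ R * c.size 1 1 1 k u t s r ∧
    c.ξ * (k * c.a r * c.a s) ≤ R * c.size 1 1 1 k u t s r ∧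
    c.a r * c.Y t s ≤ R * c.size 1 1 1 k u t s r ∧
    (c.a s - c.a t) * c.T s r ≤ R * c.size 1 1 1 k u t s r ∧
    2 * c.ξ * (c.a r * c.S s t) ≤ R * c.size 1 1 1 k u t s r := by
  have ξ0 := h.ξ_pos
  have ht := O.ts.mem_left
  have hs := O.ts.mem_right
  have hr := O.sr.mem_right
  have as := h.a_pos hs
  have at' := h.a_pos ht
  have ar := h.a_pos hr
  have As := h.A_ge s hs
  have e0 := C.e_pos
  have k0 := O.k_nonneg
  have Y0 := h.Y_nonneg ht hs O.ts.le
  have T0 := h.T_nonneg hs hr O.sr.le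
  have S0 := h.S_nonneg_of_ge ht hs O.ts.le
  have ats := h.a_le ht hs O.ts.le
  have d0 : c.det₀ t s r = c.J t s r := c.det₀_eq_J t s r
  have J0 : 0 ≤ c.det₀ t s r := by
    rw [d0]; exact h.J_nonneg ht hs hr O.ts.le O.sr.le
  have q1 : e * (2 * c.ξ * (c.a r * c.S s t)) ≤ c.det₂ t s r := by
    have i : 0 ≤ 2 * c.ξ * ((c.a r - c.a s - e * c.a r) * c.S s t) :=
      mul_nonneg (by positivity) (mul_nonneg (sub_nonneg.2 O.sr.a_sub) S0)
    unfold det₂; linarith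
  have q2 : e ^ 2 * (c.ξ * (c.a r * c.A s)) ≤ c.det₂ t s r := by
    refine le_trans ?_ q1
    have i : c.ξ * (c.a r * (e * c.A s)) ≤ c.ξ * (c.a r * c.S s t) := by
      have := O.ts.S_rev_ge
      gcongr
    have j : 0 ≤ e * (c.ξ * (c.a r * c.S s t)) := by positivity
    calc _ = e * (c.ξ * (c.a r * (e * c.A s))) := by ring
      _ ≤ e * (c.ξ * (c.a r * c.S s t)) := by gcongr
      _ ≤ _ := by linarith
  have q3 : e ^ 3 * (c.ξ * (c.a r * c.a t)) ≤ c.det₂ t s r := by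
    refine le_trans ?_ q2
    calc _ = e ^ 2 * (c.ξ * (c.a r * (e * c.a t))) := by ring
      _ ≤ _ := by gcongr; exact O.ts.a_le_A
  have q4 : e ^ 2 * (c.ξ * (k * c.a r * c.a s)) ≤ c.det₃ k u t s r := by
    have i := mul_le_mul O.ts.a_sub O.ur.S_ge (by positivity) (by linarith)
    have j : 0 ≤ c.ξ * k * ((c.a s - c.a t) * c.S u r - e * c.a s * (e * c.a r)) :=
      mul_nonneg (by positivity) (sub_nonneg.2 i)
    have l : 0 ≤ c.ξ * k * (e * c.a s * (e * c.a r)) := by positivity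
    unfold det₃; nlinarith
  have d2 : 0 ≤ c.det₂ t s r := le_trans (by positivity) q2
  have d3 : 0 ≤ c.det₃ k u t s r := le_trans (by positivity) q4
  have hS : c.size 1 1 1 k u t s r
      = c.det₀ t s r + c.det₂ t s r + c.det₃ k u t s r := by unfold size; ring
  have hJ : (c.a s - c.a t) * c.T s r + (c.a r - c.a s) * c.Y t s = c.det₀ t s r := by
    rw [d0]; rfl
  have n1 : 0 ≤ (c.a s - c.a t) * c.T s r := mul_nonneg (by linarith) T0
  have n2 : e * (c.a r * c.Y t s) ≤ (c.a r - c.a s) * c.Y t s := by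
    rw [← mul_assoc]; exact mul_le_mul_of_nonneg_right O.sr.a_sub Y0
  have n3 : 0 ≤ e * (c.a r * c.Y t s) := by positivity
  refine ⟨⟨J0, d2, d3⟩, C.le_of_sq (h.W_nonneg hs hr O.sr.le) ?_,
    C.le_of_sq (by positivity) (by linarith), C.le_of_cube (by positivity) (by linarith),
    C.le_of_sq (by positivity) (by linarith), C.le_of_self (by positivity) (by linarith),
    C.le_of_le n1 (by linarith), C.le_of_self (by positivity) (by linarith)⟩
  rw [hS, d0]; rw [d0] at J0; linarith [h.W_le_J e0 C.e_le_one O.ts O.sr]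

lemma size_pos₂ (C : IsConst κ e R M) (O : c.IsConf₂ e k u t s r) :
    0 < c.size 1 1 1 k u t s r := by
  have := (h.size_bounds₂ C O).2.2.2.1
  have h1 := mul_pos h.ξ_pos (mul_pos (h.a_pos O.sr.mem_right) (h.a_pos O.ts.mem_left))
  by_contra h2
  nlinarith [C.R_pos]

lemma abs_jac_le₂ (C : IsConst κ e R M) (O : c.IsConf₂ e k u t s r) :
    |c.jac k u t s r| ≤ c.size 1 1 1 k u t s r := by
  rw [jac_eq_size, abs_of_pos (h.size_pos₂ C O)]

lemma abs_numDeriv_le₂ (C : IsConst κ e R M) (O : c.IsConf₂ e k u t s r)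
    (h1 : |y.1| ≤ δ) (h2 : |y.2.1| ≤ δ) :
    |c.numDeriv y t s r| ≤ δ * (M * c.size 1 1 1 k u t s r) := by
  have b := (h.W_bounds C O.sr.mem_left O.sr.mem_right O.sr.le).2.2.2
  refine (h.abs_numDeriv_le O.ts.mem_left b h1 h2).trans
    (mul_le_mul_of_nonneg_left ?_ ((abs_nonneg _).trans h1))
  have i := (h.size_bounds₂ C O).2.2.2.1
  have j := C.mul_le (h.size_pos₂ C O).le
  have l := mul_pos C.R_pos (h.size_pos₂ C O)
  rw [mul_comm (c.a t)]
  linarith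

/-- An extreme time moves, and the size is monotone. -/
theorem lintegral_line₁_conf₂ (C : IsConst κ e R M) (h01 : x₀ ≤ x₁) (hθ : 0 < θ) (hθ1 : θ ≤ 1)
    (O : ∀ x ∈ Icc x₀ x₁, c.IsConf₂ e k u x s r)
    (h1 : |y.1| ≤ δ) (h2 : |y.2.1| ≤ δ) (h3 : |y.2.2| ≤ δ)
    (hg : ∀ x ∈ Icc x₀ x₁, ‖g x‖ ≤ M) (hg' : ∀ x ∈ Icc x₀ x₁, ‖g' x‖ ≤ M) :
    ∫⁻ x in Icc x₀ x₁, ‖regQuotDeriv θ (c.num₁ k u y x s r) (-c.numDeriv y x s r)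
        (c.jac k u x s r) (c.size₁ 1 1 1 k u x s r) (c.size 1 1 1 k u x s r)
        (c.size₁ 1 1 1 k u x s r) (g x) (g' x)‖ₑ
      ≤ ENNReal.ofReal (300 * δ * θ⁻¹ ^ 4 * M ^ 6) := by
  have hδ : 0 ≤ δ := (abs_nonneg _).trans h1
  have O0 := O x₀ (left_mem_Icc.2 h01)
  have O1 := O x₁ (right_mem_Icc.2 h01)
  have R1 := C.one_le_R
  have hM : 1 ≤ M := by linarith [C.le]
  have ξ0 := h.ξ_pos
  have hs := O0.sr.mem_left
  have hr := O0.sr.mem_right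
  have hsr := O0.sr.le
  have as := h.a_pos hs
  have ar := h.a_pos hr
  have As := h.A_ge s hs
  have k0 := O0.k_nonneg
  have W0 := h.W_nonneg hs hr hsr
  have asr := h.a_le hs hr hsr
  have lt1 : ∀ x ∈ Icc x₀ x₁, 1 < x := fun x hx => one_lt_of_mem_Icc (O x hx).ts.mem_left
  have n0 : 0 ≤ c.ξ * (k * c.a r * c.a s) := by positivity
  have n0' : 0 < c.ξ * (c.a r * c.A s) := by positivity
  refine lintegral_regQuotDeriv_le_of_monotone
    (n := fun _ => c.W s r + c.ξ * (k * c.a r * c.a s) + c.ξ * (c.a r * c.A s)) (n' := fun _ => 0)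
    h01 (by linarith [O0.ts.mem_left.1, O1.ts.mem_left.2]) hθ hθ1 hδ hM
    (fun x _ => hasDerivAt_const x _)
    (fun x hx => h.hasDerivAt_size₁ _ _ _ k u (lt1 x hx) s r)
    (fun x hx => ?_)
    (fun x hx => by rw [abs_neg]; exact h.abs_numDeriv_le₂ C (O x hx) h1 h2)
    (fun x hx => h.size_pos₂ C (O x hx))
    (fun x hx => h.abs_jac_le₂ C (O x hx)) (fun x hx => ?_) (fun x hx => ?_) (fun x hx => ?_)
    (Or.inr fun x hx => ?_) (fun _ _ => le_rfl) hg hg'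
  · have O := O x hx
    refine (h.abs_num₁_le (p := c.a r) (m := c.A s)
      (h.k_mul_S_mem O.k_nonneg O.ur.mem_left O.ur.mem_right O.ur.le) O.ts.mem_left hs
      (h.W_bounds C hs hr hsr) (h.A_mono O.ts.mem_left hs O.ts.le) le_rfl h1 h2 h3).trans
      (mul_le_mul_of_nonneg_left ?_ hδ)
    refine le_trans ?_ (mul_le_mul_of_nonneg_right C.le (by positivity))
    nlinarith [mul_nonneg (sub_nonneg.2 R1) W0, mul_nonneg (sub_nonneg.2 R1) n0,
      mul_nonneg (sub_nonneg.2 R1) n0'.le]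
  · positivity
  · have O := O x hx
    obtain ⟨-, bW, bA, -, bk, -⟩ := h.size_bounds₂ C O
    have := C.mul_le (h.size_pos₂ C O).le
    have := mul_pos C.R_pos (h.size_pos₂ C O)
    linarith
  · rw [abs_zero]
    exact mul_nonneg (by linarith) (h.size_pos₂ C (O x hx)).le
  · have O := O x hx
    have hx' := O.ts.mem_left
    have a2 := h.a₂_pos hx'
    have i3 := h.S_nonneg_of_le O.ur.mem_left hr O.ur.le
    have i1 : c.a₂ x * ((c.a r - c.a s) * c.P x - (c.f r - c.f s)) ≤ 0 := by
      refine mul_nonpos_of_nonneg_of_nonpos a2.le ?_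
      have j1 := h.T_nonneg hs hr hsr
      have j2 := mul_nonneg (sub_nonneg.2 (h.P_mono hx' hs O.ts.le)) (sub_nonneg.2 asr)
      unfold T at j1; linarith
    have i2 : 0 ≤ 2 * c.ξ * ((c.a r - c.a s) * ((s - x) * c.a₂ x)) :=
      mul_nonneg (by positivity) (mul_nonneg (sub_nonneg.2 asr)
        (mul_nonneg (sub_nonneg.2 O.ts.le) a2.le))
    have i4 : 0 ≤ 2 * c.ξ * k * (c.a₂ x * c.S u r) := by positivity
    unfold size₁; linarith

/-- The middle time moves, and a monotone function `E` dominated by the size replaces it, as in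
`lintegral_line₁_conf₁`. -/
theorem lintegral_line₂_conf₂ (C : IsConst κ e R M) (h01 : x₀ ≤ x₁) (hθ : 0 < θ) (hθ1 : θ ≤ 1)
    (O : ∀ x ∈ Icc x₀ x₁, c.IsConf₂ e k u t x r)
    (h1 : |y.1| ≤ δ) (h2 : |y.2.1| ≤ δ) (h3 : |y.2.2| ≤ δ)
    (hg : ∀ x ∈ Icc x₀ x₁, ‖g x‖ ≤ M) (hg' : ∀ x ∈ Icc x₀ x₁, ‖g' x‖ ≤ M) :
    ∫⁻ x in Icc x₀ x₁, ‖regQuotDeriv θ (c.num₂ k u y t x r) (c.numDeriv y t x r)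
        (c.jac k u t x r) (c.size₂ 1 1 1 k u t x r) (c.size 1 1 1 k u t x r)
        (c.size₂ 1 1 1 k u t x r) (g x) (g' x)‖ₑ
      ≤ ENNReal.ofReal (300 * δ * θ⁻¹ ^ 4 * M ^ 6) := by
  have hδ : 0 ≤ δ := (abs_nonneg _).trans h1
  have O0 := O x₀ (left_mem_Icc.2 h01)
  have O1 := O x₁ (right_mem_Icc.2 h01)
  have R1 := C.one_le_R
  have hM : 1 ≤ M := by linarith [C.le]
  have ξ0 := h.ξ_pos
  have ht := O0.ts.mem_left
  have hr := O0.sr.mem_right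
  have htr := O0.ts.le.trans O0.sr.le
  have at' := h.a_pos ht
  have ar := h.a_pos hr
  have k0 := O0.k_nonneg
  have W0 := h.W_nonneg ht hr htr
  have lt1 : ∀ x ∈ Icc x₀ x₁, 1 < x := fun x hx => one_lt_of_mem_Icc (O x hx).ts.mem_right
  have hE'0 : ∀ x ∈ Icc x₀ x₁, 0 ≤ c.a₂ x * c.T x r ∧ 0 ≤ c.P₁ x * (c.a x - c.a t) * c.a x ∧
      0 ≤ 2 * c.ξ * (c.a r * (c.a x - c.a t)) ∧ 0 ≤ c.ξ * (k * c.a r * c.a₂ x) := fun x hx => by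
    have O := O x hx
    have a2 := h.a₂_pos O.ts.mem_right
    have i := sub_nonneg.2 (h.a_le O.ts.mem_left O.ts.mem_right O.ts.le)
    exact ⟨mul_nonneg a2.le (h.T_nonneg O.sr.mem_left O.sr.mem_right O.sr.le),
      mul_nonneg (mul_nonneg (h.P₁_nonneg O.ts.mem_right) i) (h.a_pos O.ts.mem_right).le,
      by positivity, by positivity⟩
  -- the derivative of each of the contributions is controlled by that of `E` and of `Ψ`
  have key : ∀ x ∈ Icc x₀ x₁,
      |c.size₂ 1 1 1 k u t x r| ≤ M * (|c.a₂ x * c.T x r + c.P₁ x * (c.a x - c.a t) * c.a x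
        + 2 * c.ξ * (c.a r * (c.a x - c.a t)) + c.ξ * (k * c.a r * c.a₂ x)|
        + c.size 1 1 1 k u t x r * (c.a₂ x / c.a r)) := by
    intro x hx
    obtain ⟨p1, p2, p3, p4⟩ := hE'0 x hx
    have O := O x hx
    have a2 := h.a₂_pos O.ts.mem_right
    obtain ⟨-, -, -, -, -, bY, -, bS⟩ := h.size_bounds₂ C O
    have Y0 := h.Y_nonneg O.ts.mem_left O.ts.mem_right O.ts.le
    have Sx := h.S_nonneg_of_ge O.ts.mem_left O.ts.mem_right O.ts.le
    have axt := h.a_le O.ts.mem_left O.ts.mem_right O.ts.le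
    have axr := h.a_le O.sr.mem_left O.sr.mem_right O.sr.le
    have S0 := (h.size_pos₂ C O).le
    set Z := c.size 1 1 1 k u t x r * (c.a₂ x / c.a r) with hZ
    have Z0 : 0 ≤ Z := by positivity
    have j0 : |c.a₂ x * ((c.f r - c.f t) - c.P x * (c.a r - c.a t))|
        ≤ c.a₂ x * c.T x r + R * Z := by
      have e1 : c.a₂ x * ((c.f r - c.f t) - c.P x * (c.a r - c.a t))
          = c.a₂ x * c.T x r - c.a₂ x * c.Y t x := by unfold Y T; ring
      have e2 : c.a₂ x * c.Y t x ≤ R * Z := by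
        have : c.a₂ x * c.Y t x = (c.a r * c.Y t x) * (c.a₂ x / c.a r) := by field_simp
        rw [this, hZ, ← mul_assoc]
        exact mul_le_mul_of_nonneg_right bY (by positivity)
      have e3 : 0 ≤ c.a₂ x * c.Y t x := by positivity
      rw [e1]
      exact abs_le.2 ⟨by linarith, by linarith⟩
    have j2 : |2 * c.ξ * (-c.a₂ x * c.S x t + (c.a r - c.a x) * (c.a x - c.a t))|
        ≤ R * Z + 2 * c.ξ * (c.a r * (c.a x - c.a t)) := by
      have e1 : 2 * c.ξ * (c.a₂ x * c.S x t) ≤ R * Z := by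
        have : 2 * c.ξ * (c.a₂ x * c.S x t)
            = (2 * c.ξ * (c.a r * c.S x t)) * (c.a₂ x / c.a r) := by field_simp
        rw [this, hZ, ← mul_assoc R]
        exact mul_le_mul_of_nonneg_right bS (by positivity)
      have e2 : 2 * c.ξ * ((c.a r - c.a x) * (c.a x - c.a t))
          ≤ 2 * c.ξ * (c.a r * (c.a x - c.a t)) := by
        have := h.a_pos O.ts.mem_right
        have := sub_nonneg.2 axt
        gcongr; linarith
      have e3 : 0 ≤ 2 * c.ξ * (c.a₂ x * c.S x t) := by positivity
      have e4 : 0 ≤ 2 * c.ξ * ((c.a r - c.a x) * (c.a x - c.a t)) :=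
        mul_nonneg (by positivity) (mul_nonneg (by linarith) (by linarith))
      have e5 : 0 ≤ R * Z := mul_nonneg C.R_pos.le Z0
      exact abs_le.2 ⟨by linarith, by linarith⟩
    have j3 : |2 * c.ξ * k * (c.a₂ x * c.S u r)| ≤ 12 * (c.ξ * (k * c.a r * c.a₂ x)) := by
      have q := h.k_mul_S_mem O.k_nonneg O.ur.mem_left O.ur.mem_right O.ur.le
      have e1 : 2 * c.ξ * k * (c.a₂ x * c.S u r) = 2 * c.ξ * c.a₂ x * (k * c.S u r) := by ring
      rw [e1, abs_of_nonneg (mul_nonneg (by positivity) q.1)]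
      calc _ ≤ 2 * c.ξ * c.a₂ x * (6 * (k * c.a r)) :=
            mul_le_mul_of_nonneg_left q.2 (by positivity)
        _ = _ := by ring
    have tot : |c.size₂ 1 1 1 k u t x r|
        ≤ (c.a₂ x * c.T x r + R * Z) + (R * Z + 2 * c.ξ * (c.a r * (c.a x - c.a t)))
          + 12 * (c.ξ * (k * c.a r * c.a₂ x)) := by
      unfold size₂
      refine (abs_add_three _ _ _).trans ?_
      rw [one_mul, one_mul, one_mul]
      exact add_le_add (add_le_add j0 j2) j3
    refine tot.trans ?_
    rw [abs_of_nonneg (by linarith)]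
    refine le_trans ?_ (mul_le_mul_of_nonneg_right C.le (by linarith))
    nlinarith [mul_nonneg (sub_nonneg.2 R1) p1, mul_nonneg (sub_nonneg.2 R1) p2,
      mul_nonneg (sub_nonneg.2 R1) p3, mul_nonneg (sub_nonneg.2 R1) p4, mul_nonneg C.R_pos.le Z0]
  refine lintegral_regQuotDeriv_le
    (n := fun _ => c.W t r + c.ξ * (c.a r * c.a t)) (n' := fun _ => 0)
    (E := fun x => (c.a x - c.a t) * c.T x r + c.a r * c.Y t x + 2 * c.ξ * (c.a r * c.S x t)
      + c.ξ * (k * c.a r * c.a x))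
    (E' := fun x => c.a₂ x * c.T x r + c.P₁ x * (c.a x - c.a t) * c.a x
      + 2 * c.ξ * (c.a r * (c.a x - c.a t)) + c.ξ * (k * c.a r * c.a₂ x))
    (Ψ := fun x => c.a x / c.a r) (Ψ' := fun x => c.a₂ x / c.a r)
    h01 (by linarith [O0.ts.mem_right.1, O1.ts.mem_right.2]) hθ hθ1 hδ hM
    (fun x _ => hasDerivAt_const x _)
    (fun x hx => ?_) (fun x hx => (h.ha x (lt1 x hx)).div_const _)
    (fun x hx => ?_) (fun x hx => h.abs_numDeriv_le₂ C (O x hx) h1 h2)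
    (fun x hx => h.size_pos₂ C (O x hx))
    (fun x hx => h.abs_jac_le₂ C (O x hx)) (fun x hx => ?_) (fun x hx => ?_) (fun x hx => ?_)
    (fun x hx => ?_) (fun x hx => ?_) (Or.inl fun x hx => ?_) (fun x hx => ?_) (fun x hx => ?_)
    key key hg hg'
  · exact ((((((h.ha x (lt1 x hx)).sub_const _).mul (h.hasDerivAt_T_left (lt1 x hx) r)).add
      ((h.hasDerivAt_Y_right t (lt1 x hx)).const_mul _)).add
      (((h.hasDerivAt_S_left (lt1 x hx) t).const_mul _).const_mul _)).add
      (((h.ha x (lt1 x hx)).const_mul _).const_mul _)).congr_deriv (by ring)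
  · have O := O x hx
    have hx' := O.ts.mem_right
    have axr := h.a_le hx' hr O.sr.le
    have Sx := h.S_le_A ht O.ts.le
    refine (h.abs_num₂_le (m := 8 * c.a x)
      (h.k_mul_S_mem O.k_nonneg O.ur.mem_left O.ur.mem_right O.ur.le) O.k_le ht hx' hr
      (h.W_bounds C ht hr htr) ((h.A_mono ht hx' O.ts.le).trans (h.A_le x hx'))
      (h.A_le x hx') ⟨h.S_nonneg_of_ge ht hx' O.ts.le, Sx.trans (h.A_le x hx')⟩ h1 h2 h3).trans
      (mul_le_mul_of_nonneg_left ?_ hδ)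
    have i1 : c.ξ * (c.a t * (8 * c.a x)) ≤ 8 * (c.ξ * (c.a r * c.a t)) := by
      calc c.ξ * (c.a t * (8 * c.a x)) = 8 * (c.ξ * (c.a x * c.a t)) := by ring
        _ ≤ _ := by gcongr
    have i2 : 0 ≤ c.ξ * (c.a r * c.a t) := by positivity
    refine le_trans ?_ (mul_le_mul_of_nonneg_right C.le (by positivity))
    nlinarith [mul_nonneg (sub_nonneg.2 R1) W0, mul_nonneg (sub_nonneg.2 R1) i2]
  · positivity
  · have O := O x hx
    obtain ⟨-, bW, -, bξ, -⟩ := h.size_bounds₂ C O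
    have i1 := h.W_le_W_left ht O.ts.mem_right hr O.ts.le O.sr.le
    have := C.mul_le (h.size_pos₂ C O).le
    have := mul_pos C.R_pos (h.size_pos₂ C O)
    linarith
  · have O := O x hx
    have ax := h.a_pos O.ts.mem_right
    have := h.Y_nonneg O.ts.mem_left O.ts.mem_right O.ts.le
    have := h.T_nonneg O.sr.mem_left O.sr.mem_right O.sr.le
    have := h.S_nonneg_of_ge O.ts.mem_left O.ts.mem_right O.ts.le
    have := sub_nonneg.2 (h.a_le O.ts.mem_left O.ts.mem_right O.ts.le)
    positivity
  · have O := O x hx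
    obtain ⟨-, -, -, -, bk, bY, bT, bS⟩ := h.size_bounds₂ C O
    have := C.mul_le (h.size_pos₂ C O).le
    have := mul_pos C.R_pos (h.size_pos₂ C O)
    linarith
  · have O := O x hx
    have ax := h.a_pos O.ts.mem_right
    have := h.Y_nonneg O.ts.mem_left O.ts.mem_right O.ts.le
    have := h.T_nonneg O.sr.mem_left O.sr.mem_right O.sr.le
    have := h.S_nonneg_of_ge O.ts.mem_left O.ts.mem_right O.ts.le
    have := sub_nonneg.2 (h.a_le O.ts.mem_left O.ts.mem_right O.ts.le)
    rw [abs_zero]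
    positivity
  · obtain ⟨p1, p2, p3, p4⟩ := hE'0 x hx
    linarith
  · have O := O x hx
    exact ⟨div_nonneg (h.a_pos O.ts.mem_right).le ar.le, (div_le_one ar).2
      (h.a_le O.sr.mem_left O.sr.mem_right O.sr.le)⟩
  · exact div_nonneg (h.a₂_pos (O x hx).ts.mem_right).le ar.le

/-- An extreme time moves, and the size is monotone. -/
theorem lintegral_line₃_conf₂ (C : IsConst κ e R M) (h01 : x₀ ≤ x₁) (hθ : 0 < θ) (hθ1 : θ ≤ 1)
    (O : ∀ x ∈ Icc x₀ x₁, c.IsConf₂ e k u t s x)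
    (h1 : |y.1| ≤ δ) (h2 : |y.2.1| ≤ δ) (h3 : |y.2.2| ≤ δ)
    (hg : ∀ x ∈ Icc x₀ x₁, ‖g x‖ ≤ M) (hg' : ∀ x ∈ Icc x₀ x₁, ‖g' x‖ ≤ M) :
    ∫⁻ x in Icc x₀ x₁, ‖regQuotDeriv θ (c.num₃ y t s) 0
        (c.jac k u t s x) (c.size₃ 1 1 1 k u t s x) (c.size 1 1 1 k u t s x)
        (c.size₃ 1 1 1 k u t s x) (g x) (g' x)‖ₑ
      ≤ ENNReal.ofReal (300 * δ * θ⁻¹ ^ 4 * M ^ 6) := by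
  have hδ : 0 ≤ δ := (abs_nonneg _).trans h1
  have O0 := O x₀ (left_mem_Icc.2 h01)
  have O1 := O x₁ (right_mem_Icc.2 h01)
  have R1 := C.one_le_R
  have hM : 1 ≤ M := by linarith [C.le]
  have ξ0 := h.ξ_pos
  have ht := O0.ts.mem_left
  have hs := O0.ts.mem_right
  have hts := O0.ts.le
  have at' := h.a_pos ht
  have as1 := h.a_ge s hs
  have as := h.a_pos hs
  have As := h.A_ge s hs
  have W0 := h.W_nonneg ht hs hts
  have ats := h.a_le ht hs hts
  have lt1 : ∀ x ∈ Icc x₀ x₁, 1 < x := fun x hx => one_lt_of_mem_Icc (O x hx).sr.mem_right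
  refine lintegral_regQuotDeriv_le_of_monotone (N := fun _ => c.num₃ y t s) (N' := fun _ => 0)
    (n := fun _ => c.W t s + c.ξ * (c.a s * c.A s) + c.ξ * (c.a s * c.a t)) (n' := fun _ => 0)
    h01 (by linarith [O0.sr.mem_right.1, O1.sr.mem_right.2]) hθ hθ1 hδ hM
    (fun x _ => hasDerivAt_const x _)
    (fun x hx => h.hasDerivAt_size₃ _ _ _ k u t s (lt1 x hx))
    (fun x hx => ?_) (fun x hx => ?_)
    (fun x hx => h.size_pos₂ C (O x hx))
    (fun x hx => h.abs_jac_le₂ C (O x hx)) (fun x hx => ?_) (fun x hx => ?_) (fun x hx => ?_)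
    (Or.inl fun x hx => ?_) (fun _ _ => le_rfl) hg hg'
  · have bW := h.W_bounds C ht hs hts
    refine (h.abs_num₃_le (m := c.A s) (p := c.a s * c.A s) ht hs
      ⟨bW.1, bW.2.1, bW.2.2.1, bW.2.2.2.trans (le_mul_of_one_le_right as.le As)⟩
      (h.A_mono ht hs hts) le_rfl
      ⟨h.S_nonneg_of_ge ht hs hts, (h.S_le_A ht hts).trans (by nlinarith)⟩ h1 h2 h3).trans
      (mul_le_mul_of_nonneg_left ?_ hδ)
    have i1 : c.ξ * (c.a t * c.A s) ≤ c.ξ * (c.a s * c.A s) := by gcongr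
    have i2 : 0 ≤ c.ξ * (c.a s * c.A s) := by positivity
    have i3 : 0 ≤ c.ξ * (c.a s * c.a t) := by positivity
    refine le_trans ?_ (mul_le_mul_of_nonneg_right C.le (by positivity))
    nlinarith [mul_nonneg (sub_nonneg.2 R1) W0, mul_nonneg (sub_nonneg.2 R1) i2,
      mul_nonneg (sub_nonneg.2 R1) i3]
  · rw [abs_zero]
    exact mul_nonneg hδ (mul_nonneg (by linarith) (h.size_pos₂ C (O x hx)).le)
  · positivity
  · have O := O x hx
    obtain ⟨-, bW, bA, bξ, -⟩ := h.size_bounds₂ C O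
    have i1 := h.W_le_W_right ht hs O.sr.mem_right hts O.sr.le
    have i2 := h.a_le hs O.sr.mem_right O.sr.le
    have i3 : c.ξ * (c.a s * c.A s) ≤ c.ξ * (c.a x * c.A s) := by gcongr
    have i4 : c.ξ * (c.a s * c.a t) ≤ c.ξ * (c.a x * c.a t) := by gcongr
    have := C.mul_le (h.size_pos₂ C O).le
    have := mul_pos C.R_pos (h.size_pos₂ C O)
    linarith
  · rw [abs_zero]
    exact mul_nonneg (by linarith) (h.size_pos₂ C (O x hx)).le
  · have O := O x hx
    have hx' := O.sr.mem_right
    have a2 := h.a₂_pos hx'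
    have hk := O.k_nonneg
    have i2 := h.S_nonneg_of_ge ht hs hts
    have i4 : 0 ≤ c.a₂ x * ((c.a s - c.a t) * c.P x - (c.f s - c.f t)) := by
      refine mul_nonneg a2.le ?_
      have j1 := h.Y_nonneg ht hs hts
      have j2 := mul_nonneg (sub_nonneg.2 (h.P_mono hs hx' O.sr.le)) (sub_nonneg.2 ats)
      unfold Y at j1; linarith
    have i3 : 0 ≤ 2 * c.ξ * (c.a₂ x * c.S s t) := by positivity
    have i5 : 0 ≤ 2 * c.ξ * k * ((c.a s - c.a t) * ((x - u) * c.a₂ x)) :=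
      mul_nonneg (by positivity) (mul_nonneg (sub_nonneg.2 ats)
        (mul_nonneg (sub_nonneg.2 O.ur.le) a2.le))
    unfold size₃; linarith

end CurveData.IsNormalized

/-! ### Line estimates in the order `t < r < s` -/

namespace CurveData.IsNormalized

variable {c : CurveData} {κ e R M u t s r δ θ x₀ x₁ : ℝ} {y : ℝ × ℝ × ℝ} {g g' : ℝ → ℂ}
  (h : c.IsNormalized κ)
include h

/-- The determinant without cancellation controls all the quantities in the numerators. -/
lemma size_bounds₃ (C : IsConst κ e R M) (O : c.IsConf₃ e t s r) :
    (0 ≤ -c.det₀ t s r ∧ 0 ≤ -c.det₂ t s r) ∧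
    c.W r s ≤ R * c.size (-1) (-1) 1 0 u t s r ∧
    c.ξ * (c.a s * c.A s) ≤ R * c.size (-1) (-1) 1 0 u t s r ∧
    c.ξ * (c.a s * c.a t) ≤ R * c.size (-1) (-1) 1 0 u t s r ∧
    c.a s * c.Y t r ≤ R * c.size (-1) (-1) 1 0 u t s r ∧
    (c.a r - c.a t) * c.T r s ≤ R * c.size (-1) (-1) 1 0 u t s r ∧
    2 * c.ξ * (c.a s * c.S s t) ≤ R * c.size (-1) (-1) 1 0 u t s r := by
  have ξ0 := h.ξ_pos
  have ht := O.ts.mem_left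
  have hs := O.ts.mem_right
  have hr := O.tr.mem_right
  have as := h.a_pos hs
  have at' := h.a_pos ht
  have ar := h.a_pos hr
  have As := h.A_ge s hs
  have e0 := C.e_pos
  have Y0 := h.Y_nonneg ht hr O.tr.le
  have T0 := h.T_nonneg hr hs O.rs.le
  have S0 := h.S_nonneg_of_ge ht hs O.ts.le
  have atr := h.a_le ht hr O.tr.le
  have d0 : -c.det₀ t s r = c.J t r s := by rw [det₀_eq_neg_J', neg_neg]
  have J0 : 0 ≤ -c.det₀ t s r := by
    rw [d0]; exact h.J_nonneg ht hr hs O.tr.le O.rs.le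
  have q1 : e * (2 * c.ξ * (c.a s * c.S s t)) ≤ -c.det₂ t s r := by
    have i : 0 ≤ 2 * c.ξ * ((c.a s - c.a r - e * c.a s) * c.S s t) :=
      mul_nonneg (by positivity) (mul_nonneg (sub_nonneg.2 O.rs.a_sub) S0)
    unfold det₂; linarith
  have q2 : e ^ 2 * (c.ξ * (c.a s * c.A s)) ≤ -c.det₂ t s r := by
    refine le_trans ?_ q1
    have i : c.ξ * (c.a s * (e * c.A s)) ≤ c.ξ * (c.a s * c.S s t) := by
      have := O.ts.S_rev_ge
      gcongr
    have j : 0 ≤ e * (c.ξ * (c.a s * c.S s t)) := by positivity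
    calc _ = e * (c.ξ * (c.a s * (e * c.A s))) := by ring
      _ ≤ e * (c.ξ * (c.a s * c.S s t)) := by gcongr
      _ ≤ _ := by linarith
  have q3 : e ^ 3 * (c.ξ * (c.a s * c.a t)) ≤ -c.det₂ t s r := by
    refine le_trans ?_ q2
    calc _ = e ^ 2 * (c.ξ * (c.a s * (e * c.a t))) := by ring
      _ ≤ _ := by gcongr; exact O.ts.a_le_A
  have d2 : 0 ≤ -c.det₂ t s r := le_trans (by positivity) q2
  have hS : c.size (-1) (-1) 1 0 u t s r = -c.det₀ t s r + -c.det₂ t s r := by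
    unfold size det₃; ring
  have hJ : (c.a r - c.a t) * c.T r s + (c.a s - c.a r) * c.Y t r = -c.det₀ t s r := by
    rw [d0]; rfl
  have n1 : 0 ≤ (c.a r - c.a t) * c.T r s := mul_nonneg (by linarith) T0
  have n2 : e * (c.a s * c.Y t r) ≤ (c.a s - c.a r) * c.Y t r := by
    rw [← mul_assoc]; exact mul_le_mul_of_nonneg_right O.rs.a_sub Y0
  have n3 : 0 ≤ e * (c.a s * c.Y t r) := by positivity
  refine ⟨⟨J0, d2⟩, C.le_of_sq (h.W_nonneg hr hs O.rs.le) ?_,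
    C.le_of_sq (by positivity) (by linarith), C.le_of_cube (by positivity) (by linarith),
    C.le_of_self (by positivity) (by linarith),
    C.le_of_le n1 (by linarith), C.le_of_self (by positivity) (by linarith)⟩
  rw [hS, d0]; linarith [h.W_le_J e0 C.e_le_one O.tr O.rs]

lemma size_pos₃ (C : IsConst κ e R M) (O : c.IsConf₃ e t s r) :
    0 < c.size (-1) (-1) 1 0 u t s r := by
  have := (h.size_bounds₃ C O (u := u)).2.2.2.1
  have h1 := mul_pos h.ξ_pos (mul_pos (h.a_pos O.rs.mem_right) (h.a_pos O.ts.mem_left))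
  by_contra h2
  nlinarith [C.R_pos]

lemma abs_jac_le₃ (C : IsConst κ e R M) (O : c.IsConf₃ e t s r) :
    |c.jac 0 u t s r| ≤ c.size (-1) (-1) 1 0 u t s r := by
  obtain ⟨⟨d0, d2⟩, -⟩ := h.size_bounds₃ C O (u := u)
  have : c.det₃ 0 u t s r = 0 := by unfold det₃; ring
  unfold jac size
  exact abs_le.2 ⟨by linarith, by linarith⟩

lemma abs_numDeriv_le₃ (C : IsConst κ e R M) (O : c.IsConf₃ e t s r)
    (h1 : |y.1| ≤ δ) (h2 : |y.2.1| ≤ δ) :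
    |c.numDeriv y t s r| ≤ δ * (M * c.size (-1) (-1) 1 0 u t s r) := by
  have b := (h.W_bounds' C O.rs.mem_left O.rs.mem_right O.rs.le).2.2.2
  refine (h.abs_numDeriv_le O.ts.mem_left b h1 h2).trans
    (mul_le_mul_of_nonneg_left ?_ ((abs_nonneg _).trans h1))
  have i := (h.size_bounds₃ C O (u := u)).2.2.2.1
  have j := C.mul_le (h.size_pos₃ C O (u := u)).le
  have l := mul_pos C.R_pos (h.size_pos₃ C O (u := u))
  rw [mul_comm (c.a t)]
  linarith

/-- An extreme time moves, and the size is monotone. -/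
theorem lintegral_line₁_conf₃ (C : IsConst κ e R M) (h01 : x₀ ≤ x₁) (hθ : 0 < θ) (hθ1 : θ ≤ 1)
    (O : ∀ x ∈ Icc x₀ x₁, c.IsConf₃ e x s r)
    (h1 : |y.1| ≤ δ) (h2 : |y.2.1| ≤ δ) (h3 : |y.2.2| ≤ δ)
    (hg : ∀ x ∈ Icc x₀ x₁, ‖g x‖ ≤ M) (hg' : ∀ x ∈ Icc x₀ x₁, ‖g' x‖ ≤ M) :
    ∫⁻ x in Icc x₀ x₁, ‖regQuotDeriv θ (c.num₁ 0 u y x s r) (-c.numDeriv y x s r)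
        (c.jac 0 u x s r) (c.size₁ 1 1 1 0 u x s r) (c.size (-1) (-1) 1 0 u x s r)
        (c.size₁ (-1) (-1) 1 0 u x s r) (g x) (g' x)‖ₑ
      ≤ ENNReal.ofReal (300 * δ * θ⁻¹ ^ 4 * M ^ 6) := by
  have hδ : 0 ≤ δ := (abs_nonneg _).trans h1
  have O0 := O x₀ (left_mem_Icc.2 h01)
  have O1 := O x₁ (right_mem_Icc.2 h01)
  have R1 := C.one_le_R
  have hM : 1 ≤ M := by linarith [C.le]
  have ξ0 := h.ξ_pos
  have hs := O0.rs.mem_right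
  have hr := O0.rs.mem_left
  have hrs := O0.rs.le
  have as := h.a_pos hs
  have ar := h.a_pos hr
  have As := h.A_ge s hs
  have W0 := h.W_nonneg hr hs hrs
  have ars := h.a_le hr hs hrs
  have lt1 : ∀ x ∈ Icc x₀ x₁, 1 < x := fun x hx => one_lt_of_mem_Icc (O x hx).ts.mem_left
  have n0' : 0 < c.ξ * (c.a s * c.A s) := by positivity
  refine lintegral_regQuotDeriv_le_of_monotone
    (n := fun _ => c.W r s + c.ξ * (c.a s * c.A s)) (n' := fun _ => 0)
    h01 (by linarith [O0.ts.mem_left.1, O1.ts.mem_left.2]) hθ hθ1 hδ hM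
    (fun x _ => hasDerivAt_const x _)
    (fun x hx => h.hasDerivAt_size₁ _ _ _ 0 u (lt1 x hx) s r)
    (fun x hx => ?_)
    (fun x hx => by rw [abs_neg]; exact h.abs_numDeriv_le₃ C (O x hx) h1 h2)
    (fun x hx => h.size_pos₃ C (O x hx))
    (fun x hx => h.abs_jac_le₃ C (O x hx)) (fun x hx => ?_) (fun x hx => ?_) (fun x hx => ?_)
    (Or.inr fun x hx => ?_) (fun x hx => ?_) hg hg'
  · have O := O x hx
    refine (h.abs_num₁_le (p := c.a s) (m := c.A s)
      (by simp) O.ts.mem_left hs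
      (h.W_bounds' C hr hs hrs) (h.A_mono O.ts.mem_left hs O.ts.le) le_rfl h1 h2 h3).trans
      (mul_le_mul_of_nonneg_left ?_ hδ)
    refine le_trans ?_ (mul_le_mul_of_nonneg_right C.le (by positivity))
    rw [zero_mul, zero_mul, mul_zero, mul_zero]
    nlinarith [mul_nonneg (sub_nonneg.2 R1) W0, mul_nonneg (sub_nonneg.2 R1) n0'.le]
  · positivity
  · have O := O x hx
    obtain ⟨-, bW, bA, -⟩ := h.size_bounds₃ C O (u := u)
    have := C.mul_le (h.size_pos₃ C O (u := u)).le
    have := mul_pos C.R_pos (h.size_pos₃ C O (u := u))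
    linarith
  · rw [abs_zero]
    exact mul_nonneg (by linarith) (h.size_pos₃ C (O x hx)).le
  all_goals
    have O := O x hx
    have hx' := O.ts.mem_left
    have a2 := h.a₂_pos hx'
    have i1 : 0 ≤ c.a₂ x * ((c.a r - c.a s) * c.P x - (c.f r - c.f s)) := by
      refine mul_nonneg a2.le ?_
      have j1 := h.T_nonneg hr hs hrs
      have j2 := mul_nonneg (sub_nonneg.2 (h.P_mono hx' hr O.tr.le)) (sub_nonneg.2 ars)
      unfold T at j1; linarith
    have i2 : 0 ≤ 2 * c.ξ * ((c.a s - c.a r) * ((s - x) * c.a₂ x)) :=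
      mul_nonneg (by positivity) (mul_nonneg (sub_nonneg.2 ars)
        (mul_nonneg (sub_nonneg.2 O.ts.le) a2.le))
    unfold size₁
  · linarith
  · rw [abs_of_nonpos (a := -1 * _ + _ + _) (by linarith)]
    exact abs_le.2 ⟨by linarith, by linarith⟩

/-- An extreme time moves, and the size is monotone; here the bound of the numerator varies too. -/
theorem lintegral_line₂_conf₃ (C : IsConst κ e R M) (h01 : x₀ ≤ x₁) (hθ : 0 < θ) (hθ1 : θ ≤ 1)
    (O : ∀ x ∈ Icc x₀ x₁, c.IsConf₃ e t x r)
    (h1 : |y.1| ≤ δ) (h2 : |y.2.1| ≤ δ) (h3 : |y.2.2| ≤ δ)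
    (hg : ∀ x ∈ Icc x₀ x₁, ‖g x‖ ≤ M) (hg' : ∀ x ∈ Icc x₀ x₁, ‖g' x‖ ≤ M) :
    ∫⁻ x in Icc x₀ x₁, ‖regQuotDeriv θ (c.num₂ 0 u y t x r) (c.numDeriv y t x r)
        (c.jac 0 u t x r) (c.size₂ 1 1 1 0 u t x r) (c.size (-1) (-1) 1 0 u t x r)
        (c.size₂ (-1) (-1) 1 0 u t x r) (g x) (g' x)‖ₑ
      ≤ ENNReal.ofReal (300 * δ * θ⁻¹ ^ 4 * M ^ 6) := by
  have hδ : 0 ≤ δ := (abs_nonneg _).trans h1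
  have O0 := O x₀ (left_mem_Icc.2 h01)
  have O1 := O x₁ (right_mem_Icc.2 h01)
  have R1 := C.one_le_R
  have hM : 1 ≤ M := by linarith [C.le]
  have ξ0 := h.ξ_pos
  have ht := O0.tr.mem_left
  have hr := O0.tr.mem_right
  have htr := O0.tr.le
  have at' := h.a_pos ht
  have at1 := h.a_ge t ht
  have ar := h.a_pos hr
  have W0 := h.W_nonneg ht hr htr
  have atr := h.a_le ht hr htr
  have lt1 : ∀ x ∈ Icc x₀ x₁, 1 < x := fun x hx => one_lt_of_mem_Icc (O x hx).ts.mem_right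
  refine lintegral_regQuotDeriv_le_of_monotone
    (n := fun x => c.W t r + c.ξ * (c.a r * c.a t) + c.ξ * (c.a t * c.A x))
    (n' := fun x => c.ξ * (c.a t * c.a x))
    h01 (by linarith [O0.ts.mem_right.1, O1.ts.mem_right.2]) hθ hθ1 hδ hM
    (fun x hx => (((h.hA x (lt1 x hx)).const_mul _).const_mul _).const_add _)
    (fun x hx => h.hasDerivAt_size₂ _ _ _ 0 u t (lt1 x hx) r)
    (fun x hx => ?_) (fun x hx => h.abs_numDeriv_le₃ C (O x hx) h1 h2)
    (fun x hx => h.size_pos₃ C (O x hx))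
    (fun x hx => h.abs_jac_le₃ C (O x hx)) (fun x hx => ?_) (fun x hx => ?_) (fun x hx => ?_)
    (Or.inl fun x hx => ?_) (fun x hx => ?_) hg hg'
  · have O := O x hx
    have hx' := O.ts.mem_right
    have Ax := h.A_ge x hx'
    refine (h.abs_num₂_le (m := c.A x)
      (by simp) zero_le_one ht hx' hr
      (h.W_bounds C ht hr htr) (h.A_mono ht hx' O.ts.le) le_rfl
      ⟨h.S_nonneg_of_ge ht hx' O.ts.le, h.S_le_A ht O.ts.le⟩ h1 h2 h3).trans
      (mul_le_mul_of_nonneg_left ?_ hδ)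
    have i2 : 0 ≤ c.ξ * (c.a r * c.a t) := by positivity
    have i3 : 0 ≤ c.ξ * (c.a t * c.A x) := by positivity
    refine le_trans ?_ (mul_le_mul_of_nonneg_right C.le (by positivity))
    nlinarith [mul_nonneg (sub_nonneg.2 R1) W0, mul_nonneg (sub_nonneg.2 R1) i2,
      mul_nonneg (sub_nonneg.2 R1) i3]
  · have Ax := h.A_ge x (O x hx).ts.mem_right
    positivity
  · have O := O x hx
    have hx' := O.ts.mem_right
    have Ax := h.A_ge x hx'
    obtain ⟨-, bW, bA, bξ, -⟩ := h.size_bounds₃ C O (u := u)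
    have i1 := h.W_le_W_right ht hr hx' htr O.rs.le
    have i2 := h.a_le hr hx' O.rs.le
    have i3 := h.a_le ht hx' O.ts.le
    have i4 : c.ξ * (c.a r * c.a t) ≤ c.ξ * (c.a x * c.a t) := by gcongr
    have i5 : c.ξ * (c.a t * c.A x) ≤ c.ξ * (c.a x * c.A x) := by gcongr
    have := C.mul_le (h.size_pos₃ C O (u := u)).le
    have := mul_pos C.R_pos (h.size_pos₃ C O (u := u))
    linarith
  · have O := O x hx
    have ax := h.a_pos O.ts.mem_right
    obtain ⟨-, -, -, bξ, -⟩ := h.size_bounds₃ C O (u := u)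
    rw [abs_of_pos (by positivity), mul_comm (c.a t)]
    have := C.mul_le (h.size_pos₃ C O (u := u)).le
    have := mul_pos C.R_pos (h.size_pos₃ C O (u := u))
    linarith
  all_goals
    have O := O x hx
    have hx' := O.ts.mem_right
    have a2 := h.a₂_pos hx'
    have Sx := h.S_nonneg_of_ge ht hx' O.ts.le
    have i1 : 0 ≤ c.a₂ x * (c.P x * (c.a r - c.a t) - (c.f r - c.f t)) := by
      refine mul_nonneg a2.le ?_
      have j1 := h.Y_nonneg ht hr htr
      have j2 := mul_nonneg (sub_nonneg.2 (h.P_mono hr hx' O.rs.le)) (sub_nonneg.2 atr)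
      unfold Y at j1; linarith
    have i2 : 0 ≤ 2 * c.ξ * (c.a₂ x * c.S x t + (c.a x - c.a r) * (c.a x - c.a t)) := by
      have := mul_nonneg (sub_nonneg.2 (h.a_le hr hx' O.rs.le))
        (sub_nonneg.2 (h.a_le ht hx' O.ts.le))
      positivity
    unfold size₂
  · linarith
  · rw [abs_of_nonneg (a := -1 * _ + _ + _) (by linarith)]
    exact abs_le.2 ⟨by linarith, by linarith⟩

/-- The middle time moves, and a monotone function `E` dominated by the size replaces it, as in
`lintegral_line₁_conf₁`. -/
theorem lintegral_line₃_conf₃ (C : IsConst κ e R M) (h01 : x₀ ≤ x₁) (hθ : 0 < θ) (hθ1 : θ ≤ 1)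
    (O : ∀ x ∈ Icc x₀ x₁, c.IsConf₃ e t s x)
    (h1 : |y.1| ≤ δ) (h2 : |y.2.1| ≤ δ) (h3 : |y.2.2| ≤ δ)
    (hg : ∀ x ∈ Icc x₀ x₁, ‖g x‖ ≤ M) (hg' : ∀ x ∈ Icc x₀ x₁, ‖g' x‖ ≤ M) :
    ∫⁻ x in Icc x₀ x₁, ‖regQuotDeriv θ (c.num₃ y t s) 0
        (c.jac 0 u t s x) (c.size₃ 1 1 1 0 u t s x) (c.size (-1) (-1) 1 0 u t s x)
        (c.size₃ (-1) (-1) 1 0 u t s x) (g x) (g' x)‖ₑ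
      ≤ ENNReal.ofReal (300 * δ * θ⁻¹ ^ 4 * M ^ 6) := by
  have hδ : 0 ≤ δ := (abs_nonneg _).trans h1
  have O0 := O x₀ (left_mem_Icc.2 h01)
  have O1 := O x₁ (right_mem_Icc.2 h01)
  have R1 := C.one_le_R
  have hM : 1 ≤ M := by linarith [C.le]
  have ξ0 := h.ξ_pos
  have ht := O0.ts.mem_left
  have hs := O0.ts.mem_right
  have hts := O0.ts.le
  have at' := h.a_pos ht
  have as1 := h.a_ge s hs
  have as := h.a_pos hs
  have As := h.A_ge s hs
  have W0 := h.W_nonneg ht hs hts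
  have ats := h.a_le ht hs hts
  have S0 := h.S_nonneg_of_ge ht hs hts
  have lt1 : ∀ x ∈ Icc x₀ x₁, 1 < x := fun x hx => one_lt_of_mem_Icc (O x hx).tr.mem_right
  have hE'0 : ∀ x ∈ Icc x₀ x₁, 0 ≤ c.a₂ x * c.T x s ∧ 0 ≤ c.P₁ x * (c.a x - c.a t) * c.a x :=
    fun x hx => by
      have O := O x hx
      exact ⟨mul_nonneg (h.a₂_pos O.tr.mem_right).le (h.T_nonneg O.tr.mem_right hs O.rs.le),
        mul_nonneg (mul_nonneg (h.P₁_nonneg O.tr.mem_right)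
          (sub_nonneg.2 (h.a_le ht O.tr.mem_right O.tr.le))) (h.a_pos O.tr.mem_right).le⟩
  -- the derivative of each of the contributions is controlled by that of `E` and of `Ψ`
  have key : ∀ x ∈ Icc x₀ x₁, ∀ σ₀ σ₂ : ℝ, |σ₀| = 1 → |σ₂| = 1 →
      |c.size₃ σ₀ σ₂ 1 0 u t s x| ≤ M * (|c.a₂ x * c.T x s + c.P₁ x * (c.a x - c.a t) * c.a x|
        + c.size (-1) (-1) 1 0 u t s x * (c.a₂ x / c.a s)) := by
    intro x hx σ₀ σ₂ hσ₀ hσ₂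
    obtain ⟨p1, p2⟩ := hE'0 x hx
    have O := O x hx
    have a2 := h.a₂_pos O.tr.mem_right
    obtain ⟨-, -, -, -, bY, -, bS⟩ := h.size_bounds₃ C O (u := u)
    have Y0 := h.Y_nonneg ht O.tr.mem_right O.tr.le
    have S0' := (h.size_pos₃ C O (u := u)).le
    set Z := c.size (-1) (-1) 1 0 u t s x * (c.a₂ x / c.a s) with hZ
    have Z0 : 0 ≤ Z := by positivity
    have j0 : |c.a₂ x * ((c.a s - c.a t) * c.P x - (c.f s - c.f t))|
        ≤ c.a₂ x * c.T x s + R * Z := by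
      have e1 : c.a₂ x * ((c.a s - c.a t) * c.P x - (c.f s - c.f t))
          = c.a₂ x * c.Y t x - c.a₂ x * c.T x s := by unfold Y T; ring
      have e2 : c.a₂ x * c.Y t x ≤ R * Z := by
        have : c.a₂ x * c.Y t x = (c.a s * c.Y t x) * (c.a₂ x / c.a s) := by field_simp
        rw [this, hZ, ← mul_assoc R]
        exact mul_le_mul_of_nonneg_right bY (by positivity)
      have e3 : 0 ≤ c.a₂ x * c.Y t x := by positivity
      rw [e1]
      exact abs_le.2 ⟨by linarith, by linarith⟩
    have j2 : |2 * c.ξ * (c.a₂ x * c.S s t)| ≤ R * Z := by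
      have : 2 * c.ξ * (c.a₂ x * c.S s t)
          = (2 * c.ξ * (c.a s * c.S s t)) * (c.a₂ x / c.a s) := by field_simp
      rw [abs_of_nonneg (by positivity), this, hZ, ← mul_assoc R]
      exact mul_le_mul_of_nonneg_right bS (by positivity)
    have tot : |c.size₃ σ₀ σ₂ 1 0 u t s x| ≤ (c.a₂ x * c.T x s + R * Z) + R * Z := by
      unfold size₃
      rw [mul_zero, zero_mul, mul_zero, add_zero]
      refine (abs_add_le _ _).trans ?_
      rw [abs_mul σ₀, abs_mul σ₂, hσ₀, hσ₂, one_mul, one_mul]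
      exact add_le_add j0 j2
    refine tot.trans ?_
    rw [abs_of_nonneg (by linarith)]
    refine le_trans ?_ (mul_le_mul_of_nonneg_right C.le (by linarith))
    nlinarith [mul_nonneg (sub_nonneg.2 R1) p1, mul_nonneg (sub_nonneg.2 R1) p2,
      mul_nonneg C.R_pos.le Z0]
  refine lintegral_regQuotDeriv_le (N := fun _ => c.num₃ y t s) (N' := fun _ => 0)
    (n := fun _ => c.W t s + c.ξ * (c.a s * c.A s) + c.ξ * (c.a s * c.a t)) (n' := fun _ => 0)
    (E := fun x => (c.a x - c.a t) * c.T x s + c.a s * c.Y t x)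
    (E' := fun x => c.a₂ x * c.T x s + c.P₁ x * (c.a x - c.a t) * c.a x)
    (Ψ := fun x => c.a x / c.a s) (Ψ' := fun x => c.a₂ x / c.a s)
    h01 (by linarith [O0.tr.mem_right.1, O1.tr.mem_right.2]) hθ hθ1 hδ hM
    (fun x _ => hasDerivAt_const x _)
    (fun x hx => ?_) (fun x hx => (h.ha x (lt1 x hx)).div_const _)
    (fun x hx => ?_) (fun x hx => ?_)
    (fun x hx => h.size_pos₃ C (O x hx))
    (fun x hx => h.abs_jac_le₃ C (O x hx)) (fun x hx => ?_) (fun x hx => ?_) (fun x hx => ?_)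
    (fun x hx => ?_) (fun x hx => ?_) (Or.inl fun x hx => ?_) (fun x hx => ?_) (fun x hx => ?_)
    (fun x hx => key x hx 1 1 (by simp) (by simp))
    (fun x hx => key x hx (-1) (-1) (by simp) (by simp)) hg hg'
  · exact ((((h.ha x (lt1 x hx)).sub_const _).mul (h.hasDerivAt_T_left (lt1 x hx) s)).add
      ((h.hasDerivAt_Y_right t (lt1 x hx)).const_mul _)).congr_deriv (by ring)
  · have bW := h.W_bounds C ht hs hts
    refine (h.abs_num₃_le (m := c.A s) (p := c.a s * c.A s) ht hs
      ⟨bW.1, bW.2.1, bW.2.2.1, bW.2.2.2.trans (le_mul_of_one_le_right as.le As)⟩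
      (h.A_mono ht hs hts) le_rfl
      ⟨S0, (h.S_le_A ht hts).trans (by nlinarith)⟩ h1 h2 h3).trans
      (mul_le_mul_of_nonneg_left ?_ hδ)
    have i1 : c.ξ * (c.a t * c.A s) ≤ c.ξ * (c.a s * c.A s) := by gcongr
    have i2 : 0 ≤ c.ξ * (c.a s * c.A s) := by positivity
    have i3 : 0 ≤ c.ξ * (c.a s * c.a t) := by positivity
    refine le_trans ?_ (mul_le_mul_of_nonneg_right C.le (by positivity))
    nlinarith [mul_nonneg (sub_nonneg.2 R1) W0, mul_nonneg (sub_nonneg.2 R1) i2,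
      mul_nonneg (sub_nonneg.2 R1) i3]
  · rw [abs_zero]
    exact mul_nonneg hδ (mul_nonneg (by linarith) (h.size_pos₃ C (O x hx)).le)
  · positivity
  · have O := O x hx
    obtain ⟨-, bW, bA, bξ, -⟩ := h.size_bounds₃ C O (u := u)
    have i1 := h.W_le_W_left ht O.tr.mem_right hs O.tr.le O.rs.le
    have := C.mul_le (h.size_pos₃ C O (u := u)).le
    have := mul_pos C.R_pos (h.size_pos₃ C O (u := u))
    linarith
  · have O := O x hx
    have := h.Y_nonneg ht O.tr.mem_right O.tr.le
    have := h.T_nonneg O.tr.mem_right hs O.rs.le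
    have := sub_nonneg.2 (h.a_le ht O.tr.mem_right O.tr.le)
    positivity
  · have O := O x hx
    obtain ⟨-, -, -, -, bY, bT, -⟩ := h.size_bounds₃ C O (u := u)
    have := C.mul_le (h.size_pos₃ C O (u := u)).le
    have := mul_pos C.R_pos (h.size_pos₃ C O (u := u))
    linarith
  · have O := O x hx
    have := h.Y_nonneg ht O.tr.mem_right O.tr.le
    have := h.T_nonneg O.tr.mem_right hs O.rs.le
    have := sub_nonneg.2 (h.a_le ht O.tr.mem_right O.tr.le)
    rw [abs_zero]
    positivity
  · obtain ⟨p1, p2⟩ := hE'0 x hx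
    linarith
  · have O := O x hx
    exact ⟨div_nonneg (h.a_pos O.tr.mem_right).le as.le, (div_le_one as).2
      (h.a_le O.tr.mem_right hs O.rs.le)⟩
  · exact div_nonneg (h.a₂_pos (O x hx).tr.mem_right).le as.le

end CurveData.IsNormalized

/-! ### From lines to three variables -/

section Slices

/-- A compact convex set on a line is an interval. -/
lemma lintegral_enorm_le_of_convex {q : ℝ → ℂ} {D : Set ℝ} {B : ENNReal} (hD : IsCompact D)
    (hDc : Convex ℝ D) (hq : ∀ x ∉ D, q x = 0)
    (hB : ∀ x₀ x₁, x₀ ≤ x₁ → Icc x₀ x₁ ⊆ D → ∫⁻ x in Icc x₀ x₁, ‖q x‖ₑ ≤ B) :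
    ∫⁻ x, ‖q x‖ₑ ≤ B := by
  rcases D.eq_empty_or_nonempty with hE | hE
  · have : ∀ x, q x = 0 := fun x => hq x (by simp [hE])
    simp [this]
  · have hI := eq_Icc_of_connected_compact ⟨hE, hDc.isPreconnected⟩ hD
    have h01 : sInf D ≤ sSup D := by
      rw [hI] at hE; exact nonempty_Icc.1 hE
    rw [← setLIntegral_eq_of_support_subset (s := D) fun x hx => ?_]
    · conv_lhs => rw [hI]
      exact hB _ _ h01 hI.symm.subset
    · by_contra h
      simp [hq x h] at hx

variable {q : ℝ × ℝ × ℝ → ℂ} {D : Set (ℝ × ℝ × ℝ)} {B : ENNReal}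

lemma convex_preimage_ins₁ (hD : Convex ℝ D) (s r : ℝ) :
    Convex ℝ ((fun x => ((x, s, r) : ℝ × ℝ × ℝ)) ⁻¹' D) := by
  intro x hx y hy a b ha hb hab
  have := hD hx hy ha hb hab
  simpa [← add_mul, hab] using this

lemma convex_preimage_ins₂ (hD : Convex ℝ D) (t r : ℝ) :
    Convex ℝ ((fun x => ((t, x, r) : ℝ × ℝ × ℝ)) ⁻¹' D) := by
  intro x hx y hy a b ha hb hab
  have := hD hx hy ha hb hab
  simpa [← add_mul, hab] using this

lemma convex_preimage_ins₃ (hD : Convex ℝ D) (t s : ℝ) :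
    Convex ℝ ((fun x => ((t, s, x) : ℝ × ℝ × ℝ)) ⁻¹' D) := by
  intro x hx y hy a b ha hb hab
  have := hD hx hy ha hb hab
  simpa [← add_mul, hab] using this

lemma lintegral_le_of_le_indicator {f : ℝ × ℝ → ENNReal}
    (h : ∀ p, f p ≤ (Icc (2 : ℝ) 8 ×ˢ Icc (2 : ℝ) 8).indicator (fun _ => B) p) :
    ∫⁻ p, f p ≤ 36 * B := by
  refine (lintegral_mono h).trans ?_
  rw [lintegral_indicator (measurableSet_Icc.prod measurableSet_Icc), setLIntegral_const,
    Measure.volume_eq_prod, Measure.prod_prod, Real.volume_Icc, mul_comm,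
    ← ENNReal.ofReal_mul (by norm_num)]
  norm_num

variable (hq : Continuous q) (hD : IsCompact D) (hDc : Convex ℝ D)
  (hD8 : D ⊆ Icc (2 : ℝ) 8 ×ˢ Icc (2 : ℝ) 8 ×ˢ Icc (2 : ℝ) 8) (h0 : ∀ τ ∉ D, q τ = 0)
include hq hD hDc hD8 h0

/-- A uniform bound on the lines parallel to an axis is integrated over the other two times, which
range over a set of area `36`. -/
lemma lintegral_le_of_slice₁
    (hB : ∀ s r x₀ x₁, x₀ ≤ x₁ → (∀ x ∈ Icc x₀ x₁, (x, s, r) ∈ D) →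
      ∫⁻ x in Icc x₀ x₁, ‖q (x, s, r)‖ₑ ≤ B) : ∫⁻ τ, ‖q τ‖ₑ ≤ 36 * B := by
  rw [Measure.volume_eq_prod, lintegral_prod_symm _ (by fun_prop)]
  refine lintegral_le_of_le_indicator fun p => ?_
  by_cases hp : p ∈ Icc (2 : ℝ) 8 ×ˢ Icc (2 : ℝ) 8
  · rw [indicator_of_mem hp]
    refine lintegral_enorm_le_of_convex (D := (fun x => ((x, p.1, p.2) : ℝ × ℝ × ℝ)) ⁻¹' D)
      (Metric.isCompact_of_isClosed_isBounded (hD.isClosed.preimage (by fun_prop))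
        ((Metric.isBounded_Icc (2 : ℝ) 8).subset fun x hx => (hD8 hx).1))
      (convex_preimage_ins₁ hDc _ _) (fun x hx => h0 _ hx) (fun x₀ x₁ h01 h => hB _ _ _ _ h01 h)
  · rw [indicator_of_notMem hp]
    have : ∀ x : ℝ, q (x, p) = 0 := fun x => h0 _ fun hx => hp (hD8 hx).2
    simp [this]

lemma lintegral_le_of_slice₂
    (hB : ∀ t r x₀ x₁, x₀ ≤ x₁ → (∀ x ∈ Icc x₀ x₁, (t, x, r) ∈ D) →
      ∫⁻ x in Icc x₀ x₁, ‖q (t, x, r)‖ₑ ≤ B) : ∫⁻ τ, ‖q τ‖ₑ ≤ 36 * B := by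
  have hm : Measurable fun p : (ℝ × ℝ) × ℝ => ‖q (p.1.1, p.2, p.1.2)‖ₑ := by
    have : Continuous fun p : (ℝ × ℝ) × ℝ => q (p.1.1, p.2, p.1.2) := by fun_prop
    exact this.measurable.enorm
  have e : ∫⁻ τ, ‖q τ‖ₑ = ∫⁻ p : ℝ × ℝ, ∫⁻ x, ‖q (p.1, x, p.2)‖ₑ := by
    rw [Measure.volume_eq_prod, lintegral_prod _ (by fun_prop),
      Measure.volume_eq_prod, lintegral_prod _ (by exact hm.lintegral_prod_right'.aemeasurable)]
    refine lintegral_congr fun t => ?_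
    rw [lintegral_prod_symm _ (by fun_prop)]
  rw [e]
  refine lintegral_le_of_le_indicator fun p => ?_
  by_cases hp : p ∈ Icc (2 : ℝ) 8 ×ˢ Icc (2 : ℝ) 8
  · rw [indicator_of_mem hp]
    refine lintegral_enorm_le_of_convex (D := (fun x => ((p.1, x, p.2) : ℝ × ℝ × ℝ)) ⁻¹' D)
      (Metric.isCompact_of_isClosed_isBounded (hD.isClosed.preimage (by fun_prop))
        ((Metric.isBounded_Icc (2 : ℝ) 8).subset fun x hx => (hD8 hx).2.1))
      (convex_preimage_ins₂ hDc _ _) (fun x hx => h0 _ hx) (fun x₀ x₁ h01 h => hB _ _ _ _ h01 h)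
  · rw [indicator_of_notMem hp]
    have : ∀ x : ℝ, q (p.1, x, p.2) = 0 := fun x => h0 _ fun hx => hp ⟨(hD8 hx).1, (hD8 hx).2.2⟩
    simp [this]

lemma lintegral_le_of_slice₃
    (hB : ∀ t s x₀ x₁, x₀ ≤ x₁ → (∀ x ∈ Icc x₀ x₁, (t, s, x) ∈ D) →
      ∫⁻ x in Icc x₀ x₁, ‖q (t, s, x)‖ₑ ≤ B) : ∫⁻ τ, ‖q τ‖ₑ ≤ 36 * B := by
  have hm : Measurable fun p : (ℝ × ℝ) × ℝ => ‖q (p.1.1, p.1.2, p.2)‖ₑ := by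
    have : Continuous fun p : (ℝ × ℝ) × ℝ => q (p.1.1, p.1.2, p.2) := by fun_prop
    exact this.measurable.enorm
  have e : ∫⁻ τ, ‖q τ‖ₑ = ∫⁻ p : ℝ × ℝ, ∫⁻ x, ‖q (p.1, p.2, x)‖ₑ := by
    rw [Measure.volume_eq_prod, lintegral_prod _ (by fun_prop),
      Measure.volume_eq_prod, lintegral_prod _ (by exact hm.lintegral_prod_right'.aemeasurable)]
    refine lintegral_congr fun t => ?_
    rw [lintegral_prod _ (by fun_prop)]
  rw [e]
  refine lintegral_le_of_le_indicator fun p => ?_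
  by_cases hp : p ∈ Icc (2 : ℝ) 8 ×ˢ Icc (2 : ℝ) 8
  · rw [indicator_of_mem hp]
    refine lintegral_enorm_le_of_convex (D := (fun x => ((p.1, p.2, x) : ℝ × ℝ × ℝ)) ⁻¹' D)
      (Metric.isCompact_of_isClosed_isBounded (hD.isClosed.preimage (by fun_prop))
        ((Metric.isBounded_Icc (2 : ℝ) 8).subset fun x hx => (hD8 hx).2.2))
      (convex_preimage_ins₃ hDc _ _) (fun x hx => h0 _ hx) (fun x₀ x₁ h01 h => hB _ _ _ _ h01 h)
  · rw [indicator_of_notMem hp]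
    have : ∀ x : ℝ, q (p.1, p.2, x) = 0 := fun x => h0 _ fun hx => hp ⟨(hD8 hx).1, (hD8 hx).2.1⟩
    simp [this]

end Slices

/-! ### Slice primitives made from regularised quotients -/

lemma regQuotDeriv_smul (ε θ N N' D D' S S' : ℝ) (g g' : ℂ) :
    regQuotDeriv θ (ε * N) (ε * N') D D' S S' g g' = ε * regQuotDeriv θ N N' D D' S S' g g' := by
  unfold regQuotDeriv; push_cast; ring

lemma tsupport_regQuot_subset (θ : ℝ) (N D S : ℝ × ℝ × ℝ → ℝ) (g : ℝ × ℝ × ℝ → ℂ) :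
    tsupport (fun τ => regQuot θ (N τ) (D τ) (S τ) (g τ)) ⊆ tsupport g :=
  closure_mono fun τ hτ hg => hτ (by simp only [regQuot]; rw [hg, mul_zero])

lemma hasCompactSupport_regQuot {θ : ℝ} {N D S : ℝ × ℝ × ℝ → ℝ} {g : ℝ × ℝ × ℝ → ℂ}
    (hg : HasCompactSupport g) :
    HasCompactSupport fun τ => regQuot θ (N τ) (D τ) (S τ) (g τ) :=
  hg.of_isClosed_subset (isClosed_tsupport _) (tsupport_regQuot_subset θ N D S g)

lemma continuous_regQuot {θ : ℝ} (hθ : 0 < θ) {N D S : ℝ × ℝ × ℝ → ℝ} {g : ℝ × ℝ × ℝ → ℂ}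
    (hg : Continuous g) (hN : ∀ τ ∈ tsupport g, ContinuousAt N τ)
    (hD : ∀ τ ∈ tsupport g, ContinuousAt D τ) (hS : ∀ τ ∈ tsupport g, ContinuousAt S τ)
    (hpos : ∀ τ ∈ tsupport g, 0 < S τ) :
    Continuous fun τ => regQuot θ (N τ) (D τ) (S τ) (g τ) := by
  refine continuous_of_tsupport fun τ hτ' => ?_
  have hτ := tsupport_regQuot_subset θ N D S g hτ'
  have hE : (D τ) ^ 2 + θ ^ 2 * (S τ) ^ 2 ≠ 0 := by
    have := hpos τ hτ; positivity
  have e : ContinuousAt (fun τ => N τ * (D τ / ((D τ) ^ 2 + θ ^ 2 * (S τ) ^ 2))) τ :=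
    (hN τ hτ).mul ((hD τ hτ).div (((hD τ hτ).pow 2).add (((hS τ hτ).pow 2).const_mul _)) hE)
  exact (Complex.continuous_ofReal.continuousAt.comp e).mul hg.continuousAt

/-- The components of the pulled-back field, with their partial derivatives, are admissible for the
integration by parts. -/
lemma isSlicePrimitive_regQuot {ins : ℝ × ℝ × ℝ → ℝ → ℝ × ℝ × ℝ} {pr : ℝ × ℝ × ℝ → ℝ}
    (hins : ∀ τ, ins τ (pr τ) = τ) (hinsc : ∀ τ, Continuous (ins τ)) {θ : ℝ} (hθ : 0 < θ)
    {N N' D D' S S' : ℝ × ℝ × ℝ → ℝ} {g g' : ℝ × ℝ × ℝ → ℂ}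
    (hg : Continuous g) (hg' : Continuous g') (hgs : HasCompactSupport g)
    (hgs' : tsupport g' ⊆ tsupport g)
    (dg : ∀ τ, HasDerivAt (fun x => g (ins τ x)) (g' τ) (pr τ))
    (hpos : ∀ τ ∈ tsupport g, 0 < S τ)
    (dN : ∀ τ ∈ tsupport g, HasDerivAt (fun x => N (ins τ x)) (N' τ) (pr τ))
    (dD : ∀ τ ∈ tsupport g, HasDerivAt (fun x => D (ins τ x)) (D' τ) (pr τ))
    (dS : ∀ τ ∈ tsupport g, HasDerivAt (fun x => S (ins τ x)) (S' τ) (pr τ))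
    (cN : ∀ τ ∈ tsupport g, ContinuousAt N τ) (cN' : ∀ τ ∈ tsupport g, ContinuousAt N' τ)
    (cD : ∀ τ ∈ tsupport g, ContinuousAt D τ) (cD' : ∀ τ ∈ tsupport g, ContinuousAt D' τ)
    (cS : ∀ τ ∈ tsupport g, ContinuousAt S τ) (cS' : ∀ τ ∈ tsupport g, ContinuousAt S' τ) :
    IsSlicePrimitive ins pr (fun τ => regQuot θ (N τ) (D τ) (S τ) (g τ))
      (fun τ => regQuotDeriv θ (N τ) (N' τ) (D τ) (D' τ) (S τ) (S' τ) (g τ) (g' τ)) := by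
  set Q := fun τ => regQuot θ (N τ) (D τ) (S τ) (g τ) with hQ
  set q := fun τ => regQuotDeriv θ (N τ) (N' τ) (D τ) (D' τ) (S τ) (S' τ) (g τ) (g' τ) with hq
  have hq0 : ∀ τ ∉ tsupport g, q τ = 0 := fun τ hτ => by
    have h1 : g τ = 0 := image_eq_zero_of_notMem_tsupport hτ
    have h2 : g' τ = 0 := image_eq_zero_of_notMem_tsupport fun h => hτ (hgs' h)
    simp [hq, regQuotDeriv, h1, h2]
  have hqt : tsupport q ⊆ tsupport g :=
    closure_minimal (fun τ hτ => by by_contra h; exact hτ (hq0 τ h)) (isClosed_tsupport g)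
  have hev : ∀ (f : ℝ × ℝ × ℝ → ℂ) (τ), τ ∉ tsupport f →
      HasDerivAt (fun x => f (ins τ x)) 0 (pr τ) := by
    intro f τ hτ
    have : ∀ᶠ x in nhds (pr τ), ins τ x ∈ (tsupport f)ᶜ := by
      refine (hinsc τ).continuousAt.eventually_mem ?_
      rw [hins]; exact (isClosed_tsupport f).isOpen_compl.mem_nhds hτ
    refine (hasDerivAt_const (pr τ) (0 : ℂ)).congr_of_eventuallyEq (this.mono fun x hx => ?_)
    simp [image_eq_zero_of_notMem_tsupport hx]
  have hder : ∀ τ, HasDerivAt (fun x => Q (ins τ x)) (q τ) (pr τ) := by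
    intro τ
    by_cases hτ : τ ∈ tsupport g
    · have := hasDerivAt_regQuot hθ (dN τ hτ) (dD τ hτ) (dS τ hτ) (dg τ)
        (by rw [hins]; exact hpos τ hτ)
      simp only [hins] at this
      exact this
    · rw [hq0 τ hτ]
      exact hev Q τ fun h => hτ (tsupport_regQuot_subset θ N D S g h)
  refine ⟨hasCompactSupport_regQuot hgs, continuous_regQuot hθ hg cN cD cS hpos, ?_, ?_, hder⟩
  · refine continuous_of_tsupport fun τ hτ' => ?_
    have hτ := hqt hτ'
    have hE : (D τ) ^ 2 + θ ^ 2 * (S τ) ^ 2 ≠ 0 := by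
      have := hpos τ hτ; positivity
    have c1 := cN τ hτ; have c2 := cN' τ hτ; have c3 := cD τ hτ
    have c4 := cD' τ hτ; have c5 := cS τ hτ; have c6 := cS' τ hτ
    have cE : ContinuousAt (fun τ => (D τ) ^ 2 + θ ^ 2 * (S τ) ^ 2) τ := by fun_prop
    have cq := c3.div cE hE
    have e1 : ContinuousAt (fun τ => N' τ * (D τ / ((D τ) ^ 2 + θ ^ 2 * (S τ) ^ 2))
        + N τ * (D' τ / ((D τ) ^ 2 + θ ^ 2 * (S τ) ^ 2)
          - D τ * (2 * D τ * D' τ + 2 * θ ^ 2 * S τ * S' τ)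
            / ((D τ) ^ 2 + θ ^ 2 * (S τ) ^ 2) ^ 2)) τ := by
      refine (c2.mul cq).add (c1.mul ((c4.div cE hE).sub (ContinuousAt.div (by fun_prop)
        (cE.pow 2) (pow_ne_zero 2 hE))))
    have e2 : ContinuousAt (fun τ => N τ * (D τ / ((D τ) ^ 2 + θ ^ 2 * (S τ) ^ 2))) τ :=
      c1.mul cq
    exact ((Complex.continuous_ofReal.continuousAt.comp e1).mul hg.continuousAt).add
      ((Complex.continuous_ofReal.continuousAt.comp e2).mul hg'.continuousAt)
  · refine closure_minimal (fun τ hτ => ?_) (isClosed_tsupport Q)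
    by_contra h
    exact hτ ((hder τ).unique (hev Q τ h))

/-! ### Regularised weights -/

/-- The triples of times on which the curve is differentiable. -/
def regularSet : Set (ℝ × ℝ × ℝ) := {τ | 1 < τ.1 ∧ 1 < τ.2.1 ∧ 1 < τ.2.2}

lemma isOpen_regularSet : IsOpen regularSet :=
  (isOpen_lt continuous_const continuous_fst).inter
    ((isOpen_lt continuous_const (continuous_fst.comp continuous_snd)).inter
      (isOpen_lt continuous_const (continuous_snd.comp continuous_snd)))

lemma mem_regularSet_of_mem {τ : ℝ × ℝ × ℝ}
    (h : τ ∈ Icc (2 : ℝ) 8 ×ˢ Icc (2 : ℝ) 8 ×ˢ Icc (2 : ℝ) 8) : τ ∈ regularSet :=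
  ⟨one_lt_of_mem_Icc h.1, one_lt_of_mem_Icc h.2.1, one_lt_of_mem_Icc h.2.2⟩

namespace CurveData

variable (c : CurveData)

/-- A product of points of the curve at the times `t, s, r`, the last one or its inverse according
to the sign `ε`, with its partial derivatives and with Cramer's rule for the pull-back of the
right-invariant fields. -/
structure IsProductMap (k u ε : ℝ) (F F₁ F₂ F₃ : ℝ × ℝ × ℝ → ℝ × ℝ × ℝ) : Prop where
  abs_sign : |ε| = 1
  continuous : Continuous F
  deriv₁ : ∀ τ ∈ regularSet, HasDerivAt (fun x => F (ins₁ τ x)) (F₁ τ) τ.1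
  deriv₂ : ∀ τ ∈ regularSet, HasDerivAt (fun x => F (ins₂ τ x)) (F₂ τ) τ.2.1
  deriv₃ : ∀ τ ∈ regularSet, HasDerivAt (fun x => F (ins₃ τ x)) (F₃ τ) τ.2.2
  cont₁ : ContinuousOn F₁ regularSet
  cont₂ : ContinuousOn F₂ regularSet
  cont₃ : ContinuousOn F₃ regularSet
  cramer : ∀ (y τ : ℝ × ℝ × ℝ), c.num₁ k u y τ.1 τ.2.1 τ.2.2 • F₁ τ
    + c.num₂ k u y τ.1 τ.2.1 τ.2.2 • F₂ τ + (ε * c.num₃ y τ.1 τ.2.1) • F₃ τ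
    = c.jac k u τ.1 τ.2.1 τ.2.2 • rightInvField c.ξ y (F τ)

/-- A convex domain of triples of times on which the one-variable estimates hold, with the bound `B`
for weights bounded by `M`. -/
structure HasLineBounds (σ₀ σ₂ σ₃ k u θ M B : ℝ) (y : ℝ × ℝ × ℝ) (D : Set (ℝ × ℝ × ℝ)) : Prop where
  isCompact : IsCompact D
  convex : Convex ℝ D
  subset : D ⊆ Icc (2 : ℝ) 8 ×ˢ Icc (2 : ℝ) 8 ×ˢ Icc (2 : ℝ) 8
  size_pos : ∀ τ ∈ D, 0 < c.size σ₀ σ₂ σ₃ k u τ.1 τ.2.1 τ.2.2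
  line₁ : ∀ s r x₀ x₁ : ℝ, x₀ ≤ x₁ → (∀ x ∈ Icc x₀ x₁, (x, s, r) ∈ D) → ∀ g g' : ℝ → ℂ,
    (∀ x ∈ Icc x₀ x₁, ‖g x‖ ≤ M) → (∀ x ∈ Icc x₀ x₁, ‖g' x‖ ≤ M) →
    ∫⁻ x in Icc x₀ x₁, ‖regQuotDeriv θ (c.num₁ k u y x s r) (-c.numDeriv y x s r)
        (c.jac k u x s r) (c.size₁ 1 1 1 k u x s r) (c.size σ₀ σ₂ σ₃ k u x s r)
        (c.size₁ σ₀ σ₂ σ₃ k u x s r) (g x) (g' x)‖ₑ ≤ ENNReal.ofReal B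
  line₂ : ∀ t r x₀ x₁ : ℝ, x₀ ≤ x₁ → (∀ x ∈ Icc x₀ x₁, (t, x, r) ∈ D) → ∀ g g' : ℝ → ℂ,
    (∀ x ∈ Icc x₀ x₁, ‖g x‖ ≤ M) → (∀ x ∈ Icc x₀ x₁, ‖g' x‖ ≤ M) →
    ∫⁻ x in Icc x₀ x₁, ‖regQuotDeriv θ (c.num₂ k u y t x r) (c.numDeriv y t x r)
        (c.jac k u t x r) (c.size₂ 1 1 1 k u t x r) (c.size σ₀ σ₂ σ₃ k u t x r)
        (c.size₂ σ₀ σ₂ σ₃ k u t x r) (g x) (g' x)‖ₑ ≤ ENNReal.ofReal B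
  line₃ : ∀ t s x₀ x₁ : ℝ, x₀ ≤ x₁ → (∀ x ∈ Icc x₀ x₁, (t, s, x) ∈ D) → ∀ g g' : ℝ → ℂ,
    (∀ x ∈ Icc x₀ x₁, ‖g x‖ ≤ M) → (∀ x ∈ Icc x₀ x₁, ‖g' x‖ ≤ M) →
    ∫⁻ x in Icc x₀ x₁, ‖regQuotDeriv θ (c.num₃ y t s) 0
        (c.jac k u t s x) (c.size₃ 1 1 1 k u t s x) (c.size σ₀ σ₂ σ₃ k u t s x)
        (c.size₃ σ₀ σ₂ σ₃ k u t s x) (g x) (g' x)‖ₑ ≤ ENNReal.ofReal B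

/-- The weight `g`, made to vanish where the determinant is small in comparison with its size. -/
def regWeight (σ₀ σ₂ σ₃ k u θ : ℝ) (g : ℝ × ℝ × ℝ → ℂ) (τ : ℝ × ℝ × ℝ) : ℂ :=
  regQuot θ (c.jac k u τ.1 τ.2.1 τ.2.2) (c.jac k u τ.1 τ.2.1 τ.2.2)
    (c.size σ₀ σ₂ σ₃ k u τ.1 τ.2.1 τ.2.2) (g τ)

section Continuity

variable {c} {κ : ℝ} (h : c.IsNormalized κ) {τ : ℝ × ℝ × ℝ} (hτ : τ ∈ regularSet)
include h hτ

lemma IsNormalized.continuousAt_parts (σ₀ σ₂ σ₃ k u : ℝ) (y : ℝ × ℝ × ℝ) :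
    ContinuousAt (fun τ => c.size σ₀ σ₂ σ₃ k u τ.1 τ.2.1 τ.2.2) τ ∧
    ContinuousAt (fun τ => c.size₁ σ₀ σ₂ σ₃ k u τ.1 τ.2.1 τ.2.2) τ ∧
    ContinuousAt (fun τ => c.size₂ σ₀ σ₂ σ₃ k u τ.1 τ.2.1 τ.2.2) τ ∧
    ContinuousAt (fun τ => c.size₃ σ₀ σ₂ σ₃ k u τ.1 τ.2.1 τ.2.2) τ ∧
    ContinuousAt (fun τ => c.num₁ k u y τ.1 τ.2.1 τ.2.2) τ ∧
    ContinuousAt (fun τ => c.num₂ k u y τ.1 τ.2.1 τ.2.2) τ ∧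
    ContinuousAt (fun τ => c.num₃ y τ.1 τ.2.1) τ ∧
    ContinuousAt (fun τ => c.numDeriv y τ.1 τ.2.1 τ.2.2) τ := by
  obtain ⟨ht, hs, hr⟩ := hτ
  have p : ∀ {φ : ℝ → ℝ}, (∀ x, 1 < x → ContinuousAt φ x) →
      ContinuousAt (fun τ : ℝ × ℝ × ℝ => φ τ.1) τ ∧
      ContinuousAt (fun τ : ℝ × ℝ × ℝ => φ τ.2.1) τ ∧
      ContinuousAt (fun τ : ℝ × ℝ × ℝ => φ τ.2.2) τ := fun hφ =>
    ⟨ContinuousAt.comp (f := fun τ : ℝ × ℝ × ℝ => τ.1) (hφ _ ht) (by fun_prop),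
      ContinuousAt.comp (f := fun τ : ℝ × ℝ × ℝ => τ.2.1) (hφ _ hs) (by fun_prop),
      ContinuousAt.comp (f := fun τ : ℝ × ℝ × ℝ => τ.2.2) (hφ _ hr) (by fun_prop)⟩
  obtain ⟨A1, A2, A3⟩ := p fun x hx => (h.hA x hx).continuousAt
  obtain ⟨a1, a2, a3⟩ := p fun x hx => (h.ha x hx).continuousAt
  obtain ⟨f1, f2, f3⟩ := p fun x hx => (h.hf x hx).continuousAt
  obtain ⟨P1, P2, P3⟩ := p fun x hx => (h.hP x hx).continuousAt
  obtain ⟨b1, b2, b3⟩ := p fun x hx => h.ca₂.continuousAt (Ioi_mem_nhds hx)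
  unfold size size₁ size₂ size₃ num₁ num₂ num₃ numDeriv e₁ e₃ yTilde det₀ det₂ det₃ S
  refine ⟨?_, ?_, ?_, ?_, ?_, ?_, ?_, ?_⟩ <;> fun_prop

end Continuity

variable {c} {κ σ₀ σ₂ σ₃ k u θ M B ε : ℝ} {y : ℝ × ℝ × ℝ} {D : Set (ℝ × ℝ × ℝ)}
  {g : ℝ × ℝ × ℝ → ℂ}

lemma continuous_regWeight (h : c.IsNormalized κ) (hθ : 0 < θ)
    (H : c.HasLineBounds σ₀ σ₂ σ₃ k u θ M B y D) (hg : Continuous g) (hgD : tsupport g ⊆ D) :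
    Continuous (c.regWeight σ₀ σ₂ σ₃ k u θ g) := by
  have hreg : ∀ τ ∈ tsupport g, τ ∈ regularSet := fun τ hτ =>
    mem_regularSet_of_mem (H.subset (hgD hτ))
  have cj : ∀ τ ∈ tsupport g, ContinuousAt (fun τ => c.jac k u τ.1 τ.2.1 τ.2.2) τ := fun τ hτ => by
    simp only [jac_eq_size]
    exact (h.continuousAt_parts (hreg τ hτ) 1 1 1 k u y).1
  exact continuous_regQuot hθ hg cj cj
    (fun τ hτ => (h.continuousAt_parts (hreg τ hτ) _ _ _ k u y).1)
    fun τ hτ => H.size_pos τ (hgD hτ)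

/-- The transported regularised weight moves little under left translation. -/
theorem norm_integral_regWeight_sub_le (h : c.IsNormalized κ)
    {F F₁ F₂ F₃ : ℝ × ℝ × ℝ → ℝ × ℝ × ℝ} (hF : c.IsProductMap k u ε F F₁ F₂ F₃)
    (hθ : 0 < θ) (hB : 0 ≤ B) (H : c.HasLineBounds σ₀ σ₂ σ₃ k u θ M B y D)
    (hg : ContDiff ℝ 1 g) (hgD : tsupport g ⊆ D) (hgM : ∀ τ, ‖g τ‖ ≤ M)
    (hgM' : ∀ τ, ‖fderiv ℝ g τ‖ ≤ M) {φ : ℝ × ℝ × ℝ → ℝ} (hφ : IsTestFunction φ) :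
    ‖∫ τ, ((φ (F τ) - φ (heisMul c.ξ (-y) (F τ)) : ℝ) : ℂ) * c.regWeight σ₀ σ₂ σ₃ k u θ g τ‖
      ≤ 108 * B := by
  have hgc := hg.continuous
  have hgs : HasCompactSupport g := H.isCompact.of_isClosed_subset (isClosed_tsupport g) hgD
  have hreg : ∀ τ ∈ tsupport g, τ ∈ regularSet := fun τ hτ =>
    mem_regularSet_of_mem (H.subset (hgD hτ))
  have hpos : ∀ τ ∈ tsupport g, 0 < c.size σ₀ σ₂ σ₃ k u τ.1 τ.2.1 τ.2.2 := fun τ hτ =>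
    H.size_pos τ (hgD hτ)
  have hdc : ∀ v, Continuous fun τ => fderiv ℝ g τ v := fun v =>
    (hg.continuous_fderiv one_ne_zero).clm_apply continuous_const
  have hds : ∀ v, tsupport (fun τ => fderiv ℝ g τ v) ⊆ tsupport g := fun v =>
    (tsupport_fderiv_apply_subset ℝ v)
  have hdM : ∀ v : ℝ × ℝ × ℝ, ‖v‖ ≤ 1 → ∀ τ, ‖fderiv ℝ g τ v‖ ≤ M := fun v hv τ =>
    ((fderiv ℝ g τ).le_opNorm v).trans ((mul_le_of_le_one_right (norm_nonneg _) hv).trans (hgM' τ))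
  have dg : ∀ (τ v : ℝ × ℝ × ℝ) (ins : ℝ → ℝ × ℝ × ℝ) (x : ℝ), ins x = τ → HasDerivAt ins v x →
      HasDerivAt (fun x => g (ins x)) (fderiv ℝ g τ v) x := fun τ v ins x hx hv => by
    rw [← hx]; exact (hg.differentiable one_ne_zero _).hasFDerivAt.comp_hasDerivAt x hv
  have i1 : ∀ τ : ℝ × ℝ × ℝ, HasDerivAt (ins₁ τ) ((1, 0, 0) : ℝ × ℝ × ℝ) τ.1 := fun τ =>
    (hasDerivAt_id _).prodMk (hasDerivAt_const _ _)
  have i2 : ∀ τ : ℝ × ℝ × ℝ, HasDerivAt (ins₂ τ) ((0, 1, 0) : ℝ × ℝ × ℝ) τ.2.1 := fun τ =>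
    (hasDerivAt_const _ _).prodMk ((hasDerivAt_id _).prodMk (hasDerivAt_const _ _))
  have i3 : ∀ τ : ℝ × ℝ × ℝ, HasDerivAt (ins₃ τ) ((0, 0, 1) : ℝ × ℝ × ℝ) τ.2.2 := fun τ =>
    (hasDerivAt_const _ _).prodMk ((hasDerivAt_const _ _).prodMk (hasDerivAt_id _))
  have cs := fun τ (hτ : τ ∈ tsupport g) => h.continuousAt_parts (hreg τ hτ) σ₀ σ₂ σ₃ k u y
  have cj := fun τ (hτ : τ ∈ tsupport g) => h.continuousAt_parts (hreg τ hτ) 1 1 1 k u y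
  have ej : c.jac k u = c.size 1 1 1 k u := by funext t s r; exact c.jac_eq_size k u t s r
  have P1 := isSlicePrimitive_regQuot (ins := ins₁) (pr := fun τ => τ.1) (fun _ => rfl)
    (fun τ => by unfold ins₁; fun_prop) hθ
    (N := fun τ => c.num₁ k u y τ.1 τ.2.1 τ.2.2) (N' := fun τ => -c.numDeriv y τ.1 τ.2.1 τ.2.2)
    (D := fun τ => c.jac k u τ.1 τ.2.1 τ.2.2) (D' := fun τ => c.size₁ 1 1 1 k u τ.1 τ.2.1 τ.2.2)
    (S := fun τ => c.size σ₀ σ₂ σ₃ k u τ.1 τ.2.1 τ.2.2)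
    (S' := fun τ => c.size₁ σ₀ σ₂ σ₃ k u τ.1 τ.2.1 τ.2.2)
    hgc (hdc (1, 0, 0)) hgs (hds _) (fun τ => dg τ _ _ _ rfl (i1 τ)) hpos
    (fun τ hτ => h.hasDerivAt_num₁ k u y (hreg τ hτ).1 τ.2.1 τ.2.2)
    (fun τ hτ => by rw [ej]; exact h.hasDerivAt_size₁ 1 1 1 k u (hreg τ hτ).1 τ.2.1 τ.2.2)
    (fun τ hτ => h.hasDerivAt_size₁ σ₀ σ₂ σ₃ k u (hreg τ hτ).1 τ.2.1 τ.2.2)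
    (fun τ hτ => (cs τ hτ).2.2.2.2.1) (fun τ hτ => (cs τ hτ).2.2.2.2.2.2.2.neg)
    (fun τ hτ => by rw [ej]; exact (cj τ hτ).1) (fun τ hτ => (cj τ hτ).2.1)
    (fun τ hτ => (cs τ hτ).1) (fun τ hτ => (cs τ hτ).2.1)
  have P2 := isSlicePrimitive_regQuot (ins := ins₂) (pr := fun τ => τ.2.1) (fun _ => rfl)
    (fun τ => by unfold ins₂; fun_prop) hθ
    (N := fun τ => c.num₂ k u y τ.1 τ.2.1 τ.2.2) (N' := fun τ => c.numDeriv y τ.1 τ.2.1 τ.2.2)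
    (D := fun τ => c.jac k u τ.1 τ.2.1 τ.2.2) (D' := fun τ => c.size₂ 1 1 1 k u τ.1 τ.2.1 τ.2.2)
    (S := fun τ => c.size σ₀ σ₂ σ₃ k u τ.1 τ.2.1 τ.2.2)
    (S' := fun τ => c.size₂ σ₀ σ₂ σ₃ k u τ.1 τ.2.1 τ.2.2)
    hgc (hdc (0, 1, 0)) hgs (hds _) (fun τ => dg τ _ _ _ rfl (i2 τ)) hpos
    (fun τ hτ => h.hasDerivAt_num₂ k u y τ.1 (hreg τ hτ).2.1 τ.2.2)
    (fun τ hτ => by rw [ej]; exact h.hasDerivAt_size₂ 1 1 1 k u τ.1 (hreg τ hτ).2.1 τ.2.2)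
    (fun τ hτ => h.hasDerivAt_size₂ σ₀ σ₂ σ₃ k u τ.1 (hreg τ hτ).2.1 τ.2.2)
    (fun τ hτ => (cs τ hτ).2.2.2.2.2.1) (fun τ hτ => (cs τ hτ).2.2.2.2.2.2.2)
    (fun τ hτ => by rw [ej]; exact (cj τ hτ).1) (fun τ hτ => (cj τ hτ).2.2.1)
    (fun τ hτ => (cs τ hτ).1) (fun τ hτ => (cs τ hτ).2.2.1)
  have P3 := isSlicePrimitive_regQuot (ins := ins₃) (pr := fun τ => τ.2.2) (fun _ => rfl)
    (fun τ => by unfold ins₃; fun_prop) hθ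
    (N := fun τ => ε * c.num₃ y τ.1 τ.2.1) (N' := fun _ => ε * 0)
    (D := fun τ => c.jac k u τ.1 τ.2.1 τ.2.2) (D' := fun τ => c.size₃ 1 1 1 k u τ.1 τ.2.1 τ.2.2)
    (S := fun τ => c.size σ₀ σ₂ σ₃ k u τ.1 τ.2.1 τ.2.2)
    (S' := fun τ => c.size₃ σ₀ σ₂ σ₃ k u τ.1 τ.2.1 τ.2.2)
    hgc (hdc (0, 0, 1)) hgs (hds _) (fun τ => dg τ _ _ _ rfl (i3 τ)) hpos
    (fun τ hτ => (hasDerivAt_const τ.2.2 (ε * c.num₃ y τ.1 τ.2.1)).congr_deriv (mul_zero ε).symm)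
    (fun τ hτ => by rw [ej]; exact h.hasDerivAt_size₃ 1 1 1 k u τ.1 τ.2.1 (hreg τ hτ).2.2)
    (fun τ hτ => h.hasDerivAt_size₃ σ₀ σ₂ σ₃ k u τ.1 τ.2.1 (hreg τ hτ).2.2)
    (fun τ hτ => (cs τ hτ).2.2.2.2.2.2.1.const_mul ε) (fun τ hτ => continuousAt_const)
    (fun τ hτ => by rw [ej]; exact (cj τ hτ).1) (fun τ hτ => (cj τ hτ).2.2.2.1)
    (fun τ hτ => (cs τ hτ).1) (fun τ hτ => (cs τ hτ).2.2.2.1)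
  have hg0 : ∀ τ ∉ D, g τ = 0 ∧ ∀ v, fderiv ℝ g τ v = 0 := fun τ hτ =>
    ⟨image_eq_zero_of_notMem_tsupport fun h => hτ (hgD h), fun v =>
      image_eq_zero_of_notMem_tsupport (f := fun τ => fderiv ℝ g τ v)
        fun h => hτ (hgD (hds v h))⟩
  have hq0 : ∀ (N N' E E' S S' : ℝ) (v τ : ℝ × ℝ × ℝ), τ ∉ D →
      regQuotDeriv θ N N' E E' S S' (g τ) (fderiv ℝ g τ v) = 0 := fun _ _ _ _ _ _ v τ hτ => by
    simp [regQuotDeriv, (hg0 τ hτ).1, (hg0 τ hτ).2 v]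
  have b1 := lintegral_le_of_slice₁ P1.continuous_deriv H.isCompact H.convex H.subset
    (fun τ hτ => hq0 _ _ _ _ _ _ _ τ hτ) (B := ENNReal.ofReal B) fun s r x₀ x₁ h01 hx =>
      H.line₁ s r x₀ x₁ h01 hx _ _ (fun x _ => hgM _) fun x _ => hdM (1, 0, 0) (by simp [Prod.norm_def]) _
  have b2 := lintegral_le_of_slice₂ P2.continuous_deriv H.isCompact H.convex H.subset
    (fun τ hτ => hq0 _ _ _ _ _ _ _ τ hτ) (B := ENNReal.ofReal B) fun t r x₀ x₁ h01 hx =>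
      H.line₂ t r x₀ x₁ h01 hx _ _ (fun x _ => hgM _) fun x _ => hdM (0, 1, 0) (by simp [Prod.norm_def]) _
  have b3 := lintegral_le_of_slice₃ P3.continuous_deriv H.isCompact H.convex H.subset
    (fun τ hτ => hq0 _ _ _ _ _ _ _ τ hτ) (B := ENNReal.ofReal B) fun t s x₀ x₁ h01 hx => by
      refine le_trans (le_of_eq (lintegral_congr fun x => ?_)) (H.line₃ t s x₀ x₁ h01 hx
        (fun x => g (t, s, x)) (fun x => fderiv ℝ g (t, s, x) (0, 0, 1))
        (fun x _ => hgM _) fun x _ => hdM (0, 0, 1) (by simp [Prod.norm_def]) _)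
      rw [regQuotDeriv_smul, enorm_mul, ← ofReal_norm (ε : ℂ), Complex.norm_real, Real.norm_eq_abs,
        hF.abs_sign, ENNReal.ofReal_one, one_mul]
  have HP : IsPulledBack c.ξ y regularSet F F₁ F₂ F₃ (c.regWeight σ₀ σ₂ σ₃ k u θ g) _ _ _ _ _ _ :=
    { slice₁ := P1, slice₂ := P2, slice₃ := P3
      tsupport₁ := fun τ hτ => hreg τ (tsupport_regQuot_subset _ _ _ _ _ hτ)
      tsupport₂ := fun τ hτ => hreg τ (tsupport_regQuot_subset _ _ _ _ _ hτ)
      tsupport₃ := fun τ hτ => hreg τ (tsupport_regQuot_subset _ _ _ _ _ hτ)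
      deriv₁ := hF.deriv₁, deriv₂ := hF.deriv₂, deriv₃ := hF.deriv₃
      cont₁ := hF.cont₁, cont₂ := hF.cont₂, cont₃ := hF.cont₃
      hasCompactSupport := hasCompactSupport_regQuot hgs
      continuous := continuous_regWeight h hθ H hgc hgD
      eq_zero := fun τ hτ => by
        have : g τ = 0 := image_eq_zero_of_notMem_tsupport fun h => hτ (hreg τ h)
        simp [regWeight, regQuot, this]
      eq := fun τ _ => ⟨_, _, _, c.jac k u τ.1 τ.2.1 τ.2.2, _, regQuot_eq .., regQuot_eq ..,
        regQuot_eq .., regQuot_eq .., hF.cramer y τ⟩ }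
  refine HP.norm_integral_sub_le hF.continuous isOpen_regularSet (by positivity) ?_ hφ
  refine (add_le_add (add_le_add b1 b2) b3).trans (le_of_eq ?_)
  rw [ENNReal.ofReal_mul (by norm_num)]
  norm_num
  ring

end CurveData

/-! ### Products of points of the curve -/

/-- The product of three points `γ(t)⁻¹ γ(s) γ(r)⁻¹` of the curve `γ = (t, A(t), C(t))`. -/
def prodThree (A C : ℝ → ℝ) (ξ : ℝ) (τ : ℝ × ℝ × ℝ) : ℝ × ℝ × ℝ :=
  (-τ.1 + τ.2.1 - τ.2.2, -A τ.1 + A τ.2.1 - A τ.2.2,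
    -C τ.1 + C τ.2.1 - C τ.2.2 - ξ * (τ.1 * A τ.2.1 - τ.2.1 * A τ.1 - τ.1 * A τ.2.2
      + τ.2.1 * A τ.2.2 + τ.2.2 * A τ.1 - τ.2.2 * A τ.2.1))

/-- The product of four points `γ(t)⁻¹ γ(s) γ(u)⁻¹ γ(r)` of the curve `γ = (t, A(t), C(t))`. -/
def prodFour (A C : ℝ → ℝ) (ξ u : ℝ) (τ : ℝ × ℝ × ℝ) : ℝ × ℝ × ℝ :=
  (-τ.1 + τ.2.1 - u + τ.2.2, -A τ.1 + A τ.2.1 - A u + A τ.2.2,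
    -C τ.1 + C τ.2.1 - C u + C τ.2.2
      - ξ * (τ.2.1 * A u - u * A τ.2.1 - τ.2.1 * A τ.2.2 + u * A τ.2.2 + τ.2.2 * A τ.2.1
        - τ.2.2 * A u + τ.1 * A τ.2.1 - τ.1 * A u + τ.1 * A τ.2.2 - τ.2.1 * A τ.1 + u * A τ.1
        - τ.2.2 * A τ.1))

namespace CurveData.IsNormalized

variable {c : CurveData} {κ : ℝ} (h : c.IsNormalized κ)
include h

/-- The three partial derivatives are listed explicitly, after which Cramer's rule is a polynomial
identity. The last factor is an inverse, hence the sign `-1`. -/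
theorem isProductMap_prodThree (hA : Continuous c.A) {C : ℝ → ℝ} (hC : Continuous C)
    (dC : ∀ t, 1 < t → HasDerivAt C (c.f t + c.ξ * (t * c.a t - c.A t)) t) (u : ℝ) :
    c.IsProductMap 0 u (-1) (prodThree c.A C c.ξ)
      (fun τ => (-1, -c.a τ.1, -(c.f τ.1 + c.ξ * (τ.1 * c.a τ.1 - c.A τ.1))
        - c.ξ * (c.A τ.2.1 - τ.2.1 * c.a τ.1 - c.A τ.2.2 + τ.2.2 * c.a τ.1)))
      (fun τ => (1, c.a τ.2.1, c.f τ.2.1 + c.ξ * (τ.2.1 * c.a τ.2.1 - c.A τ.2.1)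
        - c.ξ * (τ.1 * c.a τ.2.1 - c.A τ.1 + c.A τ.2.2 - τ.2.2 * c.a τ.2.1)))
      (fun τ => (-1, -c.a τ.2.2, -(c.f τ.2.2 + c.ξ * (τ.2.2 * c.a τ.2.2 - c.A τ.2.2))
        - c.ξ * (-(τ.1 * c.a τ.2.2) + τ.2.1 * c.a τ.2.2 + c.A τ.1 - c.A τ.2.1))) where
  abs_sign := by simp
  continuous := by unfold prodThree; fun_prop
  deriv₁ τ hτ := by
    have dA := h.hA τ.1 hτ.1
    have dx := hasDerivAt_id τ.1
    refine HasDerivAt.congr_deriv (((dx.neg.add_const τ.2.1).sub_const τ.2.2).prodMk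
      (((dA.neg.add_const (c.A τ.2.1)).sub_const (c.A τ.2.2)).prodMk
      ((((dC τ.1 hτ.1).neg.add_const (C τ.2.1)).sub_const (C τ.2.2)).sub
      (((((((dx.mul_const (c.A τ.2.1)).sub (dA.const_mul τ.2.1)).sub
      (dx.mul_const (c.A τ.2.2))).add_const (τ.2.1 * c.A τ.2.2)).add
      (dA.const_mul τ.2.2)).sub_const (τ.2.2 * c.A τ.2.1)).const_mul c.ξ)))) ?_
    simp
  deriv₂ τ hτ := by
    have dA := h.hA τ.2.1 hτ.2.1
    have dx := hasDerivAt_id τ.2.1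
    refine HasDerivAt.congr_deriv (((dx.const_add (-τ.1)).sub_const τ.2.2).prodMk
      (((dA.const_add (-c.A τ.1)).sub_const (c.A τ.2.2)).prodMk
      ((((dC τ.2.1 hτ.2.1).const_add (-C τ.1)).sub_const (C τ.2.2)).sub
      (((((((dA.const_mul τ.1).sub (dx.mul_const (c.A τ.1))).sub_const (τ.1 * c.A τ.2.2)).add
      (dx.mul_const (c.A τ.2.2))).add_const (τ.2.2 * c.A τ.1)).sub
      (dA.const_mul τ.2.2)).const_mul c.ξ)))) ?_
    simp
  deriv₃ τ hτ := by
    have dA := h.hA τ.2.2 hτ.2.2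
    have dx := hasDerivAt_id τ.2.2
    refine HasDerivAt.congr_deriv ((dx.const_sub (-τ.1 + τ.2.1)).prodMk
      ((dA.const_sub (-c.A τ.1 + c.A τ.2.1)).prodMk
      (((dC τ.2.2 hτ.2.2).const_sub (-C τ.1 + C τ.2.1)).sub
      ((((((dA.const_mul τ.1).const_sub (τ.1 * c.A τ.2.1 - τ.2.1 * c.A τ.1)).add
      (dA.const_mul τ.2.1)).add (dx.mul_const (c.A τ.1))).sub
      (dx.mul_const (c.A τ.2.1))).const_mul c.ξ)))) ?_
    simp
  cont₁ τ hτ := by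
    have c1 : ContinuousAt (fun τ : ℝ × ℝ × ℝ => c.a τ.1) τ := ContinuousAt.comp
      (f := fun τ : ℝ × ℝ × ℝ => τ.1) (h.ha _ hτ.1).continuousAt (by fun_prop)
    have c2 : ContinuousAt (fun τ : ℝ × ℝ × ℝ => c.f τ.1) τ := ContinuousAt.comp
      (f := fun τ : ℝ × ℝ × ℝ => τ.1) (h.hf _ hτ.1).continuousAt (by fun_prop)
    refine ContinuousAt.continuousWithinAt ?_
    fun_prop
  cont₂ τ hτ := by
    have c1 : ContinuousAt (fun τ : ℝ × ℝ × ℝ => c.a τ.2.1) τ := ContinuousAt.comp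
      (f := fun τ : ℝ × ℝ × ℝ => τ.2.1) (h.ha _ hτ.2.1).continuousAt (by fun_prop)
    have c2 : ContinuousAt (fun τ : ℝ × ℝ × ℝ => c.f τ.2.1) τ := ContinuousAt.comp
      (f := fun τ : ℝ × ℝ × ℝ => τ.2.1) (h.hf _ hτ.2.1).continuousAt (by fun_prop)
    refine ContinuousAt.continuousWithinAt ?_
    fun_prop
  cont₃ τ hτ := by
    have c1 : ContinuousAt (fun τ : ℝ × ℝ × ℝ => c.a τ.2.2) τ := ContinuousAt.comp
      (f := fun τ : ℝ × ℝ × ℝ => τ.2.2) (h.ha _ hτ.2.2).continuousAt (by fun_prop)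
    have c2 : ContinuousAt (fun τ : ℝ × ℝ × ℝ => c.f τ.2.2) τ := ContinuousAt.comp
      (f := fun τ : ℝ × ℝ × ℝ => τ.2.2) (h.hf _ hτ.2.2).continuousAt (by fun_prop)
    refine ContinuousAt.continuousWithinAt ?_
    fun_prop
  cramer y τ := by
    ext <;> simp [prodThree, rightInvField, num₁, num₂, num₃, jac, det₀, det₂, det₃, e₁, e₃,
      yTilde, S] <;> ring

/-- The three partial derivatives are listed explicitly, after which Cramer's rule is a polynomial
identity. -/
theorem isProductMap_prodFour (hA : Continuous c.A) {C : ℝ → ℝ} (hC : Continuous C)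
    (dC : ∀ t, 1 < t → HasDerivAt C (c.f t + c.ξ * (t * c.a t - c.A t)) t) (u : ℝ) :
    c.IsProductMap 1 u 1 (prodFour c.A C c.ξ u)
      (fun τ => (-1, -c.a τ.1, -(c.f τ.1 + c.ξ * (τ.1 * c.a τ.1 - c.A τ.1))
        - c.ξ * (c.A τ.2.1 - c.A u + c.A τ.2.2 - τ.2.1 * c.a τ.1 + u * c.a τ.1 - τ.2.2 * c.a τ.1)))
      (fun τ => (1, c.a τ.2.1, c.f τ.2.1 + c.ξ * (τ.2.1 * c.a τ.2.1 - c.A τ.2.1)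
        - c.ξ * (c.A u - u * c.a τ.2.1 - c.A τ.2.2 + τ.2.2 * c.a τ.2.1 + τ.1 * c.a τ.2.1
          - c.A τ.1)))
      (fun τ => (1, c.a τ.2.2, c.f τ.2.2 + c.ξ * (τ.2.2 * c.a τ.2.2 - c.A τ.2.2)
        - c.ξ * (-(τ.2.1 * c.a τ.2.2) + u * c.a τ.2.2 + c.A τ.2.1 - c.A u + τ.1 * c.a τ.2.2
          - c.A τ.1))) where
  abs_sign := by simp
  continuous := by unfold prodFour; fun_prop
  deriv₁ τ hτ := by
    have dA := h.hA τ.1 hτ.1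
    have dx := hasDerivAt_id τ.1
    refine HasDerivAt.congr_deriv ((((dx.neg.add_const τ.2.1).sub_const u).add_const τ.2.2).prodMk
      ((((dA.neg.add_const (c.A τ.2.1)).sub_const (c.A u)).add_const (c.A τ.2.2)).prodMk
      (((((dC τ.1 hτ.1).neg.add_const (C τ.2.1)).sub_const (C u)).add_const (C τ.2.2)).sub
      (((((((dx.mul_const (c.A τ.2.1)).const_add (τ.2.1 * c.A u - u * c.A τ.2.1
      - τ.2.1 * c.A τ.2.2 + u * c.A τ.2.2 + τ.2.2 * c.A τ.2.1 - τ.2.2 * c.A u)).sub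
      (dx.mul_const (c.A u))).add
      (dx.mul_const (c.A τ.2.2))).sub (dA.const_mul τ.2.1)).add (dA.const_mul u)).sub
      (dA.const_mul τ.2.2) |>.const_mul c.ξ)))) ?_
    simp
  deriv₂ τ hτ := by
    have dA := h.hA τ.2.1 hτ.2.1
    have dx := hasDerivAt_id τ.2.1
    refine HasDerivAt.congr_deriv ((((dx.const_add (-τ.1)).sub_const u).add_const τ.2.2).prodMk
      ((((dA.const_add (-c.A τ.1)).sub_const (c.A u)).add_const (c.A τ.2.2)).prodMk
      (((((dC τ.2.1 hτ.2.1).const_add (-C τ.1)).sub_const (C u)).add_const (C τ.2.2)).sub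
      ((((((((((((dx.mul_const (c.A u)).sub (dA.const_mul u)).sub
      (dx.mul_const (c.A τ.2.2))).add_const (u * c.A τ.2.2)).add (dA.const_mul τ.2.2)).sub_const
      (τ.2.2 * c.A u)).add (dA.const_mul τ.1)).sub_const (τ.1 * c.A u)).add_const
      (τ.1 * c.A τ.2.2)).sub (dx.mul_const (c.A τ.1))).add_const (u * c.A τ.1)).sub_const
      (τ.2.2 * c.A τ.1) |>.const_mul c.ξ)))) ?_
    simp
  deriv₃ τ hτ := by
    have dA := h.hA τ.2.2 hτ.2.2
    have dx := hasDerivAt_id τ.2.2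
    refine HasDerivAt.congr_deriv ((dx.const_add (-τ.1 + τ.2.1 - u)).prodMk
      ((dA.const_add (-c.A τ.1 + c.A τ.2.1 - c.A u)).prodMk
      (((dC τ.2.2 hτ.2.2).const_add (-C τ.1 + C τ.2.1 - C u)).sub
      (((((((((((dA.const_mul τ.2.1).const_sub (τ.2.1 * c.A u - u * c.A τ.2.1)).add
      (dA.const_mul u)).add (dx.mul_const (c.A τ.2.1))).sub (dx.mul_const (c.A u))).add_const
      (τ.1 * c.A τ.2.1)).sub_const (τ.1 * c.A u)).add (dA.const_mul τ.1)).sub_const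
      (τ.2.1 * c.A τ.1)).add_const (u * c.A τ.1)).sub (dx.mul_const (c.A τ.1)) |>.const_mul
      c.ξ)))) ?_
    simp
  cont₁ τ hτ := by
    have c1 : ContinuousAt (fun τ : ℝ × ℝ × ℝ => c.a τ.1) τ := ContinuousAt.comp
      (f := fun τ : ℝ × ℝ × ℝ => τ.1) (h.ha _ hτ.1).continuousAt (by fun_prop)
    have c2 : ContinuousAt (fun τ : ℝ × ℝ × ℝ => c.f τ.1) τ := ContinuousAt.comp
      (f := fun τ : ℝ × ℝ × ℝ => τ.1) (h.hf _ hτ.1).continuousAt (by fun_prop)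
    refine ContinuousAt.continuousWithinAt ?_
    fun_prop
  cont₂ τ hτ := by
    have c1 : ContinuousAt (fun τ : ℝ × ℝ × ℝ => c.a τ.2.1) τ := ContinuousAt.comp
      (f := fun τ : ℝ × ℝ × ℝ => τ.2.1) (h.ha _ hτ.2.1).continuousAt (by fun_prop)
    have c2 : ContinuousAt (fun τ : ℝ × ℝ × ℝ => c.f τ.2.1) τ := ContinuousAt.comp
      (f := fun τ : ℝ × ℝ × ℝ => τ.2.1) (h.hf _ hτ.2.1).continuousAt (by fun_prop)
    refine ContinuousAt.continuousWithinAt ?_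
    fun_prop
  cont₃ τ hτ := by
    have c1 : ContinuousAt (fun τ : ℝ × ℝ × ℝ => c.a τ.2.2) τ := ContinuousAt.comp
      (f := fun τ : ℝ × ℝ × ℝ => τ.2.2) (h.ha _ hτ.2.2).continuousAt (by fun_prop)
    have c2 : ContinuousAt (fun τ : ℝ × ℝ × ℝ => c.f τ.2.2) τ := ContinuousAt.comp
      (f := fun τ : ℝ × ℝ × ℝ => τ.2.2) (h.hf _ hτ.2.2).continuousAt (by fun_prop)
    refine ContinuousAt.continuousWithinAt ?_
    fun_prop
  cramer y τ := by
    ext <;> simp [prodFour, rightInvField, num₁, num₂, num₃, jac, det₀, det₂, det₃, e₁, e₃,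
      yTilde, S] <;> ring

end CurveData.IsNormalized

/-! ### Domains with gaps -/

/-- The cube `[2, 8]³`. -/
def timeBox : Set (ℝ × ℝ × ℝ) := Icc (2 : ℝ) 8 ×ˢ Icc (2 : ℝ) 8 ×ˢ Icc (2 : ℝ) 8

/-- The triples `s < t < r` with gaps of length at least `η`, and `u ≤ t`. -/
def gapSet₁ (η u : ℝ) : Set (ℝ × ℝ × ℝ) :=
  timeBox ∩ ({τ | τ.2.1 + η ≤ τ.1} ∩ ({τ | τ.1 + η ≤ τ.2.2} ∩ {τ | u ≤ τ.1}))

/-- The triples `t < s < r` with gaps of length at least `η`, and `u ≤ t`. -/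
def gapSet₂ (η u : ℝ) : Set (ℝ × ℝ × ℝ) :=
  timeBox ∩ ({τ | τ.1 + η ≤ τ.2.1} ∩ ({τ | τ.2.1 + η ≤ τ.2.2} ∩ {τ | u ≤ τ.1}))

/-- The triples `t < r < s` with gaps of length at least `η`. -/
def gapSet₃ (η : ℝ) : Set (ℝ × ℝ × ℝ) :=
  timeBox ∩ ({τ | τ.1 + η ≤ τ.2.2} ∩ {τ | τ.2.2 + η ≤ τ.2.1})

lemma isCompact_timeBox : IsCompact timeBox :=
  isCompact_Icc.prod (isCompact_Icc.prod isCompact_Icc)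

lemma convex_timeBox : Convex ℝ timeBox :=
  (convex_Icc _ _).prod ((convex_Icc _ _).prod (convex_Icc _ _))

lemma convex_setOf_add_le {p q : ℝ × ℝ × ℝ → ℝ} (hp : IsLinearMap ℝ p) (hq : IsLinearMap ℝ q)
    (η : ℝ) : Convex ℝ {τ | p τ + η ≤ q τ} := by
  intro x hx y hy a b ha hb hab
  simp only [mem_ofPred_eq, hp.map_add, hp.map_smul, hq.map_add, hq.map_smul, smul_eq_mul] at *
  have h1 := mul_le_mul_of_nonneg_left hx ha
  have h2 := mul_le_mul_of_nonneg_left hy hb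
  have : η = a * η + b * η := by rw [← add_mul, hab, one_mul]
  linarith

lemma convex_setOf_le_fst (u : ℝ) : Convex ℝ {τ : ℝ × ℝ × ℝ | u ≤ τ.1} :=
  convex_halfSpace_ge ⟨fun _ _ => rfl, fun _ _ => rfl⟩ u

lemma isCompact_gapSet₁ (η u : ℝ) : IsCompact (gapSet₁ η u) :=
  isCompact_timeBox.inter_right ((isClosed_le (by fun_prop) (by fun_prop)).inter
    ((isClosed_le (by fun_prop) (by fun_prop)).inter (isClosed_le (by fun_prop) (by fun_prop))))

lemma isCompact_gapSet₂ (η u : ℝ) : IsCompact (gapSet₂ η u) :=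
  isCompact_timeBox.inter_right ((isClosed_le (by fun_prop) (by fun_prop)).inter
    ((isClosed_le (by fun_prop) (by fun_prop)).inter (isClosed_le (by fun_prop) (by fun_prop))))

lemma isCompact_gapSet₃ (η : ℝ) : IsCompact (gapSet₃ η) :=
  isCompact_timeBox.inter_right ((isClosed_le (by fun_prop) (by fun_prop)).inter
    (isClosed_le (by fun_prop) (by fun_prop)))

lemma convex_gapSet₁ (η u : ℝ) : Convex ℝ (gapSet₁ η u) :=
  convex_timeBox.inter ((convex_setOf_add_le ⟨fun _ _ => rfl, fun _ _ => rfl⟩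
    ⟨fun _ _ => rfl, fun _ _ => rfl⟩ η).inter ((convex_setOf_add_le ⟨fun _ _ => rfl, fun _ _ => rfl⟩
    ⟨fun _ _ => rfl, fun _ _ => rfl⟩ η).inter (convex_setOf_le_fst u)))

lemma convex_gapSet₂ (η u : ℝ) : Convex ℝ (gapSet₂ η u) :=
  convex_timeBox.inter ((convex_setOf_add_le ⟨fun _ _ => rfl, fun _ _ => rfl⟩
    ⟨fun _ _ => rfl, fun _ _ => rfl⟩ η).inter ((convex_setOf_add_le ⟨fun _ _ => rfl, fun _ _ => rfl⟩
    ⟨fun _ _ => rfl, fun _ _ => rfl⟩ η).inter (convex_setOf_le_fst u)))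

lemma convex_gapSet₃ (η : ℝ) : Convex ℝ (gapSet₃ η) :=
  convex_timeBox.inter ((convex_setOf_add_le ⟨fun _ _ => rfl, fun _ _ => rfl⟩
    ⟨fun _ _ => rfl, fun _ _ => rfl⟩ η).inter (convex_setOf_add_le ⟨fun _ _ => rfl, fun _ _ => rfl⟩
    ⟨fun _ _ => rfl, fun _ _ => rfl⟩ η))

/-- The constant for the lower bounds at times separated by gaps of length `η`. -/
def gapConst (κ η : ℝ) : ℝ := (κ * η) ^ 2 / 128

/-- The constant for the upper bounds at times separated by gaps of length `η`. -/
def gapBound (κ η L : ℝ) : ℝ := 100 * L * (gapConst κ η ^ 3)⁻¹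

namespace CurveData.IsNormalized

variable {c : CurveData} {κ η L k u θ δ M e R : ℝ} {y τ : ℝ × ℝ × ℝ} (h : c.IsNormalized κ)
include h

lemma isConst (hη : 0 < η) (hη1 : η ≤ 1) (hL : 1 ≤ L) :
    IsConst κ (gapConst κ η) (gapConst κ η ^ 3)⁻¹ (gapBound κ η L) := by
  have h0 : 0 < κ * η := mul_pos h.κ_pos hη
  have h1 : κ * η ≤ 1 := by nlinarith [h.κ_pos, h.κ_le]
  have h2 : κ * η ≤ κ := by nlinarith [h.κ_pos]
  have h3 : (κ * η) ^ 2 ≤ κ * η := by nlinarith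
  have hp : 0 < gapConst κ η := by unfold gapConst; positivity
  refine ⟨hp, by unfold gapConst; linarith, by unfold gapConst; linarith, ?_, ?_⟩
  · rw [inv_mul_cancel₀ (by positivity)]
  · unfold gapBound
    gcongr
    linarith

lemma isConf₁ (hk : 0 ≤ k) (hk1 : k ≤ 1) (hη : 0 < η) (hη1 : η ≤ 1) (hu : u ∈ Icc (2 : ℝ) 8)
    (hτ : τ ∈ gapSet₁ η u) : c.IsConf₁ (gapConst κ η) k u τ.1 τ.2.1 τ.2.2 := by
  obtain ⟨⟨b1, b2, b3⟩, h1, h2, h3⟩ := hτ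
  simp only [mem_ofPred_eq] at h1 h2 h3
  exact ⟨hk, hk1, h.isGap b2 b1 hη hη1 h1, h.isGap b1 b3 hη hη1 h2,
    h.isGap hu b3 hη hη1 (by linarith)⟩

lemma isConf₂ (hk : 0 ≤ k) (hk1 : k ≤ 1) (hη : 0 < η) (hη1 : η ≤ 1) (hu : u ∈ Icc (2 : ℝ) 8)
    (hτ : τ ∈ gapSet₂ η u) : c.IsConf₂ (gapConst κ η) k u τ.1 τ.2.1 τ.2.2 := by
  obtain ⟨⟨b1, b2, b3⟩, h1, h2, h3⟩ := hτ
  simp only [mem_ofPred_eq] at h1 h2 h3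
  exact ⟨hk, hk1, h.isGap b1 b2 hη hη1 h1, h.isGap b2 b3 hη hη1 h2,
    h.isGap hu b3 hη hη1 (by linarith)⟩

lemma isConf₃ (hη : 0 < η) (hη1 : η ≤ 1)
    (hτ : τ ∈ gapSet₃ η) : c.IsConf₃ (gapConst κ η) τ.1 τ.2.1 τ.2.2 := by
  obtain ⟨⟨b1, b2, b3⟩, h1, h2⟩ := hτ
  simp only [mem_ofPred_eq] at h1 h2
  exact ⟨h.isGap b1 b3 hη hη1 h1, h.isGap b3 b2 hη hη1 h2, h.isGap b1 b2 hη hη1 (by linarith)⟩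

variable (C : IsConst κ (gapConst κ η) R M) (hθ : 0 < θ) (hθ1 : θ ≤ 1) (hη : 0 < η) (hη1 : η ≤ 1)
  (h1 : |y.1| ≤ δ) (h2 : |y.2.1| ≤ δ) (h3 : |y.2.2| ≤ δ)
include C hθ hθ1 hη hη1 h1 h2 h3

theorem hasLineBounds₁ (hk : 0 ≤ k) (hk1 : k ≤ 1) (hu : u ∈ Icc (2 : ℝ) 8) :
    c.HasLineBounds (-1) 1 (-1) k u θ M (300 * δ * θ⁻¹ ^ 4 * M ^ 6) y (gapSet₁ η u) where
  isCompact := isCompact_gapSet₁ η u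
  convex := convex_gapSet₁ η u
  subset := inter_subset_left
  size_pos _ hτ := h.size_pos₁ C (h.isConf₁ hk hk1 hη hη1 hu hτ)
  line₁ _ _ _ _ h01 hx _ _ hg hg' := h.lintegral_line₁_conf₁ C h01 hθ hθ1
    (fun x hx' => h.isConf₁ hk hk1 hη hη1 hu (hx x hx')) h1 h2 h3 hg hg'
  line₂ _ _ _ _ h01 hx _ _ hg hg' := h.lintegral_line₂_conf₁ C h01 hθ hθ1
    (fun x hx' => h.isConf₁ hk hk1 hη hη1 hu (hx x hx')) h1 h2 h3 hg hg'
  line₃ _ _ _ _ h01 hx _ _ hg hg' := h.lintegral_line₃_conf₁ C h01 hθ hθ1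
    (fun x hx' => h.isConf₁ hk hk1 hη hη1 hu (hx x hx')) h1 h2 h3 hg hg'

theorem hasLineBounds₂ (hk : 0 ≤ k) (hk1 : k ≤ 1) (hu : u ∈ Icc (2 : ℝ) 8) :
    c.HasLineBounds 1 1 1 k u θ M (300 * δ * θ⁻¹ ^ 4 * M ^ 6) y (gapSet₂ η u) where
  isCompact := isCompact_gapSet₂ η u
  convex := convex_gapSet₂ η u
  subset := inter_subset_left
  size_pos _ hτ := h.size_pos₂ C (h.isConf₂ hk hk1 hη hη1 hu hτ)
  line₁ _ _ _ _ h01 hx _ _ hg hg' := h.lintegral_line₁_conf₂ C h01 hθ hθ1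
    (fun x hx' => h.isConf₂ hk hk1 hη hη1 hu (hx x hx')) h1 h2 h3 hg hg'
  line₂ _ _ _ _ h01 hx _ _ hg hg' := h.lintegral_line₂_conf₂ C h01 hθ hθ1
    (fun x hx' => h.isConf₂ hk hk1 hη hη1 hu (hx x hx')) h1 h2 h3 hg hg'
  line₃ _ _ _ _ h01 hx _ _ hg hg' := h.lintegral_line₃_conf₂ C h01 hθ hθ1
    (fun x hx' => h.isConf₂ hk hk1 hη hη1 hu (hx x hx')) h1 h2 h3 hg hg'

theorem hasLineBounds₃ (u : ℝ) :
    c.HasLineBounds (-1) (-1) 1 0 u θ M (300 * δ * θ⁻¹ ^ 4 * M ^ 6) y (gapSet₃ η) where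
  isCompact := isCompact_gapSet₃ η
  convex := convex_gapSet₃ η
  subset := inter_subset_left
  size_pos _ hτ := h.size_pos₃ C (h.isConf₃ hη hη1 hτ)
  line₁ _ _ _ _ h01 hx _ _ hg hg' := h.lintegral_line₁_conf₃ C h01 hθ hθ1
    (fun x hx' => h.isConf₃ hη hη1 (hx x hx')) h1 h2 h3 hg hg'
  line₂ _ _ _ _ h01 hx _ _ hg hg' := h.lintegral_line₂_conf₃ C h01 hθ hθ1
    (fun x hx' => h.isConf₃ hη hη1 (hx x hx')) h1 h2 h3 hg hg'
  line₃ _ _ _ _ h01 hx _ _ hg hg' := h.lintegral_line₃_conf₃ C h01 hθ hθ1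
    (fun x hx' => h.isConf₃ hη hη1 (hx x hx')) h1 h2 h3 hg hg'

end CurveData.IsNormalized

/-! ### The cost of the regularisation -/

lemma sub_regQuot_self {θ D S : ℝ} (hθ : 0 < θ) (hS : 0 < S) (g : ℂ) :
    g - regQuot θ D D S g = ((θ ^ 2 * S ^ 2 / (D ^ 2 + θ ^ 2 * S ^ 2) : ℝ) : ℂ) * g := by
  have hE : D ^ 2 + θ ^ 2 * S ^ 2 ≠ 0 := by positivity
  have : θ ^ 2 * S ^ 2 / (D ^ 2 + θ ^ 2 * S ^ 2) = 1 - D * (D / (D ^ 2 + θ ^ 2 * S ^ 2)) := by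
    field_simp; ring
  rw [this]
  unfold regQuot; push_cast; ring

lemma norm_sub_regQuot_le {θ D S : ℝ} (hθ : 0 < θ) (hS : 0 < S) (g : ℂ) :
    ‖g - regQuot θ D D S g‖ ≤ ‖g‖ := by
  rw [sub_regQuot_self hθ hS, norm_mul, Complex.norm_real, Real.norm_eq_abs,
    abs_of_nonneg (by positivity)]
  refine mul_le_of_le_one_left (norm_nonneg _) ((div_le_one (by positivity)).2 ?_)
  linarith [sq_nonneg D]

/-- Where the determinant exceeds a small multiple of its size, the regularisation changes little.
-/
lemma norm_sub_regQuot_le_mul {l D S : ℝ} (hl : 0 < l) (hS : 0 < S) (hD : l * S ≤ |D|) (g : ℂ) :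
    ‖g - regQuot (l ^ 2) D D S g‖ ≤ l ^ 2 * ‖g‖ := by
  have hθ : 0 < l ^ 2 := by positivity
  rw [sub_regQuot_self hθ hS, norm_mul, Complex.norm_real, Real.norm_eq_abs,
    abs_of_nonneg (by positivity)]
  refine mul_le_mul_of_nonneg_right ?_ (norm_nonneg _)
  rw [div_le_iff₀ (by positivity)]
  have h1 : (l * S) ^ 2 ≤ D ^ 2 := by
    rw [← sq_abs D]; exact pow_le_pow_left₀ (by positivity) hD 2
  have h2 : 0 ≤ l ^ 2 * ((l ^ 2) ^ 2 * S ^ 2) := by positivity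
  nlinarith

/-- The numerical end of the argument in `mul_sub_le_of_abs_jac_le`. -/
lemma six_mul_le_of_ratio_le {κ η τ : ℝ} (hκ : 0 < κ) (hκ1 : κ ≤ 1) (hη : 0 < η) (hη1 : η ≤ 1 / 2)
    (hτ : 0 < τ) (h : (1 - η ^ 2) ^ 2 * (1 + κ * τ ^ 2 / 48) ≤ (1 + η ^ 2) ^ 2) :
    κ * (6 * τ) ≤ 120 * η := by
  have l1 : η ^ 2 ≤ 1 / 4 := by nlinarith
  generalize hl : η ^ 2 = l at *
  have hm0 : 0 ≤ κ * τ ^ 2 / 48 := by positivity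
  have hm2 : κ * τ ^ 2 / 48 ≤ 64 / 9 * l := by
    have h1 : 9 / 16 ≤ (1 - l) ^ 2 := by nlinarith
    have h2 : κ * τ ^ 2 / 48 * (1 - l) ^ 2 ≤ 4 * l := by linarith
    linarith [mul_le_mul_of_nonneg_left h1 hm0]
  have h3 : (κ * τ) ^ 2 ≤ (20 * η) ^ 2 := by
    have h4 : κ * (κ * τ ^ 2) ≤ 1 * (1024 / 3 * l) :=
      mul_le_mul hκ1 (by linarith) (by positivity) zero_le_one
    have h5 : 0 ≤ l := hl ▸ sq_nonneg η
    rw [mul_pow 20, hl]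
    linarith
  linarith [le_of_sq_le_sq h3 (by positivity)]

namespace CurveData.IsNormalized

variable {c : CurveData} {κ η k u s r e R M L : ℝ} (h : c.IsNormalized κ)
include h

/-- The contribution of the conjugation grows quadratically, relative to the velocity. -/
lemma mul_S_le_S_mul {t₁ t₂ τ : ℝ} (hs : s ∈ Icc (2 : ℝ) 8) (h1 : t₁ ∈ Icc (2 : ℝ) 8)
    (h2 : t₂ ∈ Icc (2 : ℝ) 8) (hs1 : s ≤ t₁) (hτ : 0 < τ) (hτ1 : τ ≤ 1) (h12 : t₁ + τ ≤ t₂) :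
    (1 + κ * τ ^ 2 / 48) * c.S s t₁ * (c.a t₂ - c.a s) ≤ c.S s t₂ * (c.a t₁ - c.a s) := by
  have h12' : t₁ ≤ t₂ := by linarith
  have S2 := h.le_S_of_le h1 h2 hτ hτ1 h12
  have S1 := h.S_nonneg_of_le hs h1 hs1
  have S1' := h.S_nonneg_of_ge hs h1 hs1
  have ax := sub_nonneg.2 (h.a_le hs h1 hs1)
  have ay := sub_nonneg.2 (h.a_le h1 h2 h12')
  have as := h.a_pos hs
  have hκ := h.κ_pos
  have eS1 : c.S s t₁ ≤ (t₁ - s) * (c.a t₁ - c.a s) := by unfold S at *; linarith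
  have eS2 : c.S s t₂ = c.S s t₁ + (t₁ - s) * (c.a t₂ - c.a t₁) + c.S t₁ t₂ := by unfold S; ring
  have i1 : c.S s t₁ * (c.a t₂ - c.a t₁) ≤ (t₁ - s) * (c.a t₁ - c.a s) * (c.a t₂ - c.a t₁) :=
    mul_le_mul_of_nonneg_right eS1 ay
  have i2 : κ * τ ^ 2 / 48 * c.S s t₁ * (c.a t₂ - c.a s) ≤ c.S t₁ t₂ * (c.a t₁ - c.a s) := by
    have j1 : c.S s t₁ ≤ 6 * (c.a t₁ - c.a s) :=
      eS1.trans (mul_le_mul_of_nonneg_right (by linarith [hs.1, h1.2]) ax)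
    calc κ * τ ^ 2 / 48 * c.S s t₁ * (c.a t₂ - c.a s)
        ≤ κ * τ ^ 2 / 48 * (6 * (c.a t₁ - c.a s)) * c.a t₂ := by
          gcongr
          · linarith
          · linarith
      _ = κ * τ ^ 2 / 8 * c.a t₂ * (c.a t₁ - c.a s) := by ring
      _ ≤ _ := mul_le_mul_of_nonneg_right S2 ax
  rw [eS2]
  nlinarith

/-- In the order `s < t < r`, the determinant vanishes for at most one value of `t`, and it can be
small only near that value: the ratio of the positive to the negative contributions increases. -/
lemma mul_sub_le_of_abs_jac_le (C : IsConst κ e R M) {t₁ t₂ : ℝ} (O₁ : c.IsConf₁ e k u t₁ s r)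
    (O₂ : c.IsConf₁ e k u t₂ s r) (hη : 0 < η) (hη1 : η ≤ 1 / 2) (h12 : t₁ ≤ t₂)
    (b₁ : |c.jac k u t₁ s r| ≤ η ^ 2 * c.size (-1) 1 (-1) k u t₁ s r)
    (b₂ : |c.jac k u t₂ s r| ≤ η ^ 2 * c.size (-1) 1 (-1) k u t₂ s r) :
    κ * (t₂ - t₁) ≤ 120 * η := by
  rcases h12.eq_or_lt with rfl | hlt
  · rw [sub_self, mul_zero]; positivity
  have hs := O₁.st.mem_left
  have h1 := O₁.st.mem_right
  have h2 := O₂.st.mem_right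
  have hr := O₁.tr.mem_right
  set τ := min (t₂ - t₁) 1 with hτ
  have τ0 : 0 < τ := lt_min (by linarith) one_pos
  have τ1 : τ ≤ 1 := min_le_right _ _
  have τ2 : t₁ + τ ≤ t₂ := by linarith [min_le_left (t₂ - t₁) 1]
  have τ6 : t₂ - t₁ ≤ 6 * τ := by
    rcases min_choice (t₂ - t₁) 1 with h' | h' <;> rw [hτ, h'] <;> linarith [h1.1, h2.2]
  have key := h.mul_S_le_S_mul hs h1 h2 O₁.st.le τ0 τ1 τ2
  set m := κ * τ ^ 2 / 48 with hm
  have m0 : 0 ≤ m := by have := h.κ_pos; positivity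
  have e0 := C.e_pos
  have as := h.a_pos hs
  have x1 : 0 < c.a t₁ - c.a s := (mul_pos e0 (h.a_pos h1)).trans_le O₁.st.a_sub
  have x2 : 0 < c.a t₂ - c.a s := (mul_pos e0 (h.a_pos h2)).trans_le O₂.st.a_sub
  have hcb : 0 < c.a r - c.a s := by linarith [h.a_le h1 hr O₁.tr.le]
  have S1 : 0 < c.S s t₁ := (mul_pos e0 (h.a_pos h1)).trans_le O₁.st.S_ge
  have ξ0 := h.ξ_pos
  -- the contributions of both signs at the two times
  set X₁ := -c.det₀ t₁ s r + -c.det₃ k u t₁ s r with hX₁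
  set X₂ := -c.det₀ t₂ s r + -c.det₃ k u t₂ s r with hX₂
  have d1 : 0 < c.det₂ t₁ s r := by unfold det₂; positivity
  have hX : X₂ * (c.a t₁ - c.a s) ≤ X₁ * (c.a t₂ - c.a s) := by
    have J0 := mul_nonneg hcb.le (h.J_nonneg hs h1 h2 O₁.st.le h12)
    rw [hX₁, hX₂, det₀_eq_neg_J, det₀_eq_neg_J]
    unfold J T Y det₃ at *
    linarith
  have hd : (1 + m) * c.det₂ t₁ s r * (c.a t₂ - c.a s) ≤ c.det₂ t₂ s r * (c.a t₁ - c.a s) := by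
    have : 0 ≤ 2 * c.ξ * (c.a r - c.a s) := by positivity
    have := mul_le_mul_of_nonneg_left key this
    unfold det₂; linarith
  have j₁ : (1 - η ^ 2) * X₁ ≤ (1 + η ^ 2) * c.det₂ t₁ s r := by
    have := (abs_le.1 b₁).1
    unfold jac size at this
    linarith
  have j₂ : (1 - η ^ 2) * c.det₂ t₂ s r ≤ (1 + η ^ 2) * X₂ := by
    have := (abs_le.1 b₂).2
    unfold jac size at this
    linarith
  have l1 : η ^ 2 ≤ 1 / 4 := by nlinarith
  set l := η ^ 2 with hl
  have l0 : 0 < l := by positivity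
  have chain : (1 - l) ^ 2 * (1 + m) * (c.det₂ t₁ s r * (c.a t₂ - c.a s))
      ≤ (1 + l) ^ 2 * (c.det₂ t₁ s r * (c.a t₂ - c.a s)) := by
    calc (1 - l) ^ 2 * (1 + m) * (c.det₂ t₁ s r * (c.a t₂ - c.a s))
        = (1 - l) ^ 2 * ((1 + m) * c.det₂ t₁ s r * (c.a t₂ - c.a s)) := by ring
      _ ≤ (1 - l) ^ 2 * (c.det₂ t₂ s r * (c.a t₁ - c.a s)) := by gcongr
      _ = (1 - l) * (c.a t₁ - c.a s) * ((1 - l) * c.det₂ t₂ s r) := by ring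
      _ ≤ (1 - l) * (c.a t₁ - c.a s) * ((1 + l) * X₂) :=
          mul_le_mul_of_nonneg_left j₂ (mul_nonneg (by linarith) x1.le)
      _ = (1 - l) * (1 + l) * (X₂ * (c.a t₁ - c.a s)) := by ring
      _ ≤ (1 - l) * (1 + l) * (X₁ * (c.a t₂ - c.a s)) :=
          mul_le_mul_of_nonneg_left hX (mul_nonneg (by linarith) (by linarith))
      _ = (1 + l) * (c.a t₂ - c.a s) * ((1 - l) * X₁) := by ring
      _ ≤ (1 + l) * (c.a t₂ - c.a s) * ((1 + l) * c.det₂ t₁ s r) :=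
          mul_le_mul_of_nonneg_left j₁ (mul_nonneg (by linarith) x2.le)
      _ = _ := by ring
  have hm1 := le_of_mul_le_mul_right chain (mul_pos d1 x2)
  exact (mul_le_mul_of_nonneg_left τ6 h.κ_pos.le).trans
    (six_mul_le_of_ratio_le h.κ_pos h.κ_le hη hη1 τ0 hm1)

end CurveData.IsNormalized

/-- The points where `q` is not small lie within `ρ` of one another, hence in an interval of
length `2 ρ`. -/
lemma lintegral_Icc_le_of_near {q : ℝ → ℂ} {bad : ℝ → Prop} {x₀ x₁ ε ρ L : ℝ} (hε : 0 ≤ ε)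
    (hL : 0 ≤ L) (hρ : 0 ≤ ρ) (hx : x₁ - x₀ ≤ 6) (h1 : ∀ x ∈ Icc x₀ x₁, ‖q x‖ ≤ L)
    (h2 : ∀ x ∈ Icc x₀ x₁, ¬ bad x → ‖q x‖ ≤ ε * L)
    (h3 : ∀ x ∈ Icc x₀ x₁, ∀ x' ∈ Icc x₀ x₁, bad x → bad x' → x ≤ x' → x' - x ≤ ρ) :
    ∫⁻ x in Icc x₀ x₁, ‖q x‖ₑ ≤ ENNReal.ofReal ((6 * ε + 2 * ρ) * L) := by
  obtain ⟨z, hz⟩ : ∃ z, ∀ x ∈ Icc x₀ x₁, bad x → x ∈ Icc (z - ρ) (z + ρ) := by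
    by_cases hb : ∃ z ∈ Icc x₀ x₁, bad z
    · obtain ⟨z, hz, hbz⟩ := hb
      refine ⟨z, fun x hx hbx => ?_⟩
      rcases le_total x z with hxz | hxz
      · exact ⟨by linarith [h3 x hx z hz hbx hbz hxz], by linarith⟩
      · exact ⟨by linarith, by linarith [h3 z hz x hx hbz hbx hxz]⟩
    · exact ⟨0, fun x hx hbx => (hb ⟨x, hx, hbx⟩).elim⟩
  calc ∫⁻ x in Icc x₀ x₁, ‖q x‖ₑ
      ≤ ∫⁻ x in Icc x₀ x₁, (ENNReal.ofReal (ε * L)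
          + (Icc (z - ρ) (z + ρ)).indicator (fun _ => ENNReal.ofReal L) x) := by
        refine setLIntegral_mono' measurableSet_Icc fun x hx => ?_
        rw [← ofReal_norm]
        by_cases hb : bad x
        · rw [indicator_of_mem (hz x hx hb)]
          exact (ENNReal.ofReal_le_ofReal (h1 x hx)).trans le_add_self
        · exact (ENNReal.ofReal_le_ofReal (h2 x hx hb)).trans le_self_add
    _ ≤ ENNReal.ofReal (ε * L) * ENNReal.ofReal 6
          + ENNReal.ofReal L * ENNReal.ofReal (2 * ρ) := by
        rw [lintegral_add_left measurable_const, setLIntegral_const, Real.volume_Icc]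
        refine add_le_add (by gcongr) ((setLIntegral_le_lintegral _ _).trans ?_)
        rw [lintegral_indicator measurableSet_Icc, setLIntegral_const, Real.volume_Icc]
        gcongr
        linarith
    _ = _ := by
        rw [← ENNReal.ofReal_mul (by positivity), ← ENNReal.ofReal_mul hL,
          ← ENNReal.ofReal_add (by positivity) (by positivity)]
        congr 1; ring

lemma IsTestFunction.continuous_sub_heisMul {φ : ℝ × ℝ × ℝ → ℝ} (hφ : IsTestFunction φ) (ξ : ℝ)
    (y : ℝ × ℝ × ℝ) {F : ℝ × ℝ × ℝ → ℝ × ℝ × ℝ} (hF : Continuous F) :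
    Continuous fun τ => ((φ (F τ) - φ (heisMul ξ (-y) (F τ)) : ℝ) : ℂ) :=
  Complex.continuous_ofReal.comp ((hφ.contDiff.continuous.comp hF).sub
    (hφ.contDiff.continuous.comp ((continuous_heisMul ξ).comp (continuous_const.prodMk hF))))

lemma IsTestFunction.norm_sub_heisMul_le_one {φ : ℝ × ℝ × ℝ → ℝ} (hφ : IsTestFunction φ) (ξ : ℝ)
    (y z : ℝ × ℝ × ℝ) : ‖((φ z - φ (heisMul ξ (-y) z) : ℝ) : ℂ)‖ ≤ 1 := by
  rw [Complex.norm_real, Real.norm_eq_abs, abs_le]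
  constructor <;> linarith [hφ.nonneg z, hφ.le_one z,
    hφ.nonneg (heisMul ξ (-y) z), hφ.le_one (heisMul ξ (-y) z)]

namespace CurveData

variable {c : CurveData} {κ η k u M L L' σ₀ σ₂ σ₃ B : ℝ} {y : ℝ × ℝ × ℝ} {D : Set (ℝ × ℝ × ℝ)}
  {g : ℝ × ℝ × ℝ → ℂ} (h : c.IsNormalized κ)
include h

/-- The regularisation costs `O(η)` in `L¹` if on each line in the first variable the determinant
is small only within distance `O(η)` of one point. -/
lemma lintegral_sub_regWeight_le (hη : 0 < η) (hη1 : η ≤ 1)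
    (H : c.HasLineBounds σ₀ σ₂ σ₃ k u ((η ^ 2) ^ 2) M B y D)
    (hbad : ∀ s r x x', (x, s, r) ∈ D → (x', s, r) ∈ D → x ≤ x' →
      |c.jac k u x s r| ≤ η ^ 2 * c.size σ₀ σ₂ σ₃ k u x s r →
      |c.jac k u x' s r| ≤ η ^ 2 * c.size σ₀ σ₂ σ₃ k u x' s r → κ * (x' - x) ≤ 120 * η)
    (hg : Continuous g) (hgD : tsupport g ⊆ D) (hL : 0 ≤ L) (hgL : ∀ τ, ‖g τ‖ ≤ L) :
    ∫⁻ τ, ‖g τ - c.regWeight σ₀ σ₂ σ₃ k u ((η ^ 2) ^ 2) g τ‖ₑ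
      ≤ ENNReal.ofReal (10000 * (η / κ) * L) := by
  have hκ := h.κ_pos
  have hθ : 0 < (η ^ 2) ^ 2 := by positivity
  have hηκ : η ≤ η / κ := by
    rw [le_div_iff₀ hκ]
    exact mul_le_of_le_one_right hη.le h.κ_le
  have key := lintegral_le_of_slice₁ (q := fun τ => g τ - c.regWeight σ₀ σ₂ σ₃ k u ((η ^ 2) ^ 2) g τ)
    (B := ENNReal.ofReal ((6 * (η ^ 2) ^ 2 + 2 * (120 * (η / κ))) * L))
    (hg.sub (continuous_regWeight h hθ H hg hgD)) H.isCompact H.convex H.subset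
    (fun τ hτ => by
      have : g τ = 0 := image_eq_zero_of_notMem_tsupport fun h => hτ (hgD h)
      simp [regWeight, regQuot, this])
    fun s r x₀ x₁ h01 hx => by
      have b0 := (H.subset (hx x₀ ⟨le_rfl, h01⟩)).1
      have b1 := (H.subset (hx x₁ ⟨h01, le_rfl⟩)).1
      refine lintegral_Icc_le_of_near
        (bad := fun x => |c.jac k u x s r| ≤ η ^ 2 * c.size σ₀ σ₂ σ₃ k u x s r)
        (by positivity) hL (by positivity) (by linarith [b0.1, b1.2]) (fun x hxx => ?_)
        (fun x hxx hb => ?_) fun x hxx x' hxx' hb hb' hle => ?_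
      · exact (norm_sub_regQuot_le hθ (H.size_pos _ (hx x hxx)) _).trans (hgL _)
      · refine (norm_sub_regQuot_le_mul (by positivity) (H.size_pos _ (hx x hxx))
          (not_le.1 hb).le _).trans ?_
        gcongr
        exact hgL _
      · have := hbad s r x x' (hx x hxx) (hx x' hxx') hle hb hb'
        rw [← mul_div_assoc, le_div_iff₀ hκ]
        linarith
  refine key.trans ?_
  rw [show (36 : ENNReal) = ENNReal.ofReal 36 by norm_num, ← ENNReal.ofReal_mul (by norm_num)]
  apply ENNReal.ofReal_le_ofReal
  have h4 : (η ^ 2) ^ 2 ≤ η := by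
    rw [← pow_mul]; exact pow_le_of_le_one hη.le hη1 (by norm_num)
  rw [← mul_assoc]
  exact mul_le_mul_of_nonneg_right (by linarith [div_pos hη hκ]) hL

variable {ε : ℝ} {F F₁ F₂ F₃ : ℝ × ℝ × ℝ → ℝ × ℝ × ℝ} {φ : ℝ × ℝ × ℝ → ℝ}

/-- A weight supported in a domain with line estimates is moved little by left translation. -/
lemma norm_integral_sub_le_of_hasLineBounds (hF : c.IsProductMap k u ε F F₁ F₂ F₃)
    (hη : 0 < η) (hη1 : η ≤ 1) (hB : 0 ≤ B)
    (H : c.HasLineBounds σ₀ σ₂ σ₃ k u ((η ^ 2) ^ 2) M B y D)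
    (hbad : ∀ s r x x', (x, s, r) ∈ D → (x', s, r) ∈ D → x ≤ x' →
      |c.jac k u x s r| ≤ η ^ 2 * c.size σ₀ σ₂ σ₃ k u x s r →
      |c.jac k u x' s r| ≤ η ^ 2 * c.size σ₀ σ₂ σ₃ k u x' s r → κ * (x' - x) ≤ 120 * η)
    (hg : ContDiff ℝ 1 g) (hgD : tsupport g ⊆ D) (hL : 0 ≤ L) (hgL : ∀ τ, ‖g τ‖ ≤ L)
    (hgM : ∀ τ, ‖g τ‖ ≤ M) (hgM' : ∀ τ, ‖fderiv ℝ g τ‖ ≤ M) (hφ : IsTestFunction φ) :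
    ‖∫ τ, ((φ (F τ) - φ (heisMul c.ξ (-y) (F τ)) : ℝ) : ℂ) * g τ‖
      ≤ 108 * B + 10000 * (η / κ) * L := by
  have hθ : 0 < (η ^ 2) ^ 2 := by positivity
  set w := c.regWeight σ₀ σ₂ σ₃ k u ((η ^ 2) ^ 2) g with hw
  have cw : Continuous w := continuous_regWeight h hθ H hg.continuous hgD
  have hgs : HasCompactSupport g := H.isCompact.of_isClosed_subset (isClosed_tsupport g) hgD
  have sw : HasCompactSupport w := hasCompactSupport_regQuot hgs
  have cφ := hφ.continuous_sub_heisMul c.ξ y hF.continuous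
  have iw : Integrable fun τ => ((φ (F τ) - φ (heisMul c.ξ (-y) (F τ)) : ℝ) : ℂ) * w τ :=
    (cφ.mul cw).integrable_of_hasCompactSupport sw.mul_left
  have id : Integrable fun τ => ((φ (F τ) - φ (heisMul c.ξ (-y) (F τ)) : ℝ) : ℂ) * (g τ - w τ) :=
    (cφ.mul (hg.continuous.sub cw)).integrable_of_hasCompactSupport (hgs.sub sw).mul_left
  have e : ∫ τ, ((φ (F τ) - φ (heisMul c.ξ (-y) (F τ)) : ℝ) : ℂ) * g τ
      = (∫ τ, ((φ (F τ) - φ (heisMul c.ξ (-y) (F τ)) : ℝ) : ℂ) * w τ)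
        + ∫ τ, ((φ (F τ) - φ (heisMul c.ξ (-y) (F τ)) : ℝ) : ℂ) * (g τ - w τ) := by
    rw [← integral_add iw id]
    exact integral_congr_ae (.of_forall fun τ => by ring)
  rw [e]
  refine (norm_add_le _ _).trans (add_le_add
    (norm_integral_regWeight_sub_le h hF hθ hB H hg hgD hgM hgM' hφ) ?_)
  refine (norm_integral_le_lintegral_norm _).trans (ENNReal.toReal_le_of_le_ofReal
    (by have := h.κ_pos; positivity)
    (le_trans (lintegral_mono fun τ => ?_) (lintegral_sub_regWeight_le h hη hη1 H hbad
      hg.continuous hgD hL hgL)))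
  rw [ofReal_norm, enorm_mul]
  refine mul_le_of_le_one_left zero_le (?_ : _ ≤ (1 : ENNReal))
  rw [← ofReal_norm]
  exact ENNReal.ofReal_le_one.2 (hφ.norm_sub_heisMul_le_one c.ξ y _)

/-- The bound for the effect of a left translation by `y` on a weight which is bounded by `L`, has
derivatives bounded by `L'` and is supported away from the diagonals by `η`. -/
def moveBound (κ η L L' : ℝ) (y : ℝ × ℝ × ℝ) : ℝ :=
  108 * (300 * ‖y‖ * ((η ^ 2) ^ 2)⁻¹ ^ 4 * gapBound κ η L' ^ 6) + 10000 * (η / κ) * L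

section

variable (hη : 0 < η) (hη1 : η ≤ 1 / 2) (hg : ContDiff ℝ 1 g) (hL : 0 ≤ L) (hL' : 1 ≤ L')
  (hLL : L ≤ L') (hgL : ∀ τ, ‖g τ‖ ≤ L) (hgL' : ∀ τ, ‖fderiv ℝ g τ‖ ≤ L') (hφ : IsTestFunction φ)
include hη hη1 hg hL hL' hLL hgL hgL' hφ

lemma norm_integral_sub_le_moveBound (hF : c.IsProductMap k u ε F F₁ F₂ F₃)
    (H : c.HasLineBounds σ₀ σ₂ σ₃ k u ((η ^ 2) ^ 2) (gapBound κ η L')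
      (300 * ‖y‖ * ((η ^ 2) ^ 2)⁻¹ ^ 4 * gapBound κ η L' ^ 6) y D) (hgD : tsupport g ⊆ D)
    (hbad : ∀ s r x x', (x, s, r) ∈ D → (x', s, r) ∈ D → x ≤ x' →
      |c.jac k u x s r| ≤ η ^ 2 * c.size σ₀ σ₂ σ₃ k u x s r →
      |c.jac k u x' s r| ≤ η ^ 2 * c.size σ₀ σ₂ σ₃ k u x' s r → κ * (x' - x) ≤ 120 * η) :
    ‖∫ τ, ((φ (F τ) - φ (heisMul c.ξ (-y) (F τ)) : ℝ) : ℂ) * g τ‖ ≤ moveBound κ η L L' y := by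
  have C := h.isConst hη (by linarith) hL'
  have hM : L' ≤ gapBound κ η L' := by
    have h1 : 1 ≤ (gapConst κ η ^ 3)⁻¹ := by
      refine (one_le_inv₀ (pow_pos C.e_pos 3)).2 (pow_le_one₀ C.e_pos.le ?_)
      exact C.e_le.trans h.κ_le
    unfold gapBound
    nlinarith
  have hM0 : 0 ≤ gapBound κ η L' := by linarith
  exact norm_integral_sub_le_of_hasLineBounds h hF hη (by linarith) (by positivity) H hbad hg hgD hL
    hgL (fun τ => (hgL τ).trans (hLL.trans hM)) (fun τ => (hgL' τ).trans hM) hφ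

lemma norm_integral_sub_le_of_gapSet₁ (hF : c.IsProductMap k u ε F F₁ F₂ F₃)
    (hk : 0 ≤ k) (hk1 : k ≤ 1) (hu : u ∈ Icc (2 : ℝ) 8) (hgD : tsupport g ⊆ gapSet₁ η u) :
    ‖∫ τ, ((φ (F τ) - φ (heisMul c.ξ (-y) (F τ)) : ℝ) : ℂ) * g τ‖ ≤ moveBound κ η L L' y := by
  have hη' : η ≤ 1 := by linarith
  have C := h.isConst hη hη' hL'
  refine norm_integral_sub_le_moveBound h hη hη1 hg hL hL' hLL hgL hgL' hφ hF
    (h.hasLineBounds₁ C (by positivity) (pow_le_one₀ (sq_nonneg _) (pow_le_one₀ hη.le hη')) hη hη'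
      (norm_fst_le y) ((norm_fst_le y.2).trans (norm_snd_le y))
      ((norm_snd_le y.2).trans (norm_snd_le y)) hk hk1 hu) hgD fun s r x x' hx hx' hxx b b' => ?_
  exact h.mul_sub_le_of_abs_jac_le C (h.isConf₁ hk hk1 hη hη' hu hx)
    (h.isConf₁ hk hk1 hη hη' hu hx') hη hη1 hxx b b'

/-- Here the determinant equals its size, and is never small in comparison with it. -/
lemma norm_integral_sub_le_of_gapSet₂ (hF : c.IsProductMap k u ε F F₁ F₂ F₃)
    (hk : 0 ≤ k) (hk1 : k ≤ 1) (hu : u ∈ Icc (2 : ℝ) 8) (hgD : tsupport g ⊆ gapSet₂ η u) :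
    ‖∫ τ, ((φ (F τ) - φ (heisMul c.ξ (-y) (F τ)) : ℝ) : ℂ) * g τ‖ ≤ moveBound κ η L L' y := by
  have hη' : η ≤ 1 := by linarith
  have C := h.isConst hη hη' hL'
  refine norm_integral_sub_le_moveBound h hη hη1 hg hL hL' hLL hgL hgL' hφ hF
    (h.hasLineBounds₂ C (by positivity) (pow_le_one₀ (sq_nonneg _) (pow_le_one₀ hη.le hη')) hη hη'
      (norm_fst_le y) ((norm_fst_le y.2).trans (norm_snd_le y))
      ((norm_snd_le y.2).trans (norm_snd_le y)) hk hk1 hu) hgD fun s r x x' hx hx' hxx b b' => ?_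
  have p := h.size_pos₂ C (h.isConf₂ hk hk1 hη hη' hu hx)
  rw [jac_eq_size, abs_of_pos p] at b
  exact absurd b (not_le.2 (mul_lt_of_lt_one_left p (by nlinarith)))

/-- Here the determinant is the opposite of its size, and is never small in comparison with it. -/
lemma norm_integral_sub_le_of_gapSet₃ (hF : c.IsProductMap 0 u ε F F₁ F₂ F₃)
    (hgD : tsupport g ⊆ gapSet₃ η) :
    ‖∫ τ, ((φ (F τ) - φ (heisMul c.ξ (-y) (F τ)) : ℝ) : ℂ) * g τ‖ ≤ moveBound κ η L L' y := by
  have hη' : η ≤ 1 := by linarith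
  have C := h.isConst hη hη' hL'
  refine norm_integral_sub_le_moveBound h hη hη1 hg hL hL' hLL hgL hgL' hφ hF
    (h.hasLineBounds₃ C (by positivity) (pow_le_one₀ (sq_nonneg _) (pow_le_one₀ hη.le hη')) hη hη'
      (norm_fst_le y) ((norm_fst_le y.2).trans (norm_snd_le y))
      ((norm_snd_le y.2).trans (norm_snd_le y)) u) hgD fun s r x x' hx hx' hxx b b' => ?_
  have p := h.size_pos₃ C (h.isConf₃ hη hη' hx) (u := u)
  have e : c.jac 0 u x s r = -c.size (-1) (-1) 1 0 u x s r := by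
    unfold jac size det₃; ring
  rw [e, abs_neg, abs_of_pos p] at b
  exact absurd b (not_le.2 (mul_lt_of_lt_one_left p (by nlinarith)))

end

end CurveData

/-! ### Cut-offs -/

lemma exists_abs_deriv_smoothTransition_le :
    ∃ K : ℝ, 1 ≤ K ∧ ∀ x, |deriv Real.smoothTransition x| ≤ K := by
  have hc : Continuous (deriv Real.smoothTransition) :=
    (Real.smoothTransition.contDiff (n := 1)).continuous_deriv le_rfl
  obtain ⟨K, hK⟩ := isCompact_Icc.exists_bound_of_continuousOn (hc.continuousOn (s := Icc 0 1))
  refine ⟨max K 1, le_max_right _ _, fun x => ?_⟩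
  by_cases hx : x ∈ Icc (0 : ℝ) 1
  · exact (hK x hx).trans (le_max_left _ _)
  have h0 : deriv Real.smoothTransition x = 0 := by
    rcases lt_or_ge x 0 with h | h
    · have : Real.smoothTransition =ᶠ[nhds x] fun _ => 0 := by
        filter_upwards [Iio_mem_nhds h] with z hz
        exact Real.smoothTransition.zero_of_nonpos (le_of_lt hz)
      rw [this.deriv_eq, deriv_const]
    · have h1 : 1 < x := by
        by_contra h'
        exact hx ⟨h, not_lt.1 h'⟩
      have : Real.smoothTransition =ᶠ[nhds x] fun _ => 1 := by
        filter_upwards [Ioi_mem_nhds h1] with z hz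
        exact Real.smoothTransition.one_of_one_le (le_of_lt hz)
      rw [this.deriv_eq, deriv_const]
  rw [h0, abs_zero]
  exact zero_le_one.trans (le_max_right _ _)

/-- A bound for the derivative of the smooth transition function. -/
def transitionBound : ℝ := exists_abs_deriv_smoothTransition_le.choose

lemma one_le_transitionBound : 1 ≤ transitionBound :=
  exists_abs_deriv_smoothTransition_le.choose_spec.1

lemma abs_deriv_smoothTransition_le (x : ℝ) : |deriv Real.smoothTransition x| ≤ transitionBound :=
  exists_abs_deriv_smoothTransition_le.choose_spec.2 x

/-- A smooth cut-off on the line, equal to `0` on `(-∞, η]` and to `1` on `[2η, ∞)`. -/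
def cutoff (η x : ℝ) : ℂ := (Real.smoothTransition (η⁻¹ * x - 1) : ℝ)

section Cutoff

variable {η x : ℝ} (hη : 0 < η)
include hη

lemma cutoff_of_le (hx : x ≤ η) : cutoff η x = 0 := by
  have : η⁻¹ * x ≤ 1 := by rwa [inv_mul_le_iff₀ hη, mul_one]
  unfold cutoff
  rw [Real.smoothTransition.zero_of_nonpos (by linarith), Complex.ofReal_zero]

lemma cutoff_of_two_mul_le (hx : 2 * η ≤ x) : cutoff η x = 1 := by
  have : 2 ≤ η⁻¹ * x := by rwa [le_inv_mul_iff₀ hη, mul_comm]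
  unfold cutoff
  rw [Real.smoothTransition.one_of_one_le (by linarith), Complex.ofReal_one]

omit hη in
lemma contDiff_cutoff : ContDiff ℝ 1 (cutoff η) :=
  Complex.ofRealCLM.contDiff.comp (Real.smoothTransition.contDiff.comp (by fun_prop))

omit hη in
lemma norm_cutoff_le : ‖cutoff η x‖ ≤ 1 := by
  unfold cutoff
  rw [Complex.norm_real, Real.norm_eq_abs, abs_of_nonneg (Real.smoothTransition.nonneg _)]
  exact Real.smoothTransition.le_one _

lemma norm_deriv_cutoff_le : ‖deriv (cutoff η) x‖ ≤ transitionBound / η := by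
  have h1 : HasDerivAt (fun x => η⁻¹ * x - 1) η⁻¹ x := by
    simpa using ((hasDerivAt_id x).const_mul η⁻¹).sub_const 1
  have h2 : HasDerivAt Real.smoothTransition (deriv Real.smoothTransition (η⁻¹ * x - 1))
      (η⁻¹ * x - 1) :=
    ((Real.smoothTransition.contDiff (n := 1)).differentiable one_ne_zero _).hasDerivAt
  have h3 := (h2.comp x h1).ofReal_comp
  have h4 : deriv (cutoff η) x = _ := h3.deriv
  rw [h4, Complex.norm_real, Real.norm_eq_abs, abs_mul, abs_of_pos (inv_pos.2 hη), div_eq_mul_inv]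
  exact mul_le_mul_of_nonneg_right (abs_deriv_smoothTransition_le _) (inv_pos.2 hη).le

end Cutoff

/-- A continuously differentiable function, bounded by `L`, with derivative bounded by `L'`. -/
structure IsC1Bounded (L L' : ℝ) (g : ℝ × ℝ × ℝ → ℂ) : Prop where
  contDiff : ContDiff ℝ 1 g
  norm_le : ∀ τ, ‖g τ‖ ≤ L
  norm_fderiv_le : ∀ τ, ‖fderiv ℝ g τ‖ ≤ L'

namespace IsC1Bounded

variable {L L' m m' : ℝ} {g q : ℝ × ℝ × ℝ → ℂ}

lemma mul (hg : IsC1Bounded L L' g) (hq : IsC1Bounded m m' q) :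
    IsC1Bounded (L * m) (L * m' + m * L') fun τ => g τ * q τ where
  contDiff := hg.contDiff.mul hq.contDiff
  norm_le τ := by
    rw [norm_mul]
    exact mul_le_mul (hg.norm_le τ) (hq.norm_le τ) (norm_nonneg _)
      ((norm_nonneg _).trans (hg.norm_le τ))
  norm_fderiv_le τ := by
    rw [fderiv_fun_mul (hg.contDiff.differentiable one_ne_zero τ)
      (hq.contDiff.differentiable one_ne_zero τ)]
    refine (norm_add_le _ _).trans (add_le_add ?_ ?_) <;> rw [norm_smul]
    · exact mul_le_mul (hg.norm_le τ) (hq.norm_fderiv_le τ) (norm_nonneg _)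
        ((norm_nonneg _).trans (hg.norm_le τ))
    · exact mul_le_mul (hq.norm_le τ) (hg.norm_fderiv_le τ) (norm_nonneg _)
        ((norm_nonneg _).trans (hq.norm_le τ))

lemma comp {f : ℝ → ℂ} {l : ℝ × ℝ × ℝ → ℝ} {n : NNReal} (hf : ContDiff ℝ 1 f)
    (hL : ∀ x, ‖f x‖ ≤ L) (hL' : ∀ x, ‖deriv f x‖ ≤ L') (hl : ContDiff ℝ 1 l)
    (hn : LipschitzWith n l) : IsC1Bounded L (L' * n) fun τ => f (l τ) where
  contDiff := hf.comp hl
  norm_le τ := hL _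
  norm_fderiv_le τ := by
    have : fderiv ℝ (fun τ => f (l τ)) τ = (fderiv ℝ f (l τ)).comp (fderiv ℝ l τ) :=
      fderiv_comp τ (hf.differentiable one_ne_zero _) (hl.differentiable one_ne_zero _)
    rw [this]
    refine (ContinuousLinearMap.opNorm_comp_le _ _).trans (mul_le_mul ?_
      (norm_fderiv_le_of_lipschitz ℝ hn) (norm_nonneg _) ((norm_nonneg _).trans (hL' 0)))
    rw [← norm_deriv_eq_norm_fderiv]
    exact hL' _

lemma mono {M' : ℝ} (hg : IsC1Bounded L L' g) (h : L' ≤ M') : IsC1Bounded L M' g :=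
  ⟨hg.contDiff, hg.norm_le, fun τ => (hg.norm_fderiv_le τ).trans h⟩

end IsC1Bounded

lemma lipschitzWith_fst_two : LipschitzWith 2 (fun τ : ℝ × ℝ × ℝ => τ.1) :=
  LipschitzWith.prod_fst.weaken (by norm_num)

lemma lipschitzWith_snd_fst_two : LipschitzWith 2 (fun τ : ℝ × ℝ × ℝ => τ.2.1) :=
  (LipschitzWith.prod_fst.comp LipschitzWith.prod_snd).weaken (by norm_num)

lemma lipschitzWith_snd_snd_two : LipschitzWith 2 (fun τ : ℝ × ℝ × ℝ => τ.2.2) :=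
  (LipschitzWith.prod_snd.comp LipschitzWith.prod_snd).weaken (by norm_num)

/-- Slightly smoothed indicator function of the times `t, s, r ≤ b`, `u₀ ≤ t` and of the
inequalities `0 ≤ p`, `0 ≤ q`, times a product of functions of `t`, `s` and `r`. -/
def cutWeight (η b u₀ : ℝ) (f₁ f₂ f₃ : ℝ → ℂ) (p q : ℝ × ℝ × ℝ → ℝ) (τ : ℝ × ℝ × ℝ) : ℂ :=
  f₁ τ.1 * f₂ τ.2.1 * f₃ τ.2.2 * cutoff η (b - τ.1) * cutoff η (b - τ.2.1) * cutoff η (b - τ.2.2)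
    * cutoff η (τ.1 - u₀) * cutoff η (p τ) * cutoff η (q τ)

/-- A continuously differentiable function supported in `[2, 8]`, bounded with its derivative
by `K`. -/
structure IsAmplitude (K : ℝ) (f : ℝ → ℂ) : Prop where
  contDiff : ContDiff ℝ 1 f
  norm_le : ∀ x, ‖f x‖ ≤ K
  norm_deriv_le : ∀ x, ‖deriv f x‖ ≤ K
  eq_zero : ∀ x ∉ Icc (2 : ℝ) 8, f x = 0

section

variable {η b u₀ K : ℝ} {f₁ f₂ f₃ : ℝ → ℂ} {p q : ℝ × ℝ × ℝ → ℝ}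
  (h₁ : IsAmplitude K f₁) (h₂ : IsAmplitude K f₂) (h₃ : IsAmplitude K f₃)

include h₁ h₂ h₃

/-- Each of the nine factors contributes at most `2 K³ transitionBound / η` to the derivative. -/
lemma isC1Bounded_cutWeight (hK : 1 ≤ K) (hη : 0 < η) (hη1 : η ≤ 1) (hp : ContDiff ℝ 1 p)
    (hp2 : LipschitzWith 2 p) (hq : ContDiff ℝ 1 q) (hq2 : LipschitzWith 2 q) :
    IsC1Bounded (K ^ 3) (18 * K ^ 3 * transitionBound / η) (cutWeight η b u₀ f₁ f₂ f₃ p q) := by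
  have A : ∀ {f : ℝ → ℂ} {l : ℝ × ℝ × ℝ → ℝ}, IsAmplitude K f → ContDiff ℝ 1 l →
      LipschitzWith 2 l → IsC1Bounded K (K * 2) fun τ => f (l τ) := fun hf hl hl2 =>
    IsC1Bounded.comp hf.contDiff hf.norm_le hf.norm_deriv_le hl hl2
  have B : ∀ {l : ℝ × ℝ × ℝ → ℝ}, ContDiff ℝ 1 l → LipschitzWith 2 l →
      IsC1Bounded 1 (transitionBound / η * 2) fun τ => cutoff η (l τ) := fun hl hl2 =>
    IsC1Bounded.comp contDiff_cutoff (fun _ => norm_cutoff_le) (fun _ => norm_deriv_cutoff_le hη)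
      hl hl2
  have C : ∀ {l : ℝ × ℝ × ℝ → ℝ}, ContDiff ℝ 1 l → LipschitzWith 2 l →
      IsC1Bounded 1 (transitionBound / η * 2) fun τ => cutoff η (b - l τ) := fun hl hl2 =>
    B (contDiff_const.sub hl) (by simpa using (LipschitzWith.const b).sub hl2)
  have D : IsC1Bounded 1 (transitionBound / η * 2) fun τ => cutoff η (τ.1 - u₀) :=
    B (contDiff_fst.sub contDiff_const)
      (by simpa using lipschitzWith_fst_two.sub (LipschitzWith.const u₀))
  have l2 : ContDiff ℝ 1 fun τ : ℝ × ℝ × ℝ => τ.2.1 := by fun_prop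
  have l3 : ContDiff ℝ 1 fun τ : ℝ × ℝ × ℝ => τ.2.2 := by fun_prop
  have key := (((((((((A h₁ contDiff_fst lipschitzWith_fst_two).mul
    (A h₂ l2 lipschitzWith_snd_fst_two)).mul (A h₃ l3 lipschitzWith_snd_snd_two)).mul
    (C contDiff_fst lipschitzWith_fst_two)).mul (C l2 lipschitzWith_snd_fst_two)).mul
    (C l3 lipschitzWith_snd_snd_two)).mul D).mul (B hp hp2)).mul (B hq hq2))
  have e : K * K * K * 1 * 1 * 1 * 1 * 1 * 1 = K ^ 3 := by ring
  rw [e] at key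
  refine key.mono ?_
  have hT := one_le_transitionBound
  have h1 : 1 ≤ transitionBound / η := by rw [le_div_iff₀ hη]; linarith
  have h2 : K ^ 3 ≤ K ^ 3 * (transitionBound / η) := le_mul_of_one_le_right (by positivity) h1
  rw [mul_div_assoc]
  ring_nf at h2 ⊢
  linarith

end

/-! ### Strips near the diagonals -/

section

variable {η b u₀ K : ℝ} {f₁ f₂ f₃ : ℝ → ℂ} {p q : ℝ × ℝ × ℝ → ℝ}
  (h₁ : IsAmplitude K f₁) (h₂ : IsAmplitude K f₂) (h₃ : IsAmplitude K f₃)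

include h₁ h₂ h₃

lemma mul_eq_zero_of_notMem_timeBox {τ : ℝ × ℝ × ℝ} (hτ : τ ∉ timeBox) :
    f₁ τ.1 * f₂ τ.2.1 * f₃ τ.2.2 = 0 := by
  by_contra h
  simp only [mul_eq_zero, not_or] at h
  exact hτ ⟨by_contra fun h' => h.1.1 (h₁.eq_zero _ h'), by_contra fun h' => h.1.2 (h₂.eq_zero _ h'),
    by_contra fun h' => h.2 (h₃.eq_zero _ h')⟩

lemma tsupport_cutWeight_subset {D : Set (ℝ × ℝ × ℝ)} (hD : IsClosed D) (hη : 0 < η)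
    (h : ∀ τ ∈ timeBox, u₀ ≤ τ.1 → η ≤ p τ → η ≤ q τ → τ ∈ D) :
    tsupport (cutWeight η b u₀ f₁ f₂ f₃ p q) ⊆ D := by
  refine closure_minimal (fun τ hτ => ?_) hD
  unfold cutWeight at hτ
  simp only [Function.mem_support, ne_eq, mul_eq_zero, not_or] at hτ
  obtain ⟨⟨⟨hn, hu⟩, hp⟩, hq⟩ := hτ
  have pos : ∀ {x}, cutoff η x ≠ 0 → η ≤ x := fun hx => by
    by_contra h'
    exact hx (cutoff_of_le hη (not_le.1 h').le)
  refine h τ (by_contra fun h' => ?_) (by linarith [pos hu]) (pos hp) (pos hq)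
  have := mul_eq_zero_of_notMem_timeBox h₁ h₂ h₃ h'
  simp only [mul_eq_zero] at this
  tauto

end

section Strips

lemma volume_le_of_slice {E : Set (ℝ × ℝ)} (hE : MeasurableSet E)
    (h : E ⊆ Icc (2 : ℝ) 8 ×ˢ Icc (2 : ℝ) 8) {B : ENNReal}
    (hB : ∀ r, volume ((fun s => ((s, r) : ℝ × ℝ)) ⁻¹' E) ≤ B) : volume E ≤ 6 * B := by
  rw [Measure.volume_eq_prod, Measure.prod_apply_symm hE]
  calc ∫⁻ r, volume ((fun s => ((s, r) : ℝ × ℝ)) ⁻¹' E)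
      ≤ ∫⁻ r, (Icc (2 : ℝ) 8).indicator (fun _ => B) r := by
        refine lintegral_mono fun r => ?_
        by_cases hr : r ∈ Icc (2 : ℝ) 8
        · rw [indicator_of_mem hr]; exact hB r
        · have : (fun s => ((s, r) : ℝ × ℝ)) ⁻¹' E = ∅ :=
            eq_empty_of_forall_notMem fun s hs => hr (h hs).2
          rw [this, measure_empty]
          exact zero_le
    _ = 6 * B := by
        rw [lintegral_indicator measurableSet_Icc, setLIntegral_const, Real.volume_Icc, mul_comm]
        norm_num

lemma volume_le_of_slice₁ {E : Set (ℝ × ℝ × ℝ)} (hE : MeasurableSet E) (h : E ⊆ timeBox)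
    {B : ENNReal} (hB : ∀ s r, volume ((fun t => ((t, s, r) : ℝ × ℝ × ℝ)) ⁻¹' E) ≤ B) :
    volume E ≤ 36 * B := by
  rw [Measure.volume_eq_prod, Measure.prod_apply_symm hE]
  refine lintegral_le_of_le_indicator fun p => ?_
  by_cases hp : p ∈ Icc (2 : ℝ) 8 ×ˢ Icc (2 : ℝ) 8
  · rw [indicator_of_mem hp]; exact hB p.1 p.2
  · have : (fun t => ((t, p) : ℝ × ℝ × ℝ)) ⁻¹' E = ∅ :=
      eq_empty_of_forall_notMem fun t ht => hp (h ht).2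
    rw [this, measure_empty]
    exact zero_le

lemma volume_abs_sub_lt_le {η : ℝ} {S : Set ℝ} (z : ℝ) (h : ∀ x ∈ S, |x - z| < 2 * η) :
    volume S ≤ ENNReal.ofReal (4 * η) := by
  refine (measure_mono (t := Ioo (z - 2 * η) (z + 2 * η)) fun x hx => ?_).trans (le_of_eq ?_)
  · have := abs_lt.1 (h x hx)
    exact ⟨by linarith, by linarith⟩
  · rw [Real.volume_Ioo]; congr 1; ring

/-- The triples of times at which one of the smoothed inequalities is nearly an equality. -/
def strips (η b u₀ : ℝ) : Set (ℝ × ℝ × ℝ) :=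
  (timeBox ∩ {τ | |τ.1 - τ.2.1| < 2 * η}) ∪ (timeBox ∩ {τ | |τ.1 - τ.2.2| < 2 * η}) ∪
  (timeBox ∩ {τ | |τ.2.1 - τ.2.2| < 2 * η}) ∪ (timeBox ∩ {τ | |τ.1 - b| < 2 * η}) ∪
  (timeBox ∩ {τ | |τ.2.1 - b| < 2 * η}) ∪ (timeBox ∩ {τ | |τ.2.2 - b| < 2 * η}) ∪
  (timeBox ∩ {τ | |τ.1 - u₀| < 2 * η})

variable {η b u₀ : ℝ}

lemma measurableSet_timeBox_inter {l : ℝ × ℝ × ℝ → ℝ} (hl : Continuous l) :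
    MeasurableSet (timeBox ∩ {τ | |l τ| < 2 * η}) :=
  isCompact_timeBox.measurableSet.inter (isOpen_lt hl.abs continuous_const).measurableSet

lemma volume_strip_le₁ {l : ℝ × ℝ → ℝ} (hl : Continuous l) :
    volume (timeBox ∩ {τ | |τ.1 - l τ.2| < 2 * η}) ≤ 36 * ENNReal.ofReal (4 * η) :=
  volume_le_of_slice₁ (measurableSet_timeBox_inter (by fun_prop)) inter_subset_left
    fun s r => volume_abs_sub_lt_le (l (s, r)) fun _ hx => hx.2

lemma volume_strip_le₂ {l : ℝ → ℝ} (hl : Continuous l) :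
    volume (timeBox ∩ {τ | |τ.2.1 - l τ.2.2| < 2 * η}) ≤ 36 * ENNReal.ofReal (4 * η) := by
  have e : timeBox ∩ {τ | |τ.2.1 - l τ.2.2| < 2 * η} = Icc (2 : ℝ) 8 ×ˢ
      ((Icc (2 : ℝ) 8 ×ˢ Icc (2 : ℝ) 8) ∩ {σ | |σ.1 - l σ.2| < 2 * η}) := by
    ext τ; simp only [timeBox, mem_inter_iff, mem_prod, mem_ofPred_eq]; tauto
  rw [e, Measure.volume_eq_prod, Measure.prod_prod, Real.volume_Icc]
  have := volume_le_of_slice (E := (Icc (2 : ℝ) 8 ×ˢ Icc (2 : ℝ) 8) ∩ {σ | |σ.1 - l σ.2| < 2 * η})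
    (B := ENNReal.ofReal (4 * η))
    ((measurableSet_Icc.prod measurableSet_Icc).inter
      (isOpen_lt (by fun_prop) continuous_const).measurableSet) inter_subset_left
    fun r => volume_abs_sub_lt_le (l r) fun _ hx => hx.2
  calc ENNReal.ofReal (8 - 2) * _ ≤ 6 * (6 * ENNReal.ofReal (4 * η)) := by
        gcongr; norm_num
    _ = _ := by rw [← mul_assoc]; norm_num

lemma volume_strip_le₃ : volume (timeBox ∩ {τ : ℝ × ℝ × ℝ | |τ.2.2 - b| < 2 * η})
    ≤ 36 * ENNReal.ofReal (4 * η) := by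
  calc _ ≤ volume (Icc (2 : ℝ) 8 ×ˢ Icc (2 : ℝ) 8 ×ˢ {x : ℝ | |x - b| < 2 * η}) :=
        measure_mono fun τ hτ => ⟨hτ.1.1, hτ.1.2.1, hτ.2⟩
    _ = 6 * (6 * volume {x : ℝ | |x - b| < 2 * η}) := by
        rw [Measure.volume_eq_prod, Measure.prod_prod, Measure.volume_eq_prod, Measure.prod_prod,
          Real.volume_Icc]
        norm_num
    _ ≤ 6 * (6 * ENNReal.ofReal (4 * η)) := by
        gcongr
        exact volume_abs_sub_lt_le b fun x hx => hx
    _ = _ := by rw [← mul_assoc]; norm_num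

lemma measurableSet_strips : MeasurableSet (strips η b u₀) := by
  unfold strips
  refine (((((MeasurableSet.union ?_ ?_).union ?_).union ?_).union ?_).union ?_).union ?_ <;>
  exact measurableSet_timeBox_inter (by fun_prop)

/-- Each of the seven strips has volume at most `36 · 4 η`. -/
lemma volume_strips_le : volume (strips η b u₀) ≤ ENNReal.ofReal (1008 * η) := by
  have key : volume (strips η b u₀) ≤ 36 * ENNReal.ofReal (4 * η) + 36 * ENNReal.ofReal (4 * η)
      + 36 * ENNReal.ofReal (4 * η) + 36 * ENNReal.ofReal (4 * η) + 36 * ENNReal.ofReal (4 * η)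
      + 36 * ENNReal.ofReal (4 * η) + 36 * ENNReal.ofReal (4 * η) := by
    unfold strips
    refine (measure_union_le _ _).trans (add_le_add ?_ (volume_strip_le₁ (l := fun _ => u₀)
      continuous_const))
    refine (measure_union_le _ _).trans (add_le_add ?_ volume_strip_le₃)
    refine (measure_union_le _ _).trans (add_le_add ?_ (volume_strip_le₂ (l := fun _ => b)
      continuous_const))
    refine (measure_union_le _ _).trans (add_le_add ?_ (volume_strip_le₁ (l := fun _ => b)
      continuous_const))
    refine (measure_union_le _ _).trans (add_le_add ?_ (volume_strip_le₂ continuous_id))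
    exact (measure_union_le _ _).trans (add_le_add (volume_strip_le₁ continuous_fst)
      (volume_strip_le₁ continuous_snd))
  refine key.trans (le_of_eq ?_)
  rw [show (1008 : ℝ) * η = 252 * (4 * η) by ring, ENNReal.ofReal_mul (by norm_num)]
  norm_num
  ring

end Strips

section Approx

variable {η b u₀ L B : ℝ} {W G q : ℝ × ℝ × ℝ → ℂ}

/-- Two weights which agree off the strips have nearly the same moves. -/
lemma norm_integral_le_of_eq_off_strips (hη : 0 < η) (hL : 0 ≤ L) (hq : Continuous q)
    (hq1 : ∀ τ, ‖q τ‖ ≤ 1) (hW : Integrable W) (hG : Integrable G)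
    (hWG : ∀ τ, ‖W τ - G τ‖ ≤ L) (h0 : ∀ τ ∉ timeBox, W τ = G τ)
    (h1 : ∀ τ ∈ timeBox, τ ∉ strips η b u₀ → W τ = G τ) (hB : ‖∫ τ, q τ * G τ‖ ≤ B) :
    ‖∫ τ, q τ * W τ‖ ≤ B + 1008 * η * L := by
  have iG : Integrable fun τ => q τ * G τ :=
    hG.bdd_mul (c := 1) hq.aestronglyMeasurable (.of_forall hq1)
  have iD : Integrable fun τ => q τ * (W τ - G τ) :=
    (hW.sub hG).bdd_mul (c := 1) hq.aestronglyMeasurable (.of_forall hq1)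
  have e : ∫ τ, q τ * W τ = (∫ τ, q τ * G τ) + ∫ τ, q τ * (W τ - G τ) := by
    rw [← integral_add iG iD]
    exact integral_congr_ae (.of_forall fun τ => by ring)
  rw [e]
  refine (norm_add_le _ _).trans (add_le_add hB ?_)
  refine (norm_integral_le_lintegral_norm _).trans (ENNReal.toReal_le_of_le_ofReal
    (by positivity) ?_)
  calc ∫⁻ τ, ENNReal.ofReal ‖q τ * (W τ - G τ)‖
      ≤ ∫⁻ τ, (strips η b u₀).indicator (fun _ => ENNReal.ofReal L) τ := by
        refine lintegral_mono fun τ => ?_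
        by_cases hs : τ ∈ strips η b u₀
        · rw [indicator_of_mem hs]
          refine ENNReal.ofReal_le_ofReal ?_
          rw [norm_mul]
          exact (mul_le_of_le_one_left (norm_nonneg _) (hq1 τ)).trans (hWG τ)
        · have : W τ = G τ := by
            by_cases hb : τ ∈ timeBox
            · exact h1 τ hb hs
            · exact h0 τ hb
          simp [this]
    _ = ENNReal.ofReal L * volume (strips η b u₀) := by
        rw [lintegral_indicator measurableSet_strips, setLIntegral_const]
    _ ≤ ENNReal.ofReal L * ENNReal.ofReal (1008 * η) := by gcongr; exact volume_strips_le
    _ = _ := by rw [← ENNReal.ofReal_mul hL, mul_comm]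

end Approx

/-! ### Hölder estimates for the weights -/

section Constants

/-- The constant in the Hölder estimate for weights bounded by `L`. -/
def moveConst (κ L D : ℝ) : ℝ :=
  108 * (300 * 2 ^ 58 * (100 * D * (128 / κ ^ 2) ^ 3) ^ 6) + 5000 * L / κ

/-- The two parts of the bound balance for gaps proportional to `‖y‖ ^ (1 / 59)`. -/
lemma moveBound_eq {κ ρ : ℝ} (L D : ℝ) (hκ : 0 < κ) (hρ : 0 < ρ) {y : ℝ × ℝ × ℝ}
    (hy : ‖y‖ = ρ ^ 59) :
    CurveData.moveBound κ (ρ / 2) L (D / (ρ / 2)) y = moveConst κ L D * ρ := by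
  unfold CurveData.moveBound moveConst gapBound gapConst
  rw [hy]
  field_simp
  ring

lemma moveConst_nonneg {κ L : ℝ} (D : ℝ) (hκ : 0 < κ) (hL : 0 ≤ L) : 0 ≤ moveConst κ L D := by
  unfold moveConst
  have : 0 ≤ (100 * D * (128 / κ ^ 2) ^ 3) ^ 6 := by
    rw [show 6 = 2 * 3 from rfl, pow_mul]; positivity
  positivity

lemma one_le_bound_and_pow_le {K η : ℝ} (hK : 1 ≤ K) (hη : 0 < η) (hη1 : η ≤ 1) :
    1 ≤ 18 * K ^ 3 * transitionBound / η ∧ K ^ 3 ≤ 18 * K ^ 3 * transitionBound / η := by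
  have h1 : 1 ≤ K ^ 3 := one_le_pow₀ hK
  have h2 : K ^ 3 ≤ 18 * K ^ 3 * transitionBound / η := by
    rw [le_div_iff₀ hη]
    nlinarith [one_le_transitionBound]
  exact ⟨h1.trans h2, h2⟩

lemma one_le_bound {K η : ℝ} (hK : 1 ≤ K) (hη : 0 < η) (hη1 : η ≤ 1) :
    1 ≤ 18 * K ^ 3 * transitionBound / η := (one_le_bound_and_pow_le hK hη hη1).1

lemma pow_le_bound {K η : ℝ} (hK : 1 ≤ K) (hη : 0 < η) (hη1 : η ≤ 1) :
    K ^ 3 ≤ 18 * K ^ 3 * transitionBound / η := (one_le_bound_and_pow_le hK hη hη1).2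

end Constants

section Lipschitz

lemma lipschitzWith_two_of_le {l : ℝ × ℝ × ℝ → ℝ}
    (h : ∀ x y, |l x - l y| ≤ |x.1 - y.1| + |x.2.1 - y.2.1| ∨
      |l x - l y| ≤ |x.1 - y.1| + |x.2.2 - y.2.2| ∨
      |l x - l y| ≤ |x.2.1 - y.2.1| + |x.2.2 - y.2.2|) : LipschitzWith 2 l := by
  refine LipschitzWith.of_dist_le_mul fun x y => ?_
  rw [Real.dist_eq, dist_eq_norm]
  have h1 : |x.1 - y.1| ≤ ‖x - y‖ := norm_fst_le (x - y)
  have h2 : |x.2.1 - y.2.1| ≤ ‖x - y‖ := (norm_fst_le (x - y).2).trans (norm_snd_le _)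
  have h3 : |x.2.2 - y.2.2| ≤ ‖x - y‖ := (norm_snd_le (x - y).2).trans (norm_snd_le _)
  rcases h x y with h | h | h <;> norm_num <;> linarith

lemma abs_sub_sub_sub_le (a b c d : ℝ) : |a - b - (c - d)| ≤ |a - c| + |b - d| := by
  rw [show a - b - (c - d) = a - c - (b - d) by ring]; exact abs_sub _ _

lemma lipschitzWith_fst_sub_snd_fst : LipschitzWith 2 fun τ : ℝ × ℝ × ℝ => τ.1 - τ.2.1 :=
  lipschitzWith_two_of_le fun _ _ => Or.inl (abs_sub_sub_sub_le _ _ _ _)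

lemma lipschitzWith_snd_fst_sub_fst : LipschitzWith 2 fun τ : ℝ × ℝ × ℝ => τ.2.1 - τ.1 :=
  lipschitzWith_two_of_le fun _ _ => Or.inl ((abs_sub_sub_sub_le _ _ _ _).trans_eq (add_comm _ _))

lemma lipschitzWith_snd_snd_sub_fst : LipschitzWith 2 fun τ : ℝ × ℝ × ℝ => τ.2.2 - τ.1 :=
  lipschitzWith_two_of_le fun _ _ =>
    Or.inr (Or.inl ((abs_sub_sub_sub_le _ _ _ _).trans_eq (add_comm _ _)))

lemma lipschitzWith_snd_fst_sub_snd_snd : LipschitzWith 2 fun τ : ℝ × ℝ × ℝ => τ.2.1 - τ.2.2 :=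
  lipschitzWith_two_of_le fun _ _ => Or.inr (Or.inr (abs_sub_sub_sub_le _ _ _ _))

lemma lipschitzWith_snd_snd_sub_snd_fst : LipschitzWith 2 fun τ : ℝ × ℝ × ℝ => τ.2.2 - τ.2.1 :=
  lipschitzWith_two_of_le fun _ _ =>
    Or.inr (Or.inr ((abs_sub_sub_sub_le _ _ _ _).trans_eq (add_comm _ _)))

end Lipschitz

section Density

variable {W : ℝ × ℝ × ℝ → ℂ} {L : ℝ}

lemma volume_timeBox : volume timeBox = ENNReal.ofReal 216 := by
  unfold timeBox
  rw [Measure.volume_eq_prod, Measure.prod_prod, Measure.volume_eq_prod, Measure.prod_prod,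
    Real.volume_Icc, ← ENNReal.ofReal_mul (by norm_num), ← ENNReal.ofReal_mul (by norm_num)]
  norm_num

lemma integrable_of_timeBox (hW : Measurable W) (hL : ∀ τ, ‖W τ‖ ≤ L)
    (h0 : ∀ τ ∉ timeBox, W τ = 0) : Integrable W := by
  refine (integrableOn_iff_integrable_of_support_subset (s := timeBox)
    fun τ hτ => by_contra fun h => hτ (h0 τ h)).1 ?_
  exact Measure.integrableOn_of_bounded (M := L) (by rw [volume_timeBox]; exact ENNReal.ofReal_ne_top)
    hW.aestronglyMeasurable (.of_forall hL)

lemma integral_norm_le_of_timeBox (hL : ∀ τ, ‖W τ‖ ≤ L)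
    (h0 : ∀ τ ∉ timeBox, W τ = 0) : ∫ τ, ‖W τ‖ ≤ 216 * L := by
  rw [← setIntegral_eq_integral_of_forall_compl_eq_zero (s := timeBox)
    fun τ hτ => by rw [h0 τ hτ, norm_zero]]
  have := norm_setIntegral_le_of_norm_le_const (μ := volume) (s := timeBox) (f := fun τ => ‖W τ‖)
    (C := L) (by rw [volume_timeBox]; exact ENNReal.ofReal_lt_top) fun τ _ => by
      rw [norm_norm]; exact hL τ
  rw [Measure.real, volume_timeBox, ENNReal.toReal_ofReal (by norm_num), mul_comm] at this
  exact (le_abs_self _).trans this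

/-- A Hölder estimate for the moves of a transported weight gives its density, with a Hölder
estimate in `L¹`. -/
lemma exists_isDensity_of_moves {ξ C : ℝ} (hW : Measurable W) (hL : ∀ τ, ‖W τ‖ ≤ L)
    (h0 : ∀ τ ∉ timeBox, W τ = 0) {F : ℝ × ℝ × ℝ → ℝ × ℝ × ℝ} (hF : Continuous F)
    (hC : 216 * L ≤ C)
    (H : ∀ (ρ : ℝ) (y : ℝ × ℝ × ℝ) (φ : ℝ × ℝ × ℝ → ℝ), 0 < ρ → ρ ≤ 1 → ‖y‖ = ρ ^ 59 →
      IsTestFunction φ →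
      ‖∫ τ, ((φ (F τ) - φ (heisMul ξ (-y) (F τ)) : ℝ) : ℂ) * W τ‖ ≤ C * ρ) :
    ∃ κ, IsDensity ((volume.withDensityᵥ W).map F) κ ∧
      ∫⁻ z, ‖κ z‖ₑ ≤ ENNReal.ofReal (4 * C) ∧
      ∀ y, ∫⁻ z, ‖κ z - κ (heisMul ξ y z)‖ₑ
        ≤ ENNReal.ofReal (4 * (C * ‖y‖ ^ (1 / 59 : ℝ))) := by
  have L0 : 0 ≤ L := (norm_nonneg _).trans (hL 0)
  have C0 : 0 ≤ C := by linarith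
  have iW := integrable_of_timeBox hW hL h0
  have nW := (integral_norm_le_of_timeBox hL h0).trans hC
  have key : ∀ (y : ℝ × ℝ × ℝ) (φ : ℝ × ℝ × ℝ → ℝ), IsTestFunction φ →
      ‖∫ τ, ((φ (F τ) - φ (heisMul ξ (-y) (F τ)) : ℝ) : ℂ) * W τ‖
        ≤ C * ‖y‖ ^ (1 / 59 : ℝ) := fun y φ hφ => by
    rcases eq_or_ne y 0 with rfl | hy
    · have : ∀ z, heisMul ξ (-0) z = z := fun z => by simp [heisMul]
      simp only [this, sub_self, Complex.ofReal_zero, zero_mul, integral_zero, norm_zero]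
      positivity
    have y0 : 0 < ‖y‖ := norm_pos_iff.2 hy
    rcases le_or_gt ‖y‖ 1 with hy1 | hy1
    · refine H _ y φ (by positivity) (Real.rpow_le_one y0.le hy1 (by norm_num)) ?_ hφ
      rw [← Real.rpow_natCast, ← Real.rpow_mul y0.le]
      norm_num
    · -- for large `y` the `L¹` norm of the weight is bound enough
      have h1 : 1 ≤ ‖y‖ ^ (1 / 59 : ℝ) := Real.one_le_rpow hy1.le (by norm_num)
      refine ((norm_integral_le_integral_norm _).trans ?_).trans
        (nW.trans (le_mul_of_one_le_right C0 h1))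
      refine integral_mono_of_nonneg (.of_forall fun τ => norm_nonneg _) iW.norm
        (.of_forall fun τ => ?_)
      simp only [norm_mul]
      exact mul_le_of_le_one_left (norm_nonneg _) (hφ.norm_sub_heisMul_le_one ξ y _)
  obtain ⟨κ, h1, h2, h3⟩ := exists_isDensity_of_isTestFunction_bound ξ
    (b := fun y => C * ‖y‖ ^ (1 / 59 : ℝ)) iW hF.measurable (fun y φ hφ => key y φ hφ) (by
      have : Continuous fun y : ℝ × ℝ × ℝ => C * ‖y‖ ^ (1 / 59 : ℝ) :=
        continuous_const.mul (continuous_norm.rpow_const fun _ => Or.inr (by norm_num))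
      have h := this.tendsto 0
      simpa using h)
  exact ⟨κ, h1, h2.trans (ENNReal.ofReal_le_ofReal (by linarith)), h3⟩

end Density

section Weights

variable {c : CurveData} {κ η b u₀ u K ε : ℝ} {f₁ f₂ f₃ : ℝ → ℂ}

lemma cutoff_eq_ite {η x : ℝ} (hη : 0 < η) (hx : 2 * η ≤ |x|) :
    cutoff η x = if 0 ≤ x then 1 else 0 := by
  split_ifs with h
  · rw [abs_of_nonneg h] at hx; exact cutoff_of_two_mul_le hη hx
  · exact cutoff_of_le hη (by linarith)

/-- The triples of times up to `b`, with the first one at least `u₀`. -/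
def timesUpTo (b u₀ : ℝ) : Set (ℝ × ℝ × ℝ) :=
  {τ | τ.1 ≤ b} ∩ ({τ | τ.2.1 ≤ b} ∩ ({τ | τ.2.2 ≤ b} ∩ {τ | u₀ ≤ τ.1}))

lemma measurableSet_timesUpTo (b u₀ : ℝ) : MeasurableSet (timesUpTo b u₀) :=
  (measurableSet_le (by fun_prop) (by fun_prop)).inter
    ((measurableSet_le (by fun_prop) (by fun_prop)).inter
      ((measurableSet_le (by fun_prop) (by fun_prop)).inter
        (measurableSet_le (by fun_prop) (by fun_prop))))

lemma cutWeight_eq_of_notMem_strips (hη : 0 < η) {p q : ℝ × ℝ × ℝ → ℝ} {τ : ℝ × ℝ × ℝ}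
    (hb : τ ∈ timeBox) (hs : τ ∉ strips η b u₀) (hp : 2 * η ≤ |p τ|) (hq : 2 * η ≤ |q τ|) :
    cutWeight η b u₀ f₁ f₂ f₃ p q τ
      = (timesUpTo b u₀ ∩ {τ | 0 ≤ p τ ∧ 0 ≤ q τ}).indicator
          (fun τ => f₁ τ.1 * f₂ τ.2.1 * f₃ τ.2.2) τ := by
  simp only [strips, mem_union, mem_inter_iff, hb, true_and, mem_ofPred_eq, not_or, not_lt] at hs
  obtain ⟨⟨⟨⟨⟨⟨h1, h2⟩, h3⟩, h4⟩, h5⟩, h6⟩, h7⟩ := hs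
  rw [abs_sub_comm] at h4 h5 h6
  unfold cutWeight
  rw [cutoff_eq_ite hη h4, cutoff_eq_ite hη h5, cutoff_eq_ite hη h6, cutoff_eq_ite hη h7,
    cutoff_eq_ite hη hp, cutoff_eq_ite hη hq]
  simp only [sub_nonneg, indicator, timesUpTo, mem_inter_iff, mem_ofPred_eq]
  by_cases g1 : τ.1 ≤ b <;> by_cases g2 : τ.2.1 ≤ b <;> by_cases g3 : τ.2.2 ≤ b <;>
    by_cases g4 : u₀ ≤ τ.1 <;> by_cases g5 : 0 ≤ p τ <;> by_cases g6 : 0 ≤ q τ <;>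
    simp [g1, g2, g3, g4, g5, g6]

lemma norm_cutWeight_le (h₁ : IsAmplitude K f₁) (h₂ : IsAmplitude K f₂) (h₃ : IsAmplitude K f₃)
    (hK : 1 ≤ K) (p q : ℝ × ℝ × ℝ → ℝ) (τ : ℝ × ℝ × ℝ) :
    ‖cutWeight η b u₀ f₁ f₂ f₃ p q τ‖ ≤ K ^ 3 := by
  have e : K ^ 3 = K * K * K * 1 * 1 * 1 * 1 * 1 * 1 := by ring
  unfold cutWeight
  simp only [norm_mul, e]
  gcongr
  exacts [h₁.norm_le _, h₂.norm_le _, h₃.norm_le _, norm_cutoff_le, norm_cutoff_le, norm_cutoff_le,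
    norm_cutoff_le, norm_cutoff_le, norm_cutoff_le]

lemma cutWeight_eq_zero (h₁ : IsAmplitude K f₁) (h₂ : IsAmplitude K f₂) (h₃ : IsAmplitude K f₃)
    (p q : ℝ × ℝ × ℝ → ℝ) {τ : ℝ × ℝ × ℝ} (hτ : τ ∉ timeBox) :
    cutWeight η b u₀ f₁ f₂ f₃ p q τ = 0 := by
  simp [cutWeight, mul_eq_zero_of_notMem_timeBox h₁ h₂ h₃ hτ]

/-- The weight on the triples `t, s ≤ r`, with `t` at least `u₀` and all times at most `b`. -/
def lateWeight (b u₀ : ℝ) (f₁ f₂ f₃ : ℝ → ℂ) : ℝ × ℝ × ℝ → ℂ :=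
  (timesUpTo b u₀ ∩ ({τ | τ.1 ≤ τ.2.2} ∩ {τ | τ.2.1 ≤ τ.2.2})).indicator
    fun τ => f₁ τ.1 * f₂ τ.2.1 * f₃ τ.2.2

/-- The weight on the triples with `t ≤ r`, with all times at most `b`. -/
def freeWeight (b : ℝ) (f₁ f₂ f₃ : ℝ → ℂ) : ℝ × ℝ × ℝ → ℂ :=
  (timesUpTo b 0 ∩ {τ | τ.1 ≤ τ.2.2}).indicator fun τ => f₁ τ.1 * f₂ τ.2.1 * f₃ τ.2.2

section

variable (h₁ : IsAmplitude K f₁) (h₂ : IsAmplitude K f₂) (h₃ : IsAmplitude K f₃)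
include h₁ h₂ h₃

lemma measurable_indicator_mul {E : Set (ℝ × ℝ × ℝ)} (hE : MeasurableSet E) :
    Measurable (E.indicator fun τ => f₁ τ.1 * f₂ τ.2.1 * f₃ τ.2.2) := by
  have c1 := h₁.contDiff.continuous
  have c2 := h₂.contDiff.continuous
  have c3 := h₃.contDiff.continuous
  exact Measurable.indicator (by fun_prop) hE

lemma norm_indicator_mul_le (hK : 1 ≤ K) (E : Set (ℝ × ℝ × ℝ)) (τ : ℝ × ℝ × ℝ) :
    ‖E.indicator (fun τ => f₁ τ.1 * f₂ τ.2.1 * f₃ τ.2.2) τ‖ ≤ K ^ 3 := by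
  refine (norm_indicator_le_norm_self _ _).trans ?_
  rw [norm_mul, norm_mul, show K ^ 3 = K * K * K by ring]
  gcongr
  exacts [h₁.norm_le _, h₂.norm_le _, h₃.norm_le _]

lemma indicator_mul_eq_zero (E : Set (ℝ × ℝ × ℝ)) {τ : ℝ × ℝ × ℝ} (hτ : τ ∉ timeBox) :
    E.indicator (fun τ => f₁ τ.1 * f₂ τ.2.1 * f₃ τ.2.2) τ = 0 := by
  by_cases h : τ ∈ E
  · rw [indicator_of_mem h, mul_eq_zero_of_notMem_timeBox h₁ h₂ h₃ hτ]
  · rw [indicator_of_notMem h]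

end

/-- Off the strips the three times are separated from each other by `2 η`. -/
lemma two_mul_le_of_notMem_strips {τ : ℝ × ℝ × ℝ} (hb : τ ∈ timeBox) (hs : τ ∉ strips η b u₀) :
    2 * η ≤ |τ.1 - τ.2.1| ∧ 2 * η ≤ |τ.2.2 - τ.1| ∧ 2 * η ≤ |τ.2.2 - τ.2.1| := by
  simp only [strips, mem_union, mem_inter_iff, hb, true_and, mem_ofPred_eq, not_or, not_lt] at hs
  obtain ⟨⟨⟨⟨⟨⟨h1, h2⟩, h3⟩, -⟩, -⟩, -⟩, -⟩ := hs
  rw [abs_sub_comm] at h2 h3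
  exact ⟨h1, h2, h3⟩

/-- Off the strips the cut-offs take the values `0` and `1` only, and select the order of the times:
`s < t < r` or `t < s < r`. -/
lemma lateWeight_eq_of_notMem_strips (hη : 0 < η) {τ : ℝ × ℝ × ℝ} (hb : τ ∈ timeBox)
    (hs : τ ∉ strips η b u₀) :
    lateWeight b u₀ f₁ f₂ f₃ τ
      = cutWeight η b u₀ f₁ f₂ f₃ (fun τ => τ.1 - τ.2.1) (fun τ => τ.2.2 - τ.1) τ
        + cutWeight η b u₀ f₁ f₂ f₃ (fun τ => τ.2.1 - τ.1) (fun τ => τ.2.2 - τ.2.1) τ := by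
  obtain ⟨h1, h2, h3⟩ := two_mul_le_of_notMem_strips hb hs
  rw [cutWeight_eq_of_notMem_strips hη hb hs h1 h2,
    cutWeight_eq_of_notMem_strips hη hb hs (by rwa [abs_sub_comm]) h3, lateWeight]
  have n1 : τ.1 ≠ τ.2.1 := fun h => by rw [h, sub_self, abs_zero] at h1; linarith
  simp only [indicator, mem_inter_iff, mem_ofPred_eq, sub_nonneg]
  by_cases hT : τ ∈ timesUpTo b u₀
  · rcases n1.lt_or_gt with h | h
    · by_cases g : τ.2.1 ≤ τ.2.2
      · simp [hT, h.le, not_le.2 h, g, h.le.trans g]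
      · simp [hT, h.le, not_le.2 h, g]
    · by_cases g : τ.1 ≤ τ.2.2
      · simp [hT, h.le, not_le.2 h, g, h.le.trans g]
      · simp [hT, h.le, not_le.2 h, g]
  · simp [hT]

/-- Without the condition `s ≤ r`, the order `t < r < s` is also possible. -/
lemma freeWeight_eq_of_notMem_strips (hη : 0 < η) {τ : ℝ × ℝ × ℝ} (hb : τ ∈ timeBox)
    (hs : τ ∉ strips η b 0) :
    freeWeight b f₁ f₂ f₃ τ
      = lateWeight b 0 f₁ f₂ f₃ τ
        + cutWeight η b 0 f₁ f₂ f₃ (fun τ => τ.2.2 - τ.1) (fun τ => τ.2.1 - τ.2.2) τ := by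
  obtain ⟨h1, h2, h3⟩ := two_mul_le_of_notMem_strips hb hs
  rw [cutWeight_eq_of_notMem_strips hη hb hs h2 (by rwa [abs_sub_comm]), lateWeight, freeWeight]
  have n1 : τ.2.2 ≠ τ.2.1 := fun h => by rw [h, sub_self, abs_zero] at h3; linarith
  simp only [indicator, mem_inter_iff, mem_ofPred_eq, sub_nonneg]
  by_cases hT : τ ∈ timesUpTo b 0
  · by_cases g : τ.1 ≤ τ.2.2
    · rcases n1.lt_or_gt with h | h
      · simp [hT, g, h.le, not_le.2 h]
      · simp [hT, g, h.le, not_le.2 h]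
    · simp [g]
  · simp [hT]

end Weights

section Moves

lemma measurableSet_lateRegion (b u₀ : ℝ) :
    MeasurableSet (timesUpTo b u₀ ∩ ({τ | τ.1 ≤ τ.2.2} ∩ {τ | τ.2.1 ≤ τ.2.2})) :=
  (measurableSet_timesUpTo b u₀).inter ((measurableSet_le (by fun_prop) (by fun_prop)).inter
    (measurableSet_le (by fun_prop) (by fun_prop)))

lemma measurableSet_freeRegion (b : ℝ) : MeasurableSet (timesUpTo b 0 ∩ {τ | τ.1 ≤ τ.2.2}) :=
  (measurableSet_timesUpTo b 0).inter (measurableSet_le (by fun_prop) (by fun_prop))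

lemma norm_integral_mul_add_le {q G₁ G₂ : ℝ × ℝ × ℝ → ℂ} {B₁ B₂ : ℝ} (hq : Continuous q)
    (hq1 : ∀ τ, ‖q τ‖ ≤ 1) (i₁ : Integrable G₁) (i₂ : Integrable G₂)
    (h₁ : ‖∫ τ, q τ * G₁ τ‖ ≤ B₁) (h₂ : ‖∫ τ, q τ * G₂ τ‖ ≤ B₂) :
    ‖∫ τ, q τ * (G₁ + G₂) τ‖ ≤ B₁ + B₂ := by
  simp only [Pi.add_apply, mul_add]
  rw [integral_add (i₁.bdd_mul (c := 1) hq.aestronglyMeasurable (.of_forall hq1))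
    (i₂.bdd_mul (c := 1) hq.aestronglyMeasurable (.of_forall hq1))]
  exact norm_add_le_of_le h₁ h₂

/-- The constant in the Hölder estimate for the moves. -/
def totalConst (κ K : ℝ) : ℝ :=
  3 * moveConst κ (K ^ 3) (18 * K ^ 3 * transitionBound) + 2016 * K ^ 3

variable {c : CurveData} {κ b u K ε k u₀ ρ : ℝ} {f₁ f₂ f₃ : ℝ → ℂ} (h : c.IsNormalized κ)
  {F F₁ F₂ F₃ : ℝ × ℝ × ℝ → ℝ × ℝ × ℝ} {φ : ℝ × ℝ × ℝ → ℝ} {y : ℝ × ℝ × ℝ}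
  (h₁ : IsAmplitude K f₁) (h₂ : IsAmplitude K f₂) (h₃ : IsAmplitude K f₃) (hK : 1 ≤ K)
  (hρ : 0 < ρ) (hρ1 : ρ ≤ 1) (hy : ‖y‖ = ρ ^ 59) (hφ : IsTestFunction φ)
include h h₁ h₂ h₃ hK hρ hρ1 hy hφ

/-- The order `s < t < r`. -/
lemma moves_cutWeight₁ (hF : c.IsProductMap k u ε F F₁ F₂ F₃) (hk : 0 ≤ k) (hk1 : k ≤ 1)
    (hu : u ∈ Icc (2 : ℝ) 8) (hu0 : ∀ t ∈ Icc (2 : ℝ) 8, u₀ ≤ t → u ≤ t) :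
    ‖∫ τ, ((φ (F τ) - φ (heisMul c.ξ (-y) (F τ)) : ℝ) : ℂ) * cutWeight (ρ / 2) b u₀ f₁ f₂ f₃
      (fun τ => τ.1 - τ.2.1) (fun τ => τ.2.2 - τ.1) τ‖
      ≤ moveConst κ (K ^ 3) (18 * K ^ 3 * transitionBound) * ρ := by
  have hη : 0 < ρ / 2 := by positivity
  have g := isC1Bounded_cutWeight (b := b) (u₀ := u₀) (p := fun τ => τ.1 - τ.2.1)
    (q := fun τ => τ.2.2 - τ.1) h₁ h₂ h₃ hK hη (by linarith)
    (by fun_prop) (lipschitzWith_fst_sub_snd_fst) (by fun_prop) (lipschitzWith_snd_snd_sub_fst)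
  rw [← moveBound_eq _ _ h.κ_pos hρ hy]
  refine CurveData.norm_integral_sub_le_of_gapSet₁ h hη (by linarith) g.contDiff (by positivity)
    (one_le_bound hK hη (by linarith)) (pow_le_bound hK hη (by linarith)) g.norm_le
    g.norm_fderiv_le hφ hF hk hk1 hu ?_
  exact tsupport_cutWeight_subset h₁ h₂ h₃ (isCompact_gapSet₁ _ _).isClosed hη
    fun τ hb h0 hp hq => ⟨hb, by simp only [mem_ofPred_eq]; linarith,
      by simp only [mem_ofPred_eq]; linarith, hu0 _ hb.1 h0⟩

/-- The order `t < s < r`. -/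
lemma moves_cutWeight₂ (hF : c.IsProductMap k u ε F F₁ F₂ F₃) (hk : 0 ≤ k) (hk1 : k ≤ 1)
    (hu : u ∈ Icc (2 : ℝ) 8) (hu0 : ∀ t ∈ Icc (2 : ℝ) 8, u₀ ≤ t → u ≤ t) :
    ‖∫ τ, ((φ (F τ) - φ (heisMul c.ξ (-y) (F τ)) : ℝ) : ℂ) * cutWeight (ρ / 2) b u₀ f₁ f₂ f₃
      (fun τ => τ.2.1 - τ.1) (fun τ => τ.2.2 - τ.2.1) τ‖
      ≤ moveConst κ (K ^ 3) (18 * K ^ 3 * transitionBound) * ρ := by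
  have hη : 0 < ρ / 2 := by positivity
  have g := isC1Bounded_cutWeight (b := b) (u₀ := u₀) (p := fun τ => τ.2.1 - τ.1)
    (q := fun τ => τ.2.2 - τ.2.1) h₁ h₂ h₃ hK hη (by linarith)
    (by fun_prop) (lipschitzWith_snd_fst_sub_fst) (by fun_prop) (lipschitzWith_snd_snd_sub_snd_fst)
  rw [← moveBound_eq _ _ h.κ_pos hρ hy]
  refine CurveData.norm_integral_sub_le_of_gapSet₂ h hη (by linarith) g.contDiff (by positivity)
    (one_le_bound hK hη (by linarith)) (pow_le_bound hK hη (by linarith)) g.norm_le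
    g.norm_fderiv_le hφ hF hk hk1 hu ?_
  exact tsupport_cutWeight_subset h₁ h₂ h₃ (isCompact_gapSet₂ _ _).isClosed hη
    fun τ hb h0 hp hq => ⟨hb, by simp only [mem_ofPred_eq]; linarith,
      by simp only [mem_ofPred_eq]; linarith, hu0 _ hb.1 h0⟩

/-- The order `t < r < s`. -/
lemma moves_cutWeight₃ (hF : c.IsProductMap 0 u ε F F₁ F₂ F₃) :
    ‖∫ τ, ((φ (F τ) - φ (heisMul c.ξ (-y) (F τ)) : ℝ) : ℂ) * cutWeight (ρ / 2) b u₀ f₁ f₂ f₃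
      (fun τ => τ.2.2 - τ.1) (fun τ => τ.2.1 - τ.2.2) τ‖
      ≤ moveConst κ (K ^ 3) (18 * K ^ 3 * transitionBound) * ρ := by
  have hη : 0 < ρ / 2 := by positivity
  have g := isC1Bounded_cutWeight (b := b) (u₀ := u₀) (p := fun τ => τ.2.2 - τ.1)
    (q := fun τ => τ.2.1 - τ.2.2) h₁ h₂ h₃ hK hη (by linarith)
    (by fun_prop) (lipschitzWith_snd_snd_sub_fst) (by fun_prop) (lipschitzWith_snd_fst_sub_snd_snd)
  rw [← moveBound_eq _ _ h.κ_pos hρ hy]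
  refine CurveData.norm_integral_sub_le_of_gapSet₃ h hη (by linarith) g.contDiff (by positivity)
    (one_le_bound hK hη (by linarith)) (pow_le_bound hK hη (by linarith)) g.norm_le
    g.norm_fderiv_le hφ hF ?_
  exact tsupport_cutWeight_subset h₁ h₂ h₃ (isCompact_gapSet₃ _).isClosed hη
    fun τ hb h0 hp hq => ⟨hb, by simp only [mem_ofPred_eq]; linarith,
      by simp only [mem_ofPred_eq]; linarith⟩

omit h hy hφ in
lemma integrable_cutWeight {p q : ℝ × ℝ × ℝ → ℝ} (hp : ContDiff ℝ 1 p)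
    (hp2 : LipschitzWith 2 p) (hq : ContDiff ℝ 1 q) (hq2 : LipschitzWith 2 q) :
    Integrable (cutWeight (ρ / 2) b u₀ f₁ f₂ f₃ p q) :=
  integrable_of_timeBox (isC1Bounded_cutWeight h₁ h₂ h₃ hK (by positivity) (by linarith)
    hp hp2 hq hq2).contDiff.continuous.measurable (norm_cutWeight_le h₁ h₂ h₃ hK p q)
    fun _ hτ => cutWeight_eq_zero h₁ h₂ h₃ p q hτ

/-- The moves of the weight on `t, s ≤ r`. -/
lemma moves_lateWeight (hF : c.IsProductMap k u ε F F₁ F₂ F₃) (hk : 0 ≤ k) (hk1 : k ≤ 1)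
    (hu : u ∈ Icc (2 : ℝ) 8) (hu0 : ∀ t ∈ Icc (2 : ℝ) 8, u₀ ≤ t → u ≤ t) :
    ‖∫ τ, ((φ (F τ) - φ (heisMul c.ξ (-y) (F τ)) : ℝ) : ℂ) * lateWeight b u₀ f₁ f₂ f₃ τ‖
      ≤ totalConst κ K * ρ := by
  have hη : 0 < ρ / 2 := by positivity
  have hm := moveConst_nonneg (L := K ^ 3) (18 * K ^ 3 * transitionBound) h.κ_pos (by positivity)
  have m1 := moves_cutWeight₁ (b := b) h h₁ h₂ h₃ hK hρ hρ1 hy hφ hF hk hk1 hu hu0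
  have m2 := moves_cutWeight₂ (b := b) h h₁ h₂ h₃ hK hρ hρ1 hy hφ hF hk hk1 hu hu0
  have i1 := integrable_cutWeight (b := b) (u₀ := u₀) h₁ h₂ h₃ hK hρ hρ1
    (p := fun τ => τ.1 - τ.2.1) (q := fun τ => τ.2.2 - τ.1) (by fun_prop)
    lipschitzWith_fst_sub_snd_fst (by fun_prop) lipschitzWith_snd_snd_sub_fst
  have i2 := integrable_cutWeight (b := b) (u₀ := u₀) h₁ h₂ h₃ hK hρ hρ1
    (p := fun τ => τ.2.1 - τ.1) (q := fun τ => τ.2.2 - τ.2.1) (by fun_prop)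
    lipschitzWith_snd_fst_sub_fst (by fun_prop) lipschitzWith_snd_snd_sub_snd_fst
  have q0 := hφ.continuous_sub_heisMul c.ξ y hF.continuous
  have q1 := fun τ => hφ.norm_sub_heisMul_le_one c.ξ y (F τ)
  have K0 : 0 ≤ K ^ 3 := by positivity
  refine (norm_integral_le_of_eq_off_strips (b := b) (u₀ := u₀) (L := 4 * K ^ 3) hη (by positivity)
    q0 q1 (integrable_of_timeBox
      (measurable_indicator_mul h₁ h₂ h₃ (measurableSet_lateRegion b u₀))
      (norm_indicator_mul_le h₁ h₂ h₃ hK _) fun τ hτ => indicator_mul_eq_zero h₁ h₂ h₃ _ hτ)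
    (i1.add i2) (fun τ => ?_) (fun τ hτ => ?_)
    (fun τ hb hs => lateWeight_eq_of_notMem_strips hη hb hs)
    (norm_integral_mul_add_le q0 q1 i1 i2 m1 m2)).trans ?_
  · refine (norm_sub_le _ _).trans ?_
    have n0 := norm_indicator_mul_le h₁ h₂ h₃ hK
      (timesUpTo b u₀ ∩ ({τ | τ.1 ≤ τ.2.2} ∩ {τ | τ.2.1 ≤ τ.2.2})) τ
    have n1 := norm_add_le_of_le (norm_cutWeight_le (η := ρ / 2) (b := b) (u₀ := u₀) h₁ h₂ h₃ hK
      (fun τ => τ.1 - τ.2.1) (fun τ => τ.2.2 - τ.1) τ)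
      (norm_cutWeight_le (η := ρ / 2) (b := b) (u₀ := u₀) h₁ h₂ h₃ hK
      (fun τ => τ.2.1 - τ.1) (fun τ => τ.2.2 - τ.2.1) τ)
    exact (add_le_add n0 n1).trans (by linarith)
  · simp only [Pi.add_apply, indicator_mul_eq_zero h₁ h₂ h₃ _ hτ,
      cutWeight_eq_zero h₁ h₂ h₃ _ _ hτ, add_zero]
  · unfold totalConst
    have := mul_nonneg hm hρ.le
    linarith

/-- The moves of the weight on `t ≤ r`, without the factor which depends on `u`. -/
lemma moves_freeWeight (hF : c.IsProductMap 0 2 ε F F₁ F₂ F₃) :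
    ‖∫ τ, ((φ (F τ) - φ (heisMul c.ξ (-y) (F τ)) : ℝ) : ℂ) * freeWeight b f₁ f₂ f₃ τ‖
      ≤ totalConst κ K * ρ := by
  have hη : 0 < ρ / 2 := by positivity
  have m1 := moves_cutWeight₁ (b := b) (u₀ := 0) h h₁ h₂ h₃ hK hρ hρ1 hy hφ hF le_rfl zero_le_one
    ⟨le_rfl, by norm_num⟩ fun t ht _ => ht.1
  have m2 := moves_cutWeight₂ (b := b) (u₀ := 0) h h₁ h₂ h₃ hK hρ hρ1 hy hφ hF le_rfl zero_le_one
    ⟨le_rfl, by norm_num⟩ fun t ht _ => ht.1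
  have m3 := moves_cutWeight₃ (b := b) (u₀ := 0) h h₁ h₂ h₃ hK hρ hρ1 hy hφ hF
  have i1 := integrable_cutWeight (b := b) (u₀ := 0) h₁ h₂ h₃ hK hρ hρ1
    (p := fun τ => τ.1 - τ.2.1) (q := fun τ => τ.2.2 - τ.1) (by fun_prop)
    lipschitzWith_fst_sub_snd_fst (by fun_prop) lipschitzWith_snd_snd_sub_fst
  have i2 := integrable_cutWeight (b := b) (u₀ := 0) h₁ h₂ h₃ hK hρ hρ1
    (p := fun τ => τ.2.1 - τ.1) (q := fun τ => τ.2.2 - τ.2.1) (by fun_prop)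
    lipschitzWith_snd_fst_sub_fst (by fun_prop) lipschitzWith_snd_snd_sub_snd_fst
  have i3 := integrable_cutWeight (b := b) (u₀ := 0) h₁ h₂ h₃ hK hρ hρ1
    (p := fun τ => τ.2.2 - τ.1) (q := fun τ => τ.2.1 - τ.2.2) (by fun_prop)
    lipschitzWith_snd_snd_sub_fst (by fun_prop) lipschitzWith_snd_fst_sub_snd_snd
  have q0 := hφ.continuous_sub_heisMul c.ξ y hF.continuous
  have q1 := fun τ => hφ.norm_sub_heisMul_le_one c.ξ y (F τ)
  have K0 : 0 ≤ K ^ 3 := by positivity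
  refine (norm_integral_le_of_eq_off_strips (b := b) (u₀ := 0) (L := 4 * K ^ 3) hη (by positivity)
    q0 q1 (integrable_of_timeBox
      (measurable_indicator_mul h₁ h₂ h₃ (measurableSet_freeRegion b))
      (norm_indicator_mul_le h₁ h₂ h₃ hK _) fun τ hτ => indicator_mul_eq_zero h₁ h₂ h₃ _ hτ)
    ((i1.add i2).add i3) (fun τ => ?_) (fun τ hτ => ?_) (fun τ hb hs => ?_)
    (norm_integral_mul_add_le q0 q1 (i1.add i2) i3
      (norm_integral_mul_add_le q0 q1 i1 i2 m1 m2) m3)).trans ?_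
  · refine (norm_sub_le _ _).trans ?_
    have n0 := norm_indicator_mul_le h₁ h₂ h₃ hK (timesUpTo b 0 ∩ {τ | τ.1 ≤ τ.2.2}) τ
    have n1 := norm_add_le_of_le (norm_add_le_of_le
      (norm_cutWeight_le (η := ρ / 2) (b := b) (u₀ := 0) h₁ h₂ h₃ hK
        (fun τ => τ.1 - τ.2.1) (fun τ => τ.2.2 - τ.1) τ)
      (norm_cutWeight_le (η := ρ / 2) (b := b) (u₀ := 0) h₁ h₂ h₃ hK
        (fun τ => τ.2.1 - τ.1) (fun τ => τ.2.2 - τ.2.1) τ))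
      (norm_cutWeight_le (η := ρ / 2) (b := b) (u₀ := 0) h₁ h₂ h₃ hK
        (fun τ => τ.2.2 - τ.1) (fun τ => τ.2.1 - τ.2.2) τ)
    exact (add_le_add n0 n1).trans (by linarith)
  · simp only [Pi.add_apply, indicator_mul_eq_zero h₁ h₂ h₃ _ hτ,
      cutWeight_eq_zero h₁ h₂ h₃ _ _ hτ, add_zero]
  · exact (freeWeight_eq_of_notMem_strips hη hb hs).trans
      (congrArg (· + _) (lateWeight_eq_of_notMem_strips hη hb hs))
  · unfold totalConst
    linarith

end Moves

section Total

variable {c : CurveData} {κ b u K ε u₀ : ℝ} {f₁ f₂ f₃ : ℝ → ℂ} (h : c.IsNormalized κ)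
  {F F₁ F₂ F₃ : ℝ × ℝ × ℝ → ℝ × ℝ × ℝ}
  (h₁ : IsAmplitude K f₁) (h₂ : IsAmplitude K f₂) (h₃ : IsAmplitude K f₃) (hK : 1 ≤ K)
include h h₁ h₂ h₃ hK

omit h₁ h₂ h₃ in
lemma mul_pow_le_totalConst : 216 * K ^ 3 ≤ totalConst κ K := by
  have hm := moveConst_nonneg (L := K ^ 3) (18 * K ^ 3 * transitionBound) h.κ_pos (by positivity)
  have : 0 ≤ K ^ 3 := by positivity
  unfold totalConst
  linarith

theorem exists_isDensity_freeWeight (hF : c.IsProductMap 0 2 ε F F₁ F₂ F₃) :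
    ∃ χ, IsDensity ((volume.withDensityᵥ (freeWeight b f₁ f₂ f₃)).map F) χ ∧
      ∫⁻ z, ‖χ z‖ₑ ≤ ENNReal.ofReal (4 * totalConst κ K) ∧
      ∀ y, ∫⁻ z, ‖χ z - χ (heisMul c.ξ y z)‖ₑ
        ≤ ENNReal.ofReal (4 * (totalConst κ K * ‖y‖ ^ (1 / 59 : ℝ))) :=
  exists_isDensity_of_moves (measurable_indicator_mul h₁ h₂ h₃ (measurableSet_freeRegion b))
    (norm_indicator_mul_le h₁ h₂ h₃ hK _) (fun _ hτ => indicator_mul_eq_zero h₁ h₂ h₃ _ hτ)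
    hF.continuous (mul_pow_le_totalConst h hK)
    fun _ _ _ hρ hρ1 hy hφ => moves_freeWeight h h₁ h₂ h₃ hK hρ hρ1 hy hφ hF

theorem exists_isDensity_lateWeight (hF : c.IsProductMap 1 u ε F F₁ F₂ F₃)
    (hu : u ∈ Icc (2 : ℝ) 8) :
    ∃ χ, IsDensity ((volume.withDensityᵥ (lateWeight b u f₁ f₂ f₃)).map F) χ ∧
      ∫⁻ z, ‖χ z‖ₑ ≤ ENNReal.ofReal (4 * totalConst κ K) ∧
      ∀ y, ∫⁻ z, ‖χ z - χ (heisMul c.ξ y z)‖ₑ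
        ≤ ENNReal.ofReal (4 * (totalConst κ K * ‖y‖ ^ (1 / 59 : ℝ))) :=
  exists_isDensity_of_moves (measurable_indicator_mul h₁ h₂ h₃ (measurableSet_lateRegion b u))
    (norm_indicator_mul_le h₁ h₂ h₃ hK _) (fun _ hτ => indicator_mul_eq_zero h₁ h₂ h₃ _ hτ)
    hF.continuous (mul_pow_le_totalConst h hK)
    fun _ _ _ hρ hρ1 hy hφ => moves_lateWeight h h₁ h₂ h₃ hK hρ hρ1 hy hφ hF zero_le_one le_rfl hu
      fun _ _ h => h

end Total

/-! ### Regularity of the curve -/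

section Regularity

lemma hasDerivAt_of_contDiffOn_three {g : ℝ → ℝ} (hg : ContDiffOn ℝ 3 g (Ioi 0)) {t : ℝ}
    (ht : 0 < t) : HasDerivAt g (deriv g t) t ∧ HasDerivAt (deriv g) (iteratedDeriv 2 g t) t ∧
      HasDerivAt (iteratedDeriv 2 g) (iteratedDeriv 3 g t) t := by
  have e2 : iteratedDeriv 2 g = deriv (deriv g) := by rw [iteratedDeriv_succ, iteratedDeriv_one]
  have e3 : iteratedDeriv 3 g = deriv (iteratedDeriv 2 g) := iteratedDeriv_succ
  rw [show (3 : WithTop ℕ∞) = 2 + 1 by norm_num, contDiffOn_succ_iff_deriv_of_isOpen isOpen_Ioi] at hg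
  obtain ⟨d1, -, hg1⟩ := hg
  rw [show (2 : WithTop ℕ∞) = 1 + 1 by norm_num, contDiffOn_succ_iff_deriv_of_isOpen isOpen_Ioi] at hg1
  obtain ⟨d2, -, hg2⟩ := hg1
  have d3 := hg2.differentiableOn one_ne_zero
  have hn := Ioi_mem_nhds ht
  rw [e3, e2]
  exact ⟨((d1 t ht).differentiableAt hn).hasDerivAt, ((d2 t ht).differentiableAt hn).hasDerivAt,
    ((d3 t ht).differentiableAt hn).hasDerivAt⟩

namespace IsAdmissibleCurve

variable {α β : ℝ → ℝ} (H : IsAdmissibleCurve α β) {t x y : ℝ}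
include H

lemma α_zero : α 0 = 0 := by
  have := H.odd_α 0
  rw [neg_zero] at this
  linarith

lemma hasDerivAt_α (ht : 0 < t) : HasDerivAt α (deriv α t) t :=
  (hasDerivAt_of_contDiffOn_three H.contDiffOn_α ht).1

lemma hasDerivAt_deriv_α (ht : 0 < t) : HasDerivAt (deriv α) (D2 α t) t :=
  (hasDerivAt_of_contDiffOn_three H.contDiffOn_α ht).2.1

lemma hasDerivAt_h2 (ht : 0 < t) : HasDerivAt (h2 α) (t * D2 α t) t :=
  (((hasDerivAt_id t).mul (H.hasDerivAt_deriv_α ht)).sub (H.hasDerivAt_α ht)).congr_deriv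
    (by simp)

lemma deriv_α_lt (hx : 0 < x) (hxy : x < y) : deriv α x < deriv α y := by
  have hs : StrictMonoOn (deriv α) (Ioi 0) := by
    refine strictMonoOn_of_deriv_pos (convex_Ioi 0)
      (fun t ht => (H.hasDerivAt_deriv_α ht).continuousAt.continuousWithinAt) fun t ht => ?_
    rw [interior_Ioi] at ht
    rw [(H.hasDerivAt_deriv_α ht).deriv]
    exact H.D2_pos t ht
  exact hs hx (hx.trans hxy) hxy

/-- By the mean value theorem `h₂(t) / t` is a difference of two values of the increasing `α'`. -/
lemma h2_pos (ht : 0 < t) : 0 < h2 α t := by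
  obtain ⟨z, hz, e⟩ := exists_hasDerivAt_eq_slope α (deriv α) ht H.continuous_α.continuousOn
    fun x hx => H.hasDerivAt_α hx.1
  have := H.deriv_α_lt hz.1 hz.2
  rw [H.α_zero, sub_zero, sub_zero, eq_div_iff ht.ne'] at e
  unfold h2
  nlinarith

lemma monotoneOn_h2 : MonotoneOn (h2 α) (Ici 0) := by
  have hs : MonotoneOn (h2 α) (Ioi 0) := by
    refine monotoneOn_of_deriv_nonneg (convex_Ioi 0)
      (fun t ht => (H.hasDerivAt_h2 ht).continuousAt.continuousWithinAt)
      (fun t ht => ?_) fun t ht => ?_ <;> rw [interior_Ioi] at ht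
    · exact (H.hasDerivAt_h2 ht).differentiableAt.differentiableWithinAt
    · rw [(H.hasDerivAt_h2 ht).deriv]
      exact mul_nonneg (le_of_lt ht) (H.D2_pos t ht).le
  intro x hx y hy hxy
  rcases eq_or_lt_of_le (show (0 : ℝ) ≤ x from hx) with rfl | hx0
  · have h0 : h2 α 0 = 0 := by simp [h2, H.α_zero]
    rw [h0]
    rcases eq_or_lt_of_le hxy with rfl | hy0
    · exact h0.ge
    · exact (H.h2_pos hy0).le
  · exact hs hx0 (hx0.trans_le hxy) hxy

lemma intervalIntegrable_h2 (hx : 0 ≤ x) (hy : 0 ≤ y) : IntervalIntegrable (h2 α) volume x y :=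
  (H.monotoneOn_h2.mono fun _ hz => (le_min hx hy).trans hz.1).intervalIntegrable

lemma hasDerivAt_betaBar (ht : 0 < t) :
    HasDerivAt (betaBar α β) (deriv β t - 1 / 2 * h2 α t) t := by
  have c : ContinuousOn (h2 α) (Ioi 0) := fun x hx => (H.hasDerivAt_h2 hx).continuousAt.continuousWithinAt
  exact (hasDerivAt_of_contDiffOn_three H.contDiffOn_β ht).1.sub
    ((intervalIntegral.integral_hasDerivAt_right (H.intervalIntegrable_h2 le_rfl ht.le)
      (c.stronglyMeasurableAtFilter isOpen_Ioi t ht) (H.hasDerivAt_h2 ht).continuousAt).const_mul _)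

lemma contDiffOn_betaBar : ContDiffOn ℝ 3 (betaBar α β) (Ioi 0) := by
  have hα := H.contDiffOn_α
  have hβ := H.contDiffOn_β
  rw [show (3 : WithTop ℕ∞) = 2 + 1 by norm_num, contDiffOn_succ_iff_deriv_of_isOpen isOpen_Ioi]
    at hα hβ ⊢
  refine ⟨fun t ht => (H.hasDerivAt_betaBar ht).differentiableAt.differentiableWithinAt, by simp, ?_⟩
  have c : ContDiffOn ℝ 2 (fun t => deriv β t - 1 / 2 * h2 α t) (Ioi 0) :=
    hβ.2.2.sub (contDiffOn_const.mul ((contDiffOn_id.mul hα.2.2).sub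
      (H.contDiffOn_α.of_le (by norm_num))))
  exact c.congr fun t ht => (H.hasDerivAt_betaBar ht).deriv

/-- The slope `ρ = β̄'' / α''`, in terms of which `h̄₃ = h₂ ρ - h̄_β`. -/
def _root_.slopeBar (α β : ℝ → ℝ) (t : ℝ) : ℝ := iteratedDeriv 2 (betaBar α β) t / D2 α t

lemma hasDerivAt_slopeBar (ht : 0 < t) :
    HasDerivAt (slopeBar α β) (D3Bar α β t / D2 α t ^ 2) t := by
  have h1 := (hasDerivAt_of_contDiffOn_three H.contDiffOn_betaBar ht).2.2
  have h2 := (hasDerivAt_of_contDiffOn_three H.contDiffOn_α ht).2.2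
  refine (h1.div h2 (H.D2_pos t ht).ne').congr_deriv ?_
  unfold D3Bar D2
  ring

lemma slopeBar_deriv_pos (ht : 0 < t) : 0 < D3Bar α β t / D2 α t ^ 2 :=
  div_pos (H.D3Bar_pos t ht) (pow_pos (H.D2_pos t ht) 2)

lemma h3Bar_eq (ht : 0 < t) : h3Bar α β t = h2 α t * slopeBar α β t - hBeta α β t := by
  have h0 := (H.D2_pos t ht).ne'
  unfold h3Bar N3Bar slopeBar hBeta h2
  rw [Matrix.det_fin_three]
  simp only [Matrix.of_apply, Matrix.cons_val', Matrix.cons_val_zero, Matrix.cons_val_one,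
    Matrix.cons_val]
  unfold D2 at *
  field_simp
  ring

lemma hasDerivAt_hBeta (ht : 0 < t) :
    HasDerivAt (hBeta α β) (t * iteratedDeriv 2 (betaBar α β) t) t := by
  obtain ⟨h1, h2, -⟩ := hasDerivAt_of_contDiffOn_three H.contDiffOn_betaBar ht
  exact (((hasDerivAt_id t).mul h2).sub h1).congr_deriv (by simp)

lemma hasDerivAt_h3Bar (ht : 0 < t) :
    HasDerivAt (h3Bar α β) (h2 α t * (D3Bar α β t / D2 α t ^ 2)) t := by
  have h1 := ((H.hasDerivAt_h2 ht).mul (H.hasDerivAt_slopeBar ht)).sub (H.hasDerivAt_hBeta ht)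
  refine (h1.congr_of_eventuallyEq ?_).congr_deriv ?_
  · filter_upwards [Ioi_mem_nhds ht] with z hz using H.h3Bar_eq hz
  · have h0 := (H.D2_pos t ht).ne'
    have : t * D2 α t * slopeBar α β t = t * iteratedDeriv 2 (betaBar α β) t := by
      unfold slopeBar; field_simp
    rw [this]; ring

lemma mul_h2_le_integral (hx : 0 < x) (hxy : x ≤ y) :
    (y - x) * h2 α x ≤ ∫ s in (0 : ℝ)..y, h2 α s := by
  have hy := hx.le.trans hxy
  rw [← intervalIntegral.integral_add_adjacent_intervals (H.intervalIntegrable_h2 le_rfl hx.le)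
    (H.intervalIntegrable_h2 hx.le hy)]
  have h1 : 0 ≤ ∫ s in (0 : ℝ)..x, h2 α s :=
    intervalIntegral.integral_nonneg hx.le fun s hs => by
      have := H.monotoneOn_h2 (mem_Ici.2 le_rfl) (mem_Ici.2 hs.1) hs.1
      rwa [show h2 α 0 = 0 by simp [h2, H.α_zero]] at this
  have h3 : ∫ _ in x..y, h2 α x ≤ ∫ s in x..y, h2 α s :=
    intervalIntegral.integral_mono_on hxy intervalIntegrable_const
      (H.intervalIntegrable_h2 hx.le hy) fun s hs =>
        H.monotoneOn_h2 (mem_Ici.2 hx.le) (mem_Ici.2 (hx.le.trans hs.1)) hs.1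
  rw [intervalIntegral.integral_const, smul_eq_mul] at h3
  linarith

/-- A consequence of the lower bound by the integral of `h₂`. -/
lemma h3Bar_pos (ht : 0 < t) : 0 < h3Bar α β t := by
  obtain ⟨c, hc, h⟩ := H.integral_h2_le
  have h1 := H.mul_h2_le_integral (x := t / 2) (y := t) (by linarith) (by linarith)
  have h2 := mul_pos (by linarith : 0 < t - t / 2) (H.h2_pos (by linarith : 0 < t / 2))
  exact (mul_pos hc (h2.trans_le h1)).trans_le (h t ht)

end IsAdmissibleCurve

end Regularity

/-! ### Rescaling -/

namespace CurveData

/-- The minor `h₂` of a normalised curve. -/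
def H₂ (c : CurveData) (t : ℝ) : ℝ := t * c.a t - c.A t

/-- The minor `h₃` of a normalised curve with third component `B`. -/
def H₃ (c : CurveData) (B : ℝ → ℝ) (t : ℝ) : ℝ := c.H₂ t * c.P t - (t * c.f t - B t)

/-- A curve `(t, A, B)` which is tangent to the first axis at time `1`, up to normalisation, and
which satisfies the growth conditions with constant `m`. -/
structure IsRescaled (c : CurveData) (B : ℝ → ℝ) (m : ℝ) : Prop where
  m_pos : 0 < m
  m_le : m ≤ 1
  ξ_pos : 0 < c.ξ
  hA : ∀ t, 0 < t → HasDerivAt c.A (c.a t) t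
  ha : ∀ t, 0 < t → HasDerivAt c.a (c.a₂ t) t
  hB : ∀ t, 0 < t → HasDerivAt B (c.f t) t
  hf : ∀ t, 0 < t → HasDerivAt c.f (c.a₂ t * c.P t) t
  hP : ∀ t, 0 < t → HasDerivAt c.P (c.P₁ t) t
  ca₂ : ContinuousOn c.a₂ (Ioi 1)
  A_one : c.A 1 = 0
  a_one : c.a 1 = 1
  B_one : B 1 = 0
  f_one : c.f 1 = 0
  P_one : c.P 1 = 1 - 2 * c.ξ
  P_one_pos : 0 < c.P 1
  a₂_nonneg : ∀ t, 0 < t → 0 ≤ c.a₂ t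
  P₁_nonneg : ∀ t, 0 < t → 0 ≤ c.P₁ t
  growth₂ : ∀ t, 0 < t → m * c.H₂ t ≤ t ^ 2 * c.a₂ t
  growth₃ : ∀ t, 0 < t → m * c.H₃ B t ≤ t * (c.H₂ t * c.P₁ t)
  H₃_two : 2 * m * c.ξ ≤ c.H₃ B 2

namespace IsRescaled

variable {c : CurveData} {B : ℝ → ℝ} {m t : ℝ} (h : c.IsRescaled B m)
include h

omit h in
lemma le_of_deriv_le {F F' : ℝ → ℝ} (ht : 1 ≤ t) (hF : ∀ z, 0 < z → HasDerivAt F (F' z) z)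
    (hF' : ∀ z ∈ Icc 1 t, 0 ≤ F' z) : F 1 ≤ F t :=
  le_of_hasDerivAt_nonneg ht (fun z hz => hF z (by linarith [hz.1])) hF'

lemma one_le_a (ht : 1 ≤ t) : 1 ≤ c.a t := by
  have := le_of_deriv_le ht h.ha fun z hz => h.a₂_nonneg z (by linarith [hz.1])
  rwa [h.a_one] at this

lemma sub_one_le_A (ht : 1 ≤ t) : t - 1 ≤ c.A t := by
  have := le_of_deriv_le (F := fun t => c.A t - t) ht
    (fun z hz => (h.hA z hz).sub (hasDerivAt_id z)) fun z hz => by linarith [h.one_le_a hz.1]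
  simp only [h.A_one] at this
  linarith

lemma hasDerivAt_H₂ (ht : 0 < t) : HasDerivAt c.H₂ (t * c.a₂ t) t :=
  (((hasDerivAt_id t).mul (h.ha t ht)).sub (h.hA t ht)).congr_deriv (by simp)

lemma a_le_H₂ (ht : 1 ≤ t) : c.a t ≤ c.H₂ t := by
  have := le_of_deriv_le (F := fun t => c.H₂ t - c.a t) ht
    (fun z hz => (h.hasDerivAt_H₂ hz).sub (h.ha z hz)) fun z hz => by
      nlinarith [h.a₂_nonneg z (by linarith [hz.1]), hz.1]
  simp only [H₂, h.A_one, h.a_one] at this ⊢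
  linarith

lemma H₂_le (ht : 1 ≤ t) (ht8 : t ≤ 8) : c.H₂ t ≤ 8 * c.a t := by
  have h1 := h.sub_one_le_A ht
  have h2 := h.one_le_a ht
  unfold H₂
  nlinarith

lemma P_one_le (ht : 1 ≤ t) : c.P 1 ≤ c.P t :=
  le_of_deriv_le ht h.hP fun z hz => h.P₁_nonneg z (by linarith [hz.1])

lemma hasDerivAt_K (ht : 0 < t) : HasDerivAt c.K (c.a t * c.P₁ t) t :=
  (((h.ha t ht).mul (h.hP t ht)).sub (h.hf t ht)).congr_deriv (by ring)

lemma hasDerivAt_H₃ (ht : 0 < t) : HasDerivAt (c.H₃ B) (c.H₂ t * c.P₁ t) t :=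
  (((h.hasDerivAt_H₂ ht).mul (h.hP t ht)).sub
    (((hasDerivAt_id t).mul (h.hf t ht)).sub (h.hB t ht))).congr_deriv (by simp only [id]; ring)

lemma H₃_one : c.H₃ B 1 = c.P 1 := by
  simp [H₃, H₂, h.A_one, h.a_one, h.B_one, h.f_one]

lemma K_one : c.K 1 = c.P 1 := by
  simp [K, h.a_one, h.f_one]

lemma P_le_K (ht : 1 ≤ t) : c.P t ≤ c.K t := by
  have := le_of_deriv_le (F := fun t => c.K t - c.P t) ht
    (fun z hz => (h.hasDerivAt_K hz).sub (h.hP z hz)) fun z hz => by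
      nlinarith [h.P₁_nonneg z (by linarith [hz.1]), h.one_le_a hz.1]
  simp only [h.K_one] at this
  linarith

lemma K_two_le (ht : 2 ≤ t) : c.K 2 ≤ c.K t :=
  le_of_hasDerivAt_nonneg ht (fun z hz => h.hasDerivAt_K (by linarith [hz.1]))
    fun z hz => mul_nonneg (zero_le_one.trans (h.one_le_a (by linarith [hz.1])))
      (h.P₁_nonneg z (by linarith [hz.1]))

lemma K_le_H₃ (ht : 1 ≤ t) : c.K t ≤ c.H₃ B t := by
  have := le_of_deriv_le (F := fun t => c.H₃ B t - c.K t) ht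
    (fun z hz => (h.hasDerivAt_H₃ hz).sub (h.hasDerivAt_K hz)) fun z hz => by
      nlinarith [h.P₁_nonneg z (by linarith [hz.1]), h.a_le_H₂ hz.1]
  simp only [h.K_one, h.H₃_one] at this
  linarith

lemma H₃_le (ht : 1 ≤ t) (ht8 : t ≤ 8) : c.H₃ B t ≤ 8 * c.K t := by
  have := le_of_deriv_le (F := fun t => 8 * c.K t - c.H₃ B t) ht
    (fun z hz => ((h.hasDerivAt_K hz).const_mul 8).sub (h.hasDerivAt_H₃ hz)) fun z hz => by
      nlinarith [h.P₁_nonneg z (by linarith [hz.1]), h.H₂_le hz.1 (hz.2.trans ht8)]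
  simp only [h.K_one, h.H₃_one] at this
  linarith [h.P_one_pos]

/-- If `ξ` is small, `H₃` is bounded below by its value at `1`; if not, by the growth condition. -/
lemma le_H₃_two : m / 2 ≤ c.H₃ B 2 := by
  have h1 : c.H₃ B 1 ≤ c.H₃ B 2 := le_of_deriv_le one_le_two (fun z hz => h.hasDerivAt_H₃ hz)
    fun z hz => mul_nonneg (zero_le_one.trans ((h.one_le_a hz.1).trans (h.a_le_H₂ hz.1)))
      (h.P₁_nonneg z (by linarith [hz.1]))
  rw [h.H₃_one, h.P_one] at h1
  have h2 := h.H₃_two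
  rcases le_total c.ξ (1 / 4) with h3 | h3
  · linarith [h.m_le]
  · nlinarith [h.m_pos]

/-- On `[2, 8]` the minor `H₂` is comparable to `a` and `H₃` to `K`, by integration from the time
`1`; so the growth conditions pass to `a` and `K`. -/
theorem isNormalized : c.IsNormalized (m / 64) where
  κ_pos := by linarith [h.m_pos]
  κ_le := by linarith [h.m_le]
  ξ_pos := h.ξ_pos
  hA t ht := h.hA t (by linarith)
  ha t ht := h.ha t (by linarith)
  hf t ht := h.hf t (by linarith)
  hP t ht := h.hP t (by linarith)
  ca₂ := h.ca₂
  a_ge t ht := h.one_le_a (by linarith [ht.1])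
  A_ge t ht := by linarith [h.sub_one_le_A (t := t) (by linarith [ht.1]), ht.1]
  A_le t ht := by
    have h1 : 1 ≤ t := by linarith [ht.1]
    have h2 := h.a_le_H₂ h1
    have h3 := h.one_le_a h1
    have h4 := ht.2
    unfold H₂ at h2
    nlinarith
  P_nonneg t ht := h.P_one_pos.le.trans (h.P_one_le (by linarith [ht.1]))
  a₂_ge t ht := by
    have h1 : 1 ≤ t := by linarith [ht.1]
    have h2 := h.growth₂ t (by linarith)
    have h3 := mul_le_mul_of_nonneg_left (h.a_le_H₂ h1) h.m_pos.le
    have h4 : t ^ 2 * c.a₂ t ≤ 64 * c.a₂ t :=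
      mul_le_mul_of_nonneg_right (by nlinarith [ht.2]) (h.a₂_nonneg t (by linarith))
    linarith
  K_ge t ht := by
    have h1 := h.K_two_le ht.1
    have h2 := h.le_H₃_two
    have h3 := h.H₃_le one_le_two (by norm_num)
    linarith [h.m_pos]
  P_le t ht := h.P_le_K (by linarith [ht.1])
  P₁_ge t ht := by
    have h1 : 1 ≤ t := by linarith [ht.1]
    have h2 := h.growth₃ t (by linarith)
    have h3 := mul_le_mul_of_nonneg_left (h.K_le_H₃ h1) h.m_pos.le
    have h4 := mul_le_mul_of_nonneg_right (h.H₂_le h1 ht.2) (h.P₁_nonneg t (by linarith))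
    have h5 := h.P₁_nonneg t (by linarith)
    have h6 := h.a_le_H₂ h1
    have h7 := h.one_le_a h1
    have h8 : t * (c.H₂ t * c.P₁ t) ≤ 8 * (c.H₂ t * c.P₁ t) :=
      mul_le_mul_of_nonneg_right ht.2 (mul_nonneg (by linarith) h5)
    linarith

end IsRescaled
end CurveData

section Rescaling

variable (α β : ℝ → ℝ) (j : ℕ)

/-- The rescaled curve at the dyadic scale `2^{-j}`. Its third component is the one built
from `β̄`, whose velocity is the left-invariant velocity of `(t, C₂(t), C₃(t))`. -/
def rescaledCurve : CurveData where
  A := C2 α j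
  a t := (scale j * deriv α (scale j * t) - α (scale j)) / h2 α (scale j)
  a₂ t := scale j ^ 2 * D2 α (scale j * t) / h2 α (scale j)
  f t := (scale j * deriv (betaBar α β) (scale j * t) - betaBar α β (scale j)
    - (scale j * deriv α (scale j * t) - α (scale j)) * hBeta α β (scale j) / h2 α (scale j))
    / diag3 α β j
  P t := (h2 α (scale j) * slopeBar α β (scale j * t) - hBeta α β (scale j)) / diag3 α β j
  P₁ t := h2 α (scale j) * (scale j * (D3Bar α β (scale j * t) / D2 α (scale j * t) ^ 2))
    / diag3 α β j
  ξ := xi α β j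

/-- The third component of the rescaled curve, built from `β̄`. -/
def rescaledThird (t : ℝ) : ℝ :=
  (betaBar α β (scale j * t) - t * betaBar α β (scale j)
    - (α (scale j * t) - t * α (scale j)) * hBeta α β (scale j) / h2 α (scale j)) / diag3 α β j

lemma scale_pos : 0 < scale j := by unfold scale; positivity

lemma hasDerivAt_comp_scale {g : ℝ → ℝ} {g' t : ℝ} (hg : HasDerivAt g g' (scale j * t)) :
    HasDerivAt (fun t => g (scale j * t)) (scale j * g') t := by
  have := hg.comp t ((hasDerivAt_id t).const_mul (scale j))
  simpa [mul_comm, Function.comp_def] using this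

end Rescaling

namespace IsAdmissibleCurve

variable {α β : ℝ → ℝ} (H : IsAdmissibleCurve α β) (j : ℕ)
include H

lemma diag3_pos : 0 < diag3 α β j :=
  add_pos (mul_pos (scale_pos j) (H.h2_pos (scale_pos j))) (H.h3Bar_pos (scale_pos j))

lemma rescaledCurve_H₂ (t : ℝ) :
    (rescaledCurve α β j).H₂ t = h2 α (scale j * t) / h2 α (scale j) := by
  have h1 := (H.h2_pos (scale_pos j)).ne'
  simp only [rescaledCurve, CurveData.H₂, C2]
  field_simp
  unfold h2
  ring

lemma rescaledCurve_H₃ {t : ℝ} (ht : 0 < t) :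
    (rescaledCurve α β j).H₃ (rescaledThird α β j) t
      = h3Bar α β (scale j * t) / diag3 α β j := by
  have h0 := (H.h2_pos (scale_pos j)).ne'
  have d0 := (H.diag3_pos j).ne'
  rw [CurveData.H₃, H.rescaledCurve_H₂ j t, H.h3Bar_eq (mul_pos (scale_pos j) ht)]
  simp only [rescaledCurve, rescaledThird]
  field_simp
  unfold hBeta h2
  ring

lemma hasDerivAt_C2 {t : ℝ} (ht : 0 < t) :
    HasDerivAt (C2 α j) ((rescaledCurve α β j).a t) t :=
  ((hasDerivAt_comp_scale j (H.hasDerivAt_α (mul_pos (scale_pos j) ht))).sub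
    ((hasDerivAt_id t).mul_const (α (scale j)))).div_const _ |>.congr_deriv (by
      simp [rescaledCurve])

lemma hasDerivAt_rescaledThird {t : ℝ} (ht : 0 < t) :
    HasDerivAt (rescaledThird α β j) ((rescaledCurve α β j).f t) t := by
  have ht' := mul_pos (scale_pos j) ht
  have h1 := hasDerivAt_comp_scale j (hasDerivAt_of_contDiffOn_three H.contDiffOn_betaBar ht').1
  have h2 := hasDerivAt_comp_scale j (H.hasDerivAt_α ht')
  exact ((h1.sub ((hasDerivAt_id t).mul_const _)).sub (((h2.sub
    ((hasDerivAt_id t).mul_const _)).mul_const _).div_const _)).div_const _ |>.congr_deriv (by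
      simp [rescaledCurve])

/-- The third component of the curve has the left-invariant velocity of `rescaledCurve`. -/
lemma hasDerivAt_C3 {t : ℝ} (ht : 0 < t) :
    HasDerivAt (C3 α β j) ((rescaledCurve α β j).f t
      + (rescaledCurve α β j).ξ * (t * (rescaledCurve α β j).a t - (rescaledCurve α β j).A t)) t := by
  have ht' := mul_pos (scale_pos j) ht
  have h1 := hasDerivAt_comp_scale j (hasDerivAt_of_contDiffOn_three H.contDiffOn_β ht').1
  have h2 := hasDerivAt_comp_scale j (H.hasDerivAt_α ht')
  have h3 := H.rescaledCurve_H₂ j t (β := β)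
  have h4 := (H.h2_pos (scale_pos j)).ne'
  have h5 := (H.diag3_pos j).ne'
  unfold CurveData.H₂ at h3
  rw [h3]
  refine ((h1.sub ((hasDerivAt_id t).mul_const _)).sub (((h2.sub
    ((hasDerivAt_id t).mul_const _)).mul_const _).div_const _)).div_const _ |>.congr_deriv ?_
  simp only [rescaledCurve, xi, (H.hasDerivAt_betaBar ht').deriv]
  field_simp
  ring

/-- The growth conditions are invariant under dilations of the time, hence hold at all scales with
the same constant. -/
theorem exists_isRescaled :
    ∃ m, ∀ j, (rescaledCurve α β j).IsRescaled (rescaledThird α β j) m := by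
  obtain ⟨c₁, hc₁, g₁⟩ := H.growth_h2
  obtain ⟨c₂, hc₂, g₂⟩ := H.growth_h3
  obtain ⟨c₃, hc₃, g₃⟩ := H.integral_h2_le
  refine ⟨min 1 (min c₁ (min c₂ c₃)), fun j => ?_⟩
  set m := min 1 (min c₁ (min c₂ c₃)) with hm
  have m0 : 0 < m := by simp [hm, hc₁, hc₂, hc₃]
  have m1 : m ≤ c₁ := (min_le_right _ _).trans (min_le_left _ _)
  have m2 : m ≤ c₂ := (min_le_right _ _).trans ((min_le_right _ _).trans (min_le_left _ _))
  have m3 : m ≤ c₃ := (min_le_right _ _).trans ((min_le_right _ _).trans (min_le_right _ _))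
  have s0 := scale_pos j
  have h0 := H.h2_pos s0
  have d0 := H.diag3_pos j
  refine
    { m_pos := m0
      m_le := min_le_left _ _
      ξ_pos := by simp only [rescaledCurve, xi]; positivity
      hA := fun t ht => H.hasDerivAt_C2 j ht
      ha := fun t ht => ?_
      hB := fun t ht => H.hasDerivAt_rescaledThird j ht
      hf := fun t ht => ?_
      hP := fun t ht => ?_
      ca₂ := fun t ht => ?_
      A_one := by simp [rescaledCurve, C2]
      a_one := by
        simp only [rescaledCurve, mul_one]
        exact div_self h0.ne'
      B_one := by simp [rescaledThird]
      f_one := ?_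
      P_one := ?_
      P_one_pos := ?_
      a₂_nonneg := fun t ht => ?_
      P₁_nonneg := fun t ht => ?_
      growth₂ := fun t ht => ?_
      growth₃ := fun t ht => ?_
      H₃_two := ?_ }
  · exact ((hasDerivAt_comp_scale j (H.hasDerivAt_deriv_α (mul_pos s0 ht))).const_mul _).sub_const _
      |>.div_const _ |>.congr_deriv (by simp only [rescaledCurve]; ring)
  · have ht' := mul_pos s0 ht
    have e := (H.D2_pos _ ht').ne'
    refine ((((hasDerivAt_comp_scale j
      (hasDerivAt_of_contDiffOn_three H.contDiffOn_betaBar ht').2.1).const_mul _).sub_const _).sub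
      ((((hasDerivAt_comp_scale j (H.hasDerivAt_deriv_α ht')).const_mul _).sub_const _).mul_const _
        |>.div_const _)).div_const _ |>.congr_deriv ?_
    simp only [rescaledCurve, slopeBar]
    field_simp
  · exact ((hasDerivAt_comp_scale j (H.hasDerivAt_slopeBar (mul_pos s0 ht))).const_mul _).sub_const _
      |>.div_const _
  · have ht0 : 0 < t := zero_lt_one.trans ht
    have := (hasDerivAt_of_contDiffOn_three H.contDiffOn_α (mul_pos s0 ht0)).2.2
    exact (((hasDerivAt_comp_scale j this).const_mul _).div_const _).continuousAt.continuousWithinAt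
  · simp only [rescaledCurve, mul_one]
    have e : scale j * deriv (betaBar α β) (scale j) - betaBar α β (scale j)
        = hBeta α β (scale j) := rfl
    have e' : scale j * deriv α (scale j) - α (scale j) = h2 α (scale j) := rfl
    rw [e, e', mul_div_cancel_left₀ _ h0.ne', sub_self, zero_div]
  · simp only [rescaledCurve, mul_one, xi]
    rw [← H.h3Bar_eq s0]
    field_simp
    unfold diag3
    ring
  · simp only [rescaledCurve, mul_one]
    rw [← H.h3Bar_eq s0]
    exact div_pos (H.h3Bar_pos s0) d0
  · have := H.D2_pos _ (mul_pos s0 ht)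
    simp only [rescaledCurve]
    positivity
  · have := H.slopeBar_deriv_pos (mul_pos s0 ht)
    simp only [rescaledCurve]
    positivity
  · have ht' := mul_pos s0 ht
    have g := g₁ _ ht'
    rw [(H.hasDerivAt_h2 ht').deriv, ← mul_div_assoc, div_le_iff₀ ht'] at g
    have g' : m * h2 α (scale j * t) ≤ c₁ * h2 α (scale j * t) :=
      mul_le_mul_of_nonneg_right m1 (H.h2_pos ht').le
    rw [H.rescaledCurve_H₂ j t, ← mul_div_assoc, div_le_iff₀ h0]
    simp only [rescaledCurve]
    refine (g'.trans g).trans (le_of_eq ?_)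
    field_simp
  · have ht' := mul_pos s0 ht
    have g := g₂ _ ht'
    rw [(H.hasDerivAt_h3Bar ht').deriv, ← mul_div_assoc, div_le_iff₀ ht'] at g
    have g' : m * h3Bar α β (scale j * t) ≤ c₂ * h3Bar α β (scale j * t) :=
      mul_le_mul_of_nonneg_right m2 (H.h3Bar_pos ht').le
    rw [H.rescaledCurve_H₂ j t, H.rescaledCurve_H₃ j ht, ← mul_div_assoc, div_le_iff₀ d0]
    simp only [rescaledCurve]
    refine (g'.trans g).trans (le_of_eq ?_)
    field_simp
  · rw [H.rescaledCurve_H₃ j two_pos, le_div_iff₀ d0]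
    have s2 : 0 < scale j * 2 := by positivity
    have g := g₃ _ s2
    have i := H.mul_h2_le_integral s0 (y := scale j * 2) (by linarith)
    have i0 : 0 ≤ scale j * h2 α (scale j) := by positivity
    have e : 2 * m * (rescaledCurve α β j).ξ * diag3 α β j = m * (scale j * h2 α (scale j)) := by
      simp only [rescaledCurve, xi]
      field_simp
    rw [e]
    calc m * (scale j * h2 α (scale j)) ≤ c₃ * (scale j * h2 α (scale j)) := by gcongr
      _ ≤ c₃ * ∫ s in (0 : ℝ)..scale j * 2, h2 α s := by
          refine mul_le_mul_of_nonneg_left (le_trans (le_of_eq ?_) i) hc₃.le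
          ring
      _ ≤ _ := g

lemma continuous_C2 : Continuous (C2 α j) := by
  have := H.continuous_α
  unfold C2
  fun_prop

lemma continuous_C3 : Continuous (C3 α β j) := by
  have h1 := H.continuous_α
  have h2 := H.continuous_β
  unfold C3
  fun_prop

end IsAdmissibleCurve

/-! ### Amplitudes, reflection and the four measures -/

section Amplitudes

/-- The part of a function on the positive half-line, smoothly truncated near `[0, 1]`. -/
def rightPart (φ : ℝ → ℂ) (x : ℝ) : ℂ := (Real.smoothTransition x : ℝ) * φ x

lemma rightPart_of_one_le {φ : ℝ → ℂ} {x : ℝ} (hx : 1 ≤ x) : rightPart φ x = φ x := by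
  simp [rightPart, Real.smoothTransition.one_of_one_le hx]

/-- On the positive half-line the functions of a bounded family are amplitudes with a common
bound. -/
lemma IsBoundedFamily.exists_isAmplitude {φ : ℕ → ℝ → ℂ} (hφ : IsBoundedFamily φ) :
    ∃ K, 1 ≤ K ∧ ∀ j, IsAmplitude K (rightPart (φ j)) := by
  obtain ⟨C₀, h0⟩ := hφ.bounded 0
  obtain ⟨C₁, h1⟩ := hφ.bounded 1
  simp only [iteratedDeriv_zero] at h0
  simp only [iteratedDeriv_one] at h1
  refine ⟨max 1 (max C₀ C₁), le_max_left _ _, fun j => ?_⟩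
  have z0 : ∀ x, 0 < x → x ∉ Icc (2 : ℝ) 8 → φ j x = 0 := fun x hx hx' =>
    image_eq_zero_of_notMem_tsupport fun h => by
      rcases hφ.support_subset j h with h | h
      · linarith [h.2]
      · exact hx' h
  have z : ∀ x ∉ Icc (2 : ℝ) 8, rightPart (φ j) x = 0 := fun x hx => by
    unfold rightPart
    rcases le_or_gt x 0 with h | h
    · rw [Real.smoothTransition.zero_of_nonpos h, Complex.ofReal_zero, zero_mul]
    · rw [z0 x h hx, mul_zero]
  refine
    { contDiff := ?_, norm_le := fun x => ?_, norm_deriv_le := fun x => ?_, eq_zero := z }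
  · exact (Complex.ofRealCLM.contDiff.comp Real.smoothTransition.contDiff).mul
      ((hφ.smooth j).of_le (by exact_mod_cast le_top))
  · refine le_trans ?_ ((h0 j x).trans ((le_max_left _ _).trans (le_max_right _ _)))
    unfold rightPart
    rw [norm_mul, Complex.norm_real, Real.norm_eq_abs,
      abs_of_nonneg (Real.smoothTransition.nonneg x)]
    exact mul_le_of_le_one_left (norm_nonneg _) (Real.smoothTransition.le_one x)
  · rcases lt_or_ge x 2 with h | h
    · have : rightPart (φ j) =ᶠ[nhds x] fun _ => 0 := by
        filter_upwards [Iio_mem_nhds h] with y hy using z y fun h' => not_lt.2 h'.1 hy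
      rw [this.deriv_eq, deriv_const, norm_zero]
      exact zero_le_one.trans (le_max_left _ _)
    · have : rightPart (φ j) =ᶠ[nhds x] φ j := by
        filter_upwards [Ioi_mem_nhds (show (1 : ℝ) < x by linarith)] with y hy
        exact rightPart_of_one_le (le_of_lt hy)
      rw [this.deriv_eq]
      exact (h1 j x).trans ((le_max_right _ _).trans (le_max_right _ _))

lemma IsAmplitude.conj {K : ℝ} {f : ℝ → ℂ} (hf : IsAmplitude K f) :
    IsAmplitude K fun x => conj (f x) where
  contDiff := Complex.conjCLE.contDiff.comp hf.contDiff
  norm_le x := by rw [RCLike.norm_conj]; exact hf.norm_le x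
  norm_deriv_le x := by
    have h1 := (hf.contDiff.differentiable one_ne_zero x).hasDerivAt
    have h2 : HasDerivAt (fun x => starRingEnd ℂ (f x)) (starRingEnd ℂ (deriv f x)) x :=
      Complex.conjCLE.toContinuousLinearMap.hasFDerivAt.comp_hasDerivAt x h1
    rw [h2.deriv, RCLike.norm_conj]
    exact hf.norm_deriv_le x
  eq_zero x hx := by rw [hf.eq_zero x hx, map_zero]

end Amplitudes

section Reflection

/-- The reversal of the order of three times. -/
def reverse (τ : ℝ × ℝ × ℝ) : ℝ × ℝ × ℝ := (τ.2.2, τ.2.1, τ.1)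

lemma reverse_reverse (τ : ℝ × ℝ × ℝ) : reverse (reverse τ) = τ := rfl

lemma continuous_reverse : Continuous reverse := by unfold reverse; fun_prop

lemma measurePreserving_reverse : MeasurePreserving reverse := by
  have h1 : MeasurePreserving (Prod.swap : ℝ × (ℝ × ℝ) → (ℝ × ℝ) × ℝ) :=
    Measure.measurePreserving_swap
  have h2 : MeasurePreserving (Prod.map (Prod.swap : ℝ × ℝ → ℝ × ℝ) (id : ℝ → ℝ)) :=
    Measure.measurePreserving_swap.prod (MeasurePreserving.id _)
  exact (measurePreserving_prodAssoc volume volume volume).comp (h2.comp h1)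

lemma measurableEmbedding_of_involutive {f : ℝ × ℝ × ℝ → ℝ × ℝ × ℝ} (hf : Continuous f)
    (h : Function.Involutive f) : MeasurableEmbedding f :=
  (Homeomorph.mk (h.toPerm f) hf hf).measurableEmbedding

/-- Reversal of the times and reflection of the group preserve the volume, so the density is
reflected. -/
lemma IsDensity.reflect {W κ : ℝ × ℝ × ℝ → ℂ} {F : ℝ × ℝ × ℝ → ℝ × ℝ × ℝ} (hW : Integrable W)
    (hF : Measurable F) (h : IsDensity ((volume.withDensityᵥ W).map F) κ) :
    IsDensity ((volume.withDensityᵥ fun τ => W (reverse τ)).map fun τ => -F (reverse τ))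
      fun z => κ (-z) := by
  have er := measurableEmbedding_of_involutive continuous_reverse reverse_reverse
  have en := measurableEmbedding_of_involutive (f := fun w : ℝ × ℝ × ℝ => -w) continuous_neg neg_neg
  have iW : Integrable fun τ => W (reverse τ) :=
    measurePreserving_reverse.integrable_comp_of_integrable hW
  have iκ : Integrable fun z => κ (-z) := measurePreserving_neg_prod.integrable_comp_of_integrable h.1
  have hF' : Measurable fun τ => -F (reverse τ) := (hF.comp continuous_reverse.measurable).neg
  refine ⟨iκ, ?_⟩
  ext E hE
  have hE' : MeasurableSet ((fun w : ℝ × ℝ × ℝ => -w) ⁻¹' E) := measurable_neg hE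
  rw [VectorMeasure.map_apply _ hF' hE, withDensityᵥ_apply iW (hF' hE), withDensityᵥ_apply iκ hE]
  have e1 := measurePreserving_reverse.setIntegral_preimage_emb er W
    (F ⁻¹' ((fun w => -w) ⁻¹' E))
  have e2 := measurePreserving_neg_prod.setIntegral_preimage_emb en κ ((fun w => -w) ⁻¹' E)
  have e3 := h.setIntegral_eq hW hF hE'
  have e4 : (fun w : ℝ × ℝ × ℝ => -w) ⁻¹' ((fun w => -w) ⁻¹' E) = E := by
    ext w; simp
  rw [e4] at e2
  exact (e1.trans e3.symm).trans e2.symm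

lemma neg_heisMul_neg (ξ : ℝ) (w v : ℝ × ℝ × ℝ) : -heisMul ξ w (-v) = heisMul ξ v (-w) := by
  simp only [heisMul, Prod.neg_mk, Prod.fst_neg, Prod.snd_neg, Prod.mk.injEq]
  refine ⟨?_, ?_, ?_⟩ <;> ring

lemma norm_le_euclLength (y : ℝ × ℝ × ℝ) : ‖y‖ ≤ euclLength y := by
  rw [Prod.norm_def, Prod.norm_def, euclLength]
  refine max_le ?_ (max_le ?_ ?_) <;> rw [Real.norm_eq_abs] <;> refine Real.abs_le_sqrt ?_ <;>
    nlinarith [sq_nonneg y.1, sq_nonneg y.2.1, sq_nonneg y.2.2]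

lemma mul_norm_rpow_le {T M δ : ℝ} {y : ℝ × ℝ × ℝ} (hT : 0 ≤ T) (hδ : 0 ≤ δ)
    (hy : euclLength y ≤ M * δ) :
    4 * (T * ‖y‖ ^ (1 / 59 : ℝ)) ≤ 4 * (T * |M| ^ (1 / 59 : ℝ)) * δ ^ (1 / 59 : ℝ) := by
  have h : ‖y‖ ≤ |M| * δ := (norm_le_euclLength y).trans
    (hy.trans (mul_le_mul_of_nonneg_right (le_abs_self M) hδ))
  have h2 := Real.rpow_le_rpow (norm_nonneg y) h (show (0 : ℝ) ≤ 1 / 59 by norm_num)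
  rw [Real.mul_rpow (abs_nonneg M) hδ] at h2
  have := mul_le_mul_of_nonneg_left h2 hT
  linarith

end Reflection

section Weights

lemma Phi_eq (α β : ℝ → ℝ) (j : ℕ) : Phi α β j = prodThree (C2 α j) (C3 α β j) (xi α β j) := rfl

lemma Psi_eq (α β : ℝ → ℝ) (j : ℕ) (u : ℝ) :
    Psi α β j u = prodFour (C2 α j) (C3 α β j) (xi α β j) u := rfl

/-- Inversion reverses the order of the factors. -/
lemma PhiHat_eq (α β : ℝ → ℝ) (j : ℕ) : PhiHat α β j = fun τ => -Phi α β j (reverse τ) := by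
  funext τ
  simp only [PhiHat, Phi, reverse, Prod.neg_mk, Prod.mk.injEq]
  refine ⟨?_, ?_, ?_⟩ <;> ring

/-- Inversion reverses the order of the factors. -/
lemma PsiHat_eq (α β : ℝ → ℝ) (j : ℕ) (s : ℝ) :
    PsiHat α β j s = fun τ => -Psi α β j s (reverse τ) := by
  funext τ
  simp only [PsiHat, Psi, zeta, reverse, Prod.neg_mk, Prod.mk.injEq]
  refine ⟨?_, ?_, ?_⟩ <;> ring

variable {K : ℝ} {f₁ f₂ f₃ g₁ g₂ g₃ : ℝ → ℂ} (h₁ : IsAmplitude K f₁) (h₂ : IsAmplitude K f₂)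
  (h₃ : IsAmplitude K f₃) (e₁ : ∀ x ∈ Icc (2 : ℝ) 8, f₁ x = g₁ x)
  (e₂ : ∀ x ∈ Icc (2 : ℝ) 8, f₂ x = g₂ x) (e₃ : ∀ x ∈ Icc (2 : ℝ) 8, f₃ x = g₃ x) (j : ℕ)
include h₁ h₂ h₃ e₁ e₂ e₃

/-- Only the times in `[2, 8]` matter, both for the region and for the amplitudes. -/
lemma indicator_eq_of_timeBox {R E : Set (ℝ × ℝ × ℝ)} (hR : R ⊆ timeBox)
    (hE : ∀ τ ∈ timeBox, τ ∈ R ↔ τ ∈ E) :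
    R.indicator (fun τ => g₁ τ.1 * g₂ τ.2.1 * g₃ τ.2.2)
      = E.indicator fun τ => f₁ τ.1 * f₂ τ.2.1 * f₃ τ.2.2 := by
  funext τ
  by_cases hb : τ ∈ timeBox
  · by_cases hτ : τ ∈ R
    · rw [indicator_of_mem hτ, indicator_of_mem ((hE τ hb).1 hτ), e₁ _ hb.1, e₂ _ hb.2.1,
        e₃ _ hb.2.2]
    · rw [indicator_of_notMem hτ, indicator_of_notMem fun h => hτ ((hE τ hb).2 h)]
  · rw [indicator_of_notMem fun h => hb (hR h), indicator_mul_eq_zero h₁ h₂ h₃ _ hb]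

lemma R1_indicator_eq : (R1 j).indicator (fun τ => g₁ τ.1 * g₂ τ.2.1 * g₃ τ.2.2)
    = freeWeight (2 ^ j) f₁ f₂ f₃ := by
  refine indicator_eq_of_timeBox h₁ h₂ h₃ e₁ e₂ e₃
    (fun τ hτ => ⟨hτ.1.1.1, hτ.1.2.1.1, hτ.1.2.2.1⟩) fun τ hb => ?_
  obtain ⟨⟨a1, a2⟩, ⟨b1, b2⟩, c1, c2⟩ := hb
  have : 0 ≤ τ.1 ∧ 0 ≤ τ.2.1 ∧ 0 ≤ τ.2.2 := ⟨by linarith, by linarith, by linarith⟩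
  simp only [R1, timeCube, timeSet, timesUpTo, mem_inter_iff, mem_prod, mem_Icc, mem_ofPred_eq]
  tauto

lemma R3_indicator_eq (u : ℝ) : (R3 j u).indicator (fun τ => g₁ τ.1 * g₂ τ.2.1 * g₃ τ.2.2)
    = lateWeight (2 ^ j) u f₁ f₂ f₃ := by
  refine indicator_eq_of_timeBox h₁ h₂ h₃ e₁ e₂ e₃
    (fun τ hτ => ⟨hτ.1.1.1, hτ.1.2.1.1, hτ.1.2.2.1⟩) fun τ hb => ?_
  obtain ⟨⟨a1, a2⟩, ⟨b1, b2⟩, c1, c2⟩ := hb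
  have : 0 ≤ τ.1 ∧ 0 ≤ τ.2.1 ∧ 0 ≤ τ.2.2 := ⟨by linarith, by linarith, by linarith⟩
  simp only [R3, timeCube, timeSet, timesUpTo, mem_inter_iff, mem_prod, mem_Icc, mem_ofPred_eq]
  tauto

end Weights

lemma R2_indicator_eq (j : ℕ) (g₁ g₂ g₃ : ℝ → ℂ) :
    (R2 j).indicator (fun τ => g₁ τ.1 * g₂ τ.2.1 * g₃ τ.2.2)
      = fun τ => (R1 j).indicator (fun τ => g₃ τ.1 * g₂ τ.2.1 * g₁ τ.2.2) (reverse τ) := by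
  have e : ∀ τ, τ ∈ R2 j ↔ reverse τ ∈ R1 j := fun τ => by
    simp only [R1, R2, timeCube, reverse, mem_prod, mem_ofPred_eq]
    tauto
  funext τ
  by_cases h : τ ∈ R2 j
  · rw [indicator_of_mem h, indicator_of_mem ((e τ).1 h)]
    simp only [reverse]; ring
  · rw [indicator_of_notMem h, indicator_of_notMem fun h' => h ((e τ).2 h')]

lemma R4_indicator_eq (j : ℕ) (s : ℝ) (g₁ g₂ g₃ : ℝ → ℂ) :
    (R4 j s).indicator (fun τ => g₁ τ.1 * g₂ τ.2.1 * g₃ τ.2.2)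
      = fun τ => (R3 j s).indicator (fun τ => g₃ τ.1 * g₂ τ.2.1 * g₁ τ.2.2) (reverse τ) := by
  have e : ∀ τ, τ ∈ R4 j s ↔ reverse τ ∈ R3 j s := fun τ => by
    simp only [R3, R4, timeCube, reverse, mem_prod, mem_ofPred_eq]
    tauto
  funext τ
  by_cases h : τ ∈ R4 j s
  · rw [indicator_of_mem h, indicator_of_mem ((e τ).1 h)]
    simp only [reverse]; ring
  · rw [indicator_of_notMem h, indicator_of_notMem fun h' => h ((e τ).2 h')]

section Packaging

variable {m : ComplexMeasure (ℝ × ℝ × ℝ)} {ξ T : ℝ}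

/-- `m` has a density with `L¹` norm at most `4T`, with the Hölder condition in `L¹` of exponent
`1 / 59` and constant `4T` for left translations. -/
def HasHolderDensity (m : ComplexMeasure (ℝ × ℝ × ℝ)) (ξ T : ℝ) : Prop :=
  ∃ κ : ℝ × ℝ × ℝ → ℂ, IsDensity m κ ∧ ∫⁻ z, ‖κ z‖ₑ ≤ ENNReal.ofReal (4 * T) ∧
    ∀ y, ∫⁻ z, ‖κ z - κ (heisMul ξ y z)‖ₑ ≤ ENNReal.ofReal (4 * (T * ‖y‖ ^ (1 / 59 : ℝ)))

lemma HasHolderDensity.left (h : HasHolderDensity m ξ T) (hT : 0 ≤ T) : IsAbsCont m ∧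
    ∃ κ : ℝ × ℝ × ℝ → ℂ, IsDensity m κ ∧ ∫⁻ z, ‖κ z‖ₑ ≤ ENNReal.ofReal (4 * T) ∧
      ∀ (M δ : ℝ) (y : ℝ × ℝ × ℝ), 0 ≤ δ → δ ≤ 1 → euclLength y ≤ M * δ →
        ∫⁻ z, ‖κ z - κ (heisMul ξ y z)‖ₑ
          ≤ ENNReal.ofReal (4 * (T * |M| ^ (1 / 59 : ℝ)) * δ ^ (1 / 59 : ℝ)) := by
  obtain ⟨κ, h1, h2, h3⟩ := h
  exact ⟨h1.isAbsCont, κ, h1, h2, fun M δ y h0 _ hy =>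
    (h3 y).trans (ENNReal.ofReal_le_ofReal (mul_norm_rpow_le hT h0 hy))⟩

/-- The reflection turns left translations into right translations. -/
lemma HasHolderDensity.right {W : ℝ × ℝ × ℝ → ℂ} {F : ℝ × ℝ × ℝ → ℝ × ℝ × ℝ}
    (h : HasHolderDensity ((volume.withDensityᵥ W).map F) ξ T) (hW : Integrable W)
    (hF : Measurable F) (hT : 0 ≤ T)
    (hm : m = (volume.withDensityᵥ fun τ => W (reverse τ)).map fun τ => -F (reverse τ)) :
    IsAbsCont m ∧
    ∃ κ : ℝ × ℝ × ℝ → ℂ, IsDensity m κ ∧ ∫⁻ z, ‖κ z‖ₑ ≤ ENNReal.ofReal (4 * T) ∧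
      ∀ (M δ : ℝ) (v : ℝ × ℝ × ℝ), 0 ≤ δ → δ ≤ 1 → euclLength v ≤ M * δ →
        ∫⁻ z, ‖κ z - κ (heisMul ξ z (-v))‖ₑ
          ≤ ENNReal.ofReal (4 * (T * |M| ^ (1 / 59 : ℝ)) * δ ^ (1 / 59 : ℝ)) := by
  obtain ⟨κ, h1, h2, h3⟩ := h
  have en := measurableEmbedding_of_involutive (f := fun w : ℝ × ℝ × ℝ => -w) continuous_neg neg_neg
  have h1' := h1.reflect hW hF
  rw [← hm] at h1'
  refine ⟨h1'.isAbsCont, _, h1', ?_, fun M δ v h0 _ hv => ?_⟩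
  · rwa [measurePreserving_neg_prod.lintegral_comp_emb en fun z => ‖κ z‖ₑ]
  · simp only [neg_heisMul_neg]
    rw [measurePreserving_neg_prod.lintegral_comp_emb en fun z => ‖κ z - κ (heisMul ξ v z)‖ₑ]
    exact (h3 v).trans (ENNReal.ofReal_le_ofReal (mul_norm_rpow_le hT h0 hv))

end Packaging

end

theorem mainTheorem3 (α β : ℝ → ℝ) (hΓ : IsAdmissibleCurve α β)
    (φ : ℕ → ℝ → ℂ) (hφ : IsBoundedFamily φ) :
    ∃ C₀ : ℝ, ∃ σ : ℝ, 0 < σ ∧ ∃ C : ℝ → ℝ, ∀ j : ℕ,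
      (IsAbsCont (mu α β φ j) ∧
        ∃ κ : ℝ × ℝ × ℝ → ℂ, IsDensity (mu α β φ j) κ ∧
          ∫⁻ z, ‖κ z‖ₑ ≤ ENNReal.ofReal C₀ ∧
          ∀ (M δ : ℝ) (y : ℝ × ℝ × ℝ), 0 ≤ δ → δ ≤ 1 → euclLength y ≤ M * δ →
            ∫⁻ z, ‖κ z - κ (heisMul (xi α β j) y z)‖ₑ ≤ ENNReal.ofReal (C M * δ ^ σ)) ∧
      (IsAbsCont (muHat α β φ j) ∧
        ∃ κ : ℝ × ℝ × ℝ → ℂ, IsDensity (muHat α β φ j) κ ∧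
          ∫⁻ w, ‖κ w‖ₑ ≤ ENNReal.ofReal C₀ ∧
          ∀ (M δ : ℝ) (v : ℝ × ℝ × ℝ), 0 ≤ δ → δ ≤ 1 → euclLength v ≤ M * δ →
            ∫⁻ w, ‖κ w - κ (heisMul (xi α β j) w (-v))‖ₑ ≤ ENNReal.ofReal (C M * δ ^ σ)) ∧
      (∀ u ∈ Icc (2 : ℝ) 8, IsAbsCont (nu α β φ j u) ∧
        ∃ χ : ℝ × ℝ × ℝ → ℂ, IsDensity (nu α β φ j u) χ ∧
          ∫⁻ ζ, ‖χ ζ‖ₑ ≤ ENNReal.ofReal C₀ ∧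
          ∀ (M δ : ℝ) (y : ℝ × ℝ × ℝ), 0 ≤ δ → δ ≤ 1 → euclLength y ≤ M * δ →
            ∫⁻ ζ, ‖χ ζ - χ (heisMul (xi α β j) y ζ)‖ₑ ≤ ENNReal.ofReal (C M * δ ^ σ)) ∧
      (∀ s ∈ Icc (2 : ℝ) 8, IsAbsCont (nuHat α β φ j s) ∧
        ∃ χ : ℝ × ℝ × ℝ → ℂ, IsDensity (nuHat α β φ j s) χ ∧
          ∫⁻ ζ, ‖χ ζ‖ₑ ≤ ENNReal.ofReal C₀ ∧
          ∀ (M δ : ℝ) (v : ℝ × ℝ × ℝ), 0 ≤ δ → δ ≤ 1 → euclLength v ≤ M * δ →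
            ∫⁻ ζ, ‖χ ζ - χ (heisMul (xi α β j) ζ (-v))‖ₑ ≤ ENNReal.ofReal (C M * δ ^ σ)) := by
  obtain ⟨m, hm⟩ := hΓ.exists_isRescaled
  obtain ⟨K, hK, hA⟩ := hφ.exists_isAmplitude
  have hN := fun j => (hm j).isNormalized
  have hT : 0 ≤ totalConst (m / 64) K := by
    have := mul_pow_le_totalConst (hN 0) hK
    have : 0 ≤ K ^ 3 := by positivity
    linarith
  have e : ∀ j, ∀ x ∈ Icc (2 : ℝ) 8, rightPart (φ j) x = φ j x := fun j x hx =>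
    rightPart_of_one_le (by linarith [hx.1])
  have e' : ∀ j, ∀ x ∈ Icc (2 : ℝ) 8, conj (rightPart (φ j) x) = conj (φ j x) := fun j x hx => by
    rw [e j x hx]
  have pΦ := fun j => (hN j).isProductMap_prodThree (hΓ.continuous_C2 j) (hΓ.continuous_C3 j)
    (fun t ht => hΓ.hasDerivAt_C3 j (zero_lt_one.trans ht)) 2
  have pΨ := fun j u => (hN j).isProductMap_prodFour (hΓ.continuous_C2 j) (hΓ.continuous_C3 j)
    (fun t ht => hΓ.hasDerivAt_C3 j (zero_lt_one.trans ht)) u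
  refine ⟨4 * totalConst (m / 64) K, 1 / 59, by norm_num,
    fun M => 4 * (totalConst (m / 64) K * |M| ^ (1 / 59 : ℝ)), fun j => ⟨?_, ?_, fun u hu => ?_,
      fun s hs => ?_⟩⟩
  · refine HasHolderDensity.left ?_ hT
    unfold mu transported
    rw [R1_indicator_eq (hA j) (hA j).conj (hA j) (e j) (e' j) (e j), Phi_eq]
    exact exists_isDensity_freeWeight (hN j) (hA j) (hA j).conj (hA j) hK (pΦ j)
  · refine HasHolderDensity.right (exists_isDensity_freeWeight (b := 2 ^ j) (hN j) (hA j).conj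
      (hA j) (hA j).conj hK (pΦ j)) ?_ (pΦ j).continuous.measurable hT ?_
    · exact integrable_of_timeBox (measurable_indicator_mul (hA j).conj (hA j) (hA j).conj
        (measurableSet_freeRegion _)) (norm_indicator_mul_le (hA j).conj (hA j) (hA j).conj hK _)
        fun _ hτ => indicator_mul_eq_zero (hA j).conj (hA j) (hA j).conj _ hτ
    · unfold muHat transported
      rw [R2_indicator_eq j (fun x => conj (φ j x)) (φ j) fun x => conj (φ j x),
        R1_indicator_eq (hA j).conj (hA j) (hA j).conj (e' j) (e j) (e' j),
        PhiHat_eq]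
      rfl
  · refine HasHolderDensity.left ?_ hT
    unfold nu transported
    rw [R3_indicator_eq (hA j) (hA j).conj (hA j).conj (e j) (e' j) (e' j), Psi_eq]
    exact exists_isDensity_lateWeight (hN j) (hA j) (hA j).conj (hA j).conj hK (pΨ j u) hu
  · refine HasHolderDensity.right (exists_isDensity_lateWeight (b := 2 ^ j) (hN j) (hA j).conj
      (hA j) (hA j) hK (pΨ j s) hs) ?_ (pΨ j s).continuous.measurable hT ?_
    · exact integrable_of_timeBox (measurable_indicator_mul (hA j).conj (hA j) (hA j)
        (measurableSet_lateRegion _ _)) (norm_indicator_mul_le (hA j).conj (hA j) (hA j) hK _)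
        fun _ hτ => indicator_mul_eq_zero (hA j).conj (hA j) (hA j) _ hτ
    · unfold nuHat transported
      rw [R4_indicator_eq j s (φ j) (φ j) fun x => conj (φ j x),
        R3_indicator_eq (hA j).conj (hA j) (hA j) (e' j) (e j) (e j),
        PsiHat_eq]
      rfl
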